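/- Let $M$ be a smooth (Hausdorff) real manifold of dimension $d$ with a smooth torsion-free affine connection $\nabla$ on $TM$. In local coordinates $x^i$, let $y^i$ be the corresponding formal fiber coordinates of $TM$. Let $\mathcal{S}M$ be the bundle of formal power series $\sum_p a_{i_1\dots i_p}(x)y^{i_1}\cdots y^{i_p}$ (the completed symmetric algebra of $T^*M$); let $\mathcal{E}=\bigoplus_k\mathcal{E}^k$ be the bundle of fiberwise exterior forms $a_{j_1\dots j_k}(x,y)\,dx^{j_1}\cdots dx^{j_k}$, let $\mathcal{T}_{poly}=\bigoplus_{k\ge -1}\mathcal{T}^k_{poly}$ be the bundle of fiberwise polyvector fields $v^{j_0\dots j_k}(x,y)\,\partial_{y^{j_0}}\wedge\dots\wedge\partial_{y^{j_k}}$, and let $\mathcal{D}_{poly}=\bigoplus_{k\ge -1}\mathcal{D}^k_{poly}$ be the bundle of fiberwise polydifferential operators $\sum P^{\alpha_0\dots\alpha_k}(x,y)\,\partial_y^{\alpha_0}\otimes\dots\otimes\partial_y^{\alpha_k}$ (finite sums over the multi-indices $\alpha_i$); all coefficients are formal power series in $y$ whose coefficients are smooth in $x$. For a bundle $\mathcal{B}$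 among $\mathcal{S}M,\mathcal{E},\mathcal{T}_{poly},\mathcal{D}_{poly}$, let $\Omega^q(M,\mathcal{B})$ be the space of exterior $q$-forms $dy^{l_1}\cdots dy^{l_q}\,b_{l_1\dots l_q}$ with values in $\mathcal{B}$ and $\Gamma(M,\mathcal{B})=\Omega^0(M,\mathcal{B})$. Fiberwise vector fields $v\in\mathcal{T}^0_{poly}$ act on $\mathcal{S}M$ as derivations, on $\mathcal{E}$ by the Lie derivative (where $dx^i$ is treated as the differential of $y^i$), on $\mathcal{T}_{poly}$ by the Schouten–Nijenhuis bracket and on $\mathcal{D}_{poly}$ by the Gerstenhaber bracket; denote this action, and its extension to $\mathcal{T}^0_{poly}$-valued forms, by a dot. Let $\delta=dy^i\partial_{y^i}\,\cdot$, and let $\nabla=dy^i\partial_{x^i}-dy^i\Gamma^k_{ij}(x)y^j\partial_{y^k}\,\cdot$ be the induced connection on $\Omega^\bullet(M,\mathcal{B})$. Let $\delta^{-1}$ be the operator which is $\frac1{p+q}\,y^k\frac{\partial}{\partial(dy^k)}$ on the components of degree $p$ in $y$ and $q>0$ in $dy$, and $0$ for $q=0$. Let $\mathcal{R}=-\frac12dy^idy^j(R_{ij})^k_l(x)y^l\partial_{y^k}$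 with $R$ the Riemann curvature tensor of $\nabla$, and let $A\in\Omega^1(M,\mathcal{T}^0_{poly})$ be the form obtained by iterating, in degrees in $y$, $$A=\delta^{-1}\mathcal{R}+\delta^{-1}\bigl(\nabla A+\tfrac12[A,A]_{SN}\bigr).$$ The Fedosov differential is $D=\nabla-\delta+A\,\cdot$. Then for each $\mathcal{B}$ among $\mathcal{S}M,\mathcal{E},\mathcal{T}_{poly},\mathcal{D}_{poly}$ the operator $D$ maps $\Omega^q(M,\mathcal{B})$ to $\Omega^{q+1}(M,\mathcal{B})$, $D^2=0$, and $$H^{>0}(\Omega^\bullet(M,\mathcal{B}),D)=0 .$$ Furthermore, iterating the equation $$\tau(a)=a+\delta^{-1}\bigl(\nabla\tau(a)+A\cdot\tau(a)\bigr)$$ in degrees in $y$ one obtains a solution $\tau(a)$, and $\tau$ defines isomorphisms onto $H^0(\Omega^\bullet(M,\mathcal{B}),D)=\ker D\cap\Gamma(M,\mathcal{B})$: $$C^\infty(M)\cong H^0(\Omega^\bullet(M,\mathcal{S}M),D),\qquad \mathcal{A}^\bullet(M)\cong H^0(\Omega^\bullet(M,\mathcal{E}),D)$$ as graded commutative algebras,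 where $\mathcal{A}^\bullet(M)$ is the algebra of smooth exterior forms on $M$ with the wedge product; $$\ker\delta\cap\Gamma(M,\mathcal{T}_{poly})\cong H^0(\Omega^\bullet(M,\mathcal{T}_{poly}),D)$$ as graded vector spaces; and $$\ker\delta\cap\Gamma(M,\mathcal{D}_{poly})\cong H^0(\Omega^\bullet(M,\mathcal{D}_{poly}),D)$$ as graded associative algebras with respect to the cup product $(P\cup Q)(a_1,\dots,a_{r+s})=P(a_1,\dots,a_r)\,Q(a_{r+1},\dots,a_{r+s})$. Here $\ker\delta\cap\Gamma(M,\mathcal{B})$ is the space of sections with $y$-independent coefficients. -/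

import Mathlib

open scoped Manifold ContDiff

noncomputable section

namespace Fedosov

/-! ### Formal fibers

`FPS d` is the algebra `ℝ[[y¹, …, yᵈ]]`.  All fiberwise objects are given by families of formal
power series (their components), indexed by a set `ι` which depends on the bundle. -/

/-- Formal power series in the fiber coordinates `y¹, …, yᵈ`. -/
abbrev FPS (d : ℕ) : Type := MvPowerSeries (Fin d) ℝ

/-- The substitution `f(y) ↦ f(h y)` for a matrix `h`. -/
def substLin {d : ℕ} (h : Matrix (Fin d) (Fin d) ℝ) (f : FPS d) : FPS d :=
  MvPowerSeries.subst (fun i => ∑ j, h i j • (MvPowerSeries.X j : FPS d)) f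

/-- The action of the formal vector field `v = vʲ(y) ∂/∂yʲ` on a formal power series. -/
def vfApply {d : ℕ} (v : Fin d → FPS d) (f : FPS d) : FPS d :=
  ∑ j, v j * MvPowerSeries.pderiv ℝ j f

/-- A component tensor is antisymmetric if permuting its indices produces the sign. -/
def IsAntisymm {κ X : Type*} [AddCommGroup X] {k : ℕ} (a : (Fin k → κ) → X) : Prop :=
  ∀ (π : Equiv.Perm (Fin k)) (J : Fin k → κ), a (J ∘ π) = (Equiv.Perm.sign π : ℤ) • a J

/-- The higher derivative `∂^α f`, where `∂^α = ∏ⱼ (∂/∂yʲ)^(αⱼ)`: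
the coefficient of `y^m` in `∂^α f` is `(m + α)! / m!` times that of `y^(m+α)` in `f`. -/
def dPow {d : ℕ} (α : Fin d →₀ ℕ) (f : FPS d) : FPS d := fun m =>
  (∏ j, (((m j + α j).descFactorial (α j) : ℕ) : ℝ)) * MvPowerSeries.coeff (m + α) f

/-- The polydifferential operator `∑ P_{α₁…αᵣ}(y) ∂^{α₁} ⊗ ⋯ ⊗ ∂^{αᵣ}` (a finite sum) as a map
`ℝ[[y]]^r → ℝ[[y]]`. -/
def polyOp {d r : ℕ} (P : (Fin r → (Fin d →₀ ℕ)) → FPS d) (f : Fin r → FPS d) : FPS d :=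
  ∑ᶠ α : Fin r → (Fin d →₀ ℕ), P α * ∏ i, dPow (α i) (f i)

/-- The coefficients of a polydifferential operator `Q`, recovered from its values on monomials:
`Q_α = ∑_{β ≤ α} (∏ᵢ (-y)^{αᵢ-βᵢ} / (βᵢ! (αᵢ-βᵢ)!)) Q(y^{β₁}, …, y^{βᵣ})`.
This is inverse to `polyOp` on finite families of coefficients. -/
def polySymbol {d r : ℕ} (Q : (Fin r → FPS d) → FPS d) : (Fin r → (Fin d →₀ ℕ)) → FPS d :=
  fun α => ∑ β ∈ Fintype.piFinset (fun i => Finset.Iic (α i)),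
    (∏ i, MvPowerSeries.monomial (α i - β i)
      (∏ j, (-1 : ℝ) ^ (α i j - β i j) /
        (((β i j).factorial : ℝ) * ((α i j - β i j).factorial : ℝ)))) *
      Q (fun i => MvPowerSeries.monomial (β i) (1 : ℝ))

/-- A typical fiber of a bundle of formal fiberwise objects: elements are families of formal power
series indexed by `ι`, subject to a symmetry condition; `act g` is the transformation
of components under the linear change `y' = g y` of the fiber coordinates, and `lie v` is the
action of the formal vector field `v = vʲ(y) ∂/∂yʲ`.  It is used only for the four kinds of
fibers below. -/
structure FormalFiber (d : ℕ) where
  /-- the index set of the components -/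
  ι : Type
  /-- the symmetry condition on the components -/
  IsSym : (ι → FPS d) → Prop
  /-- the transformation of the components under `y' = g y` -/
  act : Matrix (Fin d) (Fin d) ℝ → (ι → FPS d) → (ι → FPS d)
  /-- the action of a formal vector field -/
  lie : (Fin d → FPS d) → (ι → FPS d) → (ι → FPS d)

/-- The fiber `ℝ[[y]]` of the formally completed symmetric algebra of `T*M`. -/
def fiberSM (d : ℕ) : FormalFiber d where
  ι := Unit
  IsSym _ := True
  act g a := fun u => substLin g⁻¹ (a u)
  lie v a := fun u => vfApply v (a u)

/-- The fiber of the bundle of fiberwise exterior `k`-forms `∑ a_{j₁…jₖ}(y) dx^{j₁} ⋯ dx^{jₖ}`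
(sum over all sequences, antisymmetric components), with the Lie derivative
`L_v dxʲ = ∑ₗ (∂vʲ/∂yˡ) dxˡ`. -/
def fiberE (d k : ℕ) : FormalFiber d where
  ι := Fin k → Fin d
  IsSym := IsAntisymm
  act g a := fun J => ∑ J' : Fin k → Fin d, (∏ s, g⁻¹ (J' s) (J s)) • substLin g⁻¹ (a J')
  lie v a := fun J => vfApply v (a J) +
    ∑ s : Fin k, ∑ l : Fin d, MvPowerSeries.pderiv ℝ (J s) (v l) * a (Function.update J s l)

/-- The fiber of the bundle of fiberwise polyvector fields
`∑ γ^{j₁…jᵣ}(y) ∂/∂y^{j₁} ∧ ⋯ ∧ ∂/∂y^{jᵣ}` with `r` arguments (degree `r - 1`), with the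
Schouten–Nijenhuis bracket `[v, ·]`, the derivation with `[v, ∂/∂yʲ] = -∑ₗ (∂vˡ/∂yʲ) ∂/∂yˡ`. -/
def fiberT (d r : ℕ) : FormalFiber d where
  ι := Fin r → Fin d
  IsSym := IsAntisymm
  act g a := fun J => ∑ J' : Fin r → Fin d, (∏ s, g (J s) (J' s)) • substLin g⁻¹ (a J')
  lie v a := fun J => vfApply v (a J) -
    ∑ s : Fin r, ∑ l : Fin d, MvPowerSeries.pderiv ℝ l (v (J s)) * a (Function.update J s l)

/-- The fiber of the bundle of fiberwise polydifferential operators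
`∑ P_{α₁…αᵣ}(y) ∂^{α₁} ⊗ ⋯ ⊗ ∂^{αᵣ}` with `r` arguments (degree `r - 1`).  A change of coordinates
acts by conjugation of operators, and a vector field by the Gerstenhaber bracket
`[v, P](f₁, …, fᵣ) = v(P(f₁, …, fᵣ)) - ∑ᵢ P(f₁, …, v(fᵢ), …, fᵣ)`. -/
def fiberD (d r : ℕ) : FormalFiber d where
  ι := Fin r → (Fin d →₀ ℕ)
  IsSym _ := True
  act g P := polySymbol fun f => substLin g⁻¹ (polyOp P fun i => substLin g (f i))
  lie v P := polySymbol fun f => vfApply v (polyOp P f) -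
    ∑ i : Fin r, polyOp P (Function.update f i (vfApply v (f i)))

/-- The bundles to be considered: `SM`, the fiberwise exterior `k`-forms, and the fiberwise
polyvector fields and polydifferential operators with `r` arguments, that is of degree `r - 1`.
The total bundles `E`, `T_poly`, `D_poly` are the direct sums over `k`, resp. `r`. -/
inductive Kind : Type
  | SM : Kind
  | E (k : ℕ) : Kind
  | Tpoly (r : ℕ) : Kind
  | Dpoly (r : ℕ) : Kind

/-- The typical fiber of a bundle. -/
def Kind.fiber (d : ℕ) : Kind → FormalFiber d
  | .SM => fiberSM d
  | .E k => fiberE d k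
  | .Tpoly r => fiberT d r
  | .Dpoly r => fiberD d r

/-- The product of exterior forms in components: if `a = a_J dx^J` and `b = b_K dx^K` with
antisymmetric components, then `wedge a b` are the antisymmetric components of
`a_J b_K dx^J dx^K`. -/
def wedge {κ X : Type*} [Ring X] [Module ℝ X] {k l : ℕ}
    (a : (Fin k → κ) → X) (b : (Fin l → κ) → X) : (Fin (k + l) → κ) → X := fun J =>
  ((Nat.factorial (k + l) : ℝ))⁻¹ • ∑ π : Equiv.Perm (Fin (k + l)),
    (Equiv.Perm.sign π : ℤ) • (a (fun s => J (π (Fin.castAdd l s))) *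
      b (fun s => J (π (Fin.natAdd k s))))

/-! ### Sections of the bundles over a manifold

Mathlib's tangent space `TangentSpace (𝓡 d) x` is `ℝᵈ`, through the preferred chart at `x`.
Accordingly a (not necessarily smooth) section of one of the bundles is a function on `M` whose
value at `x` consists of the components with respect to the coordinates `xⁱ`
of the preferred chart at `x` and the corresponding fiber coordinates `yⁱ`. -/

section Manifold

variable {d : ℕ} {M : Type*} [TopologicalSpace M] [ChartedSpace (EuclideanSpace ℝ (Fin d)) M]

/-- `q`-forms `∑ dy^{l₁} ⋯ dy^{l_q} a_{l₁…l_q}` (sum over all sequences) with values in the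
bundle with typical fiber `B`, as component functions without any condition. -/
abbrev RawForm (M : Type*) {d : ℕ} (B : FormalFiber d) (q : ℕ) : Type _ :=
  M → (Fin q → Fin d) → B.ι → FPS d

/-- The components `dy^i c_i`, antisymmetrized: if `c i` has components `c i L`, then
`∑ dy^i dy^L c i L` has the antisymmetric components `dyMul c`. -/
def dyMul {X : Type*} [AddCommGroup X] [Module ℝ X] {d q : ℕ}
    (c : Fin d → (Fin q → Fin d) → X) : (Fin (q + 1) → Fin d) → X := fun L =>
  ((q + 1 : ℕ) : ℝ)⁻¹ • ∑ s : Fin (q + 1), ((-1 : ℝ) ^ (s : ℕ)) • c (L s) (s.removeNth L)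

variable [IsManifold (𝓡 d) ∞ M]

/-- The standard basis vectors of `ℝᵈ`. -/
def e {d : ℕ} (i : Fin d) : EuclideanSpace ℝ (Fin d) := EuclideanSpace.single i 1

/-- The Jacobi matrix at `x` of the change from the coordinates of the preferred chart at `x` to
those of the preferred chart at `x₀`. -/
def jac (x₀ x : M) : Matrix (Fin d) (Fin d) ℝ :=
  Matrix.of fun i j => (tangentCoordChange (𝓡 d) x x₀ x (e j)) i

/-- The components of a form at `x` with respect to the coordinates of the preferred chart
at `x₀`. -/
def inChart {B : FormalFiber d} {q : ℕ} (x₀ : M) (a : RawForm M B q) (x : M) :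
    (Fin q → Fin d) → B.ι → FPS d := fun L n =>
  ∑ L' : Fin q → Fin d,
    (∏ s, (jac x₀ x)⁻¹ (L' s) (L s)) • B.act (jac x₀ x) (a x L') n

/-- `a` is an element of `Ω^q(M, B)`: the components have the right symmetries, only finitely many
`n : B.ι` occur (this is the finiteness of the order of a polydifferential operator; it is no
restriction for the other bundles) and are smooth functions in all charts. -/
structure IsForm (B : FormalFiber d) (q : ℕ) (a : RawForm M B q) : Prop where
  antisymm : ∀ x, IsAntisymm (a x)
  sym : ∀ x L, B.IsSym (a x L)
  finite : ∃ S : Finset B.ι, ∀ x L, ∀ n ∉ S, a x L n = 0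
  smooth : ∀ (x₀ : M) (L : Fin q → Fin d) (n : B.ι) (m : Fin d →₀ ℕ),
    ContMDiffOn (𝓡 d) 𝓘(ℝ) ∞ (fun x => MvPowerSeries.coeff m (inChart x₀ a x L n))
      (chartAt (EuclideanSpace ℝ (Fin d)) x₀).source

/-- `η` is an element of `A^k(M)`, a smooth exterior form `∑ η_{j₁…jₖ}(x) dx^{j₁} ⋯ dx^{jₖ}`,
with components `η x J` at `x` in the coordinates of the preferred chart at `x`. -/
structure IsDiffForm (k : ℕ) (η : M → (Fin k → Fin d) → ℝ) : Prop where
  antisymm : ∀ x, IsAntisymm (η x)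
  smooth : ∀ (x₀ : M) (J : Fin k → Fin d),
    ContMDiffOn (𝓡 d) 𝓘(ℝ) ∞
      (fun x => ∑ J' : Fin k → Fin d, (∏ s, (jac x₀ x)⁻¹ (J' s) (J s)) * η x J')
      (chartAt (EuclideanSpace ℝ (Fin d)) x₀).source

/-! ### The operators `δ`, `δ⁻¹`, `∇` and the action of one-forms with values in vector fields -/

/-- The operator `δ = dyⁱ ∂/∂yⁱ ·`. -/
def delta {B : FormalFiber d} {q : ℕ} (a : RawForm M B q) : RawForm M B (q + 1) := fun x =>
  dyMul fun i L => B.lie (Pi.single i 1) (a x L)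

/-- The operator `δ⁻¹` on forms of positive degree,
`δ⁻¹ a = y^k (∂/∂(dy^k)) ∫₀¹ a(x, t y, t dy) dt/t`, applied to all components: on terms of degree
`p` in `y` and `q + 1` in `dy` it is `(p + q + 1)⁻¹ y^k ∂/∂(dy^k)`. -/
def deltaInv {B : FormalFiber d} {q : ℕ} (a : RawForm M B (q + 1)) : RawForm M B q :=
  fun x L n m => ∑ k : Fin d, if 1 ≤ m k then
    ((q + 1 : ℕ) : ℝ) / ((m.degree + q : ℕ) : ℝ) *
      MvPowerSeries.coeff (m - Finsupp.single k 1) (a x (Fin.cons k L) n) else 0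

/-- The components of a fiberwise vector field. -/
def toVec {d : ℕ} (w : (fiberT d 1).ι → FPS d) : Fin d → FPS d := fun j => w fun _ => j

/-- The action `A · a = dy^k dy^L (A_k · a_L)` of `A = dy^k A_k ∈ Ω¹(M, T⁰_poly)`. -/
def actForm {B : FormalFiber d} {q : ℕ} (A : RawForm M (fiberT d 1) 1) (a : RawForm M B q) :
    RawForm M B (q + 1) := fun x =>
  dyMul fun k L => B.lie (toVec (A x fun _ => k)) (a x L)

/-- The coordinate vector field `∂/∂xʲ` of the preferred chart at `x₀` (on its domain). -/
def coordField (x₀ : M) (j : Fin d) (x : M) : TangentSpace (𝓡 d) x :=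
  tangentCoordChange (𝓡 d) x₀ x x (e j)

variable (cov : CovariantDerivative (𝓡 d) (EuclideanSpace ℝ (Fin d))
  (TangentSpace (𝓡 d) : M → Type _))

/-- The Christoffel symbol `Γᵏᵢⱼ` at `x` in the preferred chart at `x`:
`∇_{∂ᵢ} ∂ⱼ = Γᵏᵢⱼ ∂ₖ`. -/
def christoffel (x : M) (i j k : Fin d) : ℝ :=
  (show EuclideanSpace ℝ (Fin d) from cov (coordField x j) x (e i)) k

/-- The component `(R_{ij})ᵏₗ` of the Riemann curvature tensor at `x` in the preferred chart
at `x`: `∇_{∂ᵢ} ∇_{∂ⱼ} ∂ₗ - ∇_{∂ⱼ} ∇_{∂ᵢ} ∂ₗ = (R_{ij})ᵏₗ ∂ₖ`. -/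
def riemann (x : M) (i j k l : Fin d) : ℝ :=
  (show EuclideanSpace ℝ (Fin d) from
    cov (fun x' => cov (coordField x l) x' (coordField x j x')) x (e i) -
      cov (fun x' => cov (coordField x l) x' (coordField x i x')) x (e j)) k

/-- The partial derivative `∂/∂xⁱ` at `x` of the components of `a` in the preferred chart
at `x`. -/
def partialX {B : FormalFiber d} {q : ℕ} (a : RawForm M B q) (x : M) (i : Fin d) :
    (Fin q → Fin d) → B.ι → FPS d := fun L n m =>
  fderiv ℝ (fun z => MvPowerSeries.coeff m (inChart x a ((extChartAt (𝓡 d) x).symm z) L n))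
    (extChartAt (𝓡 d) x x) (e i)

/-- The vector field `Γᵢ = -Γᵏᵢⱼ yʲ ∂/∂yᵏ` at `x`. -/
def gammaVec (x : M) (i : Fin d) : Fin d → FPS d := fun k =>
  -∑ j, christoffel cov x i j k • (MvPowerSeries.X j : FPS d)

/-- The connection `∇ = dyⁱ ∂/∂xⁱ + Γ ·` with `Γ = -dyⁱ Γᵏᵢⱼ yʲ ∂/∂yᵏ`. -/
def nabla {B : FormalFiber d} {q : ℕ} (a : RawForm M B q) : RawForm M B (q + 1) := fun x =>
  dyMul fun i L => partialX a x i L + B.lie (gammaVec cov x i) (a x L)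

/-- The form `R = -½ dyⁱ dyʲ (R_{ij})ᵏₗ yˡ ∂/∂yᵏ ∈ Ω²(M, T⁰_poly)`. -/
def curvForm : RawForm M (fiberT d 1) 2 := fun x L J =>
  -((1 / 2 : ℝ) • ∑ l, riemann cov x (L 0) (L 1) (J 0) l • (MvPowerSeries.X l : FPS d))

/-! ### The Fedosov differential -/

/-- The iterations of `A = δ⁻¹ R + δ⁻¹ (∇ A + ½ [A, A])`, where
`½ [A, A] = ½ dyⁱ dyʲ [Aᵢ, Aⱼ] = ½ A · A`. -/
def fedosovIter : ℕ → RawForm M (fiberT d 1) 1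
  | 0 => 0
  | N + 1 => deltaInv (curvForm cov) + deltaInv (nabla cov (fedosovIter N) +
      (1 / 2 : ℝ) • actForm (fedosovIter N) (fedosovIter N))

/-- The form `A ∈ Ω¹(M, T⁰_poly)` to which the iterations converge: the part of degree `p` in `y`
does not change any more after `p` steps. -/
def fedosovA : RawForm M (fiberT d 1) 1 := fun x L J m =>
  MvPowerSeries.coeff m (fedosovIter cov m.degree x L J)

/-- The Fedosov differential `D = ∇ - δ + A ·`. -/
def fedosovD {B : FormalFiber d} {q : ℕ} (a : RawForm M B q) : RawForm M B (q + 1) :=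
  nabla cov a - delta a + actForm (fedosovA cov) a

/-- The iterations of `τ(a) = a + δ⁻¹ (∇ τ(a) + A · τ(a))`. -/
def liftIter {B : FormalFiber d} (a : RawForm M B 0) : ℕ → RawForm M B 0
  | 0 => a
  | N + 1 => a + deltaInv (nabla cov (liftIter a N) + actForm (fedosovA cov) (liftIter a N))

/-- The lift `τ(a)` to which the iterations converge: the part of degree `p` in `y` does not change
any more after `p` steps. -/
def lift {B : FormalFiber d} (a : RawForm M B 0) : RawForm M B 0 := fun x L n m =>
  MvPowerSeries.coeff m (liftIter cov a m.degree x L n)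

/-- `t` satisfies the equation `t = a + δ⁻¹ (∇ t + A · t)` which characterizes `t = τ(a)`. -/
def IsLift {B : FormalFiber d} (a t : RawForm M B 0) : Prop :=
  t = a + deltaInv (nabla cov t + actForm (fedosovA cov) t)

/-- The sections of `B` annihilated by the Fedosov differential: the zeroth cohomology
`H⁰(Ω(M, B), D)`. -/
def flatSections (B : FormalFiber d) : Set (RawForm M B 0) :=
  {a | IsForm B 0 a ∧ fedosovD cov a = 0}

/-- The space `ker δ ∩ Γ(M, B)` of the `y`-independent sections. -/
def constSections (M : Type*) [TopologicalSpace M] [ChartedSpace (EuclideanSpace ℝ (Fin d)) M]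
    [IsManifold (𝓡 d) ∞ M] (B : FormalFiber d) : Set (RawForm M B 0) :=
  {a | IsForm B 0 a ∧ delta a = 0}

/-- A function on `M` as a `y`-independent section of `SM`. -/
def ofFun (f : M → ℝ) : RawForm M (fiberSM d) 0 := fun x _ _ => MvPowerSeries.C (f x)

/-- An exterior form on `M` as a `y`-independent section of `E`. -/
def ofDiffForm {k : ℕ} (η : M → (Fin k → Fin d) → ℝ) : RawForm M (fiberE d k) 0 :=
  fun x _ J => MvPowerSeries.C (η x J)

/-- The product of fiberwise exterior forms. -/
def wedgeE {k l : ℕ} (a : RawForm M (fiberE d k) 0) (b : RawForm M (fiberE d l) 0) :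
    RawForm M (fiberE d (k + l)) 0 := fun x L => wedge (a x L) (b x L)

/-- The cup product of fiberwise polydifferential operators,
`(P ∪ Q)(f₁, …, f_{r+s}) = P(f₁, …, f_r) Q(f_{r+1}, …, f_{r+s})`. -/
def cup {r s : ℕ} (P : RawForm M (fiberD d r) 0) (Q : RawForm M (fiberD d s) 0) :
    RawForm M (fiberD d (r + s)) 0 := fun x L α =>
  P x L (fun i => α (Fin.castAdd s i)) * Q x L (fun i => α (Fin.natAdd r i))

end Manifold

end Fedosov

end

open scoped Manifold ContDiff

namespace Fedosov

open MvPowerSeries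

variable {d : ℕ}

/-! ### Linear substitutions and formal vector fields -/

/-! In a fiber, `δ` is the de Rham differential of formal power series. On forms of positive degree
it satisfies `δ⁻¹ δ + δ δ⁻¹ = 1`, because the Lie derivative along the Euler field multiplies by the
total degree in `y` and `dy` (`dInv_dOp_add`). The Fedosov differential perturbs `-δ` by `∇ + A ·`,
which does not lower the degree in `y`, whereas `δ⁻¹` raises it by one. Every equation `t = c + δ⁻¹
(∇ t + A · t)` is therefore a fixed point equation for a contraction in the `y`-adic filtration and
has exactly one solution (`Contracting.unique`, `Contracting.map_limForm`). The quadratic equation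
for `A` is of the same kind on one-forms that vanish at `y = 0`.

The central consequence is `eq_zero_of_fedosovD_eq_zero`: a form `a` of positive degree annihilated
by both `D` and `δ⁻¹` vanishes, since the homotopy formula turns into `a = δ⁻¹ (∇ a + A · a)`. It is
applied three times. For the curvature `F = R + ∇ A - δ A + ½ [A, A]`, the Bianchi identity gives `D
F = 0` and the equation for `A` gives `δ⁻¹ F = 0`; so `F = 0` and `D² = 0`. For a closed form `a`,
let `b` solve `b = -δ⁻¹ a + δ⁻¹ (∇ b + A · b)`; then `D b - a` is annihilated by both operators, so
`D b = a`. For a `y`-independent section `a`, the form `D τ(a)` is annihilated by both, so lifts are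
flat.

Conversely, in degree zero `δ⁻¹ δ t = t - t|_{y=0}`. A flat section `t` thus satisfies the equation
of the lift of `t|_{y=0}`, and restriction to `y = 0` inverts `τ`. Since `D` is a derivation of the
products, a product of lifts is flat, hence is the lift of its restriction to `y = 0`; this makes
`τ` multiplicative.

These arguments need `D` to have the expected expression in every chart, although the components at
`x` refer to the preferred chart at `x` itself. In a change of charts the derivative of the Jacobi
matrix produces two extra terms. One is absorbed by the inhomogeneous transformation of the
Christoffel symbols (`locGamma_eq`); the other is symmetric in two form indices and is killed by
antisymmetrization (`dyMul_symm_eq_zero`). Hence `D` is locally a covariant derivative with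
connection form `Γᵢ - ∂/∂yⁱ + Aᵢ`, and its square is the action of half the curvature (`locD_locD`).
Vanishing torsion removes the mixed terms of `δ` and `Γ` from that curvature.

The bundles enter only through `LawfulFiber`. The laws are proved by representing components
faithfully as multilinear operators (`OpModel`): on vector fields for exterior forms, on functions
for polyvector fields and polydifferential operators. There coordinate changes are conjugations and
vector fields act by commutators. As polydifferential operators have infinitely many possible
components, the laws are stated on finite sets of components stable under both actions, such as the
operators of bounded order. -/

lemma hasSubst_linear (h : Matrix (Fin d) (Fin d) ℝ) :
    HasSubst (fun i => ∑ j, h i j • (X j : FPS d)) := by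
  apply hasSubst_of_constantCoeff_zero
  intro s
  simp

/-- `substLin` as a homomorphism of algebras. -/
noncomputable def substLinHom (h : Matrix (Fin d) (Fin d) ℝ) : FPS d →ₐ[ℝ] FPS d :=
  substAlgHom (hasSubst_linear h)

lemma substLin_eq (h : Matrix (Fin d) (Fin d) ℝ) (f : FPS d) : substLin h f = substLinHom h f := by
  rw [substLin, substLinHom, coe_substAlgHom]

lemma substLin_add (h : Matrix (Fin d) (Fin d) ℝ) (f g : FPS d) :
    substLin h (f + g) = substLin h f + substLin h g := by simp [substLin_eq]

lemma substLin_mul (h : Matrix (Fin d) (Fin d) ℝ) (f g : FPS d) :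
    substLin h (f * g) = substLin h f * substLin h g := by simp [substLin_eq]

lemma substLin_smul (h : Matrix (Fin d) (Fin d) ℝ) (c : ℝ) (f : FPS d) :
    substLin h (c • f) = c • substLin h f := by simp [substLin_eq]

lemma substLin_zero (h : Matrix (Fin d) (Fin d) ℝ) : substLin h (0 : FPS d) = 0 := by
  simp [substLin_eq]

lemma substLin_one (h : Matrix (Fin d) (Fin d) ℝ) : substLin h (1 : FPS d) = 1 := by
  simp [substLin_eq]

lemma substLin_neg (h : Matrix (Fin d) (Fin d) ℝ) (f : FPS d) :
    substLin h (-f) = -substLin h f := by simp [substLin_eq]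

lemma substLin_sub (h : Matrix (Fin d) (Fin d) ℝ) (f g : FPS d) :
    substLin h (f - g) = substLin h f - substLin h g := by simp [substLin_eq]

lemma substLin_sum (h : Matrix (Fin d) (Fin d) ℝ) {ι : Type*} (s : Finset ι) (f : ι → FPS d) :
    substLin h (∑ i ∈ s, f i) = ∑ i ∈ s, substLin h (f i) := by simp [substLin_eq]

lemma substLin_prod (h : Matrix (Fin d) (Fin d) ℝ) {ι : Type*} (s : Finset ι) (f : ι → FPS d) :
    substLin h (∏ i ∈ s, f i) = ∏ i ∈ s, substLin h (f i) := by simp [substLin_eq]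

lemma substLin_C (h : Matrix (Fin d) (Fin d) ℝ) (c : ℝ) :
    substLin h (C c : FPS d) = C c := by
  rw [substLin_eq]
  exact (substLinHom h).commutes c

lemma substLin_X (h : Matrix (Fin d) (Fin d) ℝ) (i : Fin d) :
    substLin h (X i) = ∑ j, h i j • (X j : FPS d) := by
  rw [substLin, subst_X (hasSubst_linear h)]

/-- Substitution is contravariant: inserting `g y` into `f(h y)` gives `f(h (g y))`. Hence `g ↦
substLin g⁻¹` is a left action. -/
lemma substLin_substLin (g h : Matrix (Fin d) (Fin d) ℝ) (f : FPS d) :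
    substLin g (substLin h f) = substLin (h * g) f := by
  rw [substLin, substLin, subst_comp_subst_apply (hasSubst_linear h) (hasSubst_linear g), substLin]
  congr 1
  funext i
  change substLin g _ = _
  simp only [substLin_sum, substLin_smul, substLin_X, Finset.smul_sum, Matrix.mul_apply,
    Finset.sum_smul, smul_smul]
  rw [Finset.sum_comm]

lemma substLin_one_matrix (f : FPS d) : substLin 1 f = f := by
  have : (fun i => ∑ j, (1 : Matrix (Fin d) (Fin d) ℝ) i j • (X j : FPS d)) = X := by
    funext i
    simp [Matrix.one_apply]
  rw [substLin, this, subst_self]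
  rfl

/-- The finite set of exponents of a given degree. -/
def degSet (d n : ℕ) : Finset (Fin d →₀ ℕ) := Finset.univ.finsuppAntidiag n

lemma mem_degSet {n : ℕ} {m : Fin d →₀ ℕ} : m ∈ degSet d n ↔ m.degree = n := by
  simp [degSet, Finsupp.degree_eq_sum]

/-- The finite set of exponents of degree at most a given number. -/
def degSetLE (d n : ℕ) : Finset (Fin d →₀ ℕ) := (Finset.range (n + 1)).biUnion (degSet d)

lemma mem_degSetLE {n : ℕ} {m : Fin d →₀ ℕ} : m ∈ degSetLE d n ↔ m.degree ≤ n := by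
  simp [degSetLE, mem_degSet]

/-- The image of a monomial is a product of powers of linear forms, hence a homogeneous polynomial
of the same degree. -/
lemma coeff_substLin_monomial (h : Matrix (Fin d) (Fin d) ℝ) {k m : Fin d →₀ ℕ}
    (hkm : k.degree ≠ m.degree) (c : ℝ) : coeff m (substLin h (monomial k c)) = 0 := by
  have : substLin h (monomial k c) = ((MvPolynomial.C c * k.prod fun i n =>
      (∑ j, h i j • (MvPolynomial.X j : MvPolynomial (Fin d) ℝ)) ^ n : MvPolynomial (Fin d) ℝ) :
        FPS d) := by
    rw [substLin_eq, substLinHom, substAlgHom_monomial]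
    simp only [Finsupp.prod, MvPolynomial.coe_mul, MvPolynomial.coe_C]
    congr 1
    rw [← MvPolynomial.coeToMvPowerSeries.ringHom_apply, map_prod]
    refine Finset.prod_congr rfl fun i _ => ?_
    rw [map_pow, map_sum]
    congr 1
    refine Finset.sum_congr rfl fun j _ => ?_
    rw [MvPolynomial.coeToMvPowerSeries.ringHom_apply, MvPolynomial.coe_smul, MvPolynomial.coe_X]
  rw [this, MvPolynomial.coeff_coe]
  apply MvPolynomial.IsHomogeneous.coeff_eq_zero (n := 0 + ∑ i ∈ k.support, k i)
  · apply MvPolynomial.IsHomogeneous.mul (MvPolynomial.isHomogeneous_C _ _)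
    apply MvPolynomial.IsHomogeneous.prod
    intro i _
    have : (∑ j, h i j • (MvPolynomial.X j : MvPolynomial (Fin d) ℝ)).IsHomogeneous 1 := by
      apply MvPolynomial.IsHomogeneous.sum
      intro j _
      rw [MvPolynomial.smul_eq_C_mul]
      simpa using (MvPolynomial.isHomogeneous_C (Fin d) (h i j)).mul
        (MvPolynomial.isHomogeneous_X ℝ j)
    simpa using this.pow (k i)
  · rw [zero_add]
    exact fun hh => hkm hh.symm

/-- Homogeneity makes every coefficient of `f(h y)` a finite sum. Derivatives and smoothness of
families `f(h y)` can therefore be checked on monomials. -/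
lemma coeff_substLin (h : Matrix (Fin d) (Fin d) ℝ) (f : FPS d) (m : Fin d →₀ ℕ) :
    coeff m (substLin h f) = ∑ k ∈ degSet d m.degree,
      coeff k f * coeff m (substLin h (monomial k (1 : ℝ))) := by
  have key : ∀ k : Fin d →₀ ℕ, coeff m (k.prod fun s e => (∑ j, h s j • (X j : FPS d)) ^ e) =
      coeff m (substLin h (monomial k (1 : ℝ))) := by
    intro k
    rw [substLin_eq, substLinHom, substAlgHom_monomial, map_one, one_mul]
  rw [substLin, coeff_subst (hasSubst_linear h), finsum_eq_sum_of_support_subset]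
  · refine Finset.sum_congr rfl fun k _ => ?_
    rw [key, smul_eq_mul]
  · intro k hk
    by_contra hk'
    apply hk
    simp only [Finset.mem_coe, mem_degSet] at hk'
    simp only [key, coeff_substLin_monomial h hk', smul_zero]

/-- Density of polynomials: if each coefficient of the image involves only bounded degrees of the
argument, the argument may be replaced by a truncation. -/
lemma ext_of_polynomial {T T' : FPS d →ₗ[ℝ] FPS d}
    (hT : ∀ m, ∃ N : ℕ, ∀ f : FPS d, (∀ k, k.degree ≤ N → coeff k f = 0) → coeff m (T f) = 0)
    (hT' : ∀ m, ∃ N : ℕ, ∀ f : FPS d, (∀ k, k.degree ≤ N → coeff k f = 0) → coeff m (T' f) = 0)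
    (h : ∀ p : MvPolynomial (Fin d) ℝ, T p = T' p) : T = T' := by
  ext f m
  obtain ⟨N, hN⟩ := hT m
  obtain ⟨N', hN'⟩ := hT' m
  -- `truncTotal n` keeps the degrees below `n`, hence the `+ 1`.
  set p : MvPolynomial (Fin d) ℝ := truncTotal (max N N' + 1) f
  have hp : ∀ k : Fin d →₀ ℕ, k.degree ≤ max N N' → coeff k (f - (p : FPS d)) = 0 := by
    intro k hk
    rw [map_sub, MvPolynomial.coeff_coe, coeff_truncTotal _ (Nat.lt_succ_of_le hk), sub_self]
  have h1 := hN (f - (p : FPS d)) fun k hk => hp k (hk.trans (le_max_left _ _))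
  have h2 := hN' (f - (p : FPS d)) fun k hk => hp k (hk.trans (le_max_right _ _))
  rw [map_sub, map_sub, sub_eq_zero] at h1 h2
  rw [h1, h2, h]

lemma coeff_substLin_eq_zero (h : Matrix (Fin d) (Fin d) ℝ) {f : FPS d} {N : ℕ}
    (hf : ∀ k : Fin d →₀ ℕ, k.degree ≤ N → coeff k f = 0) {m : Fin d →₀ ℕ} (hm : m.degree ≤ N) :
    coeff m (substLin h f) = 0 := by
  rw [coeff_substLin]
  refine Finset.sum_eq_zero fun k hk => ?_
  rw [hf k ((mem_degSet.1 hk).le.trans hm), zero_mul]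

lemma degree_add_single (m : Fin d →₀ ℕ) (j : Fin d) (n : ℕ) :
    (m + Finsupp.single j n).degree = m.degree + n := by
  rw [map_add, Finsupp.degree_single]

/-- The chain rule for linear substitutions. -/
lemma pderiv_substLin (h : Matrix (Fin d) (Fin d) ℝ) (j : Fin d) (f : FPS d) :
    pderiv ℝ j (substLin h f) = ∑ i, h i j • substLin h (pderiv ℝ i f) := by
  let T : FPS d →ₗ[ℝ] FPS d := (pderiv ℝ j).toLinearMap ∘ₗ (substLinHom h).toLinearMap
  let T' : FPS d →ₗ[ℝ] FPS d :=
    ∑ i, h i j • ((substLinHom h).toLinearMap ∘ₗ (pderiv ℝ i).toLinearMap)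
  have hT : ∀ f, T f = pderiv ℝ j (substLin h f) := fun f => by simp [T, substLin_eq]
  have hT' : ∀ f, T' f = ∑ i, h i j • substLin h (pderiv ℝ i f) := fun f => by
    simp [T', substLin_eq]
  rw [← hT, ← hT']
  congr 1
  -- A coefficient of degree `n` on either side depends on `f` only up to degree `n + 1`, so
  -- induction over polynomials with the Leibniz rule is enough.
  apply ext_of_polynomial
  · intro m
    refine ⟨m.degree + 1, fun f hf => ?_⟩
    rw [hT, coeff_pderiv, coeff_substLin_eq_zero h hf, zero_mul]
    rw [degree_add_single]
  · intro m
    refine ⟨m.degree + 1, fun f hf => ?_⟩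
    rw [hT', map_sum]
    refine Finset.sum_eq_zero fun i _ => ?_
    rw [map_smul, coeff_substLin_eq_zero h (N := m.degree) _ le_rfl, smul_zero]
    intro k hk
    rw [coeff_pderiv, hf, zero_mul]
    rw [degree_add_single]
    omega
  · intro p
    induction p using MvPolynomial.induction_on with
    | C a =>
      rw [hT, hT', MvPolynomial.coe_C, substLin_C]
      simp [pderiv_C, substLin_zero]
    | add p q hp hq => rw [MvPolynomial.coe_add, map_add, map_add, hp, hq]
    | mul_X p i hp =>
      rw [hT, hT'] at hp
      rw [hT, hT', MvPolynomial.coe_mul, MvPolynomial.coe_X, substLin_mul, Derivation.leibniz, hp,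
        substLin_X, map_sum]
      simp only [Derivation.leibniz, smul_eq_mul, substLin_add, substLin_mul, substLin_X,
        Derivation.map_smul, smul_add, Finset.sum_add_distrib, pderiv_X, Pi.single_apply]
      congr 1
      · simp only [mul_ite, mul_one, mul_zero, smul_ite, smul_zero, apply_ite (substLin h),
          substLin_one, substLin_zero, Finset.sum_ite_eq', Finset.sum_ite_eq, Finset.mem_univ,
          if_true, mul_smul_comm]
      · rw [Finset.mul_sum]
        exact Finset.sum_congr rfl fun k _ => mul_smul_comm _ _ _

lemma pderiv_comm (i j : Fin d) (f : FPS d) :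
    pderiv ℝ i (pderiv ℝ j f) = pderiv ℝ j (pderiv ℝ i f) := by
  ext m
  simp only [coeff_pderiv, Finsupp.add_apply, Finsupp.single_apply]
  by_cases h : i = j
  · subst h; rfl
  · rw [add_right_comm]
    simp [h, Ne.symm h]
    ring

/-- The linear change of coordinates of a formal vector field. -/
noncomputable def push (g : Matrix (Fin d) (Fin d) ℝ) (v : Fin d → FPS d) : Fin d → FPS d :=
  fun i => ∑ j, g i j • substLin g⁻¹ (v j)

/-- The commutator of formal vector fields. -/
noncomputable def vbr (v w : Fin d → FPS d) : Fin d → FPS d :=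
  fun i => vfApply v (w i) - vfApply w (v i)

/-- The linear vector field with a given matrix. -/
noncomputable def linVec (B : Matrix (Fin d) (Fin d) ℝ) : Fin d → FPS d :=
  fun i => ∑ j, B i j • (X j : FPS d)

section vfApply

variable (v w : Fin d → FPS d) (f g : FPS d)

lemma vfApply_add : vfApply v (f + g) = vfApply v f + vfApply v g := by
  simp [vfApply, mul_add, Finset.sum_add_distrib]

lemma vfApply_zero : vfApply v (0 : FPS d) = 0 := by
  simp [vfApply]

lemma vfApply_one : vfApply v (1 : FPS d) = 0 := by
  simp [vfApply]

lemma vfApply_neg : vfApply v (-f) = -vfApply v f := by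
  simp [vfApply]

lemma vfApply_sub : vfApply v (f - g) = vfApply v f - vfApply v g := by
  rw [sub_eq_add_neg, vfApply_add, vfApply_neg, sub_eq_add_neg]

lemma vfApply_smul (c : ℝ) : vfApply v (c • f) = c • vfApply v f := by
  simp [vfApply, Finset.smul_sum]

lemma vfApply_sum {ι : Type*} (s : Finset ι) (f : ι → FPS d) :
    vfApply v (∑ i ∈ s, f i) = ∑ i ∈ s, vfApply v (f i) := by
  simp only [vfApply, map_sum, Finset.mul_sum]
  rw [Finset.sum_comm]

lemma vfApply_mul : vfApply v (f * g) = vfApply v f * g + f * vfApply v g := by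
  simp only [vfApply, Derivation.leibniz, smul_eq_mul, Finset.sum_mul, Finset.mul_sum,
    ← Finset.sum_add_distrib]
  refine Finset.sum_congr rfl fun i _ => ?_
  ring

lemma vfApply_prod {ι : Type*} [DecidableEq ι] (s : Finset ι) (f : ι → FPS d) :
    vfApply v (∏ i ∈ s, f i) = ∑ i ∈ s, (∏ j ∈ s.erase i, f j) * vfApply v (f i) := by
  induction s using Finset.induction_on with
  | empty => simp [vfApply_one]
  | insert a s ha ih =>
    rw [Finset.prod_insert ha, vfApply_mul, ih, Finset.sum_insert ha, Finset.erase_insert ha,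
      mul_comm, Finset.mul_sum]
    congr 1
    refine Finset.sum_congr rfl fun i hi => ?_
    have hia : i ≠ a := fun h => ha (h ▸ hi)
    rw [Finset.erase_insert_of_ne hia.symm, Finset.prod_insert (by simp [ha]), mul_assoc]

lemma vfApply_add_left : vfApply (v + w) f = vfApply v f + vfApply w f := by
  simp [vfApply, add_mul, Finset.sum_add_distrib]

lemma vfApply_smul_left (c : ℝ) : vfApply (c • v) f = c • vfApply v f := by
  simp [vfApply, Finset.smul_sum]

lemma vfApply_single (i : Fin d) : vfApply (Pi.single i 1) f = pderiv ℝ i f := by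
  simp [vfApply, Pi.single_apply]

/-- The second order terms `vʲ wⁱ ∂ⱼ∂ᵢ f` are symmetric in `v` and `w` and cancel in the commutator.
-/
lemma vfApply_vbr : vfApply (vbr v w) f = vfApply v (vfApply w f) - vfApply w (vfApply v f) := by
  have h : ∀ v w : Fin d → FPS d, vfApply v (vfApply w f) =
      ∑ i, vfApply v (w i) * pderiv ℝ i f + ∑ i, ∑ j, v j * w i * pderiv ℝ j (pderiv ℝ i f) := by
    intro v w
    conv_lhs => rw [vfApply.eq_1 w, vfApply_sum]
    rw [← Finset.sum_add_distrib]
    refine Finset.sum_congr rfl fun i _ => ?_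
    rw [vfApply_mul, vfApply.eq_1 v (pderiv ℝ i f), Finset.mul_sum]
    congr 1
    refine Finset.sum_congr rfl fun j _ => ?_
    ring
  have hs : ∑ i, ∑ j, v j * w i * pderiv ℝ j (pderiv ℝ i f) =
      ∑ i, ∑ j, w j * v i * pderiv ℝ j (pderiv ℝ i f) := by
    rw [Finset.sum_comm]
    refine Finset.sum_congr rfl fun i _ => Finset.sum_congr rfl fun j _ => ?_
    rw [pderiv_comm, mul_comm (w j)]
  rw [h v w, h w v, hs, vfApply]
  simp only [vbr, sub_mul, Finset.sum_sub_distrib]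
  ring

/-- The matrix `M⁻¹` produced by the chain rule cancels the factor `M` in `push`. -/
lemma vfApply_push {M : Matrix (Fin d) (Fin d) ℝ} (hM : IsUnit M.det) :
    vfApply (push M v) (substLin M⁻¹ f) = substLin M⁻¹ (vfApply v f) := by
  simp only [vfApply, push, pderiv_substLin, substLin_sum, substLin_mul]
  have : ∀ i, (∑ j, M i j • substLin M⁻¹ (v j)) *
      (∑ k, M⁻¹ k i • substLin M⁻¹ (pderiv ℝ k f)) =
      ∑ j, ∑ k, (M⁻¹ k i * M i j) • (substLin M⁻¹ (v j) * substLin M⁻¹ (pderiv ℝ k f)) := by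
    intro i
    rw [Finset.sum_mul_sum]
    refine Finset.sum_congr rfl fun j _ => Finset.sum_congr rfl fun k _ => ?_
    rw [smul_mul_smul_comm, mul_comm]
  simp only [this]
  rw [Finset.sum_comm]
  refine Finset.sum_congr rfl fun j _ => ?_
  rw [Finset.sum_comm]
  have h1 : ∀ k, ∑ i, M⁻¹ k i * M i j = (1 : Matrix (Fin d) (Fin d) ℝ) k j := by
    intro k
    rw [← Matrix.mul_apply, Matrix.nonsing_inv_mul _ hM]
  simp only [← Finset.sum_smul, h1, Matrix.one_apply]
  simp

end vfApply

/-! ### The order of a formal power series -/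

/-- All terms of `f` have degree at least `p` in `y`. -/
def OrdGE (p : ℕ) (f : FPS d) : Prop := ∀ k : Fin d →₀ ℕ, k.degree < p → coeff k f = 0

lemma OrdGE.zero_fun (p : ℕ) : OrdGE p (0 : FPS d) := fun _ _ => by simp

lemma OrdGE.of_zero (f : FPS d) : OrdGE 0 f := fun _ h => absurd h (Nat.not_lt_zero _)

lemma OrdGE.mono {p q : ℕ} {f : FPS d} (h : OrdGE q f) (hpq : p ≤ q) : OrdGE p f :=
  fun k hk => h k (hk.trans_le hpq)

lemma OrdGE.add {p : ℕ} {f g : FPS d} (hf : OrdGE p f) (hg : OrdGE p g) : OrdGE p (f + g) :=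
  fun k hk => by rw [map_add, hf k hk, hg k hk, add_zero]

lemma OrdGE.neg {p : ℕ} {f : FPS d} (hf : OrdGE p f) : OrdGE p (-f) :=
  fun k hk => by rw [map_neg, hf k hk, neg_zero]

lemma OrdGE.sub {p : ℕ} {f g : FPS d} (hf : OrdGE p f) (hg : OrdGE p g) : OrdGE p (f - g) :=
  fun k hk => by rw [map_sub, hf k hk, hg k hk, sub_zero]

lemma OrdGE.smul {p : ℕ} {f : FPS d} (c : ℝ) (hf : OrdGE p f) : OrdGE p (c • f) :=
  fun k hk => by rw [map_smul, hf k hk, smul_zero]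

lemma OrdGE.sum {p : ℕ} {ι : Type*} {s : Finset ι} {f : ι → FPS d}
    (hf : ∀ i ∈ s, OrdGE p (f i)) : OrdGE p (∑ i ∈ s, f i) :=
  fun k hk => by rw [map_sum]; exact Finset.sum_eq_zero fun i hi => hf i hi k hk

lemma OrdGE.mul {p q : ℕ} {f g : FPS d} (hf : OrdGE p f) (hg : OrdGE q g) :
    OrdGE (p + q) (f * g) := by
  classical
  intro k hk
  rw [coeff_mul]
  refine Finset.sum_eq_zero fun ⟨a, b⟩ hab => ?_
  rw [Finset.HasAntidiagonal.mem_antidiagonal] at hab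
  simp only at hab ⊢
  have : a.degree + b.degree < p + q := by rw [← map_add, hab]; exact hk
  by_cases ha : a.degree < p
  · rw [hf a ha, zero_mul]
  · rw [hg b (by omega), mul_zero]

lemma OrdGE.pderiv {p : ℕ} {f : FPS d} (i : Fin d) (hf : OrdGE p f) :
    OrdGE (p - 1) (MvPowerSeries.pderiv ℝ i f) := by
  intro k hk
  rw [coeff_pderiv, hf, zero_mul]
  rw [degree_add_single]
  omega

lemma OrdGE.vfApply {p q : ℕ} {v : Fin d → FPS d} {f : FPS d} (hv : ∀ i, OrdGE q (v i))
    (hf : OrdGE p f) : OrdGE (q + (p - 1)) (vfApply v f) :=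
  OrdGE.sum fun i _ => (hv i).mul (hf.pderiv i)

lemma OrdGE.substLin {p : ℕ} {f : FPS d} (h : Matrix (Fin d) (Fin d) ℝ) (hf : OrdGE p f) :
    OrdGE p (substLin h f) := by
  intro k hk
  rw [coeff_substLin]
  refine Finset.sum_eq_zero fun l hl => ?_
  rw [hf l (by rw [mem_degSet.1 hl]; exact hk), zero_mul]

lemma ordGE_X (i : Fin d) : OrdGE 1 (X i : FPS d) := by
  intro k hk
  have : k = 0 := by
    have : k.degree = 0 := by omega
    exact (Finsupp.degree_eq_zero_iff k).1 this
  subst this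
  simp

lemma ordGE_linVec (B : Matrix (Fin d) (Fin d) ℝ) (i : Fin d) : OrdGE 1 (linVec B i) :=
  OrdGE.sum fun j _ => (ordGE_X j).smul _

lemma ordGE_sub_truncTotal (N : ℕ) (f : FPS d) :
    OrdGE N (f - ((truncTotal N f : MvPolynomial (Fin d) ℝ) : FPS d)) := by
  intro k hk
  rw [map_sub, MvPolynomial.coeff_coe, coeff_truncTotal _ hk, sub_self]

/-! ### Differentiation of curves of formal power series -/

/-- The curve `f` of formal power series has the coefficientwise derivative `f'` at `0`. -/
def HasDer (f : ℝ → FPS d) (f' : FPS d) : Prop :=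
  ∀ m, HasDerivAt (fun t => coeff m (f t)) (coeff m f') 0

lemma coeff_dPow (α : Fin d →₀ ℕ) (f : FPS d) (m : Fin d →₀ ℕ) : coeff m (dPow α f) =
    (∏ j, (((m j + α j).descFactorial (α j) : ℕ) : ℝ)) * coeff (m + α) f := rfl

namespace HasDer

variable {f g : ℝ → FPS d} {f' g' : FPS d}

lemma congr (hf : HasDer f f') (h : g =ᶠ[nhds 0] f) : HasDer g f' := fun m =>
  (hf m).congr_of_eventuallyEq (h.mono fun t ht => by simp only [ht])

lemma unique {f'' : FPS d} (hf : HasDer f f') (hf' : HasDer f f'') : f' = f'' := by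
  ext m
  exact (hf m).unique (hf' m)

lemma const (f : FPS d) : HasDer (fun _ => f) 0 := fun m => by
  simpa using hasDerivAt_const (0 : ℝ) (coeff m f)

lemma add (hf : HasDer f f') (hg : HasDer g g') : HasDer (fun t => f t + g t) (f' + g') :=
  fun m => by simpa using (hf m).fun_add (hg m)

lemma neg (hf : HasDer f f') : HasDer (fun t => -f t) (-f') :=
  fun m => by simpa using (hf m).fun_neg

lemma sub (hf : HasDer f f') (hg : HasDer g g') : HasDer (fun t => f t - g t) (f' - g') :=
  fun m => by simpa using (hf m).fun_sub (hg m)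

lemma sum {ι : Type*} {s : Finset ι} {f : ι → ℝ → FPS d} {f' : ι → FPS d}
    (hf : ∀ i ∈ s, HasDer (f i) (f' i)) : HasDer (fun t => ∑ i ∈ s, f i t) (∑ i ∈ s, f' i) :=
  fun m => by simpa using HasDerivAt.fun_sum fun i hi => hf i hi m

lemma smul {c : ℝ → ℝ} {c' : ℝ} (hc : HasDerivAt c c' 0) (hf : HasDer f f') :
    HasDer (fun t => c t • f t) (c' • f 0 + c 0 • f') :=
  fun m => by simpa using hc.fun_mul (hf m)

lemma const_smul (c : ℝ) (hf : HasDer f f') : HasDer (fun t => c • f t) (c • f') :=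
  fun m => by simpa using (hf m).const_mul c

lemma mul (hf : HasDer f f') (hg : HasDer g g') :
    HasDer (fun t => f t * g t) (f' * g 0 + f 0 * g') := by
  classical
  intro m
  simp only [map_add, coeff_mul, ← Finset.sum_add_distrib]
  exact HasDerivAt.fun_sum fun p _ => (hf p.1).mul (hg p.2)

lemma prod {ι : Type*} [DecidableEq ι] {s : Finset ι} {f : ι → ℝ → FPS d} {f' : ι → FPS d}
    (hf : ∀ i ∈ s, HasDer (f i) (f' i)) :
    HasDer (fun t => ∏ i ∈ s, f i t) (∑ i ∈ s, (∏ j ∈ s.erase i, f j 0) * f' i) := by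
  induction s using Finset.induction_on with
  | empty => simpa using const (1 : FPS d)
  | insert a s ha ih =>
    have h := (hf a (by simp)).mul (ih fun i hi => hf i (by simp [hi]))
    simp only [Finset.prod_insert ha]
    convert h using 1
    rw [Finset.sum_insert ha, Finset.erase_insert ha, mul_comm, Finset.mul_sum]
    congr 1
    refine Finset.sum_congr rfl fun i hi => ?_
    have hia : i ≠ a := fun h => ha (h ▸ hi)
    rw [Finset.erase_insert_of_ne hia.symm, Finset.prod_insert (by simp [ha]), mul_assoc]

lemma pderiv (i : Fin d) (hf : HasDer f f') :
    HasDer (fun t => MvPowerSeries.pderiv ℝ i (f t)) (MvPowerSeries.pderiv ℝ i f') :=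
  fun m => by simpa [coeff_pderiv] using (hf _).mul_const _

lemma vfApply {v : ℝ → Fin d → FPS d} {v' : Fin d → FPS d}
    (hv : ∀ i, HasDer (fun t => v t i) (v' i)) (hf : HasDer f f') :
    HasDer (fun t => vfApply (v t) (f t)) (vfApply v' (f 0) + vfApply (v 0) f') := by
  simp only [Fedosov.vfApply, ← Finset.sum_add_distrib]
  exact HasDer.sum fun i _ => (hv i).mul (hf.pderiv i)

lemma dPow (α : Fin d →₀ ℕ) (hf : HasDer f f') :
    HasDer (fun t => Fedosov.dPow α (f t)) (Fedosov.dPow α f') :=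
  fun m => by simpa only [coeff_dPow] using (hf _).const_mul _

/-- On polynomials this is the product rule, starting from the linear forms `h(t) y`. The general
case follows by truncation: neither the substitution nor a linear vector field lowers the degree, so
a coefficient sees only finitely many terms of `f`. -/
lemma substLin_const {h : ℝ → Matrix (Fin d) (Fin d) ℝ} {h' : Matrix (Fin d) (Fin d) ℝ}
    (h0 : h 0 = 1) (hh : ∀ i j, HasDerivAt (fun t => h t i j) (h' i j) 0) (f : FPS d) :
    HasDer (fun t => substLin (h t) f) (Fedosov.vfApply (linVec h') f) := by
  have hp : ∀ p : MvPolynomial (Fin d) ℝ, HasDer (fun t => substLin (h t) (p : FPS d))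
      (Fedosov.vfApply (linVec h') (p : FPS d)) := by
    intro p
    induction p using MvPolynomial.induction_on with
    | C a =>
      simp only [MvPolynomial.coe_C, substLin_C]
      simpa [Fedosov.vfApply, pderiv_C] using const (C a : FPS d)
    | add p q hp hq => simpa [substLin_add, vfApply_add] using hp.add hq
    | mul_X p i hp =>
      simp only [MvPolynomial.coe_mul, MvPolynomial.coe_X, substLin_mul, vfApply_mul]
      have hX : HasDer (fun t => substLin (h t) (X i))
          (Fedosov.vfApply (linVec h') (X i)) := by
        have h1 : HasDer (fun t => ∑ j, h t i j • (X j : FPS d)) (∑ j, h' i j • (X j : FPS d)) := by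
          refine HasDer.sum fun j _ => ?_
          simpa using smul (hh i j) (const (X j : FPS d))
        simpa [substLin_X, Fedosov.vfApply, linVec, pderiv_X, Pi.single_apply] using h1
      simpa [h0, substLin_one_matrix] using hp.mul hX
  intro m
  set p : MvPolynomial (Fin d) ℝ := truncTotal (m.degree + 1) f
  have hr := ordGE_sub_truncTotal (m.degree + 1) f
  have h1 : ∀ t, coeff m (substLin (h t) f) = coeff m (substLin (h t) (p : FPS d)) := by
    intro t
    rw [← sub_eq_zero, ← map_sub, ← substLin_sub]
    exact hr.substLin _ m (Nat.lt_succ_self _)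
  have h2 : coeff m (Fedosov.vfApply (linVec h') f) =
      coeff m (Fedosov.vfApply (linVec h') (p : FPS d)) := by
    rw [← sub_eq_zero, ← map_sub, ← vfApply_sub]
    refine (OrdGE.vfApply (ordGE_linVec h') hr) m ?_
    omega
  simp only [h1, h2]
  exact hp p m

lemma substLin {h : ℝ → Matrix (Fin d) (Fin d) ℝ} {h' : Matrix (Fin d) (Fin d) ℝ}
    (h0 : h 0 = 1) (hh : ∀ i j, HasDerivAt (fun t => h t i j) (h' i j) 0) (hf : HasDer f f') :
    HasDer (fun t => substLin (h t) (f t)) (f' + Fedosov.vfApply (linVec h') (f 0)) := by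
  intro m
  have h1 := HasDerivAt.fun_sum (u := degSet d m.degree)
    fun k _ => (hf k).mul (substLin_const h0 hh (monomial k (1 : ℝ)) m)
  have h2 := HasDerivAt.fun_sum (u := degSet d m.degree)
    fun k _ => (substLin_const h0 hh (monomial k (1 : ℝ)) m).const_mul (coeff k (f 0))
  have h3 := substLin_const h0 hh (f 0) m
  simp only [← coeff_substLin, Finset.sum_add_distrib] at h1 h2
  -- The part of the product rule in which only the matrix varies is the derivative for the constant
  -- series `f 0`; uniqueness of derivatives identifies it with the action of the linear field.
  rw [h2.unique h3, h0, substLin_one_matrix] at h1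
  rw [map_add]
  refine h1.congr_of_eventuallyEq (Filter.Eventually.of_forall fun t => ?_)
  simp only [coeff_substLin (h t) (f t) m, Pi.mul_apply]

end HasDer

/-! ### Smooth families of formal power series -/

section Smooth

variable {E : Type*} [NormedAddCommGroup E] [NormedSpace ℝ E]

/-- The coefficients of the family `f` of formal power series are smooth at `z`. -/
def SmoothAt (f : E → FPS d) (z : E) : Prop :=
  ∀ m, ContDiffAt ℝ ∞ (fun t => coeff m (f t)) z

namespace SmoothAt

variable {f g : E → FPS d} {z : E}

lemma congr (hf : SmoothAt f z) (h : g =ᶠ[nhds z] f) : SmoothAt g z := fun m =>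
  (hf m).congr_of_eventuallyEq (h.mono fun t ht => by simp only [ht])

lemma const (f : FPS d) : SmoothAt (fun _ => f) z := fun _ => contDiffAt_const

lemma add (hf : SmoothAt f z) (hg : SmoothAt g z) : SmoothAt (fun t => f t + g t) z :=
  fun m => by simpa using (hf m).add (hg m)

lemma neg (hf : SmoothAt f z) : SmoothAt (fun t => -f t) z :=
  fun m => by simpa using (hf m).neg

lemma sub (hf : SmoothAt f z) (hg : SmoothAt g z) : SmoothAt (fun t => f t - g t) z :=
  fun m => by simpa using (hf m).sub (hg m)

lemma sum {ι : Type*} {s : Finset ι} {f : ι → E → FPS d}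
    (hf : ∀ i ∈ s, SmoothAt (f i) z) : SmoothAt (fun t => ∑ i ∈ s, f i t) z :=
  fun m => by simpa using ContDiffAt.sum fun i hi => hf i hi m

lemma smul {c : E → ℝ} (hc : ContDiffAt ℝ ∞ c z) (hf : SmoothAt f z) :
    SmoothAt (fun t => c t • f t) z :=
  fun m => by simpa using hc.mul (hf m)

lemma const_smul (c : ℝ) (hf : SmoothAt f z) : SmoothAt (fun t => c • f t) z :=
  smul contDiffAt_const hf

lemma mul (hf : SmoothAt f z) (hg : SmoothAt g z) : SmoothAt (fun t => f t * g t) z := by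
  classical
  intro m
  simp only [coeff_mul]
  exact ContDiffAt.sum fun p _ => (hf p.1).mul (hg p.2)

lemma prod {ι : Type*} {s : Finset ι} {f : ι → E → FPS d}
    (hf : ∀ i ∈ s, SmoothAt (f i) z) : SmoothAt (fun t => ∏ i ∈ s, f i t) z := by
  classical
  induction s using Finset.induction_on with
  | empty => simpa using const (1 : FPS d)
  | insert a s ha ih =>
    simp only [Finset.prod_insert ha]
    exact (hf a (by simp)).mul (ih fun i hi => hf i (by simp [hi]))

lemma pderiv (i : Fin d) (hf : SmoothAt f z) :
    SmoothAt (fun t => MvPowerSeries.pderiv ℝ i (f t)) z :=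
  fun m => by simpa [coeff_pderiv] using (hf _).mul contDiffAt_const

lemma vfApply {v : E → Fin d → FPS d} (hv : ∀ i, SmoothAt (fun t => v t i) z)
    (hf : SmoothAt f z) : SmoothAt (fun t => vfApply (v t) (f t)) z :=
  sum fun i _ => (hv i).mul (hf.pderiv i)

lemma dPow (α : Fin d →₀ ℕ) (hf : SmoothAt f z) : SmoothAt (fun t => dPow α (f t)) z :=
  fun m => by simpa only [coeff_dPow] using contDiffAt_const.mul (hf _)

lemma substLin {h : E → Matrix (Fin d) (Fin d) ℝ}
    (hh : ∀ i j, ContDiffAt ℝ ∞ (fun t => h t i j) z) (hf : SmoothAt f z) :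
    SmoothAt (fun t => substLin (h t) (f t)) z := by
  have hp : ∀ p : MvPolynomial (Fin d) ℝ, SmoothAt (fun t => Fedosov.substLin (h t) (p : FPS d)) z := by
    intro p
    induction p using MvPolynomial.induction_on with
    | C a => simpa only [MvPolynomial.coe_C, substLin_C] using const (C a : FPS d)
    | add p q hp hq => simpa [substLin_add] using hp.add hq
    | mul_X p i hp =>
      simp only [MvPolynomial.coe_mul, MvPolynomial.coe_X, substLin_mul, substLin_X]
      exact hp.mul (sum fun j _ => smul (hh i j) (const _))
  intro m
  refine ContDiffAt.congr_of_eventuallyEq (ContDiffAt.sum fun k _ => (hf k).mul ?_)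
    (Filter.Eventually.of_forall fun t => coeff_substLin (h t) (f t) m)
  simpa using hp (MvPolynomial.monomial k 1) m

end SmoothAt

lemma contDiffAt_det {n : Type*} [Fintype n] [DecidableEq n] {h : E → Matrix n n ℝ} {z : E}
    (hh : ∀ i j, ContDiffAt ℝ ∞ (fun t => h t i j) z) :
    ContDiffAt ℝ ∞ (fun t => (h t).det) z := by
  simp only [Matrix.det_apply']
  exact ContDiffAt.sum fun σ _ => contDiffAt_const.mul (contDiffAt_prod fun i _ => hh _ _)

lemma contDiffAt_inv {n : Type*} [Fintype n] [DecidableEq n] {h : E → Matrix n n ℝ} {z : E}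
    (hh : ∀ i j, ContDiffAt ℝ ∞ (fun t => h t i j) z) (hz : IsUnit (h z).det) (i j : n) :
    ContDiffAt ℝ ∞ (fun t => (h t)⁻¹ i j) z := by
  simp only [Matrix.inv_def, Ring.inverse_eq_inv', Matrix.smul_apply, smul_eq_mul]
  refine ((contDiffAt_det hh).inv hz.ne_zero).mul ?_
  simp only [Matrix.adjugate_apply]
  refine contDiffAt_det fun k l => ?_
  simp only [Matrix.updateRow_apply]
  split_ifs
  · exact contDiffAt_const
  · exact hh k l

end Smooth

/-- Differentiability comes from the adjugate formula; the value is then forced by differentiating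
`h h⁻¹ = 1`. -/
lemma hasDerivAt_inv_matrix {h : ℝ → Matrix (Fin d) (Fin d) ℝ} {h' : Matrix (Fin d) (Fin d) ℝ}
    (h0 : h 0 = 1) (hh : ∀ i j, HasDerivAt (fun t => h t i j) (h' i j) 0) (i j : Fin d) :
    HasDerivAt (fun t => (h t)⁻¹ i j) ((-h') i j) 0 := by
  have hdet : DifferentiableAt ℝ (fun t => (h t).det) 0 := by
    simp only [Matrix.det_apply']
    refine DifferentiableAt.fun_sum fun σ _ => (differentiableAt_const _).mul ?_
    exact DifferentiableAt.fun_finsetProd fun i _ => (hh _ _).differentiableAt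
  have hdet0 : (h 0).det ≠ 0 := by simp [h0]
  have hdiff : ∀ i j, DifferentiableAt ℝ (fun t => (h t)⁻¹ i j) 0 := by
    intro i j
    simp only [Matrix.inv_def, Ring.inverse_eq_inv', Matrix.smul_apply, smul_eq_mul]
    refine (hdet.inv hdet0).mul ?_
    simp only [Matrix.adjugate_apply, Matrix.det_apply']
    refine DifferentiableAt.fun_sum fun σ _ => (differentiableAt_const _).mul ?_
    refine DifferentiableAt.fun_finsetProd fun k _ => ?_
    simp only [Matrix.updateRow_apply]
    split_ifs
    · exact differentiableAt_const _
    · exact (hh _ _).differentiableAt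
  have hmul : (fun t => ∑ k, h t i k * (h t)⁻¹ k j) =ᶠ[nhds 0]
      fun _ => (1 : Matrix (Fin d) (Fin d) ℝ) i j := by
    filter_upwards [hdet.continuousAt.eventually_ne hdet0] with t ht
    rw [← Matrix.mul_apply, Matrix.mul_nonsing_inv _ (isUnit_iff_ne_zero.2 ht)]
  have h1 := (HasDerivAt.fun_sum (u := Finset.univ) fun k _ =>
    (hh i k).mul (hdiff k j).hasDerivAt)
  have h2 := h1.unique ((hasDerivAt_const (0 : ℝ) _).congr_of_eventuallyEq hmul)
  simp only [h0, inv_one, Finset.sum_add_distrib, Matrix.one_apply, mul_ite, mul_one, mul_zero,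
    ite_mul, one_mul, zero_mul, Finset.sum_ite_eq, Finset.sum_ite_eq', Finset.mem_univ,
    if_true] at h2
  have h3 := (hdiff i j).hasDerivAt
  rwa [show deriv (fun t => (h t)⁻¹ i j) 0 = (-h') i j by
    rw [Matrix.neg_apply]; linarith] at h3

/-! ### The laws of the action of linear changes of coordinates and of vector fields -/

/-- The family `a` of components vanishes outside of `S`. -/
def SuppIn {ι : Type*} (S : Finset ι) (a : ι → FPS d) : Prop := ∀ n, n ∉ S → a n = 0

namespace SuppIn

variable {ι : Type*} {S : Finset ι} {a b : ι → FPS d}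

lemma zero : SuppIn S (0 : ι → FPS d) := fun _ _ => rfl

lemma add (ha : SuppIn S a) (hb : SuppIn S b) : SuppIn S (a + b) := fun n hn => by
  simp [ha n hn, hb n hn]

lemma sub (ha : SuppIn S a) (hb : SuppIn S b) : SuppIn S (a - b) := fun n hn => by
  simp [ha n hn, hb n hn]

lemma smul (f : FPS d) (ha : SuppIn S a) : SuppIn S (f • a) := fun n hn => by
  simp [ha n hn]

lemma real_smul (c : ℝ) (ha : SuppIn S a) : SuppIn S (c • a) := fun n hn => by
  simp [ha n hn]

lemma sum {κ : Type*} {s : Finset κ} {a : κ → ι → FPS d} (ha : ∀ k ∈ s, SuppIn S (a k)) :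
    SuppIn S (∑ k ∈ s, a k) := fun n hn => by
  rw [Finset.sum_apply]
  exact Finset.sum_eq_zero fun k hk => ha k hk n hn

lemma mono {T : Finset ι} (h : S ⊆ T) (ha : SuppIn S a) : SuppIn T a :=
  fun n hn => ha n fun hS => hn (h hS)

end SuppIn

/-- The algebraic laws of a fiber, on components supported in the finite set `S`. -/
structure AlgLaws (B : FormalFiber d) (S : Finset B.ι) : Prop where
  act_supp : ∀ {g : Matrix (Fin d) (Fin d) ℝ} {a : B.ι → FPS d}, IsUnit g.det → SuppIn S a →
    SuppIn S (B.act g a)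
  lie_supp : ∀ {v : Fin d → FPS d} {a : B.ι → FPS d}, SuppIn S a → SuppIn S (B.lie v a)
  act_add : ∀ {g : Matrix (Fin d) (Fin d) ℝ} {a b : B.ι → FPS d}, IsUnit g.det → SuppIn S a →
    SuppIn S b → B.act g (a + b) = B.act g a + B.act g b
  act_smul : ∀ {g : Matrix (Fin d) (Fin d) ℝ} (f : FPS d) {a : B.ι → FPS d}, IsUnit g.det →
    SuppIn S a → B.act g (f • a) = substLin g⁻¹ f • B.act g a
  act_one : ∀ {a : B.ι → FPS d}, SuppIn S a → B.act 1 a = a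
  act_mul : ∀ {g h : Matrix (Fin d) (Fin d) ℝ} {a : B.ι → FPS d}, IsUnit g.det → IsUnit h.det →
    SuppIn S a → B.act (g * h) a = B.act g (B.act h a)
  lie_add : ∀ {v : Fin d → FPS d} {a b : B.ι → FPS d}, SuppIn S a →
    SuppIn S b → B.lie v (a + b) = B.lie v a + B.lie v b
  lie_smul : ∀ {v : Fin d → FPS d} (f : FPS d) {a : B.ι → FPS d}, SuppIn S a →
    B.lie v (f • a) = vfApply v f • a + f • B.lie v a
  lie_add_left : ∀ {v w : Fin d → FPS d} {a : B.ι → FPS d}, SuppIn S a →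
    B.lie (v + w) a = B.lie v a + B.lie w a
  lie_smul_left : ∀ (c : ℝ) {v : Fin d → FPS d} {a : B.ι → FPS d}, SuppIn S a →
    B.lie (c • v) a = c • B.lie v a
  act_lie : ∀ {g : Matrix (Fin d) (Fin d) ℝ} {v : Fin d → FPS d} {a : B.ι → FPS d},
    IsUnit g.det → SuppIn S a → B.act g (B.lie v a) = B.lie (push g v) (B.act g a)
  lie_vbr : ∀ {v w : Fin d → FPS d} {a : B.ι → FPS d}, SuppIn S a →
    B.lie (vbr v w) a = B.lie v (B.lie w a) - B.lie w (B.lie v a)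

/-- A model of a fiber by multilinear operators with arguments in a module `X` on which vector
fields and linear changes of coordinates act. -/
structure OpModel (B : FormalFiber d) (S : Finset B.ι) (r : ℕ) (X : Type*) [AddCommGroup X]
    [Module ℝ X] where
  vX : (Fin d → FPS d) → X → X
  gX : Matrix (Fin d) (Fin d) ℝ → X → X
  op : (B.ι → FPS d) → (Fin r → X) → FPS d
  vX_add_left : ∀ v w x, vX (v + w) x = vX v x + vX w x
  vX_smul_left : ∀ (c : ℝ) v x, vX (c • v) x = c • vX v x
  vX_vbr : ∀ v w x, vX (vbr v w) x = vX v (vX w x) - vX w (vX v x)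
  gX_one : ∀ x, gX 1 x = x
  gX_mul : ∀ g h x, IsUnit g.det → IsUnit h.det → gX (g * h) x = gX h (gX g x)
  gX_vX : ∀ g v x, IsUnit g.det → gX g (vX (push g v) x) = vX v (gX g x)
  op_add : ∀ {a b}, SuppIn S a → SuppIn S b → op (a + b) = op a + op b
  op_smul : ∀ f {a}, SuppIn S a → ∀ x, op (f • a) x = f * op a x
  op_inj : ∀ {a b}, SuppIn S a → SuppIn S b → op a = op b → a = b
  op_update_add : ∀ {a}, SuppIn S a → ∀ x s y z, op a (Function.update x s (y + z)) =
    op a (Function.update x s y) + op a (Function.update x s z)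
  op_update_smul : ∀ {a}, SuppIn S a → ∀ x s (c : ℝ) y, op a (Function.update x s (c • y)) =
    c • op a (Function.update x s y)
  lie_supp : ∀ v a, SuppIn S a → SuppIn S (B.lie v a)
  act_supp : ∀ g a, IsUnit g.det → SuppIn S a → SuppIn S (B.act g a)
  op_lie : ∀ v {a}, SuppIn S a → ∀ x, op (B.lie v a) x =
    vfApply v (op a x) - ∑ s, op a (Function.update x s (vX v (x s)))
  op_act : ∀ {g a}, IsUnit g.det → SuppIn S a → ∀ x, op (B.act g a) x =
    substLin g⁻¹ (op a fun s => gX g (x s))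

section

variable {B : FormalFiber d} {S : Finset B.ι} {r : ℕ} {X : Type*} [AddCommGroup X] [Module ℝ X]

lemma OpModel.op_sub (m : OpModel B S r X) {a b : B.ι → FPS d} (ha : SuppIn S a)
    (hb : SuppIn S b) (x : Fin r → X) : m.op (a - b) x = m.op a x - m.op b x := by
  have h : m.op (a - b + b) = m.op (a - b) + m.op b := m.op_add (ha.sub hb) hb
  rw [sub_add_cancel] at h
  rw [h]
  simp

lemma OpModel.op_real_smul (m : OpModel B S r X) {a : B.ι → FPS d} (ha : SuppIn S a)
    (c : ℝ) (x : Fin r → X) : m.op (c • a) x = c • m.op a x := by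
  have h := m.op_smul (C c) ha x
  rw [← smul_eq_C_mul] at h
  rw [← h]
  congr 1
  funext n
  simp [smul_eq_C_mul]

/-- Modifications of two different arguments commute. Only the terms in which both fields hit the
same argument depend on the order, and there the difference is the action of the bracket. This is
what remains to be checked for `lie_vbr`. -/
lemma OpModel.sum_update_comm (m : OpModel B S r X) {a : B.ι → FPS d} (ha : SuppIn S a)
    (x : Fin r → X) (v w : Fin d → FPS d) :
    ∑ s, ∑ t, m.op a (Function.update (Function.update x s (m.vX v (x s))) t
        (m.vX w (Function.update x s (m.vX v (x s)) t))) +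
      ∑ s, m.op a (Function.update x s (m.vX (vbr v w) (x s))) =
    ∑ s, ∑ t, m.op a (Function.update (Function.update x s (m.vX w (x s))) t
        (m.vX v (Function.update x s (m.vX w (x s)) t))) := by
  have h : ∀ v w : Fin d → FPS d,
      ∑ s, ∑ t, m.op a (Function.update (Function.update x s (m.vX v (x s))) t
        (m.vX w (Function.update x s (m.vX v (x s)) t))) =
      ∑ s, m.op a (Function.update x s (m.vX w (m.vX v (x s)))) +
      ∑ s, ∑ t, if t = s then 0 else
        m.op a (Function.update (Function.update x s (m.vX v (x s))) t (m.vX w (x t))) := by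
    intro v w
    rw [← Finset.sum_add_distrib]
    refine Finset.sum_congr rfl fun s _ => ?_
    have ht : ∀ t, m.op a (Function.update (Function.update x s (m.vX v (x s))) t
        (m.vX w (Function.update x s (m.vX v (x s)) t))) =
        (if t = s then m.op a (Function.update x s (m.vX w (m.vX v (x s)))) else 0) +
        (if t = s then 0 else
          m.op a (Function.update (Function.update x s (m.vX v (x s))) t (m.vX w (x t)))) := by
      intro t
      by_cases hts : t = s
      · subst hts
        simp
      · simp [hts]
    simp only [ht, Finset.sum_add_distrib, Finset.sum_ite_eq', Finset.mem_univ, if_true]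
  rw [h v w, h w v, add_right_comm]
  congr 1
  · rw [← Finset.sum_add_distrib]
    refine Finset.sum_congr rfl fun s _ => ?_
    rw [← m.op_update_add ha, m.vX_vbr, add_sub_cancel]
  · rw [Finset.sum_comm]
    refine Finset.sum_congr rfl fun s _ => Finset.sum_congr rfl fun t _ => ?_
    by_cases hst : s = t
    · simp [hst]
    · rw [if_neg hst, if_neg (Ne.symm hst), Function.update_comm hst]

/-- A fiber with a model by operators satisfies the algebraic laws. -/
lemma OpModel.algLaws (m : OpModel B S r X) : AlgLaws B S where
  act_supp hg ha := m.act_supp _ _ hg ha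
  lie_supp ha := m.lie_supp _ _ ha
  act_add {g a b} hg ha hb := by
    refine m.op_inj (m.act_supp _ _ hg (ha.add hb))
      ((m.act_supp _ _ hg ha).add (m.act_supp _ _ hg hb)) ?_
    funext x
    rw [m.op_add (m.act_supp _ _ hg ha) (m.act_supp _ _ hg hb), Pi.add_apply, m.op_act hg ha,
      m.op_act hg hb, m.op_act hg (ha.add hb), m.op_add ha hb, Pi.add_apply, substLin_add]
  act_smul {g} f {a} hg ha := by
    refine m.op_inj (m.act_supp _ _ hg (ha.smul f)) ((m.act_supp _ _ hg ha).smul _) ?_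
    funext x
    rw [m.op_smul _ (m.act_supp _ _ hg ha), m.op_act hg (ha.smul f), m.op_smul f ha,
      substLin_mul, m.op_act hg ha]
  act_one {a} ha := by
    have h1 : IsUnit (1 : Matrix (Fin d) (Fin d) ℝ).det := by simp
    refine m.op_inj (m.act_supp _ _ h1 ha) ha ?_
    funext x
    simp only [m.op_act h1 ha, m.gX_one, inv_one, substLin_one_matrix]
  act_mul {g h a} hg hh ha := by
    have hgh : IsUnit (g * h).det := by rw [Matrix.det_mul]; exact hg.mul hh
    refine m.op_inj (m.act_supp _ _ hgh ha) (m.act_supp _ _ hg (m.act_supp _ _ hh ha)) ?_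
    funext x
    rw [m.op_act hgh ha, m.op_act hg (m.act_supp _ _ hh ha), m.op_act hh ha, substLin_substLin,
      ← Matrix.mul_inv_rev]
    simp only [m.gX_mul g h _ hg hh]
  lie_add {v a b} ha hb := by
    refine m.op_inj (m.lie_supp _ _ (ha.add hb)) ((m.lie_supp _ _ ha).add (m.lie_supp _ _ hb)) ?_
    funext x
    rw [m.op_add (m.lie_supp _ _ ha) (m.lie_supp _ _ hb), Pi.add_apply, m.op_lie v ha,
      m.op_lie v hb, m.op_lie v (ha.add hb), m.op_add ha hb]
    simp only [Pi.add_apply, vfApply_add, Finset.sum_add_distrib]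
    abel
  lie_smul {v} f {a} ha := by
    refine m.op_inj (m.lie_supp _ _ (ha.smul f)) ((ha.smul _).add ((m.lie_supp _ _ ha).smul _)) ?_
    funext x
    rw [m.op_add (ha.smul _) ((m.lie_supp _ _ ha).smul _), Pi.add_apply, m.op_lie v (ha.smul f),
      m.op_smul _ ha, m.op_smul _ ha, m.op_smul _ (m.lie_supp _ _ ha), m.op_lie v ha, vfApply_mul,
      mul_sub, Finset.mul_sum]
    simp only [m.op_smul _ ha]
    abel
  lie_add_left {v w a} ha := by
    refine m.op_inj (m.lie_supp _ _ ha) ((m.lie_supp _ _ ha).add (m.lie_supp _ _ ha)) ?_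
    funext x
    rw [m.op_add (m.lie_supp _ _ ha) (m.lie_supp _ _ ha), Pi.add_apply, m.op_lie _ ha,
      m.op_lie _ ha, m.op_lie _ ha, vfApply_add_left]
    simp only [m.vX_add_left, m.op_update_add ha, Finset.sum_add_distrib]
    abel
  lie_smul_left c {v a} ha := by
    refine m.op_inj (m.lie_supp _ _ ha) ((m.lie_supp _ _ ha).real_smul c) ?_
    funext x
    rw [m.op_real_smul (m.lie_supp _ _ ha), m.op_lie _ ha, m.op_lie _ ha, vfApply_smul_left]
    simp only [m.vX_smul_left, m.op_update_smul ha, smul_sub, Finset.smul_sum]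
  act_lie {g v a} hg ha := by
    have hl := m.lie_supp v _ ha
    have hga := m.act_supp _ _ hg ha
    refine m.op_inj (m.act_supp _ _ hg hl) (m.lie_supp _ _ hga) ?_
    funext x
    rw [m.op_act hg hl, m.op_lie _ hga, m.op_lie _ ha, m.op_act hg ha, vfApply_push _ _ hg,
      substLin_sub, substLin_sum]
    congr 1
    refine Finset.sum_congr rfl fun s _ => ?_
    rw [m.op_act hg ha]
    congr 2
    funext t
    by_cases hts : t = s
    · subst hts
      simp [m.gX_vX g v _ hg]
    · simp [hts]
  lie_vbr {v w a} ha := by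
    have hv := m.lie_supp v _ ha
    have hw := m.lie_supp w _ ha
    refine m.op_inj (m.lie_supp _ _ ha) ((m.lie_supp _ _ hw).sub (m.lie_supp _ _ hv)) ?_
    funext x
    rw [m.op_sub (m.lie_supp _ _ hw) (m.lie_supp _ _ hv), m.op_lie _ ha, m.op_lie _ hv,
      m.op_lie _ hw]
    simp only [m.op_lie _ ha, vfApply_sub, vfApply_sum, vfApply_vbr, Finset.sum_sub_distrib]
    have h := m.sum_update_comm ha x v w
    rw [← h]
    abel

end

open Classical in
/-- The family with the single nonzero component `1` at `n`. -/
noncomputable def unitAt {ι : Type*} (n : ι) : ι → FPS d := fun n' => if n' = n then 1 else 0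

/-- The laws of a fiber on components supported in the finite set `S`. -/
structure FiberLaws (B : FormalFiber d) (S : Finset B.ι) : Prop extends AlgLaws B S where
  lie_single_unitAt : ∀ i, ∀ n ∈ S, B.lie (Pi.single i 1) (unitAt n) = 0
  lie_hasDer_unitAt : ∀ {v : ℝ → Fin d → FPS d} {v' : Fin d → FPS d},
    (∀ i, HasDer (fun t => v t i) (v' i)) → ∀ n ∈ S, ∀ n',
      HasDer (fun t => B.lie (v t) (unitAt n) n') (B.lie v' (unitAt n) n')
  act_hasDer_unitAt : ∀ {g : ℝ → Matrix (Fin d) (Fin d) ℝ} {g' : Matrix (Fin d) (Fin d) ℝ},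
    g 0 = 1 → (∀ i j, HasDerivAt (fun t => g t i j) (g' i j) 0) → ∀ n ∈ S, ∀ n',
      HasDer (fun t => B.act (g t) (unitAt n) n') (B.lie (linVec (-g')) (unitAt n) n')
  lie_smoothAt_unitAt : ∀ {v : EuclideanSpace ℝ (Fin d) → Fin d → FPS d}
    {z : EuclideanSpace ℝ (Fin d)}, (∀ i, SmoothAt (fun t => v t i) z) → ∀ n ∈ S, ∀ n',
      SmoothAt (fun t => B.lie (v t) (unitAt n) n') z
  act_smoothAt_unitAt : ∀ {g : EuclideanSpace ℝ (Fin d) → Matrix (Fin d) (Fin d) ℝ}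
    {z : EuclideanSpace ℝ (Fin d)}, IsUnit (g z).det →
      (∀ i j, ContDiffAt ℝ ∞ (fun t => g t i j) z) → ∀ n ∈ S, ∀ n',
      SmoothAt (fun t => B.act (g t) (unitAt n) n') z

/-! ### Tensors -/

section Tensor

variable {κ X : Type*} {r : ℕ}

/-- The multilinear operator given by a tensor. -/
noncomputable def tensorOp [Fintype κ] (χ : κ → X → FPS d) (a : (Fin r → κ) → FPS d) (x : Fin r → X) : FPS d :=
  ∑ J, a J * ∏ s, χ (J s) (x s)

lemma prod_update_apply (χ : κ → X → FPS d) (J : Fin r → κ) (x : Fin r → X) (s : Fin r) (y : X) :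
    ∏ t, χ (J t) (Function.update x s y t) =
      (∏ t ∈ Finset.univ.erase s, χ (J t) (x t)) * χ (J s) y := by
  rw [← Finset.prod_erase_mul _ _ (Finset.mem_univ s), Function.update_self]
  congr 1
  refine Finset.prod_congr rfl fun t ht => ?_
  rw [Function.update_of_ne (Finset.ne_of_mem_erase ht)]

variable [Fintype κ]

/-- Exchanging the entry at `s` with the extra index `l` is an involution of the set of pairs. It
transposes a matrix acting on one tensor slot, moving it from the components to the arguments. -/
lemma sum_update_swap {A : Type*} [AddCommMonoid A] (s : Fin r)
    (F : (Fin r → κ) → κ → A) :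
    ∑ J : Fin r → κ, ∑ l, F (Function.update J s l) (J s) = ∑ J : Fin r → κ, ∑ l, F J l := by
  simp only [← Fintype.sum_prod_type']
  refine Fintype.sum_bijective (fun p : (Fin r → κ) × κ => (Function.update p.1 s p.2, p.1 s)) ?_ _ _
    fun p => rfl
  apply Function.Involutive.bijective
  intro p
  simp

/-- Here `χ k` reads off the `k`-th component of an argument, and `c` measures how this fails to
commute with the field. The Leibniz rule for the value then says that the matrix `c` acts on the
components by its transpose. For exterior forms `c` is the Jacobi matrix of `v`; for polyvector
fields it is the negative transposed one. -/
lemma tensorOp_lie (χ : κ → X → FPS d) (v : Fin d → FPS d) (vX : X → X) (c : κ → κ → FPS d)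
    (hχ : ∀ k x, χ k (vX x) = vfApply v (χ k x) - ∑ l, c l k * χ l x)
    (a : (Fin r → κ) → FPS d) (x : Fin r → X) :
    tensorOp χ (fun J => vfApply v (a J) + ∑ s, ∑ l, c (J s) l * a (Function.update J s l)) x =
      vfApply v (tensorOp χ a x) - ∑ s, tensorOp χ a (Function.update x s (vX (x s))) := by
  have h1 : vfApply v (tensorOp χ a x) = ∑ J, vfApply v (a J) * ∏ s, χ (J s) (x s) +
      ∑ s, ∑ J, a J * ((∏ t ∈ Finset.univ.erase s, χ (J t) (x t)) * vfApply v (χ (J s) (x s))) := by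
    rw [tensorOp, vfApply_sum, Finset.sum_comm, ← Finset.sum_add_distrib]
    refine Finset.sum_congr rfl fun J _ => ?_
    rw [vfApply_mul, vfApply_prod, Finset.mul_sum]
  have h2 : ∀ s, tensorOp χ a (Function.update x s (vX (x s))) =
      ∑ J, a J * ((∏ t ∈ Finset.univ.erase s, χ (J t) (x t)) * vfApply v (χ (J s) (x s))) -
      ∑ J, ∑ l, a J * ((∏ t ∈ Finset.univ.erase s, χ (J t) (x t)) * (c l (J s) * χ l (x s))) := by
    intro s
    rw [tensorOp, ← Finset.sum_sub_distrib]
    refine Finset.sum_congr rfl fun J _ => ?_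
    rw [prod_update_apply, hχ, mul_sub, mul_sub, Finset.mul_sum, Finset.mul_sum]
  rw [h1]
  simp only [h2, Finset.sum_sub_distrib]
  rw [sub_sub_eq_add_sub, add_right_comm, add_sub_cancel_right, tensorOp]
  simp only [add_mul, Finset.sum_add_distrib]
  congr 1
  simp only [Finset.sum_mul]
  rw [Finset.sum_comm]
  refine Finset.sum_congr rfl fun s _ => ?_
  rw [← sum_update_swap s]
  refine Finset.sum_congr rfl fun J _ => Finset.sum_congr rfl fun l _ => ?_
  rw [← Finset.prod_erase_mul _ _ (Finset.mem_univ s), Function.update_self, Function.update_idem,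
    Function.update_eq_self]
  have : ∏ t ∈ Finset.univ.erase s, χ (Function.update J s l t) (x t) =
      ∏ t ∈ Finset.univ.erase s, χ (J t) (x t) := Finset.prod_congr rfl fun t ht => by
    rw [Function.update_of_ne (Finset.ne_of_mem_erase ht)]
  rw [this]
  ring

/-- The global counterpart of `tensorOp_lie`: a linear change acting on each argument through `μ`
acts on the components through the transposed matrix, after expanding the product over the slots. -/
lemma tensorOp_act (χ : κ → X → FPS d) (h : Matrix (Fin d) (Fin d) ℝ) (gX : X → X)
    (μ : κ → κ → ℝ) (hχ : ∀ k x, substLin h (χ k (gX x)) = ∑ l, μ l k • χ l x)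
    (a : (Fin r → κ) → FPS d) (x : Fin r → X) :
    tensorOp χ (fun J => ∑ J' : Fin r → κ, (∏ s, μ (J s) (J' s)) • substLin h (a J')) x =
      substLin h (tensorOp χ a fun s => gX (x s)) := by
  classical
  simp only [tensorOp, substLin_sum, substLin_mul, substLin_prod, hχ, Finset.prod_univ_sum,
    Fintype.piFinset_univ, Finset.mul_sum, Finset.sum_mul]
  rw [Finset.sum_comm]
  refine Finset.sum_congr rfl fun J _ => Finset.sum_congr rfl fun J' _ => ?_
  rw [Finset.prod_smul, smul_mul_assoc, mul_smul_comm]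

lemma tensorOp_add (χ : κ → X → FPS d) (a b : (Fin r → κ) → FPS d) :
    tensorOp χ (a + b) = tensorOp χ a + tensorOp χ b := by
  funext x
  simp [tensorOp, add_mul, Finset.sum_add_distrib]

lemma tensorOp_smul (χ : κ → X → FPS d) (f : FPS d) (a : (Fin r → κ) → FPS d) (x : Fin r → X) :
    tensorOp χ (f • a) x = f * tensorOp χ a x := by
  simp [tensorOp, Finset.mul_sum, mul_assoc]

/-- Evaluation on the dual elements `D` recovers the components. -/
lemma tensorOp_inj (χ : κ → X → FPS d) (D : κ → X) (hD : ∀ k, χ k (D k) = 1)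
    (hD' : ∀ k l, k ≠ l → χ k (D l) = 0) {a b : (Fin r → κ) → FPS d}
    (h : tensorOp χ a = tensorOp χ b) : a = b := by
  have key : ∀ a : (Fin r → κ) → FPS d, ∀ J, tensorOp χ a (fun s => D (J s)) = a J := by
    intro a J
    rw [tensorOp, Finset.sum_eq_single J]
    · simp [hD]
    · intro J' _ hJ
      obtain ⟨s, hs⟩ := Function.ne_iff.1 hJ
      rw [Finset.prod_eq_zero (Finset.mem_univ s) (hD' _ _ hs), mul_zero]
    · simp
  funext J
  rw [← key a, ← key b, h]

lemma tensorOp_update_add [Add X] (χ : κ → X → FPS d) (hχ : ∀ k x y, χ k (x + y) = χ k x + χ k y)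
    (a : (Fin r → κ) → FPS d) (x : Fin r → X) (s : Fin r) (y z : X) :
    tensorOp χ a (Function.update x s (y + z)) =
      tensorOp χ a (Function.update x s y) + tensorOp χ a (Function.update x s z) := by
  simp only [tensorOp, prod_update_apply, hχ, mul_add, Finset.sum_add_distrib]

lemma tensorOp_update_smul [SMul ℝ X] (χ : κ → X → FPS d)
    (hχ : ∀ k (c : ℝ) x, χ k (c • x) = c • χ k x)
    (a : (Fin r → κ) → FPS d) (x : Fin r → X) (s : Fin r) (c : ℝ) (y : X) :
    tensorOp χ a (Function.update x s (c • y)) = c • tensorOp χ a (Function.update x s y) := by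
  simp only [tensorOp, prod_update_apply, hχ, mul_smul_comm, Finset.smul_sum]

end Tensor

lemma suppIn_univ {ι : Type*} [Fintype ι] (a : ι → FPS d) : SuppIn Finset.univ a :=
  fun n hn => absurd (Finset.mem_univ n) hn

lemma push_one (v : Fin d → FPS d) : push 1 v = v := by
  funext i
  simp [push, Matrix.one_apply, substLin_one_matrix]

lemma push_mul (g h : Matrix (Fin d) (Fin d) ℝ) (v : Fin d → FPS d) :
    push (g * h) v = push g (push h v) := by
  funext i
  simp only [push, Matrix.mul_apply, Finset.sum_smul, substLin_sum, substLin_smul,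
    substLin_substLin, ← Matrix.mul_inv_rev, Finset.smul_sum, smul_smul]
  rw [Finset.sum_comm]

lemma push_vbr {g : Matrix (Fin d) (Fin d) ℝ} (hg : IsUnit g.det) (v w : Fin d → FPS d) :
    push g (vbr v w) = vbr (push g v) (push g w) := by
  funext i
  have h : ∀ v w : Fin d → FPS d, vfApply (push g v) (push g w i) =
      ∑ j, g i j • substLin g⁻¹ (vfApply v (w j)) := by
    intro v w
    rw [push.eq_1 g w]
    simp only [vfApply_sum, vfApply_smul, vfApply_push _ _ hg]
  rw [vbr.eq_1 (push g v), h, h, push]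
  simp only [vbr, substLin_sub, smul_sub, Finset.sum_sub_distrib]

/-- The Jacobi identity, which follows from the commutator formula applied to each component. -/
lemma vbr_vbr (u v w : Fin d → FPS d) : vbr (vbr u v) w = vbr u (vbr v w) - vbr v (vbr u w) := by
  funext i
  simp only [vbr, vfApply_vbr, vfApply_sub, Pi.sub_apply]
  abel

/-- The model of `fiberE` by operators on vector fields. -/
noncomputable def modelE (d k : ℕ) : OpModel (fiberE d k)
    (Finset.univ : Finset (Fin k → Fin d)) k (Fin d → FPS d) where
  vX := vbr
  -- Arguments are pulled back: the transformed form at `w` is the transform of the form at `g⁻¹ w`.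
  gX g := push g⁻¹
  op := tensorOp fun j w => w j
  vX_add_left v w x := by
    funext i
    simp only [vbr, vfApply_add_left, Pi.add_apply, vfApply_add]
    abel
  vX_smul_left c v x := by
    funext i
    simp only [vbr, vfApply_smul_left, Pi.smul_apply, vfApply_smul, smul_sub]
  vX_vbr := vbr_vbr
  gX_one x := by rw [inv_one, push_one]
  gX_mul g h x _ _ := by rw [Matrix.mul_inv_rev, push_mul]
  gX_vX g v x hg := by
    have hg' : IsUnit g⁻¹.det := by
      rw [Matrix.det_nonsing_inv]
      exact IsUnit.ringInverse hg
    rw [push_vbr hg', ← push_mul, Matrix.nonsing_inv_mul _ hg, push_one]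
  op_add _ _ := tensorOp_add _ _ _
  op_smul f _ _ x := tensorOp_smul _ f _ x
  op_inj _ _ h := by
    refine tensorOp_inj _ (fun j => Pi.single j 1) (fun j => by simp) (fun j l hjl => ?_) h
    simp [hjl]
  op_update_add _ x s y z := tensorOp_update_add _ (fun _ _ _ => rfl) _ x s y z
  op_update_smul _ x s c y := tensorOp_update_smul _ (fun _ _ _ => rfl) _ x s c y
  lie_supp _ _ _ := suppIn_univ (ι := Fin k → Fin d) _
  act_supp _ _ _ _ := suppIn_univ (ι := Fin k → Fin d) _
  op_lie v a _ x := by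
    refine tensorOp_lie _ v (vbr v) (fun j l => pderiv ℝ j (v l)) (fun j w => ?_) a x
    simp only [vbr]
    congr 1
    exact Finset.sum_congr rfl fun l _ => mul_comm _ _
  op_act {g a} hg _ x := by
    refine tensorOp_act _ g⁻¹ (push g⁻¹) (fun j j' => g⁻¹ j' j) (fun j w => ?_) a x
    simp only [push, substLin_sum, substLin_smul, substLin_substLin,
      Matrix.nonsing_inv_nonsing_inv _ hg, Matrix.mul_nonsing_inv _ hg, substLin_one_matrix]

/-- The model of `fiberT` by differential operators of order one in each argument. -/
noncomputable def modelT (d r : ℕ) : OpModel (fiberT d r)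
    (Finset.univ : Finset (Fin r → Fin d)) r (FPS d) where
  vX := vfApply
  gX g := substLin g
  op := tensorOp fun j f => pderiv ℝ j f
  vX_add_left v w x := vfApply_add_left _ _ _
  vX_smul_left c v x := vfApply_smul_left _ _ _
  vX_vbr v w x := vfApply_vbr _ _ _
  gX_one x := substLin_one_matrix _
  gX_mul g h x _ _ := by rw [substLin_substLin]
  gX_vX g v x hg := by
    have h : x = substLin g⁻¹ (substLin g x) := by
      rw [substLin_substLin, Matrix.mul_nonsing_inv _ hg, substLin_one_matrix]
    conv_lhs => rw [h, vfApply_push _ _ hg, substLin_substLin, Matrix.nonsing_inv_mul _ hg,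
      substLin_one_matrix]
  op_add _ _ := tensorOp_add _ _ _
  op_smul f _ _ x := tensorOp_smul _ f _ x
  op_inj _ _ h := by
    refine tensorOp_inj _ (fun j => X j) (fun j => by simp) (fun j l hjl => ?_) h
    simp [hjl.symm]
  op_update_add _ x s y z := tensorOp_update_add _ (fun _ _ _ => map_add _ _ _) _ x s y z
  op_update_smul _ x s c y :=
    tensorOp_update_smul _ (fun _ _ _ => Derivation.map_smul _ _ _) _ x s c y
  lie_supp _ _ _ := suppIn_univ (ι := Fin r → Fin d) _
  act_supp _ _ _ _ := suppIn_univ (ι := Fin r → Fin d) _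
  op_lie v a _ x := by
    have := tensorOp_lie (fun j f => pderiv ℝ j f) v (vfApply v)
      (fun j l => -pderiv ℝ l (v j)) (fun j f => ?_) a x
    · rw [← this]
      congr 1
      funext J
      simp [fiberT, sub_eq_add_neg, Finset.sum_neg_distrib]
    · simp only [neg_mul, Finset.sum_neg_distrib, sub_neg_eq_add]
      simp only [vfApply, map_sum, Derivation.leibniz, smul_eq_mul, Finset.sum_add_distrib]
      congr 1
      · exact Finset.sum_congr rfl fun l _ => by rw [pderiv_comm]
      · exact Finset.sum_congr rfl fun l _ => mul_comm _ _
  op_act {g a} hg _ x := by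
    refine tensorOp_act _ g⁻¹ (substLin g) (fun j j' => g j j') (fun j f => ?_) a x
    simp only [pderiv_substLin, substLin_sum, substLin_smul, substLin_substLin,
      Matrix.mul_nonsing_inv _ hg, substLin_one_matrix]

/-- The model of `fiberSM` by operators without arguments. -/
noncomputable def modelSM (d : ℕ) : OpModel (fiberSM d) (Finset.univ : Finset Unit) 0 (FPS d) where
  vX := vfApply
  gX g := substLin g
  op a _ := a ()
  vX_add_left v w x := vfApply_add_left _ _ _
  vX_smul_left c v x := vfApply_smul_left _ _ _
  vX_vbr v w x := vfApply_vbr _ _ _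
  gX_one x := substLin_one_matrix _
  gX_mul g h x _ _ := by rw [substLin_substLin]
  gX_vX g v x hg := (modelT d 0).gX_vX g v x hg
  op_add _ _ := rfl
  op_smul f _ _ x := rfl
  op_inj _ _ h := by
    funext u
    exact congrFun h ![]
  op_update_add _ x s y z := s.elim0
  op_update_smul _ x s c y := s.elim0
  lie_supp _ _ _ := suppIn_univ (ι := Unit) _
  act_supp _ _ _ _ := suppIn_univ (ι := Unit) _
  op_lie v a _ x := by simp [fiberSM]
  op_act {g a} hg _ x := rfl

/-! ### The analytic laws for tensors -/

lemma substLin_unitAt {ι : Type*} (h : Matrix (Fin d) (Fin d) ℝ) (n n' : ι) :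
    substLin h (unitAt n n' : FPS d) = unitAt n n' := by
  unfold unitAt
  split_ifs
  · exact substLin_one h
  · exact substLin_zero h

lemma vfApply_unitAt {ι : Type*} (v : Fin d → FPS d) (n n' : ι) :
    vfApply v (unitAt n n' : FPS d) = 0 := by
  unfold unitAt
  split_ifs
  · exact vfApply_one v
  · exact vfApply_zero v

lemma HasDer.mul_const {f : ℝ → FPS d} {f' : FPS d} (hf : HasDer f f') (g : FPS d) :
    HasDer (fun t => f t * g) (f' * g) := by
  simpa using hf.mul (HasDer.const g)

lemma pderiv_linVec (B : Matrix (Fin d) (Fin d) ℝ) (i j : Fin d) :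
    pderiv ℝ j (linVec B i) = B i j • (1 : FPS d) := by
  simp [linVec, pderiv_X, Pi.single_apply]

section TensorAnalytic

variable {κ : Type*} {r : ℕ}

open Classical in
lemma unitAt_update (n J : Fin r → κ) (s : Fin r) (l : κ) :
    (unitAt n (Function.update J s l) : FPS d) =
      if l = n s then ∏ t ∈ Finset.univ.erase s, (if J t = n t then (1 : FPS d) else 0) else 0 := by
  have h : ∀ J : Fin r → κ, (unitAt n J : FPS d) = ∏ t, if J t = n t then (1 : FPS d) else 0 := by
    intro J
    rw [Finset.prod_ite_zero, unitAt]
    simp [funext_iff]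
  rw [h, prod_update_apply (fun (k l : κ) => if l = k then (1 : FPS d) else 0) n J s l]
  split_ifs <;> simp

-- By the product rule one slot is differentiated while the other slots carry the identity matrix.
-- On a basis tensor this leaves exactly the tensors in which one index is replaced, that is, the
-- infinitesimal action.
open Classical in
lemma hasDer_prod_unitAt [Fintype κ] {μ : ℝ → κ → κ → ℝ} {μ' : κ → κ → ℝ}
    (h0 : ∀ k l, μ 0 k l = if k = l then 1 else 0)
    (h : ∀ k l, HasDerivAt (fun t => μ t k l) (μ' k l) 0) (n J : Fin r → κ) :
    HasDer (fun t => (∏ s, μ t (J s) (n s)) • (1 : FPS d))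
      (∑ s, ∑ l, (μ' (J s) l • (1 : FPS d)) * unitAt n (Function.update J s l)) := by
  have h1 := HasDerivAt.fun_finsetProd (u := Finset.univ) fun s _ => h (J s) (n s)
  have h2 := HasDer.smul h1 (HasDer.const (1 : FPS d))
  convert h2 using 1
  simp only [unitAt_update, h0, smul_zero, add_zero, Finset.sum_smul]
  refine Finset.sum_congr rfl fun s _ => ?_
  simp only [mul_ite, mul_zero, Finset.sum_ite_eq', Finset.mem_univ, if_true, smul_mul_assoc,
    one_mul]
  rw [Finset.prod_ite_zero, Finset.prod_ite_zero]
  split_ifs <;> simp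

end TensorAnalytic

lemma fiberE_act_unitAt {k : ℕ} (g : Matrix (Fin d) (Fin d) ℝ) (n J : Fin k → Fin d) :
    (fiberE d k).act g (unitAt (ι := Fin k → Fin d) n) J = (∏ s, g⁻¹ (n s) (J s)) • (1 : FPS d) := by
  simp only [fiberE, substLin_unitAt]
  simp [unitAt]

lemma fiberE_lie_unitAt {k : ℕ} (v : Fin d → FPS d) (n J : Fin k → Fin d) :
    (fiberE d k).lie v (unitAt (ι := Fin k → Fin d) n) J =
      ∑ s, ∑ l, pderiv ℝ (J s) (v l) * unitAt n (Function.update J s l) := by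
  simp only [fiberE, vfApply_unitAt, zero_add]

lemma fiberT_act_unitAt {r : ℕ} (g : Matrix (Fin d) (Fin d) ℝ) (n J : Fin r → Fin d) :
    (fiberT d r).act g (unitAt (ι := Fin r → Fin d) n) J = (∏ s, g (J s) (n s)) • (1 : FPS d) := by
  simp only [fiberT, substLin_unitAt]
  simp [unitAt]

lemma fiberT_lie_unitAt {r : ℕ} (v : Fin d → FPS d) (n J : Fin r → Fin d) :
    (fiberT d r).lie v (unitAt (ι := Fin r → Fin d) n) J =
      -∑ s, ∑ l, pderiv ℝ l (v (J s)) * unitAt n (Function.update J s l) := by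
  simp only [fiberT, vfApply_unitAt, zero_sub]

lemma pderiv_single_one (i j l : Fin d) :
    pderiv ℝ j ((Pi.single i 1 : Fin d → FPS d) l) = 0 := by
  by_cases h : l = i
  · subst h; simp
  · simp [h]

lemma fiberLaws_E (d k : ℕ) :
    FiberLaws (fiberE d k) (Finset.univ : Finset (Fin k → Fin d)) where
  toAlgLaws := (modelE d k).algLaws
  lie_single_unitAt := fun i (n : Fin k → Fin d) _ => by
    funext (J : Fin k → Fin d)
    change (fiberE d k).lie _ (unitAt (ι := Fin k → Fin d) n) J = 0
    simp [fiberE_lie_unitAt, pderiv_single_one]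
  lie_hasDer_unitAt := fun hv (n : Fin k → Fin d) _ (J : Fin k → Fin d) => by
    change HasDer (fun t => (fiberE d k).lie _ (unitAt (ι := Fin k → Fin d) n) J) ((fiberE d k).lie _ (unitAt (ι := Fin k → Fin d) n) J)
    simp only [fiberE_lie_unitAt]
    exact HasDer.sum fun s _ => HasDer.sum fun l _ => ((hv l).pderiv _).mul_const _
  act_hasDer_unitAt := fun {g g'} h0 hg (n : Fin k → Fin d) _ (J : Fin k → Fin d) => by
    change HasDer (fun t => (fiberE d k).act _ (unitAt (ι := Fin k → Fin d) n) J) ((fiberE d k).lie _ (unitAt (ι := Fin k → Fin d) n) J)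
    simp only [fiberE_lie_unitAt, fiberE_act_unitAt, pderiv_linVec]
    refine hasDer_prod_unitAt (μ := fun t k l => (g t)⁻¹ l k) (μ' := fun k l => (-g') l k)
      (fun k l => ?_) (fun k l => hasDerivAt_inv_matrix h0 hg l k) n J
    rw [h0, inv_one, Matrix.one_apply]
    simp only [eq_comm]
    congr
  lie_smoothAt_unitAt := fun hv (n : Fin k → Fin d) _ (J : Fin k → Fin d) => by
    change SmoothAt (fun t => (fiberE d k).lie _ (unitAt (ι := Fin k → Fin d) n) J) _
    simp only [fiberE_lie_unitAt]
    exact SmoothAt.sum fun s _ => SmoothAt.sum fun l _ => ((hv l).pderiv _).mul (.const _)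
  act_smoothAt_unitAt := fun hz hg (n : Fin k → Fin d) _ (J : Fin k → Fin d) => by
    change SmoothAt (fun t => (fiberE d k).act _ (unitAt (ι := Fin k → Fin d) n) J) _
    simp only [fiberE_act_unitAt]
    exact SmoothAt.smul (contDiffAt_prod fun s _ => contDiffAt_inv hg hz _ _) (.const _)

lemma fiberLaws_T (d r : ℕ) :
    FiberLaws (fiberT d r) (Finset.univ : Finset (Fin r → Fin d)) where
  toAlgLaws := (modelT d r).algLaws
  lie_single_unitAt := fun i (n : Fin r → Fin d) _ => by
    funext (J : Fin r → Fin d)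
    change (fiberT d r).lie _ (unitAt (ι := Fin r → Fin d) n) J = 0
    simp [fiberT_lie_unitAt, pderiv_single_one]
  lie_hasDer_unitAt := fun hv (n : Fin r → Fin d) _ (J : Fin r → Fin d) => by
    change HasDer (fun t => (fiberT d r).lie _ (unitAt (ι := Fin r → Fin d) n) J) ((fiberT d r).lie _ (unitAt (ι := Fin r → Fin d) n) J)
    simp only [fiberT_lie_unitAt]
    exact HasDer.neg (HasDer.sum fun s _ => HasDer.sum fun l _ => ((hv _).pderiv _).mul_const _)
  act_hasDer_unitAt := fun {g g'} h0 hg (n : Fin r → Fin d) _ (J : Fin r → Fin d) => by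
    change HasDer (fun t => (fiberT d r).act _ (unitAt (ι := Fin r → Fin d) n) J) ((fiberT d r).lie _ (unitAt (ι := Fin r → Fin d) n) J)
    simp only [fiberT_lie_unitAt, fiberT_act_unitAt, pderiv_linVec]
    have := hasDer_prod_unitAt (d := d) (μ := fun t k l => g t k l) (μ' := fun k l => g' k l)
      (fun k l => by rw [h0, Matrix.one_apply]; congr) hg n J
    convert this using 1
    simp only [Matrix.neg_apply, neg_smul, neg_mul, Finset.sum_neg_distrib, neg_neg]
  lie_smoothAt_unitAt := fun hv (n : Fin r → Fin d) _ (J : Fin r → Fin d) => by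
    change SmoothAt (fun t => (fiberT d r).lie _ (unitAt (ι := Fin r → Fin d) n) J) _
    simp only [fiberT_lie_unitAt]
    exact SmoothAt.neg
      (SmoothAt.sum fun s _ => SmoothAt.sum fun l _ => ((hv _).pderiv _).mul (.const _))
  act_smoothAt_unitAt := fun hz hg (n : Fin r → Fin d) _ (J : Fin r → Fin d) => by
    change SmoothAt (fun t => (fiberT d r).act _ (unitAt (ι := Fin r → Fin d) n) J) _
    simp only [fiberT_act_unitAt]
    exact SmoothAt.smul (contDiffAt_prod fun s _ => hg _ _) (.const _)

lemma fiberLaws_SM (d : ℕ) : FiberLaws (fiberSM d) (Finset.univ : Finset Unit) where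
  toAlgLaws := (modelSM d).algLaws
  lie_single_unitAt := fun i (n : Unit) _ => by
    funext (J : Unit)
    change (fiberSM d).lie _ (unitAt (ι := Unit) n) J = 0
    exact vfApply_unitAt _ _ _
  lie_hasDer_unitAt := fun hv (n : Unit) _ (J : Unit) => by
    change HasDer (fun t => (fiberSM d).lie _ (unitAt (ι := Unit) n) J) ((fiberSM d).lie _ (unitAt (ι := Unit) n) J)
    simp only [fiberSM, vfApply_unitAt]
    exact HasDer.const 0
  act_hasDer_unitAt := fun {g g'} h0 hg (n : Unit) _ (J : Unit) => by
    change HasDer (fun t => (fiberSM d).act _ (unitAt (ι := Unit) n) J) ((fiberSM d).lie _ (unitAt (ι := Unit) n) J)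
    simp only [fiberSM, vfApply_unitAt, substLin_unitAt]
    exact HasDer.const _
  lie_smoothAt_unitAt := fun hv (n : Unit) _ (J : Unit) => by
    change SmoothAt (fun t => (fiberSM d).lie _ (unitAt (ι := Unit) n) J) _
    simp only [fiberSM, vfApply_unitAt]
    exact .const _
  act_smoothAt_unitAt := fun hz hg (n : Unit) _ (J : Unit) => by
    change SmoothAt (fun t => (fiberSM d).act _ (unitAt (ι := Unit) n) J) _
    simp only [fiberSM, substLin_unitAt]
    exact .const _

/-! ### Polydifferential operators -/

lemma dPow_zero (f : FPS d) : dPow 0 f = f := by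
  ext m
  simp [coeff_dPow]

lemma dPow_add (α : Fin d →₀ ℕ) (f g : FPS d) : dPow α (f + g) = dPow α f + dPow α g := by
  ext m
  simp [coeff_dPow, mul_add]

lemma dPow_smul (α : Fin d →₀ ℕ) (c : ℝ) (f : FPS d) : dPow α (c • f) = c • dPow α f := by
  ext m
  simp only [coeff_dPow, map_smul, smul_eq_mul]
  ring

lemma dPow_sum (α : Fin d →₀ ℕ) {ι : Type*} (s : Finset ι) (f : ι → FPS d) :
    dPow α (∑ i ∈ s, f i) = ∑ i ∈ s, dPow α (f i) := by
  ext m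
  simp [coeff_dPow, Finset.mul_sum]

lemma pderiv_dPow (α : Fin d →₀ ℕ) (j : Fin d) (f : FPS d) :
    pderiv ℝ j (dPow α f) = dPow (α + Finsupp.single j 1) f := by
  ext m
  rw [coeff_pderiv, coeff_dPow, coeff_dPow, add_right_comm, add_assoc]
  rw [mul_right_comm]
  congr 1
  rw [← Finset.prod_erase_mul _ _ (Finset.mem_univ j),
    ← Finset.prod_erase_mul (a := j) _ _ (Finset.mem_univ j), mul_assoc]
  congr 1
  · refine Finset.prod_congr rfl fun i hi => ?_
    simp [(Finset.ne_of_mem_erase hi).symm]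
  · simp only [Finsupp.add_apply, Finsupp.single_eq_same]
    rw [Nat.descFactorial_succ, show m j + (α j + 1) - α j = m j + 1 by omega,
      show m j + 1 + α j = m j + (α j + 1) by omega]
    push_cast
    ring

lemma dPow_pderiv (α : Fin d →₀ ℕ) (j : Fin d) (f : FPS d) :
    dPow α (pderiv ℝ j f) = dPow (α + Finsupp.single j 1) f := by
  ext m
  rw [coeff_dPow, coeff_pderiv, coeff_dPow, ← add_assoc, mul_comm (coeff _ f), ← mul_assoc]
  congr 1
  rw [← Finset.prod_erase_mul _ _ (Finset.mem_univ j),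
    ← Finset.prod_erase_mul (a := j) _ _ (Finset.mem_univ j), mul_assoc]
  congr 1
  · refine Finset.prod_congr rfl fun i hi => ?_
    simp [(Finset.ne_of_mem_erase hi).symm]
  · simp only [Finsupp.add_apply, Finsupp.single_eq_same]
    rw [← add_assoc, Nat.succ_descFactorial_succ]
    push_cast
    ring

lemma dPow_monomial (α γ : Fin d →₀ ℕ) : dPow α (monomial γ (1 : ℝ)) =
    monomial (γ - α) (∏ j, (((γ j).descFactorial (α j) : ℕ) : ℝ)) := by
  classical
  ext m
  rw [coeff_dPow, coeff_monomial, coeff_monomial]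
  by_cases h : α ≤ γ
  · by_cases hm : m = γ - α
    · subst hm
      rw [if_pos (tsub_add_cancel_of_le h), if_pos rfl, mul_one]
      refine Finset.prod_congr rfl fun j _ => ?_
      rw [← Finsupp.add_apply, tsub_add_cancel_of_le h]
    · rw [if_neg hm, if_neg, mul_zero]
      rintro rfl
      exact hm (by simp)
  · have h1 : m + α ≠ γ := by
      rintro rfl
      exact h le_add_self
    have h2 : ∏ j, (((γ j).descFactorial (α j) : ℕ) : ℝ) = 0 := by
      rw [Finsupp.le_def, not_forall] at h
      obtain ⟨j, hj⟩ := h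
      refine Finset.prod_eq_zero (Finset.mem_univ j) ?_
      rw [Nat.descFactorial_eq_zero_iff_lt.2 (not_le.1 hj), Nat.cast_zero]
    rw [if_neg h1, h2, mul_zero]
    simp

/-- The terms with `n < a` vanish. After the shift `n = a + i` the factorials cancel, and with `c =
b - a` the sum becomes `(1 - 1)^c / c!` by the binomial theorem. -/
lemma sum_descFactorial_alternating (a b : ℕ) :
    ∑ n ∈ Finset.Iic b, (-1 : ℝ) ^ (b - n) / ((n.factorial : ℝ) * ((b - n).factorial : ℝ)) *
      (n.descFactorial a : ℝ) = if a = b then 1 else 0 := by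
  have hI : Finset.Iic b = Finset.range (b + 1) := by
    ext; simp
  rw [hI]
  by_cases hab : a ≤ b
  · obtain ⟨c, rfl⟩ := Nat.exists_eq_add_of_le hab
    rw [add_assoc, Finset.sum_range_add, Finset.sum_eq_zero, zero_add]
    · have h1 : ∀ n ∈ Finset.range (c + 1), (-1 : ℝ) ^ (a + c - (a + n)) /
          (((a + n).factorial : ℝ) * ((a + c - (a + n)).factorial : ℝ)) *
          ((a + n).descFactorial a : ℝ) =
          (c.factorial : ℝ)⁻¹ * ((1 : ℝ) ^ n * (-1) ^ (c - n) * (c.choose n : ℝ)) := by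
        intro n hn
        have hn' : n ≤ c := Nat.lt_succ_iff.1 (Finset.mem_range.1 hn)
        rw [Nat.add_sub_add_left, Nat.descFactorial_eq_div (Nat.le_add_right a n),
          Nat.add_sub_cancel_left, Nat.cast_div (Nat.factorial_dvd_factorial (Nat.le_add_left n a))
            (by positivity), Nat.cast_choose ℝ hn']
        field_simp
        simp
      rw [Finset.sum_congr rfl h1, ← Finset.mul_sum, ← add_pow]
      rcases Nat.eq_zero_or_pos c with rfl | hc
      · simp
      · rw [if_neg (by omega)]
        simp [hc.ne']
    · intro n hn
      rw [Nat.descFactorial_eq_zero_iff_lt.2 (Finset.mem_range.1 hn), Nat.cast_zero, mul_zero]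
  · rw [if_neg (by omega)]
    refine Finset.sum_eq_zero fun n hn => ?_
    rw [Nat.descFactorial_eq_zero_iff_lt.2 (by have := Finset.mem_range.1 hn; omega),
      Nat.cast_zero, mul_zero]

lemma sum_Iic_prod (β : Fin d →₀ ℕ) (F : Fin d → ℕ → ℝ) :
    ∑ γ ∈ Finset.Iic β, ∏ j, F j (γ j) = ∏ j, ∑ n ∈ Finset.Iic (β j), F j n := by
  classical
  rw [Finset.prod_univ_sum]
  refine Finset.sum_bij' (fun γ _ => (γ : Fin d → ℕ)) (fun γ _ => Finsupp.equivFunOnFinite.symm γ)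
    ?_ ?_ ?_ ?_ ?_
  · intro γ hγ
    rw [Finset.mem_Iic] at hγ
    simpa using fun j => hγ j
  · intro γ hγ
    rw [Finset.mem_Iic]
    intro j
    simpa using (Fintype.mem_piFinset.1 hγ j)
  · intro γ _
    ext; simp
  · intro γ _
    ext; simp
  · intro γ _; rfl

-- The inversion formula in one slot. All nonzero terms carry the same power `y^(β-α)`, so the sum
-- reduces to scalars; it factors over the coordinates, each factor being the alternating sum above.
open Classical in
lemma sum_symbol_slot (α β : Fin d →₀ ℕ) :
    ∑ γ ∈ Finset.Iic β, monomial (β - γ) (∏ j, (-1 : ℝ) ^ (β j - γ j) /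
        (((γ j).factorial : ℝ) * ((β j - γ j).factorial : ℝ))) *
      dPow α (monomial γ (1 : ℝ)) = if α = β then (1 : FPS d) else 0 := by
  have h : ∀ γ ∈ Finset.Iic β, monomial (β - γ) (∏ j, (-1 : ℝ) ^ (β j - γ j) /
        (((γ j).factorial : ℝ) * ((β j - γ j).factorial : ℝ))) *
      dPow α (monomial γ (1 : ℝ)) = monomial (β - α) (∏ j, ((-1 : ℝ) ^ (β j - γ j) /
        (((γ j).factorial : ℝ) * ((β j - γ j).factorial : ℝ)) *
          (((γ j).descFactorial (α j) : ℕ) : ℝ))) := by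
    intro γ hγ
    rw [Finset.mem_Iic] at hγ
    rw [dPow_monomial, monomial_mul_monomial, ← Finset.prod_mul_distrib]
    by_cases hα : α ≤ γ
    · congr 2
      ext j
      have h1 := hα j
      have h2 := hγ j
      simp only [Finsupp.add_apply, Finsupp.tsub_apply]
      omega
    · rw [Finsupp.le_def, not_forall] at hα
      obtain ⟨j, hj⟩ := hα
      rw [Finset.prod_eq_zero (Finset.mem_univ j), map_zero, map_zero]
      rw [Nat.descFactorial_eq_zero_iff_lt.2 (not_le.1 hj), Nat.cast_zero, mul_zero]
  rw [Finset.sum_congr rfl h, ← map_sum, sum_Iic_prod β fun j n => (-1 : ℝ) ^ (β j - n) /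
        ((n.factorial : ℝ) * ((β j - n).factorial : ℝ)) * ((n.descFactorial (α j) : ℕ) : ℝ)]
  simp only [sum_descFactorial_alternating, Finset.prod_ite_zero]
  by_cases hαβ : α = β
  · subst hαβ
    simp
  · rw [if_neg hαβ, if_neg, map_zero]
    intro hh
    exact hαβ (Finsupp.ext fun j => hh j (Finset.mem_univ j))

lemma mem_span_image_finset {R V κ : Type*} [Ring R] [AddCommGroup V] [Module R V] {s : Finset κ}
    {w : κ → V} {x : V} :
    x ∈ Submodule.span R (w '' s) ↔ ∃ c : κ → R, ∑ i ∈ s, c i • w i = x := by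
  classical
  constructor
  · intro hx
    obtain ⟨c, rfl⟩ := (Submodule.mem_span_image_finset_iff_exists_fun R).1 hx
    refine ⟨fun i => if h : i ∈ s then c ⟨i, h⟩ else 0, ?_⟩
    rw [← Finset.sum_coe_sort]
    exact Finset.sum_congr rfl fun i _ => by simp
  · rintro ⟨c, rfl⟩
    exact Submodule.sum_mem _ fun i hi => Submodule.smul_mem _ _ (Submodule.subset_span ⟨i, hi, rfl⟩)

section PolyOp

variable {r : ℕ}

lemma polyOp_eq_sum {S : Finset (Fin r → (Fin d →₀ ℕ))} {P : (Fin r → (Fin d →₀ ℕ)) → FPS d}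
    (hP : SuppIn S P) (f : Fin r → FPS d) :
    polyOp P f = ∑ α ∈ S, P α * ∏ i, dPow (α i) (f i) := by
  rw [polyOp, finsum_eq_sum_of_support_subset]
  intro α hα
  by_contra hS
  exact hα (by simp only [hP α hS, zero_mul])

/-- The summation over `β` factors over the slots, each handled by `sum_symbol_slot`. Consequently
an operator determines its coefficients, which allows all laws of `fiberD` to be checked on
operators. -/
lemma polySymbol_polyOp {S : Finset (Fin r → (Fin d →₀ ℕ))}
    {P : (Fin r → (Fin d →₀ ℕ)) → FPS d} (hP : SuppIn S P) : polySymbol (polyOp P) = P := by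
  classical
  funext β
  simp only [polySymbol, polyOp_eq_sum hP, Finset.mul_sum]
  rw [Finset.sum_comm]
  have h : ∀ α : Fin r → (Fin d →₀ ℕ), ∑ γ ∈ Fintype.piFinset fun i => Finset.Iic (β i),
      (∏ i, monomial (β i - γ i) (∏ j, (-1 : ℝ) ^ (β i j - γ i j) /
        (((γ i j).factorial : ℝ) * ((β i j - γ i j).factorial : ℝ)))) *
        (P α * ∏ i, dPow (α i) (monomial (γ i) (1 : ℝ))) = P α * if α = β then 1 else 0 := by
    intro α
    have h1 : ∏ i, (if α i = β i then (1 : FPS d) else 0) = if α = β then 1 else 0 := by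
      rw [Finset.prod_ite_zero]
      simp [funext_iff]
    rw [← h1]
    simp only [← sum_symbol_slot, Finset.prod_univ_sum, Finset.mul_sum]
    refine Finset.sum_congr rfl fun γ _ => ?_
    rw [Finset.prod_mul_distrib]
    ring
  simp only [h]
  by_cases hβ : β ∈ S
  · simp [hβ]
  · simp [hβ, hP β hβ]

/-- The multi-indices of polydifferential operators of order at most `N` in each argument. -/
noncomputable def ordSet (d r N : ℕ) : Finset (Fin r → (Fin d →₀ ℕ)) :=
  Fintype.piFinset fun _ => degSetLE d N

lemma mem_ordSet {N : ℕ} {α : Fin r → (Fin d →₀ ℕ)} :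
    α ∈ ordSet d r N ↔ ∀ i, (α i).degree ≤ N := by
  simp [ordSet, mem_degSetLE]

/-- The polydifferential operators of order at most `N` in each argument. -/
noncomputable def polyOps (d r N : ℕ) : Submodule (FPS d) ((Fin r → FPS d) → FPS d) :=
  Submodule.span (FPS d)
    ((fun (α : Fin r → (Fin d →₀ ℕ)) f => ∏ i, dPow (α i) (f i)) '' (ordSet d r N))

/-- The differential operators of order at most `N`. -/
noncomputable def diffOps (d N : ℕ) : Submodule (FPS d) (FPS d → FPS d) :=
  Submodule.span (FPS d) (dPow '' (degSetLE d N))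

lemma mem_polyOps_iff {N : ℕ} {Q : (Fin r → FPS d) → FPS d} :
    Q ∈ polyOps d r N ↔ ∃ P, SuppIn (ordSet d r N) P ∧ polyOp P = Q := by
  classical
  rw [polyOps, mem_span_image_finset]
  constructor
  · rintro ⟨c, rfl⟩
    refine ⟨fun α => if α ∈ ordSet d r N then c α else 0, fun α hα => if_neg hα, ?_⟩
    funext f
    rw [polyOp_eq_sum (S := ordSet d r N) fun α hα => if_neg hα, Finset.sum_apply]
    refine Finset.sum_congr rfl fun α hα => ?_
    simp [hα]
  · rintro ⟨P, hP, rfl⟩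
    refine ⟨P, ?_⟩
    funext f
    rw [polyOp_eq_sum hP, Finset.sum_apply]
    rfl

lemma suppIn_polySymbol {N : ℕ} {Q : (Fin r → FPS d) → FPS d} (hQ : Q ∈ polyOps d r N) :
    SuppIn (ordSet d r N) (polySymbol Q) := by
  obtain ⟨P, hP, rfl⟩ := mem_polyOps_iff.1 hQ
  rwa [polySymbol_polyOp hP]

lemma polyOp_polySymbol {N : ℕ} {Q : (Fin r → FPS d) → FPS d} (hQ : Q ∈ polyOps d r N) :
    polyOp (polySymbol Q) = Q := by
  obtain ⟨P, hP, rfl⟩ := mem_polyOps_iff.1 hQ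
  rw [polySymbol_polyOp hP]

/-- Expanding the product of the sums gives the coefficients `∏ᵢ cᵢ(αᵢ)`. -/
lemma prod_mem_polyOps {N : ℕ} {D : Fin r → FPS d → FPS d} (hD : ∀ i, D i ∈ diffOps d N) :
    (fun f : Fin r → FPS d => ∏ i, D i (f i)) ∈ polyOps d r N := by
  classical
  simp only [diffOps, mem_span_image_finset] at hD
  choose c hc using hD
  rw [polyOps, mem_span_image_finset]
  refine ⟨fun α => ∏ i, c i (α i), ?_⟩
  funext f
  rw [Finset.sum_apply]
  simp only [← hc, Finset.sum_apply, Finset.prod_univ_sum, Pi.smul_apply, smul_eq_mul,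
    Finset.prod_mul_distrib]
  rfl

lemma dPow_mem_diffOps {N : ℕ} {α : Fin d →₀ ℕ} (hα : α.degree ≤ N) : dPow α ∈ diffOps d N :=
  Submodule.subset_span ⟨α, mem_degSetLE.2 hα, rfl⟩

lemma diffOps_mono {N N' : ℕ} (h : N ≤ N') : diffOps d N ≤ diffOps d N' :=
  Submodule.span_mono (Set.image_mono fun α hα => by
    simp only [Finset.mem_coe, mem_degSetLE] at hα ⊢
    omega)

lemma pderiv_comp_mem_diffOps {N : ℕ} {D : FPS d → FPS d} (hD : D ∈ diffOps d N) (j : Fin d) :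
    (fun f => pderiv ℝ j (D f)) ∈ diffOps d (N + 1) := by
  induction hD using Submodule.span_induction with
  | mem D hD =>
    obtain ⟨α, hα, rfl⟩ := hD
    simp only [pderiv_dPow]
    refine dPow_mem_diffOps ?_
    rw [degree_add_single]
    exact Nat.succ_le_succ (mem_degSetLE.1 hα)
  | zero =>
    convert (diffOps d (N + 1)).zero_mem using 1
    funext f
    simp
  | add D D' _ _ h h' =>
    convert (diffOps d (N + 1)).add_mem h h' using 1
    funext f
    simp
  | smul c D hD h =>
    convert (diffOps d (N + 1)).add_mem ((diffOps d (N + 1)).smul_mem c h)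
      ((diffOps d (N + 1)).smul_mem (pderiv ℝ j c) (diffOps_mono (Nat.le_succ N) hD)) using 1
    funext f
    simp [Derivation.leibniz]
    ring

lemma comp_pderiv_mem_diffOps {N : ℕ} {D : FPS d → FPS d} (hD : D ∈ diffOps d N) (j : Fin d) :
    (fun f => D (pderiv ℝ j f)) ∈ diffOps d (N + 1) := by
  induction hD using Submodule.span_induction with
  | mem D hD =>
    obtain ⟨α, hα, rfl⟩ := hD
    simp only [dPow_pderiv]
    refine dPow_mem_diffOps ?_
    rw [degree_add_single]
    exact Nat.succ_le_succ (mem_degSetLE.1 hα)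
  | zero => exact (diffOps d (N + 1)).zero_mem
  | add D D' _ _ h h' => exact (diffOps d (N + 1)).add_mem h h'
  | smul c D hD h => exact (diffOps d (N + 1)).smul_mem c h

lemma exists_eq_add_single {α : Fin d →₀ ℕ} {n : ℕ} (h : α.degree = n + 1) :
    ∃ (β : Fin d →₀ ℕ) (j : Fin d), α = β + Finsupp.single j 1 ∧ β.degree = n := by
  have hα : α ≠ 0 := by
    rintro rfl
    simp at h
  obtain ⟨j, hj⟩ := Finsupp.ne_iff.1 hα
  have h1 : α = (α - Finsupp.single j 1) + Finsupp.single j 1 := by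
    rw [tsub_add_cancel_of_le]
    simpa [Nat.one_le_iff_ne_zero] using hj
  refine ⟨_, j, h1, ?_⟩
  rw [h1, degree_add_single] at h
  omega

/-- A commutator with a vector field does not raise the order. Inductively, `[v, ∂ⱼ ∂^β] = ∂ⱼ [v,
∂^β] - ∑ₖ (∂ⱼ vᵏ) ∂ₖ ∂^β`. Thus the Gerstenhaber bracket preserves the finite sets `ordSet d r N`.
-/
lemma commutator_mem_diffOps (v : Fin d → FPS d) {N : ℕ} {α : Fin d →₀ ℕ} (hα : α.degree ≤ N) :
    (fun f => vfApply v (dPow α f) - dPow α (vfApply v f)) ∈ diffOps d N := by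
  suffices h : ∀ n (α : Fin d →₀ ℕ), α.degree = n →
      (fun f => vfApply v (dPow α f) - dPow α (vfApply v f)) ∈ diffOps d n from
    diffOps_mono hα (h _ α rfl)
  intro n
  induction n with
  | zero =>
    intro α hα
    rw [Finsupp.degree_eq_zero_iff] at hα
    subst hα
    simp only [dPow_zero, sub_self]
    exact (diffOps d 0).zero_mem
  | succ n ih =>
    intro α hα
    obtain ⟨β, j, rfl, hβ⟩ := exists_eq_add_single hα
    have h1 := pderiv_comp_mem_diffOps (ih β hβ) j
    have h2 : (fun f => ∑ k, pderiv ℝ j (v k) * pderiv ℝ k (dPow β f)) ∈ diffOps d (n + 1) := by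
      have : (fun f => ∑ k, pderiv ℝ j (v k) * pderiv ℝ k (dPow β f)) =
          ∑ k, pderiv ℝ j (v k) • fun f => pderiv ℝ k (dPow β f) := by
        funext f
        simp
      rw [this]
      exact Submodule.sum_mem _ fun k _ => Submodule.smul_mem _ _
        (pderiv_comp_mem_diffOps (dPow_mem_diffOps hβ.le) k)
    convert (diffOps d (n + 1)).sub_mem h1 h2 using 1
    funext f
    simp only [Pi.sub_apply, map_sub, ← pderiv_dPow]
    have h3 : pderiv ℝ j (vfApply v (dPow β f)) = vfApply v (pderiv ℝ j (dPow β f)) +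
        ∑ k, pderiv ℝ j (v k) * pderiv ℝ k (dPow β f) := by
      simp only [vfApply, map_sum, Derivation.leibniz, smul_eq_mul, Finset.sum_add_distrib]
      congr 1
      · exact Finset.sum_congr rfl fun k _ => by rw [pderiv_comm]
      · exact Finset.sum_congr rfl fun k _ => mul_comm _ _
    rw [h3]
    ring

/-- By the chain rule, conjugation with `g` turns one `∂ⱼ` into a combination of the `∂ᵢ` with
constant coefficients; the derivatives are peeled off one at a time. -/
lemma conj_mem_diffOps {g : Matrix (Fin d) (Fin d) ℝ} (hg : IsUnit g.det) {N : ℕ}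
    {α : Fin d →₀ ℕ} (hα : α.degree ≤ N) :
    (fun f => substLin g⁻¹ (dPow α (substLin g f))) ∈ diffOps d N := by
  suffices h : ∀ n (α : Fin d →₀ ℕ), α.degree = n →
      (fun f => substLin g⁻¹ (dPow α (substLin g f))) ∈ diffOps d n from
    diffOps_mono hα (h _ α rfl)
  intro n
  induction n with
  | zero =>
    intro α hα
    rw [Finsupp.degree_eq_zero_iff] at hα
    subst hα
    simp only [dPow_zero, substLin_substLin, Matrix.mul_nonsing_inv _ hg, substLin_one_matrix]
    convert dPow_mem_diffOps (d := d) (N := 0) (α := 0) (by simp) using 1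
    funext f
    rw [dPow_zero]
  | succ n ih =>
    intro α hα
    obtain ⟨β, j, rfl, hβ⟩ := exists_eq_add_single hα
    simp only [← dPow_pderiv, pderiv_substLin, dPow_sum, dPow_smul, substLin_sum, substLin_smul]
    have : (fun f => ∑ i, g i j • substLin g⁻¹ (dPow β (substLin g (pderiv ℝ i f)))) =
        ∑ i, (C (g i j) : FPS d) •
          fun f => substLin g⁻¹ (dPow β (substLin g (pderiv ℝ i f))) := by
      funext f
      simp [smul_eq_C_mul]
    rw [this]
    exact Submodule.sum_mem _ fun i _ => Submodule.smul_mem _ _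
      (comp_pderiv_mem_diffOps (ih β hβ) i)

end PolyOp

/-! ### The fiber of polydifferential operators and its laws -/

section FiberD

variable {r N : ℕ} {P : (Fin r → (Fin d →₀ ℕ)) → FPS d}

lemma polyOp_update_eq (hP : SuppIn (ordSet d r N) P) (f : Fin r → FPS d) (i : Fin r)
    (y : FPS d) : polyOp P (Function.update f i y) = ∑ α ∈ ordSet d r N,
      P α * ((∏ j ∈ Finset.univ.erase i, dPow (α j) (f j)) * dPow (α i) y) := by
  simp only [polyOp_eq_sum hP, prod_update_apply (fun α f => dPow α f)]

/-- On a single term the Leibniz rule leaves two contributions: the field differentiates the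
coefficient, or `∂^{αᵢ}` in one slot is replaced by its commutator with the field. Neither raises
the order. -/
lemma lie_mem_polyOps (v : Fin d → FPS d) (hP : SuppIn (ordSet d r N) P) :
    (fun f => vfApply v (polyOp P f) - ∑ i, polyOp P (Function.update f i (vfApply v (f i)))) ∈
      polyOps d r N := by
  classical
  have h : (fun f => vfApply v (polyOp P f) -
      ∑ i, polyOp P (Function.update f i (vfApply v (f i)))) = ∑ α ∈ ordSet d r N,
      (vfApply v (P α) • (fun f : Fin r → FPS d => ∏ i, dPow (α i) (f i)) +
        P α • ∑ i, fun f : Fin r → FPS d => ∏ j, Function.update (fun j => dPow (α j)) i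
          (fun f => vfApply v (dPow (α i) f) - dPow (α i) (vfApply v f)) j (f j)) := by
    funext f
    have h1 : ∀ α : Fin r → (Fin d →₀ ℕ), ∀ i, ∏ j, Function.update (fun j => dPow (α j)) i
          (fun f => vfApply v (dPow (α i) f) - dPow (α i) (vfApply v f)) j (f j) =
        (∏ j ∈ Finset.univ.erase i, dPow (α j) (f j)) *
          (vfApply v (dPow (α i) (f i)) - dPow (α i) (vfApply v (f i))) := by
      intro α i
      rw [← Finset.prod_erase_mul _ _ (Finset.mem_univ i), Function.update_self]
      congr 1
      refine Finset.prod_congr rfl fun j hj => ?_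
      rw [Function.update_of_ne (Finset.ne_of_mem_erase hj)]
    simp only [polyOp_update_eq hP]
    rw [polyOp_eq_sum hP, vfApply_sum, Finset.sum_comm, ← Finset.sum_sub_distrib, Finset.sum_apply]
    refine Finset.sum_congr rfl fun α _ => ?_
    simp only [Pi.add_apply, Pi.smul_apply, Finset.sum_apply, h1, smul_eq_mul]
    rw [vfApply_mul, vfApply_prod, add_sub_assoc, Finset.mul_sum, Finset.mul_sum,
      ← Finset.sum_sub_distrib]
    congr 1
    exact Finset.sum_congr rfl fun i _ => by ring
  rw [h]
  refine Submodule.sum_mem _ fun α hα => Submodule.add_mem _ (Submodule.smul_mem _ _ ?_)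
    (Submodule.smul_mem _ _ (Submodule.sum_mem _ fun i _ => prod_mem_polyOps fun j => ?_))
  · exact prod_mem_polyOps fun i => dPow_mem_diffOps (mem_ordSet.1 hα i)
  · by_cases hji : j = i
    · subst hji
      rw [Function.update_self]
      exact commutator_mem_diffOps v (mem_ordSet.1 hα j)
    · rw [Function.update_of_ne hji]
      exact dPow_mem_diffOps (mem_ordSet.1 hα j)

lemma act_mem_polyOps {g : Matrix (Fin d) (Fin d) ℝ} (hg : IsUnit g.det)
    (hP : SuppIn (ordSet d r N) P) :
    (fun f => substLin g⁻¹ (polyOp P fun i => substLin g (f i))) ∈ polyOps d r N := by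
  have h : (fun f => substLin g⁻¹ (polyOp P fun i => substLin g (f i))) =
      ∑ α ∈ ordSet d r N, substLin g⁻¹ (P α) • fun f : Fin r → FPS d =>
        ∏ i, (fun f => substLin g⁻¹ (dPow (α i) (substLin g f))) (f i) := by
    funext f
    rw [polyOp_eq_sum hP, substLin_sum, Finset.sum_apply]
    simp only [substLin_mul, substLin_prod, Pi.smul_apply, smul_eq_mul]
  rw [h]
  exact Submodule.sum_mem _ fun α hα => Submodule.smul_mem _ _
    (prod_mem_polyOps fun i => conj_mem_diffOps hg (mem_ordSet.1 hα i))

/-- The model of `fiberD` by polydifferential operators. -/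
noncomputable def modelD (d r N : ℕ) : OpModel (fiberD d r) (ordSet d r N) r (FPS d) where
  vX := vfApply
  gX g := substLin g
  op := polyOp
  vX_add_left v w x := vfApply_add_left _ _ _
  vX_smul_left c v x := vfApply_smul_left _ _ _
  vX_vbr v w x := vfApply_vbr _ _ _
  gX_one x := substLin_one_matrix _
  gX_mul g h x _ _ := by rw [substLin_substLin]
  gX_vX g v x hg := (modelT d 0).gX_vX g v x hg
  op_add {a b} ha hb := by
    funext f
    change polyOp (a + b) f = polyOp a f + polyOp b f
    rw [polyOp_eq_sum (ha.add hb), polyOp_eq_sum ha, polyOp_eq_sum hb, ← Finset.sum_add_distrib]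
    exact Finset.sum_congr rfl fun α _ => add_mul _ _ _
  op_smul c a ha f := by
    rw [polyOp_eq_sum (ha.smul c), polyOp_eq_sum ha, Finset.mul_sum]
    exact Finset.sum_congr rfl fun α _ => mul_assoc _ _ _
  op_inj {a b} ha hb h := by rw [← polySymbol_polyOp ha, ← polySymbol_polyOp hb, h]
  op_update_add {a} ha f i y z := by
    simp only [polyOp_update_eq ha, dPow_add, mul_add, Finset.sum_add_distrib]
  op_update_smul {a} ha f i c y := by
    simp only [polyOp_update_eq ha, dPow_smul, mul_smul_comm, Finset.smul_sum]
  lie_supp v a ha := suppIn_polySymbol (lie_mem_polyOps v ha)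
  act_supp g a hg ha := suppIn_polySymbol (act_mem_polyOps hg ha)
  op_lie v a ha f := congrFun (polyOp_polySymbol (lie_mem_polyOps v ha)) f
  op_act {g a} hg ha f := congrFun (polyOp_polySymbol (act_mem_polyOps hg ha)) f

lemma suppIn_unitAt {ι : Type*} {S : Finset ι} {n : ι} (hn : n ∈ S) :
    SuppIn S (unitAt n : ι → FPS d) := by
  intro n' hn'
  unfold unitAt
  rw [if_neg]
  rintro rfl
  exact hn' hn

lemma polyOp_unitAt (α : Fin r → (Fin d →₀ ℕ)) (f : Fin r → FPS d) :
    polyOp (unitAt α) f = ∏ i, dPow (α i) (f i) := by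
  rw [polyOp_eq_sum (S := {α}) (suppIn_unitAt (by simp)), Finset.sum_singleton]
  simp [unitAt]

lemma linVec_neg (B : Matrix (Fin d) (Fin d) ℝ) : linVec (-B) = -linVec B := by
  funext i
  simp [linVec]

lemma vfApply_neg_left (v : Fin d → FPS d) (f : FPS d) : vfApply (-v) f = -vfApply v f := by
  simp [vfApply]

lemma polySymbol_hasDer {Q : ℝ → (Fin r → FPS d) → FPS d} {Q' : (Fin r → FPS d) → FPS d}
    (h : ∀ f, HasDer (fun t => Q t f) (Q' f)) (α : Fin r → (Fin d →₀ ℕ)) :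
    HasDer (fun t => polySymbol (Q t) α) (polySymbol Q' α) := by
  simp only [polySymbol]
  exact HasDer.sum fun _ _ => by simpa using (HasDer.const _).mul (h _)

lemma polySymbol_smoothAt {E : Type*} [NormedAddCommGroup E] [NormedSpace ℝ E]
    {Q : E → (Fin r → FPS d) → FPS d} {z : E} (h : ∀ f, SmoothAt (fun t => Q t f) z)
    (α : Fin r → (Fin d →₀ ℕ)) : SmoothAt (fun t => polySymbol (Q t) α) z :=
  SmoothAt.sum fun _ _ => (SmoothAt.const _).mul (h _)

lemma HasDer.of_eq {f g : ℝ → FPS d} {f' g' : FPS d} (h : HasDer f f') (hfg : ∀ t, g t = f t)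
    (h' : g' = f') : HasDer g g' := by
  rw [h', show g = f from funext hfg]
  exact h

lemma SmoothAt.of_eq {E : Type*} [NormedAddCommGroup E] [NormedSpace ℝ E] {f g : E → FPS d} {z : E}
    (h : SmoothAt f z) (hfg : ∀ t, g t = f t) : SmoothAt g z := by
  rw [show g = f from funext hfg]
  exact h

lemma fiberD_lie_unitAt (v : Fin d → FPS d) (n n' : Fin r → (Fin d →₀ ℕ)) :
    (fiberD d r).lie v (unitAt (ι := Fin r → (Fin d →₀ ℕ)) n) n' = polySymbol (fun f =>
      vfApply v (∏ i, dPow (n i) (f i)) -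
        ∑ s, (∏ i ∈ Finset.univ.erase s, dPow (n i) (f i)) * dPow (n s) (vfApply v (f s))) n' := by
  change polySymbol (fun f => vfApply v (polyOp (unitAt n) f) - ∑ s, polyOp (unitAt n)
      (Function.update f s (vfApply v (f s)))) n' = _
  simp only [polyOp_unitAt, prod_update_apply (fun α f => dPow α f)]

lemma fiberD_act_unitAt (g : Matrix (Fin d) (Fin d) ℝ) (n n' : Fin r → (Fin d →₀ ℕ)) :
    (fiberD d r).act g (unitAt (ι := Fin r → (Fin d →₀ ℕ)) n) n' = polySymbol (fun f =>
      substLin g⁻¹ (∏ i, dPow (n i) (substLin g (f i)))) n' := by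
  change polySymbol (fun f => substLin g⁻¹ (polyOp (unitAt n) fun i => substLin g (f i))) n' = _
  simp only [polyOp_unitAt]

/-- Constant vector fields commute with all `∂^α`. -/
lemma fiberD_lie_single_unitAt (i : Fin d) {n : Fin r → (Fin d →₀ ℕ)} (hn : n ∈ ordSet d r N) :
    (fiberD d r).lie (Pi.single i 1) (unitAt (ι := Fin r → (Fin d →₀ ℕ)) n) = 0 := by
  refine (modelD d r N).op_inj (((modelD d r N).lie_supp) _ _ (suppIn_unitAt hn)) .zero ?_
  funext f
  refine ((modelD d r N).op_lie _ (suppIn_unitAt hn) f).trans ?_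
  change vfApply (Pi.single i 1) (polyOp (unitAt n) f) - ∑ s, polyOp (unitAt n)
    (Function.update f s (vfApply (Pi.single i 1) (f s))) = polyOp 0 f
  rw [polyOp_eq_sum (S := ∅) SuppIn.zero, Finset.sum_empty]
  simp only [polyOp_unitAt, prod_update_apply (fun α f => dPow α f)]
  rw [vfApply_prod, ← Finset.sum_sub_distrib]
  refine Finset.sum_eq_zero fun s _ => ?_
  rw [vfApply_single, vfApply_single, pderiv_dPow, dPow_pderiv, sub_self]

lemma fiberD_lie_hasDer {v : ℝ → Fin d → FPS d} {v' : Fin d → FPS d}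
    (hv : ∀ i, HasDer (fun t => v t i) (v' i)) (n n' : Fin r → (Fin d →₀ ℕ)) :
    HasDer (fun t => (fiberD d r).lie (v t) (unitAt (ι := Fin r → (Fin d →₀ ℕ)) n) n')
      ((fiberD d r).lie v' (unitAt (ι := Fin r → (Fin d →₀ ℕ)) n) n') := by
  refine HasDer.of_eq (polySymbol_hasDer (fun f => ?_) n') (fun t => fiberD_lie_unitAt (v t) n n')
    (fiberD_lie_unitAt v' n n')
  have hvf : ∀ f, HasDer (fun t => vfApply (v t) f) (vfApply v' f) := fun f => by
    simpa [vfApply_zero] using HasDer.vfApply hv (HasDer.const f)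
  refine (hvf _).sub (HasDer.sum fun s _ => ?_)
  simpa using (HasDer.const _).mul ((hvf (f s)).dPow (n s))

lemma fiberD_act_hasDer {g : ℝ → Matrix (Fin d) (Fin d) ℝ} {g' : Matrix (Fin d) (Fin d) ℝ}
    (h0 : g 0 = 1) (hg : ∀ i j, HasDerivAt (fun t => g t i j) (g' i j) 0)
    (n n' : Fin r → (Fin d →₀ ℕ)) :
    HasDer (fun t => (fiberD d r).act (g t) (unitAt (ι := Fin r → (Fin d →₀ ℕ)) n) n')
      ((fiberD d r).lie (linVec (-g')) (unitAt (ι := Fin r → (Fin d →₀ ℕ)) n) n') := by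
  refine HasDer.of_eq (polySymbol_hasDer (fun f => ?_) n') (fun t => fiberD_act_unitAt (g t) n n')
    (fiberD_lie_unitAt _ n n')
  -- The outer substitution uses `g⁻¹` and contributes the field of `-g'`; each inner one uses `g`
  -- and contributes the field of `g'`. Together they form the bracket with the field of `-g'`.
  have h1 := HasDer.substLin (h := fun t => (g t)⁻¹) (by rw [h0, inv_one])
    (hasDerivAt_inv_matrix h0 hg)
    (HasDer.prod (s := Finset.univ) fun i _ => (HasDer.substLin_const h0 hg (f i)).dPow (n i))
  refine HasDer.of_eq h1 (fun t => rfl) ?_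
  simp only [h0, substLin_one_matrix]
  rw [sub_eq_add_neg, add_comm]
  congr 1
  rw [← Finset.sum_neg_distrib]
  refine Finset.sum_congr rfl fun i _ => ?_
  rw [← mul_neg, linVec_neg, vfApply_neg_left, ← neg_one_smul ℝ (vfApply _ _), dPow_smul, neg_one_smul,
    neg_neg]

lemma fiberD_lie_smoothAt {E : Type*} [NormedAddCommGroup E] [NormedSpace ℝ E]
    {v : E → Fin d → FPS d} {z : E} (hv : ∀ i, SmoothAt (fun t => v t i) z)
    (n n' : Fin r → (Fin d →₀ ℕ)) :
    SmoothAt (fun t => (fiberD d r).lie (v t) (unitAt (ι := Fin r → (Fin d →₀ ℕ)) n) n') z := by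
  refine SmoothAt.of_eq (polySymbol_smoothAt (fun f => ?_) n')
    (fun t => fiberD_lie_unitAt (v t) n n')
  exact (SmoothAt.vfApply hv (.const _)).sub (SmoothAt.sum fun s _ =>
      (SmoothAt.const _).mul ((SmoothAt.vfApply hv (.const _)).dPow _))

lemma fiberD_act_smoothAt {E : Type*} [NormedAddCommGroup E] [NormedSpace ℝ E]
    {g : E → Matrix (Fin d) (Fin d) ℝ} {z : E} (hz : IsUnit (g z).det)
    (hg : ∀ i j, ContDiffAt ℝ ∞ (fun t => g t i j) z) (n n' : Fin r → (Fin d →₀ ℕ)) :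
    SmoothAt (fun t => (fiberD d r).act (g t) (unitAt (ι := Fin r → (Fin d →₀ ℕ)) n) n') z := by
  refine SmoothAt.of_eq (polySymbol_smoothAt (fun f => ?_) n')
    (fun t => fiberD_act_unitAt (g t) n n')
  exact SmoothAt.substLin (contDiffAt_inv hg hz)
      (SmoothAt.prod fun i _ => (SmoothAt.substLin hg (.const _)).dPow _)

lemma fiberLaws_D (d r N : ℕ) : FiberLaws (fiberD d r) (ordSet d r N) where
  toAlgLaws := (modelD d r N).algLaws
  lie_single_unitAt i _ hn := fiberD_lie_single_unitAt i hn
  lie_hasDer_unitAt hv n _ n' := fiberD_lie_hasDer hv n n'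
  act_hasDer_unitAt h0 hg n _ n' := fiberD_act_hasDer h0 hg n n'
  lie_smoothAt_unitAt hv n _ n' := fiberD_lie_smoothAt hv n n'
  act_smoothAt_unitAt hz hg n _ n' := fiberD_act_smoothAt hz hg n n'

lemma exists_subset_ordSet (S : Finset (Fin r → (Fin d →₀ ℕ))) : ∃ N, S ⊆ ordSet d r N := by
  -- The sum of all degrees occurring in `S` serves as a crude common bound.
  refine ⟨∑ α ∈ S, ∑ i, (α i).degree, fun α hα => mem_ordSet.2 fun i => ?_⟩
  refine le_trans ?_ (Finset.single_le_sum (f := fun α : Fin r → (Fin d →₀ ℕ) =>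
    ∑ i, (α i).degree) (fun _ _ => Nat.zero_le _) hα)
  exact Finset.single_le_sum (f := fun i => (α i).degree) (fun _ _ => Nat.zero_le _)
    (Finset.mem_univ i)

end FiberD

/-- The laws of a fiber: they hold on large finite sets of components, and the symmetry condition
consists of linear relations between components which are preserved by the actions. -/
structure LawfulFiber (B : FormalFiber d) : Prop where
  exists_laws : ∀ S : Finset B.ι, ∃ S', S ⊆ S' ∧ FiberLaws B S'
  sym : ∃ R : B.ι → B.ι → ℝ → Prop, ∀ a, B.IsSym a ↔ ∀ n n' c, R n n' c → a n = c • a n'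
  act_sym : ∀ g a, B.IsSym a → B.IsSym (B.act g a)
  lie_sym : ∀ v a, B.IsSym a → B.IsSym (B.lie v a)

lemma lawfulFiber_SM (d : ℕ) : LawfulFiber (fiberSM d) where
  exists_laws S := ⟨_, Finset.subset_univ (α := Unit) S, fiberLaws_SM d⟩
  sym := ⟨fun _ _ _ => False, fun a => by simp [fiberSM]⟩
  act_sym _ _ _ := trivial
  lie_sym _ _ _ := trivial

lemma lawfulFiber_D (d r : ℕ) : LawfulFiber (fiberD d r) where
  exists_laws S := by
    obtain ⟨N, hN⟩ := exists_subset_ordSet S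
    exact ⟨_, hN, fiberLaws_D d r N⟩
  sym := ⟨fun _ _ _ => False, fun a => by simp [fiberD]⟩
  act_sym _ _ _ := trivial
  lie_sym _ _ _ := trivial

lemma isAntisymm_iff {κ : Type*} {k : ℕ} (a : (Fin k → κ) → FPS d) :
    IsAntisymm a ↔ ∀ n n' (c : ℝ), (∃ π : Equiv.Perm (Fin k), n = n' ∘ π ∧
      c = ((Equiv.Perm.sign π : ℤ) : ℝ)) → a n = c • a n' := by
  constructor
  · rintro h n n' c ⟨π, rfl, rfl⟩
    rw [h π n', Int.cast_smul_eq_zsmul]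
  · intro h π J
    rw [h (J ∘ π) J _ ⟨π, rfl, rfl⟩, Int.cast_smul_eq_zsmul]

/-! ### Antisymmetry is preserved by both actions -/

section TensorSym

variable {κ : Type*} {k : ℕ}

lemma IsAntisymm.tensorAct [Fintype κ] {μ : κ → κ → ℝ} {h : Matrix (Fin d) (Fin d) ℝ}
    {a : (Fin k → κ) → FPS d} (ha : IsAntisymm a) :
    IsAntisymm fun J => ∑ J' : Fin k → κ, (∏ s, μ (J s) (J' s)) • substLin h (a J') := by
  intro π J
  simp only
  rw [Finset.smul_sum]
  refine Fintype.sum_bijective (fun J' => J' ∘ π.symm)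
    ⟨fun a b hab => by
      funext s
      simpa using congrFun hab (π s), fun a => ⟨a ∘ π, by funext; simp⟩⟩ _ _
    fun J' => ?_
  rw [ha π.symm J', smul_comm, ← Int.cast_smul_eq_zsmul ℝ, ← Int.cast_smul_eq_zsmul ℝ, substLin_smul,
    smul_smul]
  have h1 : ((Equiv.Perm.sign π : ℤ) : ℝ) * ((Equiv.Perm.sign π.symm : ℤ) : ℝ) = 1 := by
    rw [Equiv.Perm.sign_symm]
    norm_cast
    exact Int.units_coe_mul_self _
  have h2 : ∏ s, μ ((J ∘ π) s) (J' s) = ∏ s, μ (J s) ((J' ∘ π.symm) s) := by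
    rw [← Equiv.prod_comp π fun s => μ (J s) ((J' ∘ π.symm) s)]
    simp
  rw [smul_smul, mul_assoc, h1, mul_one, h2]

lemma IsAntisymm.tensorLie [Fintype κ] {c : κ → κ → FPS d} {a : (Fin k → κ) → FPS d}
    (ha : IsAntisymm a) :
    IsAntisymm fun J => ∑ s, ∑ l, c (J s) l * a (Function.update J s l) := by
  intro π J
  simp only [Finset.smul_sum]
  rw [← Equiv.sum_comp π fun s => ∑ l, (Equiv.Perm.sign π : ℤ) •
    (c (J s) l * a (Function.update J s l))]
  refine Finset.sum_congr rfl fun s _ => Finset.sum_congr rfl fun l _ => ?_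
  have : Function.update (J ∘ π) s l = Function.update J (π s) l ∘ π := by
    funext t
    by_cases h : t = s
    · subst h; simp
    · simp [h]
  rw [this, ha π, mul_smul_comm]
  rfl

lemma IsAntisymm.comp_linear {X Y : Type*} [AddCommGroup X] [AddCommGroup Y]
    {a : (Fin k → κ) → X} (ha : IsAntisymm a) (T : X →+ Y) : IsAntisymm fun J => T (a J) := by
  intro π J
  simp only [ha π J, map_zsmul]

lemma IsAntisymm.add {X : Type*} [AddCommGroup X] {a b : (Fin k → κ) → X} (ha : IsAntisymm a)
    (hb : IsAntisymm b) : IsAntisymm fun J => a J + b J := by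
  intro π J
  simp only [ha π J, hb π J, smul_add]

end TensorSym

/-- The action of a formal vector field as an additive map. -/
noncomputable def vfApplyHom (v : Fin d → FPS d) : FPS d →+ FPS d where
  toFun := vfApply v
  map_zero' := vfApply_zero v
  map_add' := vfApply_add v

lemma lawfulFiber_E (d k : ℕ) : LawfulFiber (fiberE d k) where
  exists_laws S := ⟨_, Finset.subset_univ (α := Fin k → Fin d) S, fiberLaws_E d k⟩
  sym := ⟨_, isAntisymm_iff⟩
  act_sym g _ ha := IsAntisymm.tensorAct (μ := fun j j' => g⁻¹ j' j) ha
  lie_sym v a ha := by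
    change IsAntisymm fun J : Fin k → Fin d => vfApply v (a J) + ∑ s : Fin k, ∑ l : Fin d,
      pderiv ℝ (J s) (v l) * a (Function.update J s l)
    exact IsAntisymm.add (IsAntisymm.comp_linear ha (vfApplyHom v))
      (IsAntisymm.tensorLie (c := fun j l => pderiv ℝ j (v l)) ha)

lemma lawfulFiber_T (d r : ℕ) : LawfulFiber (fiberT d r) where
  exists_laws S := ⟨_, Finset.subset_univ (α := Fin r → Fin d) S, fiberLaws_T d r⟩
  sym := ⟨_, isAntisymm_iff⟩
  act_sym g _ ha := IsAntisymm.tensorAct (μ := fun j j' => g j j') ha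
  lie_sym v a ha := by
    have h := (ha.comp_linear (vfApplyHom v)).add
      (IsAntisymm.tensorLie (c := fun j l => -pderiv ℝ l (v j)) ha)
    have h2 : (fiberT d r).lie v a = fun J : Fin r → Fin d => vfApplyHom v (a J) +
        ∑ s : Fin r, ∑ l : Fin d, -pderiv ℝ l (v (J s)) * a (Function.update J s l) := by
      funext J
      simp [fiberT, vfApplyHom, sub_eq_add_neg, Finset.sum_neg_distrib]
    rw [h2]
    exact h

lemma Kind.lawful (d : ℕ) (K : Kind) : LawfulFiber (K.fiber d) := by
  cases K with
  | SM => exact lawfulFiber_SM d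
  | E k => exact lawfulFiber_E d k
  | Tpoly r => exact lawfulFiber_T d r
  | Dpoly r => exact lawfulFiber_D d r

/-! ### Consequences of the laws of a fiber -/

lemma HasDer.substLin_left (h : Matrix (Fin d) (Fin d) ℝ) {f : ℝ → FPS d} {f' : FPS d}
    (hf : HasDer f f') : HasDer (fun t => Fedosov.substLin h (f t)) (Fedosov.substLin h f') := by
  intro m
  have h1 := HasDerivAt.fun_sum (u := degSet d m.degree)
    fun k _ => (hf k).mul_const (coeff m (Fedosov.substLin h (monomial k (1 : ℝ))))
  rw [← coeff_substLin] at h1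
  exact h1.congr_of_eventuallyEq (Filter.Eventually.of_forall fun t => coeff_substLin h (f t) m)

lemma eq_C_of_pderiv_eq_zero {f : FPS d} (h : ∀ i, pderiv ℝ i f = 0) :
    f = C (constantCoeff f) := by
  classical
  ext m
  rw [coeff_C]
  split_ifs with hm
  · rw [hm, coeff_zero_eq_constantCoeff_apply]
  · obtain ⟨j, hj⟩ := Finsupp.ne_iff.1 hm
    have h1 : m = (m - Finsupp.single j 1) + Finsupp.single j 1 := by
      rw [tsub_add_cancel_of_le]
      simpa [Nat.one_le_iff_ne_zero] using hj
    have h2 := congrArg (coeff (m - Finsupp.single j 1)) (h j)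
    rw [coeff_pderiv, ← h1, map_zero] at h2
    refine (mul_eq_zero.1 h2).resolve_right ?_
    positivity

section

variable {B : FormalFiber d} {S : Finset B.ι}

namespace AlgLaws

variable (L : AlgLaws B S)
include L

lemma act_zero {g : Matrix (Fin d) (Fin d) ℝ} (hg : IsUnit g.det) : B.act g 0 = 0 := by
  have h := L.act_add hg (SuppIn.zero (S := S)) SuppIn.zero
  rw [add_zero] at h
  exact left_eq_add.1 h

lemma lie_zero (v : Fin d → FPS d) : B.lie v 0 = 0 := by
  have h := L.lie_add (v := v) (SuppIn.zero (S := S)) SuppIn.zero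
  rw [add_zero] at h
  exact left_eq_add.1 h

lemma act_real_smul {g : Matrix (Fin d) (Fin d) ℝ} (hg : IsUnit g.det) (c : ℝ) {a : B.ι → FPS d}
    (ha : SuppIn S a) : B.act g (c • a) = c • B.act g a := by
  have h := L.act_smul (C c) hg ha
  rw [substLin_C] at h
  have h2 : ∀ a : B.ι → FPS d, (C c : FPS d) • a = c • a := fun a => by
    funext n
    simp [smul_eq_C_mul]
  rwa [h2, h2] at h

lemma lie_real_smul (v : Fin d → FPS d) (c : ℝ) {a : B.ι → FPS d}
    (ha : SuppIn S a) : B.lie v (c • a) = c • B.lie v a := by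
  have h := L.lie_smul (v := v) (C c) ha
  have h2 : ∀ a : B.ι → FPS d, (C c : FPS d) • a = c • a := fun a => by
    funext n
    simp [smul_eq_C_mul]
  have h3 : vfApply v (C c) = 0 := by simp [vfApply, pderiv_C]
  rwa [h2, h2, h3, zero_smul, zero_add] at h

lemma act_sum {g : Matrix (Fin d) (Fin d) ℝ} (hg : IsUnit g.det) {κ : Type*} (s : Finset κ)
    {a : κ → B.ι → FPS d} (ha : ∀ k ∈ s, SuppIn S (a k)) :
    B.act g (∑ k ∈ s, a k) = ∑ k ∈ s, B.act g (a k) := by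
  classical
  induction s using Finset.induction_on with
  | empty => simpa using L.act_zero hg
  | insert k s hk ih =>
    rw [Finset.sum_insert hk, Finset.sum_insert hk, L.act_add hg (ha k (by simp))
      (SuppIn.sum fun k hk => ha k (by simp [hk])), ih fun k hk => ha k (by simp [hk])]

lemma lie_sum (v : Fin d → FPS d) {κ : Type*} (s : Finset κ)
    {a : κ → B.ι → FPS d} (ha : ∀ k ∈ s, SuppIn S (a k)) :
    B.lie v (∑ k ∈ s, a k) = ∑ k ∈ s, B.lie v (a k) := by
  classical
  induction s using Finset.induction_on with
  | empty => simpa using L.lie_zero v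
  | insert k s hk ih =>
    rw [Finset.sum_insert hk, Finset.sum_insert hk, L.lie_add (ha k (by simp))
      (SuppIn.sum fun k hk => ha k (by simp [hk])), ih fun k hk => ha k (by simp [hk])]

lemma lie_zero_left {a : B.ι → FPS d} (ha : SuppIn S a) : B.lie 0 a = 0 := by
  have h := L.lie_add_left (v := 0) (w := 0) ha
  rw [add_zero] at h
  exact left_eq_add.1 h

lemma lie_neg_left (v : Fin d → FPS d) {a : B.ι → FPS d} (ha : SuppIn S a) :
    B.lie (-v) a = -B.lie v a := by
  have h := L.lie_smul_left (-1) (v := v) ha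
  rwa [neg_one_smul, neg_one_smul] at h

lemma lie_sub_left (v w : Fin d → FPS d) {a : B.ι → FPS d} (ha : SuppIn S a) :
    B.lie (v - w) a = B.lie v a - B.lie w a := by
  rw [sub_eq_add_neg, L.lie_add_left ha, L.lie_neg_left _ ha, sub_eq_add_neg]

lemma lie_sum_left {κ : Type*} (s : Finset κ) (v : κ → Fin d → FPS d)
    {a : B.ι → FPS d} (ha : SuppIn S a) :
    B.lie (∑ k ∈ s, v k) a = ∑ k ∈ s, B.lie (v k) a := by
  classical
  induction s using Finset.induction_on with
  | empty => simpa using L.lie_zero_left ha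
  | insert k s hk ih =>
    rw [Finset.sum_insert hk, Finset.sum_insert hk, L.lie_add_left ha, ih]

end AlgLaws

lemma eq_sum_unitAt {ι : Type*} {S : Finset ι} {a : ι → FPS d} (ha : SuppIn S a) :
    a = ∑ n ∈ S, a n • (unitAt n : ι → FPS d) := by
  classical
  funext n
  simp only [Finset.sum_apply, Pi.smul_apply, unitAt, smul_eq_mul, mul_ite, mul_one, mul_zero]
  by_cases hn : n ∈ S
  · simp [hn]
  · simp [hn, ha n hn]

namespace FiberLaws

variable (L : FiberLaws B S)
include L

/-- Semilinearity over power series reduces the action to its values on unit components. Together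
with `lie_eq` this is how differentiability and smoothness are extended from unit components to all
families with finite support. -/
lemma act_eq {g : Matrix (Fin d) (Fin d) ℝ} (hg : IsUnit g.det) {a : B.ι → FPS d}
    (ha : SuppIn S a) (n' : B.ι) :
    B.act g a n' = ∑ n ∈ S, substLin g⁻¹ (a n) * B.act g (unitAt n) n' := by
  conv_lhs => rw [eq_sum_unitAt ha, L.act_sum hg _ fun n hn => (suppIn_unitAt hn).smul _]
  rw [Finset.sum_apply]
  refine Finset.sum_congr rfl fun n hn => ?_
  rw [L.act_smul _ hg (suppIn_unitAt hn)]
  rfl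

lemma lie_eq (v : Fin d → FPS d) {a : B.ι → FPS d} (ha : SuppIn S a) (n' : B.ι) :
    B.lie v a n' = vfApply v (a n') + ∑ n ∈ S, a n * B.lie v (unitAt n) n' := by
  have h1 : vfApply v (a n') = ∑ n ∈ S, (vfApply v (a n) • (unitAt n : B.ι → FPS d)) n' := by
    rw [← Finset.sum_apply, ← eq_sum_unitAt (a := fun n => vfApply v (a n))]
    intro n hn
    change vfApply v (a n) = 0
    rw [ha n hn, vfApply_zero]
  rw [h1, ← Finset.sum_add_distrib]
  conv_lhs => rw [eq_sum_unitAt ha, L.lie_sum _ _ fun n hn => (suppIn_unitAt hn).smul _]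
  rw [Finset.sum_apply]
  refine Finset.sum_congr rfl fun n hn => ?_
  rw [L.lie_smul _ (suppIn_unitAt hn)]
  rfl

lemma lie_single (i : Fin d) {a : B.ι → FPS d} (ha : SuppIn S a) (n : B.ι) :
    B.lie (Pi.single i 1) a n = pderiv ℝ i (a n) := by
  rw [L.lie_eq _ ha, vfApply_single, Finset.sum_eq_zero, add_zero]
  intro k hk
  rw [L.lie_single_unitAt i k hk, Pi.zero_apply, mul_zero]

/-- Unit components are annihilated by constant fields. A linear change maps constant fields to
constant fields, so the transformed components are annihilated as well and have no terms of positive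
degree in `y`. -/
lemma act_unitAt_eq_C {g : Matrix (Fin d) (Fin d) ℝ} (hg : IsUnit g.det) {n : B.ι} (hn : n ∈ S)
    (n' : B.ι) : B.act g (unitAt n) n' = C (constantCoeff (B.act g (unitAt n) n')) := by
  refine eq_C_of_pderiv_eq_zero fun i => ?_
  have hu := suppIn_unitAt (d := d) hn
  rw [← L.lie_single i (L.act_supp hg hu)]
  have hg' : IsUnit g⁻¹.det := by
    rw [Matrix.det_nonsing_inv]
    exact IsUnit.ringInverse hg
  have h1 : push g (push g⁻¹ (Pi.single i 1)) = Pi.single i 1 := by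
    rw [← push_mul, Matrix.mul_nonsing_inv _ hg, push_one]
  have h2 : push g⁻¹ (Pi.single i 1) = ∑ j, g⁻¹ j i • (Pi.single j 1 : Fin d → FPS d) := by
    funext k
    simp [push, Pi.single_apply, apply_ite (substLin _), substLin_one, substLin_zero]
  have h3 : B.lie (push g⁻¹ (Pi.single i 1)) (unitAt n) = 0 := by
    rw [h2, L.lie_sum_left _ _ hu]
    refine Finset.sum_eq_zero fun j _ => ?_
    rw [L.lie_smul_left _ hu, L.lie_single_unitAt j n hn, smul_zero]
  rw [← h1, ← L.act_lie hg hu, h3, L.act_zero hg]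
  rfl

lemma coeff_act {g : Matrix (Fin d) (Fin d) ℝ} (hg : IsUnit g.det) {a : B.ι → FPS d}
    (ha : SuppIn S a) (n' : B.ι) (m : Fin d →₀ ℕ) :
    coeff m (B.act g a n') =
      ∑ n ∈ S, coeff m (substLin g⁻¹ (a n)) * constantCoeff (B.act g (unitAt n) n') := by
  rw [L.act_eq hg ha, map_sum]
  refine Finset.sum_congr rfl fun n hn => ?_
  rw [L.act_unitAt_eq_C hg hn, coeff_mul_C, constantCoeff_C]

/-- The terms of a degree in `y` are transformed among themselves. -/
lemma coeff_act_congr {g : Matrix (Fin d) (Fin d) ℝ} (hg : IsUnit g.det) {a b : B.ι → FPS d}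
    (ha : SuppIn S a) (hb : SuppIn S b) {m : Fin d →₀ ℕ} {c : ℝ}
    (hab : ∀ n k, k.degree = m.degree → coeff k (a n) = c * coeff k (b n)) (n' : B.ι) :
    coeff m (B.act g a n') = c * coeff m (B.act g b n') := by
  rw [L.coeff_act hg ha, L.coeff_act hg hb, Finset.mul_sum]
  refine Finset.sum_congr rfl fun n _ => ?_
  rw [coeff_substLin, coeff_substLin, Finset.sum_mul, Finset.sum_mul, Finset.mul_sum]
  refine Finset.sum_congr rfl fun k hk => ?_
  rw [hab n k (mem_degSet.1 hk)]
  ring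

lemma act_ordGE {g : Matrix (Fin d) (Fin d) ℝ} (hg : IsUnit g.det) {a : B.ι → FPS d}
    (ha : SuppIn S a) {p : ℕ} (hp : ∀ n, OrdGE p (a n)) (n' : B.ι) : OrdGE p (B.act g a n') := by
  intro m hm
  rw [L.coeff_act hg ha]
  refine Finset.sum_eq_zero fun n _ => ?_
  rw [(hp n).substLin _ m hm, zero_mul]

/-- The degree lost by differentiation is regained from a field that vanishes at `y = 0`; the
remaining terms multiply the components by power series. -/
lemma lie_ordGE {v : Fin d → FPS d} (hv : ∀ i, OrdGE 1 (v i)) {a : B.ι → FPS d}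
    (ha : SuppIn S a) {p : ℕ} (hp : ∀ n, OrdGE p (a n)) (n' : B.ι) : OrdGE p (B.lie v a n') := by
  rw [L.lie_eq v ha]
  refine OrdGE.add ((OrdGE.vfApply hv (hp n')).mono (by omega)) (OrdGE.sum fun n _ => ?_)
  exact ((hp n).mul (OrdGE.of_zero _)).mono (by omega)

lemma lie_hasDer {v : ℝ → Fin d → FPS d} {v' : Fin d → FPS d} {a : ℝ → B.ι → FPS d}
    {a' : B.ι → FPS d} (hv : ∀ i, HasDer (fun t => v t i) (v' i))
    (hS : ∀ᶠ t in nhds 0, SuppIn S (a t)) (hS' : SuppIn S a')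
    (ha : ∀ n, HasDer (fun t => a t n) (a' n)) (n : B.ι) :
    HasDer (fun t => B.lie (v t) (a t) n) (B.lie v' (a 0) n + B.lie (v 0) a' n) := by
  have h := (HasDer.vfApply hv (ha n)).add (HasDer.sum (s := S) fun k hk =>
    (ha k).mul (L.lie_hasDer_unitAt hv k hk n))
  have h0 : SuppIn S (a 0) := hS.self_of_nhds
  refine (HasDer.congr h (hS.mono fun t ht => L.lie_eq (v t) ht n)).of_eq (fun _ => rfl) ?_
  rw [L.lie_eq v' h0, L.lie_eq (v 0) hS', Finset.sum_add_distrib]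
  abel

/-- A linear change substitutes `g⁻¹ y`, so its derivative at the identity is the action of the
linear field of `-g'`. This converts derivatives of Jacobi matrices into terms of the same shape as
the Christoffel terms. -/
lemma act_hasDer {g : ℝ → Matrix (Fin d) (Fin d) ℝ} {g' : Matrix (Fin d) (Fin d) ℝ}
    {a : ℝ → B.ι → FPS d} {a' : B.ι → FPS d} (h0 : g 0 = 1)
    (hg : ∀ i j, HasDerivAt (fun t => g t i j) (g' i j) 0)
    (hdet : ∀ᶠ t in nhds 0, IsUnit (g t).det)
    (hS : ∀ᶠ t in nhds 0, SuppIn S (a t)) (hS' : SuppIn S a')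
    (ha : ∀ n, HasDer (fun t => a t n) (a' n)) (n : B.ι) :
    HasDer (fun t => B.act (g t) (a t) n) (a' n + B.lie (linVec (-g')) (a 0) n) := by
  have h := HasDer.sum (s := S) fun k hk =>
    (HasDer.substLin (h := fun t => (g t)⁻¹) (by rw [h0, inv_one]) (hasDerivAt_inv_matrix h0 hg)
      (ha k)).mul (L.act_hasDer_unitAt h0 hg k hk n)
  have hS0 : SuppIn S (a 0) := hS.self_of_nhds
  refine (HasDer.congr h ((hS.and hdet).mono fun t ht => L.act_eq ht.2 ht.1 n)).of_eq
    (fun _ => rfl) ?_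
  have h1 : IsUnit (1 : Matrix (Fin d) (Fin d) ℝ).det := by simp
  have h2 : a' n + vfApply (linVec (-g')) (a 0 n) = ∑ k ∈ S,
      (a' k + vfApply (linVec (-g')) (a 0 k)) * (unitAt k n : FPS d) := by
    have := congrFun (eq_sum_unitAt (S := S)
      (a := fun k => a' k + vfApply (linVec (-g')) (a 0 k)) fun k hk => by
        change a' k + vfApply (linVec (-g')) (a 0 k) = 0
        rw [hS' k hk, hS0 k hk, vfApply_zero, add_zero]) n
    rw [this, Finset.sum_apply]
    rfl
  rw [L.lie_eq _ hS0, ← add_assoc, h2, ← Finset.sum_add_distrib]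
  refine Finset.sum_congr rfl fun k hk => ?_
  rw [h0, L.act_one (suppIn_unitAt hk), inv_one, substLin_one_matrix]

lemma act_hasDer_left {g : Matrix (Fin d) (Fin d) ℝ} (hg : IsUnit g.det)
    {a : ℝ → B.ι → FPS d} {a' : B.ι → FPS d}
    (hS : ∀ᶠ t in nhds 0, SuppIn S (a t)) (hS' : SuppIn S a')
    (ha : ∀ n, HasDer (fun t => a t n) (a' n)) (n : B.ι) :
    HasDer (fun t => B.act g (a t) n) (B.act g a' n) := by
  have h := HasDer.sum (s := S) fun k hk =>
    ((ha k).substLin_left g⁻¹).mul_const (B.act g (unitAt k) n)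
  exact (HasDer.congr h (hS.mono fun t ht => L.act_eq hg ht n)).of_eq (fun _ => rfl)
    (L.act_eq hg hS' n)

lemma lie_smoothAt {v : EuclideanSpace ℝ (Fin d) → Fin d → FPS d}
    {a : EuclideanSpace ℝ (Fin d) → B.ι → FPS d} {z : EuclideanSpace ℝ (Fin d)}
    (hv : ∀ i, SmoothAt (fun t => v t i) z)
    (hS : ∀ᶠ t in nhds z, SuppIn S (a t)) (ha : ∀ n, SmoothAt (fun t => a t n) z) (n : B.ι) :
    SmoothAt (fun t => B.lie (v t) (a t) n) z := by
  refine SmoothAt.congr ?_ (hS.mono fun t ht => L.lie_eq (v t) ht n)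
  exact (SmoothAt.vfApply hv (ha n)).add (SmoothAt.sum fun k hk =>
    (ha k).mul (L.lie_smoothAt_unitAt hv k hk n))

lemma act_smoothAt {g : EuclideanSpace ℝ (Fin d) → Matrix (Fin d) (Fin d) ℝ}
    {a : EuclideanSpace ℝ (Fin d) → B.ι → FPS d} {z : EuclideanSpace ℝ (Fin d)}
    (hg : ∀ i j, ContDiffAt ℝ ∞ (fun t => g t i j) z)
    (hdet : ∀ᶠ t in nhds z, IsUnit (g t).det)
    (hS : ∀ᶠ t in nhds z, SuppIn S (a t)) (ha : ∀ n, SmoothAt (fun t => a t n) z) (n : B.ι) :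
    SmoothAt (fun t => B.act (g t) (a t) n) z := by
  refine SmoothAt.congr ?_ ((hS.and hdet).mono fun t ht => L.act_eq ht.2 ht.1 n)
  exact SmoothAt.sum fun k hk =>
    (SmoothAt.substLin (contDiffAt_inv hg hdet.self_of_nhds) (ha k)).mul
      (L.act_smoothAt_unitAt hdet.self_of_nhds hg k hk n)

end FiberLaws

end

/-! ### Changes of charts -/

lemma clm_apply_eq_sum (T : EuclideanSpace ℝ (Fin d) →L[ℝ] EuclideanSpace ℝ (Fin d))
    (v : EuclideanSpace ℝ (Fin d)) : T v = ∑ j, v j • T (e j) := by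
  have h : v = ∑ j, v j • (e j : EuclideanSpace ℝ (Fin d)) := by
    ext i
    simp [e, Finset.sum_apply, Pi.single_apply]
  conv_lhs => rw [h]
  simp

section Geometry

variable {M : Type*} [TopologicalSpace M] [ChartedSpace (EuclideanSpace ℝ (Fin d)) M]

/-- The Jacobi matrix at `q` of the change from the coordinates of the preferred chart at `a` to
those of the preferred chart at `b`. -/
noncomputable def tcMatrix (d : ℕ) {M : Type*} [TopologicalSpace M]
    [ChartedSpace (EuclideanSpace ℝ (Fin d)) M] [IsManifold (𝓡 d) ∞ M] (a b q : M) : Matrix (Fin d) (Fin d) ℝ :=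
  Matrix.of fun i j => (tangentCoordChange (𝓡 d) a b q (e j)) i

/-- The change of coordinates from the preferred chart at `a` to the one at `b`. -/
noncomputable def transition (d : ℕ) {M : Type*} [TopologicalSpace M]
    [ChartedSpace (EuclideanSpace ℝ (Fin d)) M] (a b : M) : EuclideanSpace ℝ (Fin d) → EuclideanSpace ℝ (Fin d) :=
  extChartAt (𝓡 d) b ∘ (extChartAt (𝓡 d) a).symm

lemma mem_source_self (x : M) : x ∈ (extChartAt (𝓡 d) x).source := mem_extChartAt_source x

lemma source_mem_nhds {a q : M} (ha : q ∈ (extChartAt (𝓡 d) a).source) :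
    (extChartAt (𝓡 d) a).source ∈ nhds q :=
  (isOpen_extChartAt_source a).mem_nhds ha

lemma target_mem_nhds {a : M} {z : EuclideanSpace ℝ (Fin d)}
    (hz : z ∈ (extChartAt (𝓡 d) a).target) : (extChartAt (𝓡 d) a).target ∈ nhds z :=
  (isOpen_extChartAt_target a).mem_nhds hz

lemma tendsto_symm {a : M} {z : EuclideanSpace ℝ (Fin d)}
    (hz : z ∈ (extChartAt (𝓡 d) a).target) :
    Filter.Tendsto (extChartAt (𝓡 d) a).symm (nhds z) (nhds ((extChartAt (𝓡 d) a).symm z)) :=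
  continuousAt_extChartAt_symm'' hz

variable [IsManifold (𝓡 d) ∞ M]

lemma jac_eq (x₀ x : M) : jac (d := d) x₀ x = tcMatrix d x x₀ x := rfl

lemma tangentCoordChange_apply (a b q : M) (v : EuclideanSpace ℝ (Fin d)) (i : Fin d) :
    (tangentCoordChange (𝓡 d) a b q v) i = ∑ j, tcMatrix d a b q i j * v j := by
  rw [clm_apply_eq_sum]
  simp [tcMatrix, mul_comm]

lemma tcMatrix_mul {a b c q : M} (ha : q ∈ (extChartAt (𝓡 d) a).source)
    (hb : q ∈ (extChartAt (𝓡 d) b).source) (hc : q ∈ (extChartAt (𝓡 d) c).source) :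
    tcMatrix d b c q * tcMatrix d a b q = tcMatrix d a c q := by
  ext i j
  rw [Matrix.mul_apply]
  have h := tangentCoordChange_comp (I := 𝓡 d) (v := e j) ⟨⟨ha, hb⟩, hc⟩
  have h2 := tangentCoordChange_apply b c q (tangentCoordChange (𝓡 d) a b q (e j)) i
  rw [h] at h2
  exact h2.symm

lemma tcMatrix_self {a q : M} (ha : q ∈ (extChartAt (𝓡 d) a).source) : tcMatrix d a a q = 1 := by
  ext i j
  have h := tangentCoordChange_self (I := 𝓡 d) (v := e j) ha
  rw [tcMatrix, Matrix.of_apply, h]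
  simp [e, Matrix.one_apply]

lemma tcMatrix_mul_self {a b q : M} (ha : q ∈ (extChartAt (𝓡 d) a).source)
    (hb : q ∈ (extChartAt (𝓡 d) b).source) : tcMatrix d b a q * tcMatrix d a b q = 1 := by
  rw [tcMatrix_mul ha hb ha, tcMatrix_self ha]

lemma isUnit_det_tcMatrix {a b q : M} (ha : q ∈ (extChartAt (𝓡 d) a).source)
    (hb : q ∈ (extChartAt (𝓡 d) b).source) : IsUnit (tcMatrix d a b q).det :=
  (Matrix.isUnit_iff_isUnit_det _).1 (IsUnit.of_mul_eq_one _ (tcMatrix_mul_self hb ha))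

lemma inv_tcMatrix {a b q : M} (ha : q ∈ (extChartAt (𝓡 d) a).source)
    (hb : q ∈ (extChartAt (𝓡 d) b).source) : (tcMatrix d a b q)⁻¹ = tcMatrix d b a q :=
  Matrix.inv_eq_left_inv (tcMatrix_mul_self ha hb)

lemma isUnit_det_jac {x₀ x : M} (h : x ∈ (extChartAt (𝓡 d) x₀).source) :
    IsUnit (jac (d := d) x₀ x).det :=
  isUnit_det_tcMatrix (mem_source_self x) h

lemma jac_self (x : M) : jac (d := d) x x = 1 := tcMatrix_self (mem_source_self x)

lemma hasFDerivAt_transition {a b q : M} (ha : q ∈ (extChartAt (𝓡 d) a).source)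
    (hb : q ∈ (extChartAt (𝓡 d) b).source) :
    HasFDerivAt (transition d a b) (tangentCoordChange (𝓡 d) a b q) (extChartAt (𝓡 d) a q) := by
  have h := hasFDerivWithinAt_tangentCoordChange (I := 𝓡 d) ⟨ha, hb⟩
  rwa [ModelWithCorners.range_eq_univ, hasFDerivWithinAt_univ] at h

lemma contDiffAt_transition {a b q : M} (ha : q ∈ (extChartAt (𝓡 d) a).source)
    (hb : q ∈ (extChartAt (𝓡 d) b).source) :
    ContDiffAt ℝ ∞ (transition d a b) (extChartAt (𝓡 d) a q) := by
  have h := contDiffWithinAt_ext_coord_change (n := ∞) (I := 𝓡 d) b a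
    (y := extChartAt (𝓡 d) a q) (by
      rw [ext_coord_change_source]
      rw [extChartAt_source] at ha hb
      exact ⟨chartAt (EuclideanSpace ℝ (Fin d)) a q,
        ⟨(chartAt (EuclideanSpace ℝ (Fin d)) a).map_source ha, by
          change (chartAt (EuclideanSpace ℝ (Fin d)) a).symm _ ∈
            (chartAt (EuclideanSpace ℝ (Fin d)) b).source
          rwa [(chartAt (EuclideanSpace ℝ (Fin d)) a).left_inv ha]⟩, rfl⟩)
  rwa [ModelWithCorners.range_eq_univ, contDiffWithinAt_univ] at h

omit [IsManifold (𝓡 d) ∞ M] in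
lemma transition_chart {a q : M} (b : M) (ha : q ∈ (extChartAt (𝓡 d) a).source) :
    transition d a b (extChartAt (𝓡 d) a q) = extChartAt (𝓡 d) b q := by
  rw [transition, Function.comp_apply, (extChartAt (𝓡 d) a).left_inv ha]

/-! ### Vector fields in coordinates -/

/-- The components of the vector field `σ` in the coordinates of the preferred chart at `a`. -/
noncomputable def localVec (a : M) (σ : ∀ q : M, TangentSpace (𝓡 d) q) (q : M) :
    EuclideanSpace ℝ (Fin d) :=
  tangentCoordChange (𝓡 d) q a q (σ q)

lemma contMDiffAt_iff_comp_symm {F : Type*} [NormedAddCommGroup F] [NormedSpace ℝ F] {f : M → F}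
    {a p : M} (hp : p ∈ (extChartAt (𝓡 d) a).source) :
    ContMDiffAt (𝓡 d) 𝓘(ℝ, F) ∞ f p ↔
      ContDiffAt ℝ ∞ (f ∘ (extChartAt (𝓡 d) a).symm) (extChartAt (𝓡 d) a p) := by
  rw [contMDiffAt_iff_source_of_mem_source (x := a) (by rwa [extChartAt_source] at hp),
    ModelWithCorners.range_eq_univ, contMDiffWithinAt_univ, contMDiffAt_iff_contDiffAt]

lemma contMDiffAt_section_iff {σ : ∀ q : M, TangentSpace (𝓡 d) q} {a p : M}
    (hp : p ∈ (extChartAt (𝓡 d) a).source) :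
    ContMDiffAt (𝓡 d) ((𝓡 d).prod 𝓘(ℝ, EuclideanSpace ℝ (Fin d))) ∞
      (fun q => Bundle.TotalSpace.mk' (EuclideanSpace ℝ (Fin d)) q (σ q)) p ↔
    ContMDiffAt (𝓡 d) 𝓘(ℝ, EuclideanSpace ℝ (Fin d)) ∞ (localVec a σ) p := by
  -- The tangent bundle costs one order of differentiability, and `∞ + 1 = ∞`.
  have : IsManifold (𝓡 d) (∞ + 1) M := inferInstanceAs (IsManifold (𝓡 d) ∞ M)
  rw [(trivializationAt (EuclideanSpace ℝ (Fin d)) (TangentSpace (𝓡 d)) a).contMDiffAt_section_iff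
    (by rwa [TangentBundle.trivializationAt_baseSet, ← extChartAt_source (𝓡 d)])]
  rfl

lemma localVec_coordField {a : M} {q : M} (j : Fin d)
    (hq : q ∈ (extChartAt (𝓡 d) a).source) : localVec a (coordField a j) q = e j := by
  have h := tangentCoordChange_comp (I := 𝓡 d) (w := a) (x := q) (y := a) (z := q)
    (v := (e j : EuclideanSpace ℝ (Fin d)))
    ⟨⟨hq, mem_source_self q⟩, hq⟩
  exact h.trans (tangentCoordChange_self (I := 𝓡 d) hq)

lemma contMDiffAt_coordField {a p : M} (j : Fin d) (hp : p ∈ (extChartAt (𝓡 d) a).source) :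
    ContMDiffAt (𝓡 d) ((𝓡 d).prod 𝓘(ℝ, EuclideanSpace ℝ (Fin d))) ∞
      (fun q => Bundle.TotalSpace.mk' (EuclideanSpace ℝ (Fin d)) q
        (coordField a j q : TangentSpace (𝓡 d) q)) p := by
  rw [contMDiffAt_section_iff hp]
  exact (contMDiffAt_const (c := (e j : EuclideanSpace ℝ (Fin d)))).congr_of_eventuallyEq
    (Filter.eventually_of_mem (source_mem_nhds hp) fun q hq => localVec_coordField j hq)

lemma sum_localVec_smul_coordField {a q : M} (σ : ∀ q : M, TangentSpace (𝓡 d) q)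
    (hq : q ∈ (extChartAt (𝓡 d) a).source) :
    ∑ j, localVec a σ q j • (coordField a j q : TangentSpace (𝓡 d) q) = σ q := by
  have h := clm_apply_eq_sum (tangentCoordChange (𝓡 d) a q q) (localVec a σ q)
  have h2 := tangentCoordChange_comp (I := 𝓡 d) (w := q) (x := a) (y := q) (z := q)
    (v := σ q) ⟨⟨mem_source_self q, hq⟩, mem_source_self q⟩
  exact h.symm.trans (h2.trans (tangentCoordChange_self (I := 𝓡 d) (mem_source_self q)))

/-- The derivative on the manifold at `p` is taken in the preferred chart at `p`; the chain rule for
the transition map moves it to the chart at `a`. -/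
lemma mvfderiv_coordField {F : Type*} [NormedAddCommGroup F] [NormedSpace ℝ F] {f : M → F}
    {a p : M} (hf : ContMDiffAt (𝓡 d) 𝓘(ℝ, F) ∞ f p) (hp : p ∈ (extChartAt (𝓡 d) a).source)
    (i : Fin d) : mvfderiv (𝓡 d) f p (coordField a i p) =
      fderiv ℝ (f ∘ (extChartAt (𝓡 d) a).symm) (extChartAt (𝓡 d) a p) (e i) := by
  have h1 : mvfderiv (𝓡 d) f p (coordField a i p) =
      fderiv ℝ (f ∘ (extChartAt (𝓡 d) p).symm) (extChartAt (𝓡 d) p p)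
        (tangentCoordChange (𝓡 d) a p p (e i)) := by
    have := (hf.mdifferentiableAt (by simp)).mfderiv
    rw [ModelWithCorners.range_eq_univ, fderivWithin_univ] at this
    change mfderiv (𝓡 d) 𝓘(ℝ, F) f p (coordField a i p) = _
    rw [this]
    rfl
  rw [h1]
  have h2 := hasFDerivAt_transition hp (mem_source_self p)
  have h3 : DifferentiableAt ℝ (f ∘ (extChartAt (𝓡 d) p).symm)
      (transition d a p (extChartAt (𝓡 d) a p)) := by
    have := ((contMDiffAt_iff_comp_symm (mem_source_self p)).1 hf).differentiableAt (by simp)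
    rwa [transition_chart p hp]
  have h4 := h3.hasFDerivAt.comp _ h2
  have h5 : f ∘ (extChartAt (𝓡 d) a).symm =ᶠ[nhds (extChartAt (𝓡 d) a p)]
      (f ∘ (extChartAt (𝓡 d) p).symm) ∘ transition d a p := by
    have h6 := (tendsto_symm ((extChartAt (𝓡 d) a).map_source hp)).eventually
      (p := fun q => q ∈ (extChartAt (𝓡 d) p).source) (by
        rw [(extChartAt (𝓡 d) a).left_inv hp]
        exact source_mem_nhds (mem_source_self p))
    filter_upwards [h6] with w hw
    rw [transition, Function.comp_apply, Function.comp_apply, Function.comp_apply,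
      Function.comp_apply, (extChartAt (𝓡 d) p).left_inv hw]
  rw [(h4.congr_of_eventuallyEq h5).fderiv]
  rw [transition_chart p hp]
  rfl

/-! ### The covariant derivative in a coordinate frame -/

section Connection

variable (cov : CovariantDerivative (𝓡 d) (EuclideanSpace ℝ (Fin d))
  (TangentSpace (𝓡 d) : M → Type _))

lemma cov_sum {κ : Type*} (s : Finset κ) {σ : κ → ∀ q : M, TangentSpace (𝓡 d) q} {p : M}
    (hσ : ∀ k ∈ s, ContMDiffAt (𝓡 d) ((𝓡 d).prod 𝓘(ℝ, EuclideanSpace ℝ (Fin d))) ∞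
      (fun q => Bundle.TotalSpace.mk' (EuclideanSpace ℝ (Fin d)) q (σ k q)) p) :
    cov (fun q => ∑ k ∈ s, σ k q) p = ∑ k ∈ s, cov (σ k) p := by
  classical
  induction s using Finset.induction_on with
  | empty =>
    have := congrFun (CovariantDerivative.zero cov) p
    simpa only [Finset.sum_empty] using! this
  | insert k s hk ih =>
    have h1 := (ContMDiffAt.sum_section fun k hk => hσ k (Finset.mem_insert_of_mem hk))
    have h2 := cov.isCovariantDerivativeOnUniv.add
      ((hσ k (by simp)).mdifferentiableAt (by simp)) (h1.mdifferentiableAt (by simp))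
    rw [Finset.sum_insert hk, ← ih fun k hk => hσ k (Finset.mem_insert_of_mem hk), ← h2]
    congr 1
    funext q
    rw [Finset.sum_insert hk]
    rfl

/-- Near `p` the field is a combination of coordinate fields with smooth coefficients; locality,
additivity and the Leibniz rule give the formula. -/
lemma cov_eq {σ : ∀ q : M, TangentSpace (𝓡 d) q} {a p : M}
    (hp : p ∈ (extChartAt (𝓡 d) a).source)
    (hσ : ContMDiffAt (𝓡 d) ((𝓡 d).prod 𝓘(ℝ, EuclideanSpace ℝ (Fin d))) ∞
      (fun q => Bundle.TotalSpace.mk' (EuclideanSpace ℝ (Fin d)) q (σ q)) p)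
    (v : TangentSpace (𝓡 d) p) :
    cov σ p v = ∑ k, (mvfderiv (𝓡 d) (fun q => localVec a σ q k) p v •
      (coordField a k p : TangentSpace (𝓡 d) p) + localVec a σ p k • cov (coordField a k) p v) := by
  have hf : ∀ k, ContMDiffAt (𝓡 d) 𝓘(ℝ) ∞ (fun q => localVec a σ q k) p := fun k =>
    ((EuclideanSpace.proj (𝕜 := ℝ) k).contMDiff.contMDiffAt).comp p
      ((contMDiffAt_section_iff hp).1 hσ)
  have hk : ∀ k, ContMDiffAt (𝓡 d) ((𝓡 d).prod 𝓘(ℝ, EuclideanSpace ℝ (Fin d))) ∞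
      (fun q => Bundle.TotalSpace.mk' (EuclideanSpace ℝ (Fin d)) q
        (((fun q => localVec a σ q k) • (coordField a k : ∀ q, TangentSpace (𝓡 d) q)) q)) p :=
    fun k => (hf k).smul_section (contMDiffAt_coordField k hp)
  have h1 : cov σ p = cov (fun q => ∑ k, ((fun q => localVec a σ q k) •
      (coordField a k : ∀ q, TangentSpace (𝓡 d) q)) q) p :=
    cov.isCovariantDerivativeOnUniv.congr_of_eventuallyEq (hσ.mdifferentiableAt (by simp))
      ((ContMDiffAt.sum_section fun k _ => hk k).mdifferentiableAt (by simp)) Filter.univ_mem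
      (Filter.eventually_of_mem (source_mem_nhds hp) fun q hq =>
        (sum_localVec_smul_coordField σ hq).symm)
  rw [h1, cov_sum cov _ fun k _ => hk k, sum_apply]
  refine Finset.sum_congr rfl fun k _ => ?_
  rw [cov.isCovariantDerivativeOnUniv.leibniz ((contMDiffAt_coordField k hp).mdifferentiableAt
    (by simp)) ((hf k).mdifferentiableAt (by simp)), add_comm]
  rfl

end Connection

end Geometry

lemma lieBracketWithin_eq_zero_of_const {E : Type*} [NormedAddCommGroup E] [NormedSpace ℝ E]
    {V W : E → E} {v w z : E} (hV : V =ᶠ[nhds z] fun _ => v) (hW : W =ᶠ[nhds z] fun _ => w) :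
    VectorField.lieBracketWithin ℝ V W Set.univ z = 0 := by
  rw [VectorField.lieBracketWithin_eq]
  simp only [fderivWithin_univ]
  rw [hV.fderiv_eq, hW.fderiv_eq]
  simp

/-! ### Christoffel symbols, their smoothness and transformation, and the curvature tensor -/

section Christoffel

variable {M : Type*} [TopologicalSpace M] [ChartedSpace (EuclideanSpace ℝ (Fin d)) M]
  [IsManifold (𝓡 d) ∞ M]

lemma coordField_self (x : M) (i : Fin d) : coordField x i x = (e i : EuclideanSpace ℝ (Fin d)) :=
  tangentCoordChange_self (I := 𝓡 d) (mem_source_self x)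

lemma localVec_self (x : M) (σ : ∀ q : M, TangentSpace (𝓡 d) q) : localVec x σ x = σ x :=
  tangentCoordChange_self (I := 𝓡 d) (mem_source_self x)

lemma localVec_coordField_apply {a b q : M} (j k : Fin d)
    (ha : q ∈ (extChartAt (𝓡 d) a).source) (hb : q ∈ (extChartAt (𝓡 d) b).source) :
    localVec b (coordField a j) q k = tcMatrix d a b q k j := by
  have h := tangentCoordChange_comp (I := 𝓡 d) (w := a) (x := q) (y := b) (z := q)
    (v := (e j : EuclideanSpace ℝ (Fin d))) ⟨⟨ha, mem_source_self q⟩, hb⟩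
  exact congrArg (fun v : EuclideanSpace ℝ (Fin d) => v k) h

variable (cov : CovariantDerivative (𝓡 d) (EuclideanSpace ℝ (Fin d))
  (TangentSpace (𝓡 d) : M → Type _))

/-- The components of a tangent vector at `p` in the preferred chart at `p`. -/
noncomputable def tangentCoord (p : M) (k : Fin d) : TangentSpace (𝓡 d) p →ₗ[ℝ] ℝ :=
  (EuclideanSpace.proj (𝕜 := ℝ) k : EuclideanSpace ℝ (Fin d) →L[ℝ] ℝ).toLinearMap

lemma tangentCoord_coordField (p : M) (k c : Fin d) :
    tangentCoord p k (coordField p c p) = if k = c then 1 else 0 := by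
  rw [coordField_self]
  change (e c : EuclideanSpace ℝ (Fin d)) k = _
  simp [e]

lemma tangentCoord_cov (p : M) (i j k : Fin d) :
    tangentCoord p k (cov (coordField p j) p (coordField p i p)) = christoffel cov p i j k := by
  rw [coordField_self]
  rfl

/-- The vector field `∇_{∂ᵢ} ∂ⱼ` for the coordinates of the preferred chart at `a`. -/
noncomputable def covCoord (a : M) (i j : Fin d) (q : M) : TangentSpace (𝓡 d) q :=
  cov (coordField a j) q (coordField a i q)

/-- The Christoffel symbol `Γᵏᵢⱼ` at `q` in the preferred chart at `a`. -/
noncomputable def locChristoffel (a q : M) (i j k : Fin d) : ℝ :=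
  localVec a (covCoord cov a i j) q k

lemma locChristoffel_self (x : M) (i j k : Fin d) :
    locChristoffel cov x x i j k = christoffel cov x i j k := by
  rw [locChristoffel, localVec_self, christoffel, covCoord, coordField_self]

/-- Smoothness of the connection concerns globally smooth fields. A coordinate field multiplied by a
bump function is global, and it has the same covariant derivative near `p` by locality. -/
lemma contMDiffAt_covCoord [T2Space M]
    [CovariantDerivative.ContMDiffCovariantDerivative cov ∞] {a p : M}
    (hp : p ∈ (extChartAt (𝓡 d) a).source) (i j : Fin d) :
    ContMDiffAt (𝓡 d) ((𝓡 d).prod 𝓘(ℝ, EuclideanSpace ℝ (Fin d))) ∞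
      (fun q => Bundle.TotalSpace.mk' (EuclideanSpace ℝ (Fin d)) q (covCoord cov a i j q)) p := by
  obtain ⟨f, hf⟩ := (SmoothBumpFunction.nhds_basis_tsupport (I := 𝓡 d) p).mem_iff.1
    (source_mem_nhds hp)
  have hglob : ContMDiff (𝓡 d) ((𝓡 d).prod 𝓘(ℝ, EuclideanSpace ℝ (Fin d))) ∞
      (fun q => Bundle.TotalSpace.mk' (EuclideanSpace ℝ (Fin d)) q
        (((f : M → ℝ) • (coordField a j : ∀ q, TangentSpace (𝓡 d) q)) q)) :=
    ContMDiffOn.smul_section_of_tsupport f.contMDiff.contMDiffOn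
      (isOpen_extChartAt_source a) hf.2 fun q hq =>
        (contMDiffAt_coordField j hq).contMDiffWithinAt
  have h1 := (CovariantDerivative.ContMDiffCovariantDerivative.contMDiff (cov := cov)
    (k := ∞)).contMDiff (σ := (f : M → ℝ) • (coordField a j : ∀ q, TangentSpace (𝓡 d) q))
    hglob.contMDiffOn
  have h2 := (h1.contMDiffAt Filter.univ_mem).clm_bundle_apply (contMDiffAt_coordField i hp)
  refine h2.congr_of_eventuallyEq ?_
  filter_upwards [f.eventuallyEq_one.eventuallyEq_nhds, source_mem_nhds hp] with q hq hqa
  have h3 : cov (coordField a j) q =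
      cov ((f : M → ℝ) • (coordField a j : ∀ q, TangentSpace (𝓡 d) q)) q := by
    refine cov.isCovariantDerivativeOnUniv.congr_of_eventuallyEq
      ((contMDiffAt_coordField j hqa).mdifferentiableAt (by simp))
      ((hglob q).mdifferentiableAt (by simp)) Filter.univ_mem ?_
    filter_upwards [hq] with q' hq'
    simp [hq']
  rw [covCoord, h3]

lemma contDiffAt_locChristoffel [T2Space M]
    [CovariantDerivative.ContMDiffCovariantDerivative cov ∞] {a : M}
    {z : EuclideanSpace ℝ (Fin d)} (hz : z ∈ (extChartAt (𝓡 d) a).target) (i j k : Fin d) :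
    ContDiffAt ℝ ∞
      (fun w => locChristoffel cov a ((extChartAt (𝓡 d) a).symm w) i j k) z := by
  have hp := (extChartAt (𝓡 d) a).map_target hz
  have h := (EuclideanSpace.proj (𝕜 := ℝ) k).contMDiff.contMDiffAt.comp _
    ((contMDiffAt_section_iff hp).1 (contMDiffAt_covCoord cov hp i j))
  have h2 := (contMDiffAt_iff_comp_symm hp).1 h
  rwa [(extChartAt (𝓡 d) a).right_inv hz] at h2

lemma contDiffAt_tcMatrix {a b q : M} (ha : q ∈ (extChartAt (𝓡 d) a).source)
    (hb : q ∈ (extChartAt (𝓡 d) b).source) (k j : Fin d) :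
    ContDiffAt ℝ ∞ (fun w => tcMatrix d a b ((extChartAt (𝓡 d) a).symm w) k j)
      (extChartAt (𝓡 d) a q) := by
  have h := (contMDiffAt_section_iff hb).1 (contMDiffAt_coordField j ha)
  have h1 := (contMDiffAt_iff_comp_symm ha).1
    ((EuclideanSpace.proj (𝕜 := ℝ) k).contMDiff.contMDiffAt.comp _ h)
  refine h1.congr_of_eventuallyEq ?_
  have h6 := (tendsto_symm ((extChartAt (𝓡 d) a).map_source ha)).eventually
    (p := fun q => q ∈ (extChartAt (𝓡 d) a).source ∧ q ∈ (extChartAt (𝓡 d) b).source) (by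
      rw [(extChartAt (𝓡 d) a).left_inv ha]
      exact Filter.inter_mem (source_mem_nhds ha) (source_mem_nhds hb))
  filter_upwards [h6] with w hw
  exact (localVec_coordField_apply j k hw.1 hw.2).symm

/-- The classical transformation law: the coordinate fields of the chart at `a` are expanded in the
frame of the chart at `p`, and the derivative of the Jacobi matrix is the inhomogeneous term. -/
lemma locChristoffel_eq {a p : M} (hp : p ∈ (extChartAt (𝓡 d) a).source) (i j k : Fin d) :
    locChristoffel cov a p i j k = ∑ b, tcMatrix d p a p k b *
      (fderiv ℝ (fun w => tcMatrix d a p ((extChartAt (𝓡 d) a).symm w) b j)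
          (extChartAt (𝓡 d) a p) (e i) +
        ∑ i', ∑ c, tcMatrix d a p p i' i * tcMatrix d a p p c j * christoffel cov p i' c b) := by
  have hpp := mem_source_self (d := d) p
  refine (tangentCoordChange_apply p a p (covCoord cov a i j p) k).trans ?_
  refine Finset.sum_congr rfl fun b _ => ?_
  congr 1
  have hf : ∀ c, ContMDiffAt (𝓡 d) 𝓘(ℝ) ∞ (fun q => localVec p (coordField a j) q c) p :=
    fun c => (EuclideanSpace.proj (𝕜 := ℝ) c).contMDiff.contMDiffAt.comp _
      ((contMDiffAt_section_iff hpp).1 (contMDiffAt_coordField j hp))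
  have h1 : ∀ c, mvfderiv (𝓡 d) (fun q => localVec p (coordField a j) q c) p (coordField a i p) =
      fderiv ℝ (fun w => tcMatrix d a p ((extChartAt (𝓡 d) a).symm w) c j)
          (extChartAt (𝓡 d) a p) (e i) := by
    intro c
    rw [mvfderiv_coordField (hf c) hp]
    congr 1
    apply Filter.EventuallyEq.fderiv_eq
    have h6 := (tendsto_symm ((extChartAt (𝓡 d) a).map_source hp)).eventually
      (p := fun q => q ∈ (extChartAt (𝓡 d) a).source ∧ q ∈ (extChartAt (𝓡 d) p).source) (by
        rw [(extChartAt (𝓡 d) a).left_inv hp]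
        exact Filter.inter_mem (source_mem_nhds hp) (source_mem_nhds hpp))
    filter_upwards [h6] with w hw
    exact localVec_coordField_apply j c hw.1 hw.2
  have h2 : ∀ c : Fin d, cov (coordField p c) p (coordField a i p) =
      ∑ i', tcMatrix d a p p i' i • cov (coordField p c) p (coordField p i' p) := by
    intro c
    rw [← sum_localVec_smul_coordField (coordField a i) hpp, map_sum]
    refine Finset.sum_congr rfl fun i' _ => ?_
    rw [map_smul, localVec_coordField_apply i i' hp hpp]
  have h3 := congrArg (tangentCoord p b) (cov_eq cov hpp (contMDiffAt_coordField j hp)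
    (coordField a i p))
  refine (show _ = tangentCoord p b (covCoord cov a i j p) from rfl).trans (h3.trans ?_)
  simp only [h1, h2, map_sum, map_add, map_smul, tangentCoord_coordField,
    localVec_coordField_apply j _ hp hpp, smul_eq_mul, Finset.sum_add_distrib, Finset.mul_sum]
  congr 1
  · simp
  · rw [Finset.sum_comm]
    refine Finset.sum_congr rfl fun i' _ => Finset.sum_congr rfl fun c _ => ?_
    rw [tangentCoord_cov]
    ring

/-- For commuting fields vanishing torsion means `∇_{∂ᵢ} ∂ⱼ = ∇_{∂ⱼ} ∂ᵢ`. -/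
lemma christoffel_symm (htors : cov.torsion = 0) (p : M) (i j k : Fin d) :
    christoffel cov p i j k = christoffel cov p j i k := by
  have hpp := mem_source_self (d := d) p
  have h := (CovariantDerivative.torsion_eq_zero_iff cov).1 htors
    ((contMDiffAt_coordField i hpp).mdifferentiableAt (by simp))
    ((contMDiffAt_coordField j hpp).mdifferentiableAt (by simp))
  have h2 : VectorField.mlieBracket (𝓡 d) (coordField p i) (coordField p j) p = 0 := by
    -- Pulled back to the chart, coordinate fields are constant, so their bracket vanishes.
    have h3 : ∀ i : Fin d, VectorField.mpullbackWithin 𝓘(ℝ, EuclideanSpace ℝ (Fin d)) (𝓡 d)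
        (extChartAt (𝓡 d) p).symm (coordField p i) Set.univ
        =ᶠ[nhds (extChartAt (𝓡 d) p p)] fun _ => (e i : EuclideanSpace ℝ (Fin d)) := by
      intro i
      filter_upwards [target_mem_nhds ((extChartAt (𝓡 d) p).map_source hpp)] with z hz
      have hq := (extChartAt (𝓡 d) p).map_target hz
      have h4 := mfderiv_extChartAt_comp_mfderivWithin_extChartAt_symm hz
      have h5 := mfderivWithin_extChartAt_symm_comp_mfderiv_extChartAt hz
      rw [ModelWithCorners.range_eq_univ] at h4 h5
      rw [VectorField.mpullbackWithin_apply, ContinuousLinearMap.inverse_eq h5 h4]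
      have h6 := mfderiv_chartAt_eq_tangentCoordChange (I := 𝓡 d) (x := (extChartAt (𝓡 d) p).symm z)
        (y := p) (by rwa [extChartAt_source] at hq)
      have h7 := localVec_coordField i hq
      rw [← h7, localVec, ← h6]
      rfl
    rw [VectorField.mlieBracket, VectorField.mlieBracketWithin_apply]
    simp only [ModelWithCorners.range_eq_univ, Set.preimage_univ, Set.inter_univ]
    exact (congrArg _ (lieBracketWithin_eq_zero_of_const (h3 i) (h3 j))).trans (map_zero _)
  rw [h2, sub_eq_zero] at h
  have := congrArg (tangentCoord p k) h
  rwa [tangentCoord_cov, tangentCoord_cov] at this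

/-- The first covariant derivative of a coordinate field has the Christoffel symbols as components;
`cov_eq` applied to it yields the derivatives and products of these symbols. -/
lemma riemann_eq [T2Space M] [CovariantDerivative.ContMDiffCovariantDerivative cov ∞]
    (p : M) (i j k l : Fin d) : riemann cov p i j k l =
      fderiv ℝ (fun w => locChristoffel cov p ((extChartAt (𝓡 d) p).symm w) j l k)
          (extChartAt (𝓡 d) p p) (e i) -
        fderiv ℝ (fun w => locChristoffel cov p ((extChartAt (𝓡 d) p).symm w) i l k)
          (extChartAt (𝓡 d) p p) (e j) +
      ∑ c, (christoffel cov p j l c * christoffel cov p i c k -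
        christoffel cov p i l c * christoffel cov p j c k) := by
  have hpp := mem_source_self (d := d) p
  have key : ∀ i j, tangentCoord p k (cov (covCoord cov p j l) p (coordField p i p)) =
      fderiv ℝ (fun w => locChristoffel cov p ((extChartAt (𝓡 d) p).symm w) j l k)
          (extChartAt (𝓡 d) p p) (e i) +
        ∑ c, christoffel cov p j l c * christoffel cov p i c k := by
    intro i j
    have hs := contMDiffAt_covCoord cov hpp j l
    have hf : ∀ c, ContMDiffAt (𝓡 d) 𝓘(ℝ) ∞ (fun q => localVec p (covCoord cov p j l) q c) p :=
      fun c => (EuclideanSpace.proj (𝕜 := ℝ) c).contMDiff.contMDiffAt.comp _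
        ((contMDiffAt_section_iff hpp).1 hs)
    rw [cov_eq cov hpp hs]
    simp only [map_sum, map_add, map_smul, tangentCoord_coordField, mvfderiv_coordField (hf _) hpp,
      tangentCoord_cov, smul_eq_mul, Finset.sum_add_distrib]
    congr 1
    · simp
      rfl
    · refine Finset.sum_congr rfl fun c _ => ?_
      congr 1
      exact locChristoffel_self cov p j l c
  have h : riemann cov p i j k l = tangentCoord p k (cov (covCoord cov p j l) p (coordField p i p)) -
      tangentCoord p k (cov (covCoord cov p i l) p (coordField p j p)) := by
    rw [coordField_self, coordField_self]
    rfl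
  rw [h, key, key, Finset.sum_sub_distrib]
  ring

end Christoffel

/-! ### Antisymmetric components -/

section Antisymmetric

variable {X : Type*} [AddCommGroup X] [Module ℝ X] {q : ℕ}

lemma zsmul_sign_eq (π : Equiv.Perm (Fin q)) (x : X) :
    (Equiv.Perm.sign π : ℤ) • x = ((Equiv.Perm.sign π : ℤ) : ℝ) • x := by
  rw [Int.cast_smul_eq_zsmul]

/-- The multilinear map with given components. -/
noncomputable def toMultilinear (c : (Fin q → Fin d) → X) :
    MultilinearMap ℝ (fun _ : Fin q => Fin d → ℝ) X :=
  ∑ L : Fin q → Fin d, ((MultilinearMap.mkPiAlgebra ℝ (Fin q) ℝ).compLinearMap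
    fun s => LinearMap.proj (L s)).smulRight (c L)

lemma toMultilinear_apply (c : (Fin q → Fin d) → X) (v : Fin q → Fin d → ℝ) :
    toMultilinear c v = ∑ L : Fin q → Fin d, (∏ s, v s (L s)) • c L := by
  simp [toMultilinear]

/-- The alternating map with given antisymmetric components. -/
noncomputable def toAlternating (c : (Fin q → Fin d) → X) (hc : IsAntisymm c) :
    (Fin d → ℝ) [⋀^Fin q]→ₗ[ℝ] X where
  toMultilinearMap := toMultilinear c
  map_eq_zero_of_eq' v i j hv hij := by
    change toMultilinear c v = 0
    -- Exchanging the indices at `i` and `j` keeps the product of the entries, since `v i = v j`,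
    -- but changes the sign of the component.
    have h : toMultilinear c v = -toMultilinear c v := by
      rw [toMultilinear_apply, ← Finset.sum_neg_distrib]
      refine Fintype.sum_equiv ((Equiv.swap i j).arrowCongr (Equiv.refl _)) _ _ fun L => ?_
      have h1 : c (L ∘ Equiv.swap i j) = -c L := by
        rw [hc, Equiv.Perm.sign_swap hij]
        simp
      have h2 : (Equiv.swap i j).arrowCongr (Equiv.refl _) L = L ∘ Equiv.swap i j := by
        funext s
        simp [Equiv.arrowCongr]
      rw [h2, h1, smul_neg, neg_neg]
      congr 1
      refine Fintype.prod_equiv (Equiv.swap i j) _ _ fun s => ?_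
      rw [Function.comp_apply, Equiv.swap_apply_self]
      rcases eq_or_ne s i with rfl | hi
      · rw [Equiv.swap_apply_left, hv]
      rcases eq_or_ne s j with rfl | hj
      · rw [Equiv.swap_apply_right, hv]
      rw [Equiv.swap_apply_of_ne_of_ne hi hj]
    have h3 : (2 : ℝ) • toMultilinear c v = 0 := by
      rw [two_smul]
      nth_rewrite 2 [h]
      exact add_neg_cancel _
    exact (smul_eq_zero.1 h3).resolve_left two_ne_zero

lemma toAlternating_single {c : (Fin q → Fin d) → X} (hc : IsAntisymm c) (L : Fin q → Fin d) :
    toAlternating c hc (fun s => Pi.single (L s) 1) = c L := by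
  change toMultilinear c _ = _
  rw [toMultilinear_apply, Finset.sum_eq_single L]
  · simp
  · intro L' _ hL
    obtain ⟨s, hs⟩ := Function.ne_iff.1 hL
    rw [Finset.prod_eq_zero (Finset.mem_univ s), zero_smul]
    rw [Pi.single_eq_of_ne hs]
  · simp

lemma IsAntisymm.insertNth {c : (Fin (q + 1) → Fin d) → X} (hc : IsAntisymm c) (p : Fin (q + 1))
    (i : Fin d) (L : Fin q → Fin d) :
    c (p.insertNth i L) = ((-1 : ℝ) ^ (p : ℕ)) • c (Fin.cons i L) := by
  have h := hc p.cycleRange (Fin.cons i L)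
  rw [Fin.cons_comp_cycleRange, zsmul_sign_eq] at h
  rw [h]
  simp

lemma IsAntisymm.cons_removeNth {c : (Fin (q + 1) → Fin d) → X} (hc : IsAntisymm c)
    (p : Fin (q + 1)) (L : Fin (q + 1) → Fin d) :
    ((-1 : ℝ) ^ (p : ℕ)) • c (Fin.cons (L p) (p.removeNth L)) = c L := by
  rw [← hc.insertNth, Fin.insertNth_self_removeNth]

lemma IsAntisymm.cons {c : (Fin (q + 1) → Fin d) → X} (hc : IsAntisymm c) (i : Fin d) :
    IsAntisymm fun L => c (Fin.cons i L) := by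
  intro π L
  have h := hc (Equiv.Perm.decomposeFin.symm (0, π)) (Fin.cons i L)
  have h2 : (Fin.cons i L : Fin (q + 1) → Fin d) ∘ Equiv.Perm.decomposeFin.symm (0, π) =
      Fin.cons i (L ∘ π) := by
    funext s
    refine Fin.cases ?_ (fun s => ?_) s <;> simp
  rw [h2] at h
  simpa using h

lemma IsAntisymm.map {Y : Type*} [AddCommGroup Y] [Module ℝ Y] {c : (Fin q → Fin d) → X}
    (hc : IsAntisymm c) {T : X → Y} (hT : ∀ (r : ℝ) L, T (r • c L) = r • T (c L)) :
    IsAntisymm fun L => T (c L) := fun π L => by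
  simp only [hc π L, zsmul_sign_eq, hT]

lemma IsAntisymm.const_smul {c : (Fin q → Fin d) → X} (r : ℝ) (hc : IsAntisymm c) :
    IsAntisymm fun L => r • c L :=
  hc.map fun r' L => smul_comm r r' (c L)

lemma isAntisymm_sum {κ : Type*} (s : Finset κ) {c : κ → (Fin q → Fin d) → X}
    (hc : ∀ k ∈ s, IsAntisymm (c k)) : IsAntisymm fun L => ∑ k ∈ s, c k L := fun π L => by
  simp only [zsmul_sign_eq, Finset.smul_sum]
  exact Finset.sum_congr rfl fun k hk => by rw [hc k hk π L, zsmul_sign_eq]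

lemma isAntisymm_fin_zero (c : (Fin 0 → Fin d) → X) : IsAntisymm c := fun π L => by
  rw [Subsingleton.elim π 1, Subsingleton.elim (L ∘ _) L]
  simp

lemma isAntisymm_fin_one (c : (Fin 1 → Fin d) → X) : IsAntisymm c := fun π L => by
  rw [Subsingleton.elim π 1]
  simp

/-! ### The operator `dyMul` -/

/-- Up to its normalization `dyMul` is the alternatization of Mathlib, whose antisymmetry and
vanishing on symmetric second order data can then be used. -/
lemma dyMul_eq_alternatizeUncurryFin (c : Fin d → (Fin q → Fin d) → X)
    (hc : ∀ i, IsAntisymm (c i)) (L : Fin (q + 1) → Fin d) : dyMul c L = ((q + 1 : ℕ) : ℝ)⁻¹ •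
      AlternatingMap.alternatizeUncurryFin
        (∑ i, (LinearMap.proj i : (Fin d → ℝ) →ₗ[ℝ] ℝ).smulRight (toAlternating (c i) (hc i)))
        (fun s => Pi.single (L s) 1) := by
  rw [dyMul, AlternatingMap.alternatizeUncurryFin_apply]
  congr 1
  refine Finset.sum_congr rfl fun s _ => ?_
  have h := toAlternating_single (hc (L s)) (s.removeNth L)
  rw [← h, ← Int.cast_smul_eq_zsmul ℝ]
  simp [Pi.single_apply]
  rfl

lemma IsAntisymm.dyMul {c : Fin d → (Fin q → Fin d) → X} (hc : ∀ i, IsAntisymm (c i)) :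
    IsAntisymm (dyMul c) := by
  intro π L
  rw [dyMul_eq_alternatizeUncurryFin c hc, dyMul_eq_alternatizeUncurryFin c hc,
    zsmul_sign_eq, smul_comm]
  congr 1
  have h := AlternatingMap.map_perm (AlternatingMap.alternatizeUncurryFin
    (∑ i, (LinearMap.proj i : (Fin d → ℝ) →ₗ[ℝ] ℝ).smulRight (toAlternating (c i) (hc i))))
    (fun s => (Pi.single (L s) 1 : Fin d → ℝ)) π
  rw [Int.cast_smul_eq_zsmul, ← Units.smul_def, ← h]
  rfl

/-- `dyⁱ dyʲ` is antisymmetric, so symmetric coefficients contribute nothing. This disposes of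
second derivatives, both in the square of a covariant derivative and in changes of charts. -/
lemma dyMul_dyMul_eq_zero {c : Fin d → Fin d → (Fin q → Fin d) → X}
    (hc : ∀ i j, IsAntisymm (c i j)) (hs : ∀ i j, c i j = c j i) :
    Fedosov.dyMul (fun i => Fedosov.dyMul (c i)) = 0 := by
  funext L
  let f : (Fin d → ℝ) →ₗ[ℝ] (Fin d → ℝ) →ₗ[ℝ] (Fin d → ℝ) [⋀^Fin q]→ₗ[ℝ] X :=
    ∑ i, (LinearMap.proj i : (Fin d → ℝ) →ₗ[ℝ] ℝ).smulRight
      (∑ j, (LinearMap.proj j : (Fin d → ℝ) →ₗ[ℝ] ℝ).smulRight (toAlternating (c i j) (hc i j)))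
  have hf : ∀ x y, f x y = f y x := by
    intro x y
    simp only [f, LinearMap.sum_apply, LinearMap.smulRight_apply, LinearMap.smul_apply,
      Finset.smul_sum, LinearMap.proj_apply]
    rw [Finset.sum_comm]
    refine Finset.sum_congr rfl fun j _ => Finset.sum_congr rfl fun i _ => ?_
    rw [smul_comm]
    simp only [hs i j]
  have h0 := AlternatingMap.alternatizeUncurryFin_alternatizeUncurryFinLM_comp_of_symmetric hf
  have h1 := DFunLike.congr_fun h0 (fun s => (Pi.single (L s) 1 : Fin d → ℝ))
  rw [AlternatingMap.alternatizeUncurryFin_apply] at h1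
  rw [Fedosov.dyMul, Pi.zero_apply]
  refine smul_eq_zero.2 (Or.inr ?_)
  have h2 : ∀ s : Fin (q + 2), ((-1 : ℝ) ^ (s : ℕ)) • Fedosov.dyMul (c (L s)) (s.removeNth L) =
      ((q + 1 : ℕ) : ℝ)⁻¹ • ((-1 : ℤ) ^ (s : ℕ) •
        ((AlternatingMap.alternatizeUncurryFinLM ∘ₗ f)
          ((fun s => (Pi.single (L s) 1 : Fin d → ℝ)) s))
            (s.removeNth fun s => (Pi.single (L s) 1 : Fin d → ℝ))) := by
    intro s
    have h3 : f (Pi.single (L s) 1) = ∑ j, (LinearMap.proj j : (Fin d → ℝ) →ₗ[ℝ] ℝ).smulRight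
        (toAlternating (c (L s) j) (hc (L s) j)) := by
      simp [f, Pi.single_apply]
    rw [dyMul_eq_alternatizeUncurryFin _ (hc (L s)), smul_comm, ← Int.cast_smul_eq_zsmul ℝ,
      LinearMap.comp_apply, h3, AlternatingMap.alternatizeUncurryFinLM_apply]
    simp only [Int.reduceNeg, Int.cast_pow, Int.cast_neg, Int.cast_one]
    rfl
  simp only [h2, ← Finset.smul_sum, h1]
  simp

lemma dyMul_add (c c' : Fin d → (Fin q → Fin d) → X) :
    Fedosov.dyMul (fun i L => c i L + c' i L) = Fedosov.dyMul c + Fedosov.dyMul c' := by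
  funext L
  simp only [Fedosov.dyMul, Pi.add_apply, smul_add, Finset.sum_add_distrib]

lemma dyMul_sub (c c' : Fin d → (Fin q → Fin d) → X) :
    Fedosov.dyMul (fun i L => c i L - c' i L) = Fedosov.dyMul c - Fedosov.dyMul c' := by
  funext L
  simp only [Fedosov.dyMul, Pi.sub_apply, smul_sub, Finset.sum_sub_distrib]

lemma dyMul_smul (r : ℝ) (c : Fin d → (Fin q → Fin d) → X) :
    Fedosov.dyMul (fun i L => r • c i L) = r • Fedosov.dyMul c := by
  funext L
  simp only [Fedosov.dyMul, Pi.smul_apply, Finset.smul_sum]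
  exact Finset.sum_congr rfl fun s _ => by rw [smul_comm r, smul_comm r]

/-! ### Linear changes of the form indices -/

/-- The transformation of the components of a form under a linear change of coordinates with
inverse matrix `h`. -/
def idxAct (h : Matrix (Fin d) (Fin d) ℝ) (c : (Fin q → Fin d) → X) : (Fin q → Fin d) → X :=
  fun L => ∑ L' : Fin q → Fin d, (∏ s, h (L' s) (L s)) • c L'

lemma idxAct_one (c : (Fin q → Fin d) → X) : idxAct 1 c = c := by
  funext L
  rw [idxAct, Finset.sum_eq_single L]
  · simp
  · intro L' _ hL
    obtain ⟨s, hs⟩ := Function.ne_iff.1 hL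
    rw [Finset.prod_eq_zero (Finset.mem_univ s), zero_smul]
    rw [Matrix.one_apply_ne hs]
  · simp

lemma idxAct_idxAct (h k : Matrix (Fin d) (Fin d) ℝ) (c : (Fin q → Fin d) → X) :
    idxAct h (idxAct k c) = idxAct (k * h) c := by
  funext L
  simp only [idxAct, Finset.smul_sum, smul_smul, Matrix.mul_apply, Finset.prod_univ_sum,
    Finset.sum_smul, ← Finset.prod_mul_distrib]
  rw [Finset.sum_comm]
  refine Finset.sum_congr rfl fun L' _ => ?_
  rw [Fintype.piFinset_univ]
  refine Finset.sum_congr rfl fun L'' _ => ?_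
  simp only [mul_comm]

lemma IsAntisymm.idxAct {c : (Fin q → Fin d) → X} (hc : IsAntisymm c)
    (h : Matrix (Fin d) (Fin d) ℝ) : IsAntisymm (idxAct h c) := by
  intro π L
  simp only [Fedosov.idxAct, zsmul_sign_eq, Finset.smul_sum]
  refine (Fintype.sum_equiv (π.arrowCongr (Equiv.refl _)) _ _ fun L' => ?_)
  have h1 : π.arrowCongr (Equiv.refl _) L' = L' ∘ π.symm := rfl
  have h2 := hc π (L' ∘ π.symm)
  rw [Function.comp_assoc, Equiv.symm_comp_self, Function.comp_id, zsmul_sign_eq] at h2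
  rw [h1, h2, smul_comm]
  congr 2
  refine Fintype.prod_equiv π _ _ fun s => ?_
  simp

lemma idxAct_dyMul (h : Matrix (Fin d) (Fin d) ℝ) (c : Fin d → (Fin q → Fin d) → X) :
    idxAct h (Fedosov.dyMul c) =
      Fedosov.dyMul fun i => ∑ i', h i' i • idxAct h (c i') := by
  funext L
  simp only [idxAct, Fedosov.dyMul, Finset.smul_sum, Finset.sum_apply, Pi.smul_apply]
  rw [Finset.sum_comm]
  refine Finset.sum_congr rfl fun s _ => ?_
  rw [← Fintype.sum_prod_type']
  refine Fintype.sum_equiv (Fin.insertNthEquiv (fun _ => Fin d) s).symm _ _ fun L' => ?_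
  rw [Fin.prod_univ_succAbove _ s]
  simp only [Fin.insertNthEquiv_symm_apply, Fin.removeNth_apply]
  module

end Antisymmetric

/-- The Kronecker symbols leave only the tuples that agree with `L` away from `s`. -/
lemma sum_prod_erase_smul {q : ℕ} {X : Type*} [AddCommGroup X] [Module ℝ X] (s : Fin q)
    (L : Fin q → Fin d) (F : Fin d → ℝ) (G : (Fin q → Fin d) → X) :
    ∑ L' : Fin q → Fin d, ((∏ t ∈ Finset.univ.erase s, if L' t = L t then (1 : ℝ) else 0) *
      F (L' s)) • G L' = ∑ l, F l • G (Function.update L s l) := by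
  symm
  refine Fintype.sum_of_injective (fun l => Function.update L s l) (Function.update_injective L s)
    _ _ (fun L' hL' => ?_) fun l => ?_
  · have h : ∃ t, t ≠ s ∧ L' t ≠ L t := by
      by_contra! h
      refine hL' ⟨L' s, ?_⟩
      funext t
      rcases eq_or_ne t s with rfl | ht
      · simp
      · simp [ht, h t ht]
    obtain ⟨t, ht, h⟩ := h
    rw [Finset.prod_eq_zero (Finset.mem_erase.2 ⟨ht, Finset.mem_univ t⟩) (by simp [h]), zero_mul,
      zero_smul]
  · rw [Finset.prod_eq_one fun t ht => by simp [(Finset.mem_erase.1 ht).1]]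
    simp

/-! ### The transformation of forms with values in a fiber -/

section FormAct

variable {B : FormalFiber d} {S : Finset B.ι} {q : ℕ}

/-- The transformation of the components of a form with values in `B` under the linear change of
coordinates with matrix `g`. -/
noncomputable def formAct (g : Matrix (Fin d) (Fin d) ℝ) (a : (Fin q → Fin d) → B.ι → FPS d) :
    (Fin q → Fin d) → B.ι → FPS d :=
  idxAct g⁻¹ fun L => B.act g (a L)

lemma inChart_eq {M : Type*} [TopologicalSpace M] [ChartedSpace (EuclideanSpace ℝ (Fin d)) M]
    [IsManifold (𝓡 d) ∞ M] (x₀ : M) (a : RawForm M B q) (x : M) :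
    inChart x₀ a x = formAct (jac x₀ x) (a x) := by
  funext L n
  simp [formAct, idxAct, inChart, Finset.sum_apply]

lemma isUnit_det_inv {g : Matrix (Fin d) (Fin d) ℝ} (hg : IsUnit g.det) : IsUnit g⁻¹.det := by
  rw [Matrix.det_nonsing_inv]
  exact IsUnit.ringInverse hg

lemma isUnit_det_mul {g h : Matrix (Fin d) (Fin d) ℝ} (hg : IsUnit g.det) (hh : IsUnit h.det) :
    IsUnit (g * h).det := by
  rw [Matrix.det_mul]
  exact hg.mul hh

lemma SuppIn.idxAct (h : Matrix (Fin d) (Fin d) ℝ) {c : (Fin q → Fin d) → B.ι → FPS d}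
    (hc : ∀ L, SuppIn S (c L)) (L : Fin q → Fin d) : SuppIn S (idxAct h c L) :=
  SuppIn.sum fun L' _ => (hc L').real_smul _

lemma SuppIn.dyMul {c : Fin d → (Fin q → Fin d) → B.ι → FPS d}
    (hc : ∀ i L, SuppIn S (c i L)) (L : Fin (q + 1) → Fin d) : SuppIn S (dyMul c L) :=
  (SuppIn.sum fun _ _ => (hc _ _).real_smul _).real_smul _

variable (LB : FiberLaws B S)
include LB

lemma act_idxAct {g : Matrix (Fin d) (Fin d) ℝ} (hg : IsUnit g.det) (h : Matrix (Fin d) (Fin d) ℝ)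
    {c : (Fin q → Fin d) → B.ι → FPS d} (hc : ∀ L, SuppIn S (c L)) (L : Fin q → Fin d) :
    B.act g (idxAct h c L) = idxAct h (fun L => B.act g (c L)) L := by
  rw [idxAct, LB.act_sum hg _ fun L' _ => (hc L').real_smul _]
  exact Finset.sum_congr rfl fun L' _ => LB.act_real_smul hg _ (hc L')

lemma lie_idxAct (v : Fin d → FPS d) (h : Matrix (Fin d) (Fin d) ℝ)
    {c : (Fin q → Fin d) → B.ι → FPS d} (hc : ∀ L, SuppIn S (c L)) (L : Fin q → Fin d) :
    B.lie v (idxAct h c L) = idxAct h (fun L => B.lie v (c L)) L := by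
  rw [idxAct, LB.lie_sum _ _ fun L' _ => (hc L').real_smul _]
  exact Finset.sum_congr rfl fun L' _ => LB.lie_real_smul _ _ (hc L')

lemma lie_dyMul (v : Fin d → FPS d) {c : Fin d → (Fin q → Fin d) → B.ι → FPS d}
    (hc : ∀ i L, SuppIn S (c i L)) (L : Fin (q + 1) → Fin d) :
    B.lie v (dyMul c L) = dyMul (fun i L => B.lie v (c i L)) L := by
  rw [dyMul, LB.lie_real_smul _ _ (SuppIn.sum fun s _ => (hc _ _).real_smul _),
    LB.lie_sum _ _ fun s _ => (hc _ _).real_smul _, dyMul]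
  congr 1
  exact Finset.sum_congr rfl fun s _ => LB.lie_real_smul _ _ (hc _ _)

lemma act_dyMul {g : Matrix (Fin d) (Fin d) ℝ} (hg : IsUnit g.det)
    {c : Fin d → (Fin q → Fin d) → B.ι → FPS d}
    (hc : ∀ i L, SuppIn S (c i L)) (L : Fin (q + 1) → Fin d) :
    B.act g (dyMul c L) = dyMul (fun i L => B.act g (c i L)) L := by
  rw [dyMul, LB.act_real_smul hg _ (SuppIn.sum fun s _ => (hc _ _).real_smul _),
    LB.act_sum hg _ fun s _ => (hc _ _).real_smul _, dyMul]
  congr 1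
  exact Finset.sum_congr rfl fun s _ => LB.act_real_smul hg _ (hc _ _)

lemma formAct_supp {g : Matrix (Fin d) (Fin d) ℝ} (hg : IsUnit g.det)
    {a : (Fin q → Fin d) → B.ι → FPS d} (ha : ∀ L, SuppIn S (a L)) (L : Fin q → Fin d) :
    SuppIn S (formAct g a L) :=
  SuppIn.idxAct _ (fun L' => LB.act_supp hg (ha L')) L

lemma formAct_one {a : (Fin q → Fin d) → B.ι → FPS d} (ha : ∀ L, SuppIn S (a L)) :
    formAct 1 a = a := by
  rw [formAct, inv_one, idxAct_one]
  funext L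
  rw [LB.act_one (ha L)]

lemma formAct_mul {g h : Matrix (Fin d) (Fin d) ℝ} (hg : IsUnit g.det) (hh : IsUnit h.det)
    {a : (Fin q → Fin d) → B.ι → FPS d} (ha : ∀ L, SuppIn S (a L)) :
    formAct (g * h) a = formAct g (formAct h a) := by
  have h1 : (fun L => B.act g (formAct h a L)) = idxAct h⁻¹ fun L => B.act g (B.act h (a L)) :=
    funext fun L => act_idxAct LB hg _ (fun L => LB.act_supp hh (ha L)) L
  rw [formAct, formAct, h1, idxAct_idxAct, Matrix.mul_inv_rev]
  congr 1
  funext L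
  rw [LB.act_mul hg hh (ha L)]

lemma formAct_add {g : Matrix (Fin d) (Fin d) ℝ} (hg : IsUnit g.det)
    {a b : (Fin q → Fin d) → B.ι → FPS d} (ha : ∀ L, SuppIn S (a L)) (hb : ∀ L, SuppIn S (b L)) :
    formAct g (a + b) = formAct g a + formAct g b := by
  funext L
  simp only [formAct, idxAct, Pi.add_apply]
  rw [← Finset.sum_add_distrib]
  exact Finset.sum_congr rfl fun L' _ => by rw [LB.act_add hg (ha L') (hb L'), smul_add]

lemma formAct_smul {g : Matrix (Fin d) (Fin d) ℝ} (hg : IsUnit g.det) (r : ℝ)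
    {a : (Fin q → Fin d) → B.ι → FPS d} (ha : ∀ L, SuppIn S (a L)) :
    formAct g (r • a) = r • formAct g a := by
  funext L
  simp only [formAct, idxAct, Pi.smul_apply, Finset.smul_sum]
  exact Finset.sum_congr rfl fun L' _ => by rw [LB.act_real_smul hg _ (ha L'), smul_comm]

lemma formAct_antisymm {g : Matrix (Fin d) (Fin d) ℝ} (hg : IsUnit g.det)
    {a : (Fin q → Fin d) → B.ι → FPS d} (ha : ∀ L, SuppIn S (a L)) (has : IsAntisymm a) :
    IsAntisymm (formAct g a) :=
  IsAntisymm.idxAct (has.map fun r L => LB.act_real_smul hg r (ha L)) _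

lemma formAct_dyMul {g : Matrix (Fin d) (Fin d) ℝ} (hg : IsUnit g.det)
    {c : Fin d → (Fin q → Fin d) → B.ι → FPS d} (hc : ∀ i L, SuppIn S (c i L)) :
    formAct g (dyMul c) = dyMul fun i => ∑ i', g⁻¹ i' i • formAct g (c i') := by
  have h1 : (fun L => B.act g (dyMul c L)) = dyMul fun i L => B.act g (c i L) :=
    funext fun L => act_dyMul LB hg hc L
  rw [formAct, h1, idxAct_dyMul]
  rfl

lemma formAct_lie {g : Matrix (Fin d) (Fin d) ℝ} (hg : IsUnit g.det) (v : Fin d → FPS d)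
    {a : (Fin q → Fin d) → B.ι → FPS d} (ha : ∀ L, SuppIn S (a L)) :
    formAct g (fun L => B.lie v (a L)) = fun L => B.lie (push g v) (formAct g a L) := by
  funext L
  rw [formAct, formAct, lie_idxAct LB _ _ fun L => LB.act_supp hg (ha L)]
  congr 1
  funext L'
  rw [LB.act_lie hg (ha L')]

/-- The action of a one-form with values in vector fields is equivariant. -/
lemma formAct_dyMul_lie {g : Matrix (Fin d) (Fin d) ℝ} (hg : IsUnit g.det)
    (v : Fin d → Fin d → FPS d)
    {a : (Fin q → Fin d) → B.ι → FPS d} (ha : ∀ L, SuppIn S (a L)) :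
    formAct g (dyMul fun i L => B.lie (v i) (a L)) =
      dyMul fun i L => B.lie (∑ i', g⁻¹ i' i • push g (v i')) (formAct g a L) := by
  rw [formAct_dyMul LB hg fun i L => LB.lie_supp (ha L)]
  congr 1
  funext i L
  rw [LB.lie_sum_left _ _ (formAct_supp LB hg ha L), Finset.sum_apply]
  refine Finset.sum_congr rfl fun i' _ => ?_
  rw [formAct_lie LB hg _ ha, LB.lie_smul_left _ (formAct_supp LB hg ha L)]
  rfl

lemma formAct_smoothAt {g : EuclideanSpace ℝ (Fin d) → Matrix (Fin d) (Fin d) ℝ}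
    {a : EuclideanSpace ℝ (Fin d) → (Fin q → Fin d) → B.ι → FPS d} {z : EuclideanSpace ℝ (Fin d)}
    (hg : ∀ i j, ContDiffAt ℝ ∞ (fun t => g t i j) z)
    (hdet : ∀ᶠ t in nhds z, IsUnit (g t).det)
    (hS : ∀ᶠ t in nhds z, ∀ L, SuppIn S (a t L)) (ha : ∀ L n, SmoothAt (fun t => a t L n) z)
    (L : Fin q → Fin d) (n : B.ι) : SmoothAt (fun t => formAct (g t) (a t) L n) z := by
  have h : ∀ t, formAct (g t) (a t) L n =
      ∑ L' : Fin q → Fin d, (∏ s, (g t)⁻¹ (L' s) (L s)) • B.act (g t) (a t L') n := fun t => by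
    simp [formAct, idxAct, Finset.sum_apply]
  simp only [h]
  refine SmoothAt.sum fun L' _ => SmoothAt.smul ?_
    (LB.act_smoothAt hg hdet (hS.mono fun t ht => ht L') (ha L') n)
  exact contDiffAt_prod fun s _ => contDiffAt_inv hg hdet.self_of_nhds _ _

lemma formAct_hasDer_left {g : Matrix (Fin d) (Fin d) ℝ} (hg : IsUnit g.det)
    {a : ℝ → (Fin q → Fin d) → B.ι → FPS d} {a' : (Fin q → Fin d) → B.ι → FPS d}
    (hS : ∀ᶠ t in nhds 0, ∀ L, SuppIn S (a t L)) (hS' : ∀ L, SuppIn S (a' L))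
    (ha : ∀ L n, HasDer (fun t => a t L n) (a' L n)) (L : Fin q → Fin d) (n : B.ι) :
    HasDer (fun t => formAct g (a t) L n) (formAct g a' L n) := by
  have h : ∀ a : (Fin q → Fin d) → B.ι → FPS d, formAct g a L n =
      ∑ L' : Fin q → Fin d, (∏ s, g⁻¹ (L' s) (L s)) • B.act g (a L') n := fun a => by
    simp [formAct, idxAct, Finset.sum_apply]
  simp only [h]
  exact HasDer.sum fun L' _ => (LB.act_hasDer_left hg (hS.mono fun t ht => ht L') (hS' L')
    (ha L') n).const_smul _

/-- Two contributions: the fiber yields the action of the linear field of `-g'`, and each form index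
yields `-g'` in its slot. The second contribution has no counterpart in the definition of `∇` and
must disappear by antisymmetrization. -/
lemma formAct_hasDer {g : ℝ → Matrix (Fin d) (Fin d) ℝ} {g' : Matrix (Fin d) (Fin d) ℝ}
    {a : ℝ → (Fin q → Fin d) → B.ι → FPS d} {a' : (Fin q → Fin d) → B.ι → FPS d} (h0 : g 0 = 1)
    (hg : ∀ i j, HasDerivAt (fun t => g t i j) (g' i j) 0)
    (hdet : ∀ᶠ t in nhds 0, IsUnit (g t).det)
    (hS : ∀ᶠ t in nhds 0, ∀ L, SuppIn S (a t L)) (hS' : ∀ L, SuppIn S (a' L))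
    (ha : ∀ L n, HasDer (fun t => a t L n) (a' L n)) (L : Fin q → Fin d) (n : B.ι) :
    HasDer (fun t => formAct (g t) (a t) L n)
      (a' L n + B.lie (linVec (-g')) (a 0 L) n -
        ∑ s, ∑ l, g' l (L s) • a 0 (Function.update L s l) n) := by
  have h : ∀ t, formAct (g t) (a t) L n =
      ∑ L' : Fin q → Fin d, (∏ s, (g t)⁻¹ (L' s) (L s)) • B.act (g t) (a t L') n := fun t => by
    simp [formAct, idxAct, Finset.sum_apply]
  simp only [h]
  have hp : ∀ L' : Fin q → Fin d, HasDerivAt (fun t => ∏ s, (g t)⁻¹ (L' s) (L s))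
      (∑ s, (∏ t ∈ Finset.univ.erase s, if L' t = L t then (1 : ℝ) else 0) * -g' (L' s) (L s)) 0 := by
    intro L'
    have h1 := HasDerivAt.fun_finsetProd (u := Finset.univ) (x := (0 : ℝ))
      fun s _ => hasDerivAt_inv_matrix h0 hg (L' s) (L s)
    refine h1.congr_deriv (Finset.sum_congr rfl fun s _ => ?_)
    rw [h0, inv_one, smul_eq_mul]
    rfl
  have h1 := HasDer.sum (s := Finset.univ) fun L' _ => HasDer.smul (hp L')
    (LB.act_hasDer h0 hg hdet (hS.mono fun t ht => ht L') (hS' L') (ha L') n)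
  refine h1.of_eq (fun _ => rfl) ?_
  rw [Finset.sum_add_distrib, h0, inv_one]
  have hS0 : ∀ L, SuppIn S (a 0 L) := hS.self_of_nhds
  have h2 : ∑ L' : Fin q → Fin d, (∏ s, (1 : Matrix (Fin d) (Fin d) ℝ) (L' s) (L s)) •
      (a' L' n + B.lie (linVec (-g')) (a 0 L') n) = a' L n + B.lie (linVec (-g')) (a 0 L) n :=
    congrFun (idxAct_one fun L' => a' L' n + B.lie (linVec (-g')) (a 0 L') n) L
  rw [h2, sub_eq_neg_add, ← Finset.sum_neg_distrib]
  congr 1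
  simp only [LB.act_one (hS0 _), Finset.sum_smul]
  rw [Finset.sum_comm]
  refine Finset.sum_congr rfl fun s _ => ?_
  rw [sum_prod_erase_smul s L (fun l => -g' l (L s)) fun L' => a 0 L' n,
    ← Finset.sum_neg_distrib]
  exact Finset.sum_congr rfl fun l _ => (neg_smul _ _).symm

end FormAct

/-! ### Partial derivatives of families of formal power series -/

lemma two_le_infty : (2 : WithTop ℕ∞) ≤ ∞ := by
  have h : ((2 : ℕ∞) : WithTop ℕ∞) ≤ ∞ := WithTop.coe_le_coe.2 le_top
  exact h

section PartialDerivative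

variable {ι : Type*} {q : ℕ}

/-- The partial derivative of components depending on a point of `ℝᵈ`. -/
noncomputable def pdF (α : EuclideanSpace ℝ (Fin d) → (Fin q → Fin d) → ι → FPS d)
    (z : EuclideanSpace ℝ (Fin d)) (i : Fin d) : (Fin q → Fin d) → ι → FPS d := fun L n m =>
  fderiv ℝ (fun w => coeff m (α w L n)) z (e i)

lemma coeff_pdF (α : EuclideanSpace ℝ (Fin d) → (Fin q → Fin d) → ι → FPS d)
    (z : EuclideanSpace ℝ (Fin d)) (i : Fin d) (L : Fin q → Fin d) (n : ι) (m : Fin d →₀ ℕ) :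
    coeff m (pdF α z i L n) = fderiv ℝ (fun w => coeff m (α w L n)) z (e i) := rfl

variable {α β : EuclideanSpace ℝ (Fin d) → (Fin q → Fin d) → ι → FPS d}
  {z : EuclideanSpace ℝ (Fin d)}

lemma pdF_congr (h : α =ᶠ[nhds z] β) (i : Fin d) : pdF α z i = pdF β z i := by
  funext L n
  ext m
  rw [coeff_pdF, coeff_pdF]
  congr 1
  exact Filter.EventuallyEq.fderiv_eq (h.mono fun w hw => by simp only [hw])

lemma pdF_curve {L : Fin q → Fin d} {n : ι} (hα : SmoothAt (fun w => α w L n) z)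
    {w : ℝ → EuclideanSpace ℝ (Fin d)} {w' : EuclideanSpace ℝ (Fin d)} (h0 : w 0 = z)
    (hw : HasDerivAt w w' 0) :
    HasDer (fun t => α (w t) L n) (∑ i, w' i • pdF α z i L n) := by
  intro m
  have h1 : HasFDerivAt (fun w => coeff m (α w L n))
      (fderiv ℝ (fun w => coeff m (α w L n)) z) (w 0) := by
    rw [h0]
    exact ((hα m).differentiableAt (by simp)).hasFDerivAt
  have h2 := h1.comp_hasDerivAt 0 hw
  refine h2.congr_deriv ?_
  have h3 : w' = ∑ j, w' j • (e j : EuclideanSpace ℝ (Fin d)) := by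
    ext i
    simp [e, Finset.sum_apply, Pi.single_apply]
  conv_lhs => rw [h3]
  simp only [map_sum, map_smul, coeff_pdF]

lemma hasDerivAt_line (z v : EuclideanSpace ℝ (Fin d)) :
    HasDerivAt (fun t : ℝ => z + t • v) v 0 := by
  simpa using ((hasDerivAt_id (0 : ℝ)).smul_const v).const_add z

lemma pdF_line {L : Fin q → Fin d} {n : ι} (hα : SmoothAt (fun w => α w L n) z) (i : Fin d) :
    HasDer (fun t => α (z + t • e i) L n) (pdF α z i L n) := by
  refine (pdF_curve hα (by simp) (hasDerivAt_line z (e i))).of_eq (fun _ => rfl) ?_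
  simp [e]

lemma pdF_smooth {L : Fin q → Fin d} {n : ι} (hα : SmoothAt (fun w => α w L n) z) (i : Fin d) :
    SmoothAt (fun w => pdF α w i L n) z := fun m => by
  simp only [coeff_pdF]
  exact ((hα m).fderiv_right (m := ∞) (by simp)).clm_apply contDiffAt_const

lemma pdF_supp {S : Finset ι} (h : ∀ᶠ w in nhds z, ∀ L, SuppIn S (α w L)) (i : Fin d)
    (L : Fin q → Fin d) : SuppIn S (pdF α z i L) := by
  intro n hn
  ext m
  rw [coeff_pdF]
  have h1 : (fun w => coeff m (α w L n)) =ᶠ[nhds z] fun _ => 0 :=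
    h.mono fun w hw => by simp only [hw L n hn, map_zero]
  rw [h1.fderiv_eq]
  simp

lemma pdF_comm {L : Fin q → Fin d} {n : ι} (hα : SmoothAt (fun w => α w L n) z) (i j : Fin d) :
    pdF (fun w => pdF α w i) z j L n = pdF (fun w => pdF α w j) z i L n := by
  ext m
  have h1 : ∀ i j, coeff m (pdF (fun w => pdF α w i) z j L n) =
      fderiv ℝ (fderiv ℝ fun w => coeff m (α w L n)) z (e j) (e i) := by
    intro i j
    rw [coeff_pdF]
    simp only [coeff_pdF]
    have h2 : DifferentiableAt ℝ (fderiv ℝ fun w => coeff m (α w L n)) z :=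
      ((hα m).fderiv_right (m := 1) (by
      rw [one_add_one_eq_two]
      exact two_le_infty)).differentiableAt (by simp)
    rw [fderiv_clm_apply h2 (differentiableAt_const _)]
    simp
  rw [h1, h1]
  exact ((hα m).isSymmSndFDerivAt (by simpa using two_le_infty)) _ _

lemma pdF_antisymm (hα : ∀ᶠ w in nhds z, IsAntisymm (α w)) (i : Fin d) :
    IsAntisymm (pdF α z i) := by
  intro π L
  funext n
  ext m
  rw [Pi.smul_apply, map_zsmul, coeff_pdF, coeff_pdF]
  have h1 : (fun w => coeff m (α w (L ∘ π) n)) =ᶠ[nhds z]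
      fun w => ((Equiv.Perm.sign π : ℤ) : ℝ) • coeff m (α w L n) :=
    hα.mono fun w hw => by
      simp only [hw π L, Pi.smul_apply, map_zsmul, Int.cast_smul_eq_zsmul]
  rw [h1.fderiv_eq, ← Int.cast_smul_eq_zsmul ℝ]
  have h2 := congrFun (fderiv_const_smul_field (𝕜 := ℝ) (f := fun w => coeff m (α w L n))
    (((Equiv.Perm.sign π : ℤ) : ℝ))) z
  exact congrArg (fun T => T (e i)) h2

end PartialDerivative

/-! ### The vanishing of the terms with second derivatives -/

/-- Replacing one form index by means of `Gᵢ` is multiplication by `dyʲ` of the contraction of `α`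
with `Gˡᵢⱼ`. With the outer `dyⁱ` this is a double multiplication with coefficients symmetric in `i`
and `j`. For `q = 0` there is no index to replace. -/
lemma dyMul_symm_eq_zero {X : Type*} [AddCommGroup X] [Module ℝ X] {q : ℕ}
    (G : Fin d → Fin d → Fin d → ℝ) (hG : ∀ i k j, G i k j = G j k i)
    {α : (Fin q → Fin d) → X} (hα : IsAntisymm α) :
    dyMul (fun i L => ∑ s, ∑ l, G i l (L s) • α (Function.update L s l)) = 0 := by
  cases q with
  | zero =>
    funext L
    simp [dyMul]
  | succ q =>
    -- The factor `q + 1` cancels the normalization of the inner `dyMul`.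
    have h1 : ∀ i, (fun L : Fin (q + 1) → Fin d =>
        ∑ s, ∑ l, G i l (L s) • α (Function.update L s l)) =
        dyMul fun j L' => ((q + 1 : ℕ) : ℝ) • ∑ l, G i l j • α (Fin.cons l L') := by
      intro i
      funext L
      rw [dyMul, Finset.smul_sum]
      refine Finset.sum_congr rfl fun s _ => ?_
      rw [smul_comm ((-1 : ℝ) ^ (s : ℕ)), smul_smul, inv_mul_cancel₀ (by positivity), one_smul,
        Finset.smul_sum]
      refine Finset.sum_congr rfl fun l _ => ?_
      rw [smul_comm, ← hα.insertNth, Fin.insertNth_removeNth]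
    refine (congrArg dyMul (funext h1)).trans (dyMul_dyMul_eq_zero (fun i j => ?_) fun i j => ?_)
    · exact (isAntisymm_sum _ fun l _ => (hα.cons l).const_smul _).const_smul _
    · simp only [hG i _ j]

/-! ### Components of a form in different charts -/

section Covariance

variable {M : Type*} [TopologicalSpace M] [ChartedSpace (EuclideanSpace ℝ (Fin d)) M]
  [IsManifold (𝓡 d) ∞ M] {B : FormalFiber d} {S : Finset B.ι} {q : ℕ}

/-- The components of a form in the coordinates of the preferred chart at `x₀`, as functions of
these coordinates. -/
noncomputable def loc (x₀ : M) (a : RawForm M B q) (z : EuclideanSpace ℝ (Fin d)) :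
    (Fin q → Fin d) → B.ι → FPS d :=
  inChart x₀ a ((extChartAt (𝓡 d) x₀).symm z)

/-- The components of `a` in the chart at `x₀` are smooth at `p`. -/
def SmoothNear (x₀ p : M) (a : RawForm M B q) : Prop :=
  ∀ L n, SmoothAt (fun w => loc x₀ a w L n) (extChartAt (𝓡 d) x₀ p)

lemma loc_chart {x₀ p : M} (hp : p ∈ (extChartAt (𝓡 d) x₀).source) (a : RawForm M B q) :
    loc x₀ a (extChartAt (𝓡 d) x₀ p) = inChart x₀ a p := by
  rw [loc, (extChartAt (𝓡 d) x₀).left_inv hp]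

lemma partialX_eq (a : RawForm M B q) (x : M) (i : Fin d) :
    partialX a x i = pdF (loc x a) (extChartAt (𝓡 d) x x) i := rfl

lemma eventually_source {x₀ p : M} (hp : p ∈ (extChartAt (𝓡 d) x₀).source) {P : M → Prop}
    (hP : ∀ᶠ q in nhds p, P q) :
    ∀ᶠ w in nhds (extChartAt (𝓡 d) x₀ p), P ((extChartAt (𝓡 d) x₀).symm w) := by
  have h := tendsto_symm ((extChartAt (𝓡 d) x₀).map_source hp)
  rw [(extChartAt (𝓡 d) x₀).left_inv hp] at h
  exact h.eventually hP

variable (LB : FiberLaws B S)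
include LB

lemma inChart_supp {a : RawForm M B q} (hS : ∀ x L, SuppIn S (a x L)) {x₀ p : M}
    (hp : p ∈ (extChartAt (𝓡 d) x₀).source) (L : Fin q → Fin d) :
    SuppIn S (inChart x₀ a p L) := by
  rw [inChart_eq]
  exact formAct_supp LB (isUnit_det_jac hp) (hS p) L

lemma inChart_antisymm {a : RawForm M B q} (hS : ∀ x L, SuppIn S (a x L))
    (ha : ∀ x, IsAntisymm (a x)) {x₀ p : M}
    (hp : p ∈ (extChartAt (𝓡 d) x₀).source) : IsAntisymm (inChart x₀ a p) := by
  rw [inChart_eq]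
  exact formAct_antisymm LB (isUnit_det_jac hp) (hS p) (ha p)

lemma inChart_self {a : RawForm M B q} (hS : ∀ x L, SuppIn S (a x L)) (p : M) :
    inChart p a p = a p := by
  rw [inChart_eq, jac_self, formAct_one LB (hS p)]

lemma inChart_change {a : RawForm M B q} (hS : ∀ x L, SuppIn S (a x L)) {x₀ x₁ p : M}
    (h₀ : p ∈ (extChartAt (𝓡 d) x₀).source) (h₁ : p ∈ (extChartAt (𝓡 d) x₁).source) :
    inChart x₁ a p = formAct (tcMatrix d x₀ x₁ p) (inChart x₀ a p) := by
  rw [inChart_eq, inChart_eq, ← formAct_mul LB (isUnit_det_tcMatrix h₀ h₁) (isUnit_det_jac h₀)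
    (hS p), jac_eq, jac_eq, tcMatrix_mul (mem_source_self p) h₀ h₁]

lemma loc_supp {a : RawForm M B q} (hS : ∀ x L, SuppIn S (a x L)) {x₀ p : M}
    (hp : p ∈ (extChartAt (𝓡 d) x₀).source) :
    ∀ᶠ w in nhds (extChartAt (𝓡 d) x₀ p), ∀ L, SuppIn S (loc x₀ a w L) :=
  (eventually_source hp (source_mem_nhds hp)).mono fun _ hw => inChart_supp LB hS hw

lemma loc_antisymm {a : RawForm M B q} (hS : ∀ x L, SuppIn S (a x L))
    (ha : ∀ x, IsAntisymm (a x)) {x₀ p : M} (hp : p ∈ (extChartAt (𝓡 d) x₀).source) :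
    ∀ᶠ w in nhds (extChartAt (𝓡 d) x₀ p), IsAntisymm (loc x₀ a w) :=
  (eventually_source hp (source_mem_nhds hp)).mono fun _ hw => inChart_antisymm LB hS ha hw

lemma loc_change {a : RawForm M B q} (hS : ∀ x L, SuppIn S (a x L)) {x₀ x₁ p : M}
    (h₀ : p ∈ (extChartAt (𝓡 d) x₀).source) (h₁ : p ∈ (extChartAt (𝓡 d) x₁).source) :
    ∀ᶠ w in nhds (extChartAt (𝓡 d) x₁ p), loc x₁ a w =
      formAct (tcMatrix d x₀ x₁ ((extChartAt (𝓡 d) x₁).symm w))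
        (loc x₀ a (transition d x₁ x₀ w)) := by
  filter_upwards [eventually_source h₁ (source_mem_nhds h₁),
    eventually_source h₁ (source_mem_nhds h₀)] with w hw₁ hw₀
  rw [transition, Function.comp_apply, loc_chart hw₀, loc, inChart_change LB hS hw₀ hw₁]

lemma SmoothNear.change {a : RawForm M B q} (hS : ∀ x L, SuppIn S (a x L)) {x₀ x₁ p : M}
    (h₀ : p ∈ (extChartAt (𝓡 d) x₀).source) (h₁ : p ∈ (extChartAt (𝓡 d) x₁).source)
    (h : SmoothNear x₀ p a) : SmoothNear x₁ p a := by
  intro L n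
  have hT : ContDiffAt ℝ ∞ (transition d x₁ x₀) (extChartAt (𝓡 d) x₁ p) :=
    contDiffAt_transition h₁ h₀
  have hT' : Filter.Tendsto (transition d x₁ x₀) (nhds (extChartAt (𝓡 d) x₁ p))
      (nhds (extChartAt (𝓡 d) x₀ p)) := by
    have := hT.continuousAt.tendsto
    rwa [transition_chart x₀ h₁] at this
  have hdet : ∀ᶠ w in nhds (extChartAt (𝓡 d) x₁ p),
      IsUnit (tcMatrix d x₀ x₁ ((extChartAt (𝓡 d) x₁).symm w)).det := by
    filter_upwards [eventually_source h₁ (source_mem_nhds h₁),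
      eventually_source h₁ (source_mem_nhds h₀)] with w hw₁ hw₀
    exact isUnit_det_tcMatrix hw₀ hw₁
  -- The entries of a Jacobi matrix are known to be smooth in the coordinates of its source chart,
  -- which is `x₁` only for the inverse matrix.
  have hinv : (fun w => tcMatrix d x₀ x₁ ((extChartAt (𝓡 d) x₁).symm w))
      =ᶠ[nhds (extChartAt (𝓡 d) x₁ p)]
      fun w => (tcMatrix d x₁ x₀ ((extChartAt (𝓡 d) x₁).symm w))⁻¹ := by
    filter_upwards [eventually_source h₁ (source_mem_nhds h₁),
      eventually_source h₁ (source_mem_nhds h₀)] with w hw₁ hw₀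
    rw [inv_tcMatrix hw₁ hw₀]
  refine SmoothAt.congr (f := fun w => formAct
    (tcMatrix d x₀ x₁ ((extChartAt (𝓡 d) x₁).symm w)) (loc x₀ a (transition d x₁ x₀ w)) L n) ?_
    ((loc_change LB hS h₀ h₁).mono fun w hw => by simp only [hw])
  refine formAct_smoothAt LB (fun i j => ?_) hdet
    (hT'.eventually (loc_supp LB hS h₀)) (fun L n m => ?_) L n
  · refine ContDiffAt.congr_of_eventuallyEq (contDiffAt_inv (h := fun w =>
      tcMatrix d x₁ x₀ ((extChartAt (𝓡 d) x₁).symm w))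
      (fun i j => contDiffAt_tcMatrix h₁ h₀ i j) ?_ i j) (hinv.mono fun w hw => by
        simp only at hw ⊢
        rw [hw])
    rw [(extChartAt (𝓡 d) x₁).left_inv h₁]
    exact isUnit_det_tcMatrix h₁ h₀
  · have := h L n m
    rw [← transition_chart x₀ h₁] at this
    exact this.comp _ hT

end Covariance

/-! ### Transformation of partial derivatives and of the connection form -/

section Connection

variable {M : Type*} [TopologicalSpace M] [ChartedSpace (EuclideanSpace ℝ (Fin d)) M]
  [IsManifold (𝓡 d) ∞ M] {B : FormalFiber d} {S : Finset B.ι} {q : ℕ}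

/-- The inhomogeneous term of the transformation of the Christoffel symbols. -/
noncomputable def christoffelDefect (x₀ p : M) (i k j : Fin d) : ℝ :=
  ∑ b, tcMatrix d p x₀ p k b *
    fderiv ℝ (fun w => tcMatrix d x₀ p ((extChartAt (𝓡 d) x₀).symm w) b j)
      (extChartAt (𝓡 d) x₀ p) (e i)

/-- The derivative of the Jacobi matrix is the second derivative of the transition map, which is
symmetric. -/
lemma christoffelDefect_symm {x₀ p : M} (hp : p ∈ (extChartAt (𝓡 d) x₀).source) (i k j : Fin d) :
    christoffelDefect x₀ p i k j = christoffelDefect x₀ p j k i := by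
  have hpp := mem_source_self (d := d) p
  have hψ := contDiffAt_transition hp hpp
  have key : ∀ b i j : Fin d,
      fderiv ℝ (fun w => tcMatrix d x₀ p ((extChartAt (𝓡 d) x₀).symm w) b j)
        (extChartAt (𝓡 d) x₀ p) (e i) =
      fderiv ℝ (fderiv ℝ (transition d x₀ p)) (extChartAt (𝓡 d) x₀ p) (e i) (e j) b := by
    intro b i j
    have h1 : (fun w => tcMatrix d x₀ p ((extChartAt (𝓡 d) x₀).symm w) b j)
        =ᶠ[nhds (extChartAt (𝓡 d) x₀ p)]
        fun w => EuclideanSpace.proj (𝕜 := ℝ) b (fderiv ℝ (transition d x₀ p) w (e j)) := by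
      filter_upwards [eventually_source hp (source_mem_nhds hp),
        eventually_source hp (source_mem_nhds hpp),
        target_mem_nhds ((extChartAt (𝓡 d) x₀).map_source hp)] with w hw hw' hwt
      have h2 := (hasFDerivAt_transition hw hw').fderiv
      rw [(extChartAt (𝓡 d) x₀).right_inv hwt] at h2
      rw [h2]
      rfl
    rw [h1.fderiv_eq]
    have h2 : DifferentiableAt ℝ (fderiv ℝ (transition d x₀ p)) (extChartAt (𝓡 d) x₀ p) :=
      (hψ.fderiv_right (m := 1) (by
        rw [one_add_one_eq_two]
        exact two_le_infty)).differentiableAt (by simp)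
    have h3 := ((EuclideanSpace.proj (𝕜 := ℝ) b).hasFDerivAt.comp (extChartAt (𝓡 d) x₀ p)
      (h2.hasFDerivAt.clm_apply (hasFDerivAt_const (e j) _)))
    refine (congrArg (fun T => T (e i)) h3.fderiv).trans ?_
    simp
  simp only [christoffelDefect, key]
  refine Finset.sum_congr rfl fun b _ => ?_
  rw [hψ.isSymmSndFDerivAt (by simpa using two_le_infty)]

/-- The components of a form transform by linear changes of coordinates, so that their partial
derivatives transform with an inhomogeneous term. -/
lemma pdF_loc_eq (LB : FiberLaws B S) {a : RawForm M B q} (hS : ∀ x L, SuppIn S (a x L))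
    {x₀ p : M} (hp : p ∈ (extChartAt (𝓡 d) x₀).source) (hsm : SmoothNear x₀ p a) (i : Fin d)
    (L : Fin q → Fin d) (n : B.ι) :
    pdF (loc x₀ a) (extChartAt (𝓡 d) x₀ p) i L n +
        B.lie (linVec (-Matrix.of (christoffelDefect x₀ p i))) (inChart x₀ a p L) n -
        ∑ s, ∑ l, christoffelDefect x₀ p i l (L s) • inChart x₀ a p (Function.update L s l) n =
      (∑ i', (jac x₀ p)⁻¹ i' i • formAct (jac x₀ p) (partialX a p i')) L n := by
  have hpp := mem_source_self (d := d) p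
  set z := extChartAt (𝓡 d) x₀ p with hz
  have hg := isUnit_det_jac hp
  have hginv : (jac (d := d) x₀ p)⁻¹ = tcMatrix d x₀ p p := inv_tcMatrix hpp hp
  have hline := (hasDerivAt_line z (e i)).continuousAt.tendsto
  simp only [zero_smul, add_zero] at hline
  let K : EuclideanSpace ℝ (Fin d) → Matrix (Fin d) (Fin d) ℝ :=
    fun w => tcMatrix d x₀ p ((extChartAt (𝓡 d) x₀).symm w)
  have hK0 : K z = (jac (d := d) x₀ p)⁻¹ := by
    simp only [K, hz, (extChartAt (𝓡 d) x₀).left_inv hp, hginv]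
  have hsp : SmoothNear p p a := hsm.change LB hS hp hpp
  have hψ := hasFDerivAt_transition hp hpp
  -- the derivative of the components in the chart at `x₀`
  have h1 := formAct_hasDer LB (g := fun t => jac x₀ p * K (z + t • e i))
    (g' := Matrix.of (christoffelDefect x₀ p i)) (a := fun t => loc x₀ a (z + t • e i))
    (a' := pdF (loc x₀ a) z i) (by
      simp only [zero_smul, add_zero, hK0]
      exact Matrix.mul_nonsing_inv _ hg) (fun k j => by
      have h2 : ∀ b, HasDerivAt (fun t : ℝ => K (z + t • e i) b j)
          (fderiv ℝ (fun w => K w b j) z (e i)) 0 := fun b => by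
        have h3 : HasFDerivAt (fun w => K w b j) (fderiv ℝ (fun w => K w b j) z)
            (z + (0 : ℝ) • e i) := by
          rw [zero_smul, add_zero]
          exact ((contDiffAt_tcMatrix hp hpp b j).differentiableAt (by simp)).hasFDerivAt
        exact h3.comp_hasDerivAt (0 : ℝ) (hasDerivAt_line z (e i))
      simp only [Matrix.mul_apply]
      exact HasDerivAt.fun_sum fun b _ => (h2 b).const_mul _)
    (hline.eventually (by
      filter_upwards [eventually_source hp (source_mem_nhds hp),
        eventually_source hp (source_mem_nhds hpp)] with w hw hw'
      exact isUnit_det_mul hg (isUnit_det_tcMatrix hw hw')))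
    (hline.eventually (loc_supp LB hS hp)) (pdF_supp (loc_supp LB hS hp) i)
    (fun L n => pdF_line (hsm L n) i) L n
  -- the derivative of the components in the chart at `p`
  have hcurve : HasDerivAt (fun t : ℝ => transition d x₀ p (z + t • e i))
      (tangentCoordChange (𝓡 d) x₀ p p (e i)) 0 := by
    have h3 : HasFDerivAt (transition d x₀ p) (tangentCoordChange (𝓡 d) x₀ p p)
        (z + (0 : ℝ) • e i) := by
      rw [zero_smul, add_zero]
      exact hψ
    exact h3.comp_hasDerivAt (0 : ℝ) (hasDerivAt_line z (e i))
  have hcurve0 : transition d x₀ p (z + (0 : ℝ) • e i) = extChartAt (𝓡 d) p p := by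
    rw [zero_smul, add_zero, hz, transition_chart p hp]
  have hcl : Filter.Tendsto (fun t : ℝ => transition d x₀ p (z + t • e i)) (nhds 0)
      (nhds (extChartAt (𝓡 d) p p)) := by
    have := hcurve.continuousAt.tendsto
    rwa [hcurve0] at this
  have h2 := formAct_hasDer_left LB hg
    (a := fun t => loc p a (transition d x₀ p (z + t • e i)))
    (a' := ∑ i', (jac x₀ p)⁻¹ i' i • partialX a p i')
    (hcl.eventually (loc_supp LB hS hpp))
    (fun L => by
      rw [Finset.sum_apply]
      exact SuppIn.sum fun i' _ => (pdF_supp (loc_supp LB hS hpp) i' L).real_smul _)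
    (fun L n => (pdF_curve (hsp L n) hcurve0 hcurve).of_eq (fun _ => rfl) (by
      simp only [Finset.sum_apply, Pi.smul_apply]
      refine Finset.sum_congr rfl fun i' _ => ?_
      rw [hginv]
      rfl)) L n
  -- Along the coordinate line the components in the chart at `p`, transformed by the fixed matrix
  -- `jac x₀ p`, are also obtained from the components in the chart at `x₀` by a matrix equal to `1`
  -- at `t = 0`. Equating the two derivatives gives the claim.
  have heq : (fun t : ℝ => formAct (jac x₀ p * K (z + t • e i)) (loc x₀ a (z + t • e i)) L n)
      =ᶠ[nhds 0]
      fun t => formAct (jac x₀ p) (loc p a (transition d x₀ p (z + t • e i))) L n := by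
    refine hline.eventually (p := fun w => formAct (jac x₀ p * K w) (loc x₀ a w) L n =
      formAct (jac x₀ p) (loc p a (transition d x₀ p w)) L n) ?_
    filter_upwards [eventually_source hp (source_mem_nhds hp),
      eventually_source hp (source_mem_nhds hpp)] with w hw hw'
    change formAct (jac x₀ p * tcMatrix d x₀ p ((extChartAt (𝓡 d) x₀).symm w))
      (inChart x₀ a ((extChartAt (𝓡 d) x₀).symm w)) L n = _
    rw [formAct_mul LB hg (isUnit_det_tcMatrix hw hw') (fun L => inChart_supp LB hS hw L),
      transition, Function.comp_apply, loc_chart hw', inChart_change LB hS hw hw']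
  have h3 := h1.unique (h2.congr heq)
  simp only [zero_smul, add_zero, hz, loc_chart hp] at h3
  rw [← hz] at h3
  refine h3.trans ?_
  have hsup : ∀ i' L, SuppIn S (partialX a p i' L) := fun i' => pdF_supp (loc_supp LB hS hpp) i'
  have hsum : ∀ s : Finset (Fin d), formAct (jac x₀ p) (∑ i' ∈ s, (jac x₀ p)⁻¹ i' i • partialX a p i') =
      ∑ i' ∈ s, (jac x₀ p)⁻¹ i' i • formAct (jac x₀ p) (partialX a p i') := by
    intro s
    induction s using Finset.induction_on with
    | empty =>
      have := formAct_smul LB hg 0 (a := (0 : (Fin q → Fin d) → B.ι → FPS d))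
        fun L => SuppIn.zero
      simpa using this
    | insert k s hk ih =>
      have hA : ∀ L, SuppIn S (((jac x₀ p)⁻¹ k i • partialX a p k) L) :=
        fun L => (hsup k L).real_smul _
      have hB : ∀ L, SuppIn S ((∑ i' ∈ s, (jac x₀ p)⁻¹ i' i • partialX a p i') L) := fun L => by
        rw [Finset.sum_apply]
        exact SuppIn.sum fun i' _ => (hsup i' L).real_smul _
      rw [Finset.sum_insert hk, Finset.sum_insert hk, formAct_add LB hg hA hB, ih,
        formAct_smul LB hg _ (hsup k)]
  exact congrFun (congrFun (hsum _) L) n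

variable (cov : CovariantDerivative (𝓡 d) (EuclideanSpace ℝ (Fin d))
  (TangentSpace (𝓡 d) : M → Type _))

/-- The vector field `Γᵢ = -Γᵏᵢⱼ yʲ ∂/∂yᵏ` at `p` in the coordinates of the preferred chart
at `x₀`. -/
noncomputable def locGamma (x₀ p : M) (i : Fin d) : Fin d → FPS d := fun k =>
  -∑ j, locChristoffel cov x₀ p i j k • (MvPowerSeries.X j : FPS d)

lemma sum_comm_four {X : Type*} [AddCommMonoid X] (f : Fin d → Fin d → Fin d → Fin d → X) :
    ∑ j, ∑ b, ∑ i, ∑ c, f j b i c = ∑ i, ∑ b, ∑ c, ∑ j, f j b i c := by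
  rw [Finset.sum_comm]
  have h : ∀ b, ∑ j, ∑ i, ∑ c, f j b i c = ∑ i, ∑ c, ∑ j, f j b i c := fun b => by
    rw [Finset.sum_comm]
    exact Finset.sum_congr rfl fun i _ => Finset.sum_comm
  simp only [h]
  exact Finset.sum_comm

/-- The inhomogeneous term is exactly the linear field that occurs in `pdF_loc_eq`, so it cancels in
the formula for `∇`. -/
lemma locGamma_eq {x₀ p : M} (hp : p ∈ (extChartAt (𝓡 d) x₀).source) (i : Fin d) :
    locGamma cov x₀ p i = linVec (-Matrix.of (christoffelDefect x₀ p i)) +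
      ∑ i', (jac x₀ p)⁻¹ i' i • push (jac x₀ p) (gammaVec cov p i') := by
  have hginv : (jac (d := d) x₀ p)⁻¹ = tcMatrix d x₀ p p := inv_tcMatrix (mem_source_self p) hp
  funext k
  simp only [locGamma, locChristoffel_eq cov hp, linVec, push, gammaVec, Pi.add_apply,
    Finset.sum_apply, Pi.smul_apply, hginv, Matrix.neg_apply, Matrix.of_apply, substLin_neg,
    substLin_sum, substLin_smul, substLin_X, christoffelDefect]
  simp only [mul_add, Finset.sum_add_distrib, add_smul, neg_smul, Finset.sum_neg_distrib, neg_add,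
    smul_neg]
  congr 2
  simp only [Finset.mul_sum, Finset.sum_smul, Finset.smul_sum, smul_smul]
  rw [sum_comm_four]
  refine Finset.sum_congr rfl fun i' _ => Finset.sum_congr rfl fun b _ =>
    Finset.sum_congr rfl fun c _ => Finset.sum_congr rfl fun j _ => ?_
  rw [jac_eq]
  congr 1
  ring

end Connection

/-! ### Covariant derivatives and curvature in a coordinate domain -/

section LocalConnection

variable {B : FormalFiber d} {S : Finset B.ι} {q : ℕ}
  {α : EuclideanSpace ℝ (Fin d) → (Fin q → Fin d) → B.ι → FPS d}
  {W : EuclideanSpace ℝ (Fin d) → Fin d → Fin d → FPS d} {z : EuclideanSpace ℝ (Fin d)}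

lemma pdF_eq_of_hasDer {ι : Type*} {α : EuclideanSpace ℝ (Fin d) → (Fin q → Fin d) → ι → FPS d}
    {L : Fin q → Fin d} {n : ι} (hα : SmoothAt (fun w => α w L n) z) {i : Fin d} {f : FPS d}
    (h : HasDer (fun t => α (z + t • e i) L n) f) : pdF α z i L n = f :=
  (pdF_line hα i).unique h

lemma dyMul_smoothAt {ι : Type*} {c : EuclideanSpace ℝ (Fin d) → Fin d → (Fin q → Fin d) → ι → FPS d}
    (hc : ∀ i L n, SmoothAt (fun w => c w i L n) z) (L : Fin (q + 1) → Fin d) (n : ι) :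
    SmoothAt (fun w => dyMul (c w) L n) z := by
  simp only [dyMul, Pi.smul_apply, Finset.sum_apply]
  exact (SmoothAt.sum fun s _ => (hc _ _ n).const_smul _).const_smul _

lemma pdF_dyMul {ι : Type*} {c : EuclideanSpace ℝ (Fin d) → Fin d → (Fin q → Fin d) → ι → FPS d}
    (hc : ∀ i L n, SmoothAt (fun w => c w i L n) z) (i : Fin d) :
    pdF (fun w => dyMul (c w)) z i = dyMul fun j => pdF (fun w => c w j) z i := by
  funext L n
  refine pdF_eq_of_hasDer (dyMul_smoothAt hc L n) ?_
  simp only [dyMul, Pi.smul_apply, Finset.sum_apply]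
  exact (HasDer.sum fun s _ => (pdF_line (hc _ _ n) i).const_smul _).const_smul _

/-- The partial derivative of the coefficients of a family of vector fields. -/
noncomputable def pdV (W : EuclideanSpace ℝ (Fin d) → Fin d → Fin d → FPS d)
    (z : EuclideanSpace ℝ (Fin d)) (i j k : Fin d) : FPS d :=
  pdF (q := 1) (ι := Fin d) (fun w L k => W w (L 0) k) z i (fun _ => j) k

lemma pdV_line {i j k : Fin d} (hW : SmoothAt (fun w => W w j k) z) :
    HasDer (fun t => W (z + t • e i) j k) (pdV W z i j k) :=
  pdF_line (q := 1) (ι := Fin d) (α := fun w L k => W w (L 0) k) (L := fun _ => j) hW i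

lemma pdV_smooth {i j k : Fin d} (hW : SmoothAt (fun w => W w j k) z) :
    SmoothAt (fun w => pdV W w i j k) z :=
  pdF_smooth (q := 1) (ι := Fin d) (α := fun w L k => W w (L 0) k) (L := fun _ => j) hW i

lemma pdV_comm {j k : Fin d} (hW : SmoothAt (fun w => W w j k) z) (i i' : Fin d) :
    pdV (fun w => pdV W w i) z i' j k = pdV (fun w => pdV W w i') z i j k :=
  pdF_comm (q := 1) (ι := Fin d) (α := fun w L k => W w (L 0) k) (L := fun _ => j) hW i i'

/-- The covariant derivative with the connection form `W` in a coordinate domain. -/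
noncomputable def locD (W : EuclideanSpace ℝ (Fin d) → Fin d → Fin d → FPS d)
    (α : EuclideanSpace ℝ (Fin d) → (Fin q → Fin d) → B.ι → FPS d)
    (w : EuclideanSpace ℝ (Fin d)) : (Fin (q + 1) → Fin d) → B.ι → FPS d :=
  dyMul fun i L => pdF α w i L + B.lie (W w i) (α w L)

/-- The curvature of the connection form `W`. -/
noncomputable def curvV (W : EuclideanSpace ℝ (Fin d) → Fin d → Fin d → FPS d)
    (z : EuclideanSpace ℝ (Fin d)) (i j : Fin d) : Fin d → FPS d :=
  pdV W z i j - pdV W z j i + vbr (W z i) (W z j)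

variable (LB : FiberLaws B S)
include LB

lemma IsAntisymm.lie {a : (Fin q → Fin d) → B.ι → FPS d} (ha : IsAntisymm a)
    (hS : ∀ L, SuppIn S (a L)) (v : Fin d → FPS d) : IsAntisymm fun L => B.lie v (a L) :=
  ha.map fun r L => LB.lie_real_smul v r (hS L)

lemma locD_term_smoothAt (hS : ∀ᶠ w in nhds z, ∀ L, SuppIn S (α w L))
    (hα : ∀ L n, SmoothAt (fun w => α w L n) z) (hW : ∀ i k, SmoothAt (fun w => W w i k) z)
    (i : Fin d) (L : Fin q → Fin d) (n : B.ι) :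
    SmoothAt (fun w => (pdF α w i L + B.lie (W w i) (α w L)) n) z :=
  (pdF_smooth (hα L n) i).add (LB.lie_smoothAt (hW i) (hS.mono fun _ h => h L) (hα L) n)

lemma locD_smoothAt (hS : ∀ᶠ w in nhds z, ∀ L, SuppIn S (α w L))
    (hα : ∀ L n, SmoothAt (fun w => α w L n) z) (hW : ∀ i k, SmoothAt (fun w => W w i k) z)
    (L : Fin (q + 1) → Fin d) (n : B.ι) : SmoothAt (fun w => locD W α w L n) z :=
  dyMul_smoothAt (locD_term_smoothAt LB hS hα hW) L n

/-- The square of a covariant derivative is the action of the curvature. -/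
lemma locD_locD (hS : ∀ᶠ w in nhds z, ∀ L, SuppIn S (α w L))
    (has : ∀ᶠ w in nhds z, IsAntisymm (α w))
    (hα : ∀ L n, SmoothAt (fun w => α w L n) z) (hW : ∀ i k, SmoothAt (fun w => W w i k) z) :
    locD W (locD W α) z =
      dyMul fun i => dyMul fun j L => (1 / 2 : ℝ) • B.lie (curvV W z i j) (α z L) := by
  have hSz := hS.self_of_nhds
  have hP : ∀ j L, SuppIn S (pdF α z j L) := fun j => pdF_supp hS j
  -- The coefficient of `dyⁱ dyʲ` in the square, before antisymmetrization, as given by the product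
  -- rule.
  let c : Fin d → Fin d → (Fin q → Fin d) → B.ι → FPS d := fun i j L =>
    pdF (fun w => pdF α w j) z i L + B.lie (pdV W z i j) (α z L) + B.lie (W z j) (pdF α z i L) +
      (B.lie (W z i) (pdF α z j L) + B.lie (W z i) (B.lie (W z j) (α z L)))
  have hline : ∀ i, Filter.Tendsto (fun t : ℝ => z + t • (e i : EuclideanSpace ℝ (Fin d)))
      (nhds 0) (nhds z) := fun i => by
    simpa using (hasDerivAt_line z (e i)).continuousAt.tendsto
  have hterm : ∀ i j L n, pdF (fun w L => pdF α w j L + B.lie (W w j) (α w L)) z i L n =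
      (pdF (fun w => pdF α w j) z i L + B.lie (pdV W z i j) (α z L) +
        B.lie (W z j) (pdF α z i L)) n := by
    intro i j L n
    refine pdF_eq_of_hasDer (locD_term_smoothAt LB hS hα hW j L n) ?_
    have h1 := (pdF_line (α := fun w => pdF α w j) (pdF_smooth (hα L n) j) i).add
      (LB.lie_hasDer (v := fun t => W (z + t • e i) j) (a := fun t => α (z + t • e i) L)
        (fun k => pdV_line (hW j k)) ((hline i).eventually (hS.mono fun _ h => h L)) (hP i L)
        (fun n => pdF_line (hα L n) i) n)
    refine h1.of_eq (fun _ => rfl) ?_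
    simp only [zero_smul, add_zero, Pi.add_apply, add_assoc]
  have h1 : locD W (locD W α) z = dyMul fun i => dyMul fun j => c i j := by
    rw [locD]
    congr 1
    funext i L
    have h2 : pdF (locD W α) z i = dyMul fun j => pdF (fun w L => pdF α w j L +
        B.lie (W w j) (α w L)) z i := pdF_dyMul (locD_term_smoothAt LB hS hα hW) i
    rw [h2, locD, lie_dyMul LB _ fun j L => (hP j L).add (LB.lie_supp (hSz L)), ← Pi.add_apply,
      ← dyMul_add]
    congr 1
    funext j L
    rw [LB.lie_add (hP j L) (LB.lie_supp (hSz L))]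
    funext n
    rw [Pi.add_apply, hterm]
    rfl
  have hcas : ∀ i j, IsAntisymm (c i j) := fun i j => by
    have hz := has.self_of_nhds
    have hcont : ∀ᶠ w in nhds z, IsAntisymm (pdF α w j) :=
      has.eventually_nhds.mono fun w hw => pdF_antisymm hw j
    refine (((pdF_antisymm hcont i).add (hz.lie LB hSz _)).add
      ((pdF_antisymm has i).lie LB (hP i) _)).add (((pdF_antisymm has j).lie LB (hP j) _).add
      ((hz.lie LB hSz _).lie LB (fun L => LB.lie_supp (hSz L)) _))
  -- The symmetric part will be killed by `dyMul_dyMul_eq_zero`. In the antisymmetric part the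
  -- second derivatives and the mixed first order terms cancel, and half the curvature remains.
  have hc : ∀ i j L, c i j L = (1 / 2 : ℝ) • (c i j L + c j i L) +
      (1 / 2 : ℝ) • B.lie (curvV W z i j) (α z L) := by
    intro i j L
    have h3 : B.lie (curvV W z i j) (α z L) = c i j L - c j i L := by
      rw [curvV, LB.lie_add_left (hSz L), LB.lie_sub_left _ _ (hSz L), LB.lie_vbr (hSz L)]
      have h4 : pdF (fun w => pdF α w j) z i L = pdF (fun w => pdF α w i) z j L := by
        funext n
        exact pdF_comm (hα L n) j i
      simp only [c, h4]
      abel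
    rw [h3, ← smul_add]
    have h5 : c i j L + c j i L + (c i j L - c j i L) = (2 : ℝ) • c i j L := by
      rw [two_smul]
      abel
    rw [h5, smul_smul]
    norm_num
  have h6 : (dyMul fun i => dyMul fun j => c i j) =
      dyMul (fun i => dyMul fun j L => (1 / 2 : ℝ) • (c i j L + c j i L)) +
      dyMul fun i => dyMul fun j L => (1 / 2 : ℝ) • B.lie (curvV W z i j) (α z L) := by
    rw [← dyMul_add]
    congr 1
    funext i L
    rw [← Pi.add_apply, ← dyMul_add]
    congr 1
    funext j L
    exact hc i j L
  rw [h1, h6, dyMul_dyMul_eq_zero (fun i j => ((hcas i j).add (hcas j i)).const_smul _)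
    fun i j => by simp only [add_comm], zero_add]

end LocalConnection

/-! ### Expressions of `∇`, `δ` and `A ·` in an arbitrary chart -/

section Covariance

variable {M : Type*} [TopologicalSpace M] [ChartedSpace (EuclideanSpace ℝ (Fin d)) M]
  [IsManifold (𝓡 d) ∞ M] {B : FormalFiber d} {S : Finset B.ι} {q : ℕ}

variable (cov : CovariantDerivative (𝓡 d) (EuclideanSpace ℝ (Fin d))
  (TangentSpace (𝓡 d) : M → Type _))

/-- The connection in the coordinates of the preferred chart at `x₀`. -/
lemma inChart_nabla (LB : FiberLaws B S) {a : RawForm M B q} (hS : ∀ x L, SuppIn S (a x L))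
    (has : ∀ x, IsAntisymm (a x)) {x₀ p : M} (hp : p ∈ (extChartAt (𝓡 d) x₀).source)
    (hsm : SmoothNear x₀ p a) :
    inChart x₀ (nabla cov a) p = dyMul fun i L => pdF (loc x₀ a) (extChartAt (𝓡 d) x₀ p) i L +
      B.lie (locGamma cov x₀ p i) (inChart x₀ a p L) := by
  have hg := isUnit_det_jac hp
  have hpp := mem_source_self (d := d) p
  have hsup : ∀ i' L, SuppIn S (partialX a p i' L) := fun i' => pdF_supp (loc_supp LB hS hpp) i'
  have hc := inChart_supp LB hS hp
  rw [inChart_eq, nabla, formAct_dyMul LB hg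
    fun i L => (hsup i L).add (LB.lie_supp (hS p L))]
  have h1 : ∀ i L, (∑ i', (jac x₀ p)⁻¹ i' i • formAct (jac x₀ p)
      (fun L => partialX a p i' L + B.lie (gammaVec cov p i') (a p L))) L =
      (pdF (loc x₀ a) (extChartAt (𝓡 d) x₀ p) i L + B.lie (locGamma cov x₀ p i) (inChart x₀ a p L))
        - ∑ s, ∑ l, christoffelDefect x₀ p i l (L s) •
          inChart x₀ a p (Function.update L s l) := by
    intro i L
    have h2 : ∀ i', formAct (jac x₀ p)
        (fun L => partialX a p i' L + B.lie (gammaVec cov p i') (a p L)) =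
        formAct (jac x₀ p) (partialX a p i') +
          fun L => B.lie (push (jac x₀ p) (gammaVec cov p i')) (inChart x₀ a p L) := by
      intro i'
      rw [inChart_eq, ← formAct_lie LB hg _ (hS p)]
      exact formAct_add LB hg (hsup i') fun L => LB.lie_supp (hS p L)
    simp only [h2, smul_add, Finset.sum_add_distrib, Pi.add_apply]
    rw [locGamma_eq cov hp, LB.lie_add_left (hc L), LB.lie_sum_left _ _ (hc L)]
    have h3 : (∑ i', (jac x₀ p)⁻¹ i' i • formAct (jac x₀ p) (partialX a p i')) L =
        pdF (loc x₀ a) (extChartAt (𝓡 d) x₀ p) i L +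
        B.lie (linVec (-Matrix.of (christoffelDefect x₀ p i))) (inChart x₀ a p L) -
        ∑ s, ∑ l, christoffelDefect x₀ p i l (L s) • inChart x₀ a p (Function.update L s l) := by
      funext n
      rw [← pdF_loc_eq LB hS hp hsm]
      simp only [Pi.sub_apply, Pi.add_apply, Finset.sum_apply, Pi.smul_apply]
    rw [h3]
    simp only [LB.lie_smul_left _ (hc L), Finset.sum_apply, Pi.smul_apply]
    abel
  -- The contribution of the form indices is symmetric because it comes from second derivatives of
  -- the transition map.
  have h4 := dyMul_symm_eq_zero (q := q) (christoffelDefect x₀ p)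
    (christoffelDefect_symm hp) (inChart_antisymm LB hS has hp)
  have h5 : (dyMul fun i => ∑ i', (jac x₀ p)⁻¹ i' i • formAct (jac x₀ p)
      (fun L => partialX a p i' L + B.lie (gammaVec cov p i') (a p L))) =
      dyMul fun i L => (pdF (loc x₀ a) (extChartAt (𝓡 d) x₀ p) i L +
        B.lie (locGamma cov x₀ p i) (inChart x₀ a p L))
        - ∑ s, ∑ l, christoffelDefect x₀ p i l (L s) •
          inChart x₀ a p (Function.update L s l) := by
    congr 1
    funext i L
    exact h1 i L
  rw [h5, dyMul_sub, h4, sub_zero]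

/-- The element `dyⁱ ∂/∂yⁱ` is invariant, since `dyⁱ` and `∂/∂yⁱ` transform by mutually inverse
matrices. Hence `δ` has the same form in all charts. -/
lemma sum_inv_smul_push_single {g : Matrix (Fin d) (Fin d) ℝ} (hg : IsUnit g.det) (i : Fin d) :
    ∑ i', g⁻¹ i' i • push g (Pi.single i' 1) = Pi.single i 1 := by
  funext k
  have h : ∀ i', push g (Pi.single i' 1) k = g k i' • (1 : FPS d) := by
    intro i'
    rw [push, Finset.sum_eq_single i']
    · simp [substLin_one]
    · intro j _ hj
      simp [hj, substLin_zero]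
    · simp
  simp only [Finset.sum_apply, Pi.smul_apply, h, smul_smul, ← Finset.sum_smul]
  have h2 : ∑ i', g⁻¹ i' i * g k i' = (g * g⁻¹) k i := by
    rw [Matrix.mul_apply]
    exact Finset.sum_congr rfl fun _ _ => mul_comm _ _
  rw [h2, Matrix.mul_nonsing_inv _ hg, Matrix.one_apply, Pi.single_apply]
  split_ifs <;> simp

lemma inChart_delta (LB : FiberLaws B S) {a : RawForm M B q} (hS : ∀ x L, SuppIn S (a x L))
    {x₀ p : M} (hp : p ∈ (extChartAt (𝓡 d) x₀).source) :
    inChart x₀ (delta a) p = dyMul fun i L => B.lie (Pi.single i 1) (inChart x₀ a p L) := by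
  have hg := isUnit_det_jac hp
  rw [inChart_eq, delta, formAct_dyMul_lie LB hg _ (hS p), inChart_eq]
  simp only [sum_inv_smul_push_single hg]

lemma sum_fin_one {X : Type*} [AddCommMonoid X] (F : (Fin 1 → Fin d) → X) :
    ∑ L, F L = ∑ i, F fun _ => i :=
  Fintype.sum_equiv (Equiv.funUnique (Fin 1) (Fin d)) _ _ fun L => by
    congr 1
    funext s
    rw [Subsingleton.elim s default]
    rfl

lemma toVec_formAct (g : Matrix (Fin d) (Fin d) ℝ)
    (A : (Fin 1 → Fin d) → (fiberT d 1).ι → FPS d) (i : Fin d) :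
    toVec (formAct g A fun _ => i) = ∑ i', g⁻¹ i' i • push g (toVec (A fun _ => i')) := by
  funext k
  simp only [toVec, formAct, idxAct, sum_fin_one, Fin.prod_univ_one]
  refine (Finset.sum_apply (M := fun _ : (Fin 1 → Fin d) => FPS d) _ _ _).trans ?_
  rw [Finset.sum_apply]
  refine Finset.sum_congr rfl fun i' _ => congrArg (fun f : FPS d => g⁻¹ i' i • f) ?_
  refine (sum_fin_one (X := FPS d) fun J' : Fin 1 → Fin d =>
    (∏ s, g k (J' s)) • substLin g⁻¹ (A (fun _ => i') J')).trans ?_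
  simp only [Fin.prod_univ_one]
  rfl

lemma inChart_actForm (LB : FiberLaws B S) (A : RawForm M (fiberT d 1) 1) {a : RawForm M B q}
    (hS : ∀ x L, SuppIn S (a x L)) {x₀ p : M} (hp : p ∈ (extChartAt (𝓡 d) x₀).source) :
    inChart x₀ (actForm A a) p =
      dyMul fun k L => B.lie (toVec (inChart x₀ A p fun _ => k)) (inChart x₀ a p L) := by
  have hg := isUnit_det_jac hp
  rw [inChart_eq, actForm, formAct_dyMul_lie LB hg _ (hS p), inChart_eq, inChart_eq]
  simp only [toVec_formAct]

end Covariance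

/-! ### Stability of the symmetry condition under linear operations and derivatives -/

namespace LawfulFiber

variable {B : FormalFiber d} (LF : LawfulFiber B) {q : ℕ}
include LF

lemma sym_zero : B.IsSym 0 := by
  obtain ⟨R, hR⟩ := LF.sym
  exact (hR 0).2 fun n n' c _ => by simp

lemma sym_add {a b : B.ι → FPS d} (ha : B.IsSym a) (hb : B.IsSym b) : B.IsSym (a + b) := by
  obtain ⟨R, hR⟩ := LF.sym
  refine (hR _).2 fun n n' c h => ?_
  rw [Pi.add_apply, Pi.add_apply, (hR a).1 ha n n' c h, (hR b).1 hb n n' c h, smul_add]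

lemma sym_smul (r : ℝ) {a : B.ι → FPS d} (ha : B.IsSym a) : B.IsSym (r • a) := by
  obtain ⟨R, hR⟩ := LF.sym
  refine (hR _).2 fun n n' c h => ?_
  rw [Pi.smul_apply, Pi.smul_apply, (hR a).1 ha n n' c h, smul_comm]

lemma sym_sum {κ : Type*} (s : Finset κ) {a : κ → B.ι → FPS d} (ha : ∀ k ∈ s, B.IsSym (a k)) :
    B.IsSym (∑ k ∈ s, a k) :=
  Finset.sum_induction a B.IsSym (fun _ _ => LF.sym_add) LF.sym_zero ha

/-- The symmetry condition is a condition on the single coefficients. -/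
lemma sym_of_coeff {a : B.ι → FPS d} (b : (Fin d →₀ ℕ) → B.ι → FPS d)
    (hb : ∀ m, B.IsSym (b m)) (hab : ∀ m n, coeff m (a n) = coeff m (b m n)) : B.IsSym a := by
  obtain ⟨R, hR⟩ := LF.sym
  refine (hR _).2 fun n n' c h => ?_
  ext m
  rw [map_smul, hab, hab, (hR _).1 (hb m) n n' c h, map_smul]

lemma sym_dyMul {c : Fin d → (Fin q → Fin d) → B.ι → FPS d} (hc : ∀ i L, B.IsSym (c i L))
    (L : Fin (q + 1) → Fin d) : B.IsSym (dyMul c L) :=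
  LF.sym_smul _ (LF.sym_sum _ fun _ _ => LF.sym_smul _ (hc _ _))

lemma sym_idxAct {c : (Fin q → Fin d) → B.ι → FPS d} (hc : ∀ L, B.IsSym (c L))
    (h : Matrix (Fin d) (Fin d) ℝ) (L : Fin q → Fin d) : B.IsSym (idxAct h c L) :=
  LF.sym_sum _ fun _ _ => LF.sym_smul _ (hc _)

lemma sym_pdF {α : EuclideanSpace ℝ (Fin d) → (Fin q → Fin d) → B.ι → FPS d}
    {z : EuclideanSpace ℝ (Fin d)} (h : ∀ᶠ w in nhds z, ∀ L, B.IsSym (α w L)) (i : Fin d)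
    (L : Fin q → Fin d) : B.IsSym (pdF α z i L) := by
  obtain ⟨R, hR⟩ := LF.sym
  refine (hR _).2 fun n n' c hn => ?_
  ext m
  rw [map_smul, coeff_pdF, coeff_pdF]
  have h1 : (fun w => coeff m (α w L n)) =ᶠ[nhds z] fun w => c • coeff m (α w L n') :=
    h.mono fun w hw => by simp only [(hR _).1 (hw L) n n' c hn, map_smul]
  rw [h1.fderiv_eq]
  exact congrArg (fun T : EuclideanSpace ℝ (Fin d) →L[ℝ] ℝ => T (e i))
    (congrFun (fderiv_const_smul_field (𝕜 := ℝ) (f := fun w => coeff m (α w L n')) c) z)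

end LawfulFiber

/-! ### Contraction with the Euler vector field -/

section Contraction

variable {B : FormalFiber d} {S : Finset B.ι} {q : ℕ}

/-- The contraction `yᵏ ∂/∂(dyᵏ)`, up to a factor. -/
noncomputable def contr {ι : Type*} (b : (Fin (q + 1) → Fin d) → ι → FPS d) :
    (Fin q → Fin d) → ι → FPS d := fun L => ∑ k, (X k : FPS d) • b (Fin.cons k L)

lemma coeff_contr {ι : Type*} (b : (Fin (q + 1) → Fin d) → ι → FPS d) (L : Fin q → Fin d) (n : ι)
    (m : Fin d →₀ ℕ) : coeff m (contr b L n) =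
      ∑ k, if 1 ≤ m k then coeff (m - Finsupp.single k 1) (b (Fin.cons k L) n) else 0 := by
  classical
  rw [contr, Finset.sum_apply, map_sum]
  refine Finset.sum_congr rfl fun k _ => ?_
  rw [Pi.smul_apply, smul_eq_mul, X, coeff_monomial_mul, one_mul]
  refine if_congr ?_ rfl rfl
  exact Finsupp.single_le_iff

/-- The operator `δ⁻¹` in a fiber. -/
noncomputable def dInv {ι : Type*} (b : (Fin (q + 1) → Fin d) → ι → FPS d) :
    (Fin q → Fin d) → ι → FPS d := fun L n m =>
  ((q + 1 : ℕ) : ℝ) / ((m.degree + q : ℕ) : ℝ) * coeff m (contr b L n)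

lemma coeff_dInv {ι : Type*} (b : (Fin (q + 1) → Fin d) → ι → FPS d) (L : Fin q → Fin d) (n : ι)
    (m : Fin d →₀ ℕ) : coeff m (dInv b L n) =
      ((q + 1 : ℕ) : ℝ) / ((m.degree + q : ℕ) : ℝ) * coeff m (contr b L n) := rfl

lemma deltaInv_eq {M : Type*} (a : RawForm M B (q + 1)) (x : M) :
    deltaInv a x = dInv (a x) := by
  funext L n
  ext m
  change (∑ k : Fin d, if 1 ≤ m k then ((q + 1 : ℕ) : ℝ) / ((m.degree + q : ℕ) : ℝ) *
    coeff (m - Finsupp.single k 1) (a x (Fin.cons k L) n) else 0) = _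
  rw [coeff_dInv, coeff_contr, Finset.mul_sum]
  refine Finset.sum_congr rfl fun k _ => ?_
  rw [mul_ite, mul_zero]

lemma contr_supp {b : (Fin (q + 1) → Fin d) → B.ι → FPS d} (hS : ∀ L, SuppIn S (b L))
    (L : Fin q → Fin d) : SuppIn S (contr b L) :=
  SuppIn.sum fun _ _ => (hS _).smul _

lemma dInv_supp {b : (Fin (q + 1) → Fin d) → B.ι → FPS d} (hS : ∀ L, SuppIn S (b L))
    (L : Fin q → Fin d) : SuppIn S (dInv b L) := fun n hn => by
  ext m
  rw [coeff_dInv, contr_supp hS L n hn, map_zero, mul_zero]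

lemma isAntisymm_iff_coeff {ι : Type*} {c : (Fin q → Fin d) → ι → FPS d} :
    IsAntisymm c ↔ ∀ n m, IsAntisymm fun L => coeff m (c L n) := by
  constructor
  · intro h n m π L
    simp only
    rw [h π L, Pi.smul_apply, map_zsmul]
  · intro h π L
    funext n
    ext m
    rw [Pi.smul_apply, map_zsmul]
    exact h n m π L

lemma contr_antisymm {ι : Type*} {b : (Fin (q + 1) → Fin d) → ι → FPS d} (hb : IsAntisymm b) :
    IsAntisymm (contr b) :=
  isAntisymm_sum _ fun k _ => (hb.cons k).map fun _ _ => smul_comm _ _ _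

lemma dInv_antisymm {ι : Type*} {b : (Fin (q + 1) → Fin d) → ι → FPS d} (hb : IsAntisymm b) :
    IsAntisymm (dInv b) :=
  isAntisymm_iff_coeff.2 fun n m =>
    (isAntisymm_iff_coeff.1 (contr_antisymm hb) n m).const_smul _

lemma contr_sym (LF : LawfulFiber B) {b : (Fin (q + 1) → Fin d) → B.ι → FPS d}
    (hb : ∀ L, B.IsSym (b L)) (L : Fin q → Fin d) : B.IsSym (contr b L) := by
  refine LF.sym_sum _ fun k _ => ?_
  obtain ⟨R, hR⟩ := LF.sym
  refine (hR _).2 fun n n' c h => ?_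
  rw [Pi.smul_apply, Pi.smul_apply, (hR _).1 (hb _) n n' c h, smul_comm]

lemma dInv_sym (LF : LawfulFiber B) {b : (Fin (q + 1) → Fin d) → B.ι → FPS d}
    (hb : ∀ L, B.IsSym (b L)) (L : Fin q → Fin d) : B.IsSym (dInv b L) :=
  LF.sym_of_coeff (fun m => (((q + 1 : ℕ) : ℝ) / ((m.degree + q : ℕ) : ℝ)) • contr b L)
    (fun _ => LF.sym_smul _ (contr_sym LF hb L)) fun m n => by
      rw [coeff_dInv, Pi.smul_apply, map_smul, smul_eq_mul]

variable (LB : FiberLaws B S)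
include LB

lemma formAct_coeff_congr {g : Matrix (Fin d) (Fin d) ℝ} (hg : IsUnit g.det)
    {a b : (Fin q → Fin d) → B.ι → FPS d} (ha : ∀ L, SuppIn S (a L)) (hb : ∀ L, SuppIn S (b L))
    {m : Fin d →₀ ℕ} {c : ℝ}
    (hab : ∀ L n k, k.degree = m.degree → coeff k (a L n) = c * coeff k (b L n))
    (L : Fin q → Fin d) (n : B.ι) : coeff m (formAct g a L n) = c * coeff m (formAct g b L n) := by
  simp only [formAct, idxAct, Finset.sum_apply, Pi.smul_apply, map_sum, map_smul, smul_eq_mul,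
    Finset.mul_sum]
  refine Finset.sum_congr rfl fun L' _ => ?_
  rw [LB.coeff_act_congr hg (ha L') (hb L') (hab L') n]
  ring

/-- `yᵏ` and `dyᵏ` transform by the same matrix, so the contraction with the Euler field is
invariant. -/
lemma formAct_contr {g : Matrix (Fin d) (Fin d) ℝ} (hg : IsUnit g.det)
    {b : (Fin (q + 1) → Fin d) → B.ι → FPS d} (hb : ∀ L, SuppIn S (b L)) :
    formAct g (contr b) = contr (formAct g b) := by
  funext L
  have h1 : ∀ L', B.act g (contr b L') =
      ∑ k', ∑ k, g⁻¹ k' k • (X k : FPS d) • B.act g (b (Fin.cons k' L')) := by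
    intro L'
    rw [contr, LB.act_sum hg _ fun k _ => (hb _).smul _]
    refine Finset.sum_congr rfl fun k' _ => ?_
    rw [LB.act_smul _ hg (hb _), substLin_X, Finset.sum_smul]
    simp only [smul_assoc]
  have h2 : ∀ k, formAct g b (Fin.cons k L) = ∑ k', ∑ L' : Fin q → Fin d,
      (g⁻¹ k' k * ∏ s, g⁻¹ (L' s) (L s)) • B.act g (b (Fin.cons k' L')) := by
    intro k
    rw [formAct, idxAct, ← (Fin.consEquiv fun _ : Fin (q + 1) => Fin d).sum_comp,
      Fintype.sum_prod_type]
    refine Finset.sum_congr rfl fun k' _ => Finset.sum_congr rfl fun L' _ => ?_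
    simp [Fin.consEquiv, Fin.prod_univ_succ]
  change idxAct g⁻¹ (fun L' => B.act g (contr b L')) L =
    ∑ k, (X k : FPS d) • formAct g b (Fin.cons k L)
  simp only [idxAct, h1, h2, Finset.smul_sum]
  rw [Finset.sum_comm]
  have h3 : ∀ k' : Fin d, (∑ L' : Fin q → Fin d, ∑ k, (∏ s, g⁻¹ (L' s) (L s)) • g⁻¹ k' k •
      (X k : FPS d) • B.act g (b (Fin.cons k' L'))) =
      ∑ k, ∑ L' : Fin q → Fin d, (X k : FPS d) • (g⁻¹ k' k * ∏ s, g⁻¹ (L' s) (L s)) •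
        B.act g (b (Fin.cons k' L')) := by
    intro k'
    rw [Finset.sum_comm]
    refine Finset.sum_congr rfl fun k _ => Finset.sum_congr rfl fun L' _ => ?_
    rw [smul_smul, mul_comm, smul_comm]
  simp only [h3]
  exact Finset.sum_comm

/-- The contraction is invariant, and the normalizing factor depends only on the degree in `y`,
which linear changes preserve. -/
lemma formAct_dInv {g : Matrix (Fin d) (Fin d) ℝ} (hg : IsUnit g.det)
    {b : (Fin (q + 1) → Fin d) → B.ι → FPS d} (hb : ∀ L, SuppIn S (b L)) :
    formAct g (dInv b) = dInv (formAct g b) := by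
  funext L n
  ext m
  rw [coeff_dInv, ← formAct_contr LB hg hb]
  refine formAct_coeff_congr LB hg (dInv_supp hb) (contr_supp hb) (fun L n k hk => ?_) L n
  rw [coeff_dInv, hk]

end Contraction

/-! ### The operators preserve smooth forms -/

section Forms

variable {M : Type*} [TopologicalSpace M] [ChartedSpace (EuclideanSpace ℝ (Fin d)) M]
  [IsManifold (𝓡 d) ∞ M] {B : FormalFiber d} {S : Finset B.ι} {q : ℕ}

/-- `a` is an element of `Ω^q(M, B)` with components in `S`. -/
structure FormIn (S : Finset B.ι) (a : RawForm M B q) : Prop where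
  antisymm : ∀ x, IsAntisymm (a x)
  sym : ∀ x L, B.IsSym (a x L)
  supp : ∀ x L, SuppIn S (a x L)
  smooth : ∀ {x₀ p : M}, p ∈ (extChartAt (𝓡 d) x₀).source → SmoothNear x₀ p a

/-- Making the finite set of components explicit allows the use of fiber laws on such a set;
smoothness on the manifold is translated into smoothness in chart coordinates. -/
lemma isForm_iff {a : RawForm M B q} : IsForm B q a ↔ ∃ S, FormIn S a := by
  have key : (∀ (x₀ : M) (L : Fin q → Fin d) (n : B.ι) (m : Fin d →₀ ℕ),
      ContMDiffOn (𝓡 d) 𝓘(ℝ) ∞ (fun x => MvPowerSeries.coeff m (inChart x₀ a x L n))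
      (chartAt (EuclideanSpace ℝ (Fin d)) x₀).source) ↔
      ∀ {x₀ p : M}, p ∈ (extChartAt (𝓡 d) x₀).source → SmoothNear x₀ p a := by
    simp only [extChartAt_source]
    constructor
    · intro h x₀ p hp L n m
      have h1 := (h x₀ L n m).contMDiffAt ((chartAt _ x₀).open_source.mem_nhds hp)
      exact (contMDiffAt_iff_comp_symm (by rwa [extChartAt_source])).1 h1
    · intro h x₀ L n m p hp
      exact ((contMDiffAt_iff_comp_symm (by rwa [extChartAt_source])).2
        (h hp L n m)).contMDiffWithinAt
  constructor
  · rintro ⟨h1, h2, ⟨S, h3⟩, h4⟩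
    exact ⟨S, h1, h2, h3, key.1 h4⟩
  · rintro ⟨S, h1, h2, h3, h4⟩
    exact ⟨h1, h2, ⟨S, h3⟩, key.2 h4⟩

namespace FormIn

lemma mono {T : Finset B.ι} (h : S ⊆ T) {a : RawForm M B q} (ha : FormIn S a) : FormIn T a :=
  ⟨ha.antisymm, ha.sym, fun x L => (ha.supp x L).mono h, ha.smooth⟩

variable (LF : LawfulFiber B) (LB : FiberLaws B S) {a b : RawForm M B q}
include LF LB

omit LF in
lemma loc_add (ha : FormIn S a) (hb : FormIn S b) {x₀ p : M}
    (hp : p ∈ (extChartAt (𝓡 d) x₀).source) :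
    loc x₀ (a + b) =ᶠ[nhds (extChartAt (𝓡 d) x₀ p)] loc x₀ a + loc x₀ b :=
  (eventually_source hp (source_mem_nhds hp)).mono fun w hw => by
    rw [Pi.add_apply, loc, loc, loc, inChart_eq, inChart_eq, inChart_eq, Pi.add_apply,
      formAct_add LB (isUnit_det_jac hw) (ha.supp _) (hb.supp _)]

omit LF in
lemma loc_smul (c : ℝ) (ha : FormIn S a) {x₀ p : M}
    (hp : p ∈ (extChartAt (𝓡 d) x₀).source) :
    loc x₀ (c • a) =ᶠ[nhds (extChartAt (𝓡 d) x₀ p)] c • loc x₀ a :=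
  (eventually_source hp (source_mem_nhds hp)).mono fun w hw => by
    rw [Pi.smul_apply, loc, loc, inChart_eq, inChart_eq, Pi.smul_apply,
      formAct_smul LB (isUnit_det_jac hw) _ (ha.supp _)]

lemma add (ha : FormIn S a) (hb : FormIn S b) : FormIn S (a + b) where
  antisymm x := (ha.antisymm x).add (hb.antisymm x)
  sym x L := LF.sym_add (ha.sym x L) (hb.sym x L)
  supp x L := (ha.supp x L).add (hb.supp x L)
  smooth hp L n := ((ha.smooth hp L n).add (hb.smooth hp L n)).congr
    ((loc_add LB ha hb hp).mono fun w hw => by simp only [hw]; rfl)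

lemma smul (c : ℝ) (ha : FormIn S a) : FormIn S (c • a) where
  antisymm x := (ha.antisymm x).const_smul c
  sym x L := LF.sym_smul c (ha.sym x L)
  supp x L := (ha.supp x L).real_smul c
  smooth hp L n := ((ha.smooth hp L n).const_smul c).congr
    ((loc_smul LB c ha hp).mono fun w hw => by simp only [hw]; rfl)

lemma sub (ha : FormIn S a) (hb : FormIn S b) : FormIn S (a - b) := by
  have h : a - b = a + (-1 : ℝ) • b := by
    rw [neg_one_smul, sub_eq_add_neg]
  rw [h]
  exact ha.add LF LB (hb.smul LF LB _)

lemma zero : FormIn S (0 : RawForm M B q) where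
  antisymm x π L := by simp
  sym x L := LF.sym_zero
  supp x L := SuppIn.zero
  smooth {x₀ p} hp L n := (SmoothAt.const 0).congr
    ((eventually_source hp (source_mem_nhds hp)).mono fun w hw => by
      have h := formAct_smul LB (isUnit_det_jac hw) 0
        (a := (0 : (Fin q → Fin d) → B.ι → FPS d)) fun L => SuppIn.zero
      rw [zero_smul, zero_smul] at h
      simp only
      rw [loc, inChart_eq, Pi.zero_apply, h]
      rfl)

omit LB in
lemma inChart_sym (ha : FormIn S a) (x₀ p : M) (L : Fin q → Fin d) :
    B.IsSym (inChart x₀ a p L) := by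
  rw [inChart_eq]
  exact LF.sym_idxAct (fun L => LF.act_sym _ _ (ha.sym p L)) _ L

lemma delta (ha : FormIn S a) : FormIn S (delta a) where
  antisymm x := IsAntisymm.dyMul fun i => (ha.antisymm x).lie LB (ha.supp x) _
  sym x := LF.sym_dyMul fun i L => LF.lie_sym _ _ (ha.sym x L)
  supp x := SuppIn.dyMul fun i L => LB.lie_supp (ha.supp x L)
  smooth {x₀ p} hp L n := (dyMul_smoothAt (c := fun w i L => B.lie (Pi.single i 1) (loc x₀ a w L))
    (fun i L n => LB.lie_smoothAt (fun k => SmoothAt.const ((Pi.single i 1 : Fin d → FPS d) k))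
      ((loc_supp LB ha.supp hp).mono fun _ h => h L) (ha.smooth hp L) n) L n).congr
    ((eventually_source hp (source_mem_nhds hp)).mono fun w hw => by
      simp only [loc]
      rw [inChart_delta LB ha.supp hw])

lemma actForm {T : Finset (fiberT d 1).ι} {A : RawForm M (fiberT d 1) 1} (hA : FormIn T A)
    (ha : FormIn S a) : FormIn S (actForm A a) where
  antisymm x := IsAntisymm.dyMul fun i => (ha.antisymm x).lie LB (ha.supp x) _
  sym x := LF.sym_dyMul fun i L => LF.lie_sym _ _ (ha.sym x L)
  supp x := SuppIn.dyMul fun i L => LB.lie_supp (ha.supp x L)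
  smooth {x₀ p} hp L n := (dyMul_smoothAt
    (c := fun w i L => B.lie (toVec (loc x₀ A w fun _ => i)) (loc x₀ a w L))
    (fun i L n => LB.lie_smoothAt (fun k => hA.smooth hp (fun _ => i) fun _ => k)
      ((loc_supp LB ha.supp hp).mono fun _ h => h L) (ha.smooth hp L) n) L n).congr
    ((eventually_source hp (source_mem_nhds hp)).mono fun w hw => by
      simp only [loc]
      rw [inChart_actForm LB A ha.supp hw])

lemma deltaInv {a : RawForm M B (q + 1)} (ha : FormIn S a) : FormIn S (deltaInv a) where
  antisymm x := by
    rw [deltaInv_eq]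
    exact dInv_antisymm (ha.antisymm x)
  sym x := by
    rw [deltaInv_eq]
    exact dInv_sym LF (ha.sym x)
  supp x := by
    rw [deltaInv_eq]
    exact dInv_supp (ha.supp x)
  smooth {x₀ p} hp L n m := by
    have h1 : (fun w => coeff m (loc x₀ (Fedosov.deltaInv a) w L n))
        =ᶠ[nhds (extChartAt (𝓡 d) x₀ p)] fun w => ((q + 1 : ℕ) : ℝ) / ((m.degree + q : ℕ) : ℝ) *
          coeff m (contr (loc x₀ a w) L n) :=
      (eventually_source hp (source_mem_nhds hp)).mono fun w hw => by
        simp only [loc]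
        rw [inChart_eq, deltaInv_eq, formAct_dInv LB (isUnit_det_jac hw) (ha.supp _), ← inChart_eq,
          coeff_dInv]
    refine ContDiffAt.congr_of_eventuallyEq ?_ h1
    refine contDiffAt_const.mul ?_
    have h2 : SmoothAt (fun w => contr (loc x₀ a w) L n) (extChartAt (𝓡 d) x₀ p) := by
      simp only [contr, Finset.sum_apply, Pi.smul_apply, smul_eq_mul]
      exact SmoothAt.sum fun k _ => (SmoothAt.const _).mul (ha.smooth hp _ n)
    exact h2 m

end FormIn

variable (cov : CovariantDerivative (𝓡 d) (EuclideanSpace ℝ (Fin d))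
  (TangentSpace (𝓡 d) : M → Type _))

lemma locGamma_smoothAt [T2Space M] [CovariantDerivative.ContMDiffCovariantDerivative cov ∞]
    {x₀ p : M} (hp : p ∈ (extChartAt (𝓡 d) x₀).source) (i k : Fin d) :
    SmoothAt (fun w => locGamma cov x₀ ((extChartAt (𝓡 d) x₀).symm w) i k)
      (extChartAt (𝓡 d) x₀ p) :=
  (SmoothAt.sum fun j _ => SmoothAt.smul
    (contDiffAt_locChristoffel cov ((extChartAt (𝓡 d) x₀).map_source hp) i j k)
    (SmoothAt.const _)).neg

/-- The connection form of `∇` in the chart at `x₀`. -/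
noncomputable def gammaForm (x₀ : M) (w : EuclideanSpace ℝ (Fin d)) : Fin d → Fin d → FPS d :=
  locGamma cov x₀ ((extChartAt (𝓡 d) x₀).symm w)

/-- Smoothness is required only near `p`, so that the statement applies to `coordSection`, whose
smoothness is available only on the domain of its chart. -/
lemma loc_nabla (LB : FiberLaws B S) {a : RawForm M B q} (hS : ∀ x L, SuppIn S (a x L))
    (has : ∀ x, IsAntisymm (a x)) {x₀ p : M} (hp : p ∈ (extChartAt (𝓡 d) x₀).source)
    (hsm : ∀ᶠ p' in nhds p, SmoothNear x₀ p' a) :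
    loc x₀ (nabla cov a) =ᶠ[nhds (extChartAt (𝓡 d) x₀ p)]
      locD (gammaForm cov x₀) (loc x₀ a) := by
  filter_upwards [eventually_source hp (source_mem_nhds hp), eventually_source hp hsm,
    target_mem_nhds ((extChartAt (𝓡 d) x₀).map_source hp)] with w hw hw' hwt
  rw [loc, inChart_nabla cov LB hS has hw hw', (extChartAt (𝓡 d) x₀).right_inv hwt]
  rfl

lemma SmoothNear.nabla [T2Space M] [CovariantDerivative.ContMDiffCovariantDerivative cov ∞]
    (LB : FiberLaws B S) {a : RawForm M B q} (hS : ∀ x L, SuppIn S (a x L))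
    (has : ∀ x, IsAntisymm (a x)) {x₀ p : M} (hp : p ∈ (extChartAt (𝓡 d) x₀).source)
    (hsm : ∀ᶠ p' in nhds p, SmoothNear x₀ p' a) : SmoothNear x₀ p (nabla cov a) := fun L n =>
  (locD_smoothAt LB (loc_supp LB hS hp) hsm.self_of_nhds (locGamma_smoothAt cov hp) L n).congr
    ((loc_nabla cov LB hS has hp hsm).mono fun w hw => by simp only [hw]; rfl)

lemma FormIn.nabla [T2Space M] [CovariantDerivative.ContMDiffCovariantDerivative cov ∞]
    (LF : LawfulFiber B) (LB : FiberLaws B S) {a : RawForm M B q} (ha : FormIn S a) :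
    FormIn S (nabla cov a) where
  antisymm x := IsAntisymm.dyMul fun i => (pdF_antisymm (loc_antisymm LB ha.supp ha.antisymm
    (mem_source_self x)) i).add ((ha.antisymm x).lie LB (ha.supp x) _)
  sym x := LF.sym_dyMul fun i L => LF.sym_add (LF.sym_pdF (Filter.Eventually.of_forall fun _ L =>
    ha.inChart_sym LF x _ L) i L) (LF.lie_sym _ _ (ha.sym x L))
  supp x := SuppIn.dyMul fun i L => (pdF_supp (loc_supp LB ha.supp (mem_source_self x)) i L).add
    (LB.lie_supp (ha.supp x L))
  smooth hp := SmoothNear.nabla cov LB ha.supp ha.antisymm hp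
    (Filter.eventually_of_mem (source_mem_nhds hp) fun _ h => ha.smooth h)

end Forms

lemma dyMul_zero_index {X : Type*} [AddCommGroup X] [Module ℝ X]
    (c : Fin d → (Fin 0 → Fin d) → X) (L : Fin 1 → Fin d) : dyMul c L = c (L 0) Fin.elim0 := by
  simp [dyMul, Subsingleton.elim ((0 : Fin 1).removeNth L) Fin.elim0]

lemma dyMul_one_index {X : Type*} [AddCommGroup X] [Module ℝ X]
    (c : Fin d → (Fin 1 → Fin d) → X) (L : Fin 2 → Fin d) :
    dyMul c L = (1 / 2 : ℝ) • (c (L 0) (fun _ => L 1) - c (L 1) fun _ => L 0) := by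
  have h0 : (0 : Fin 2).removeNth L = fun _ => L 1 := by
    funext s
    rw [Subsingleton.elim s 0]
    rfl
  have h1 : (1 : Fin 2).removeNth L = fun _ => L 0 := by
    funext s
    rw [Subsingleton.elim s 0]
    rfl
  refine (congrArg _ (Fin.sum_univ_two _)).trans ?_
  simp only [h0, h1]
  norm_num
  rw [smul_sub, sub_eq_add_neg]

lemma dyMul_two_index {X : Type*} [AddCommGroup X] [Module ℝ X]
    (c : Fin d → (Fin 2 → Fin d) → X) (L : Fin 3 → Fin d) :
    dyMul c L = (1 / 3 : ℝ) •
      (c (L 0) ![L 1, L 2] - c (L 1) ![L 0, L 2] + c (L 2) ![L 0, L 1]) := by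
  have h0 : (0 : Fin 3).removeNth L = ![L 1, L 2] := by
    funext s
    fin_cases s <;> rfl
  have h1 : (1 : Fin 3).removeNth L = ![L 0, L 2] := by
    funext s
    fin_cases s <;> rfl
  have h2 : (2 : Fin 3).removeNth L = ![L 0, L 1] := by
    funext s
    fin_cases s <;> rfl
  refine (congrArg _ (Fin.sum_univ_three _)).trans ?_
  simp only [h0, h1, h2]
  norm_num
  rw [smul_sub, sub_eq_add_neg]

section VectorValued

/-- On vector fields the Schouten–Nijenhuis bracket is the commutator, so vector-valued forms can be
treated with `vbr`. -/
lemma fiberT_lie_one (v : Fin d → FPS d) (a : (fiberT d 1).ι → FPS d) :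
    toVec ((fiberT d 1).lie v a) = vbr v (toVec a) := by
  funext j
  have h : ∀ l : Fin d, Function.update (fun _ : Fin 1 => j) 0 l = fun _ => l := fun l => by
    funext s
    rw [Subsingleton.elim s 0, Function.update_self]
  simp only [toVec, fiberT, vbr, Fin.sum_univ_one, h]
  congr 1
  exact Finset.sum_congr rfl fun l _ => mul_comm _ _

lemma eq_toVec (a : (fiberT d 1).ι → FPS d) (J : (fiberT d 1).ι) : a J = toVec a (J 0) := by
  rw [toVec]
  congr 1
  funext s
  rw [Subsingleton.elim s 0]

lemma toVec_injective {a b : (fiberT d 1).ι → FPS d} (h : toVec a = toVec b) : a = b := by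
  funext J
  rw [eq_toVec a, eq_toVec b, h]

variable {W : EuclideanSpace ℝ (Fin d) → Fin d → Fin d → FPS d} {z : EuclideanSpace ℝ (Fin d)}

lemma curvV_swap (i j : Fin d) : curvV W z j i = -curvV W z i j := by
  funext k
  simp only [curvV, vbr, Pi.add_apply, Pi.sub_apply, Pi.neg_apply]
  abel

lemma curvV_smoothAt (hW : ∀ i k, SmoothAt (fun w => W w i k) z) (i j k : Fin d) :
    SmoothAt (fun w => curvV W w i j k) z :=
  ((pdV_smooth (hW j k)).sub (pdV_smooth (hW i k))).add
    ((SmoothAt.vfApply (hW i) (hW j k)).sub (SmoothAt.vfApply (hW j) (hW i k)))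

end VectorValued

lemma isAntisymm_two {X : Type*} [AddCommGroup X] {c : Fin d → Fin d → X}
    (h : ∀ i j, c j i = -c i j) : IsAntisymm fun L : Fin 2 → Fin d => c (L 0) (L 1) := by
  intro π L
  have hπ : ∀ π : Equiv.Perm (Fin 2), π = 1 ∨ π = Equiv.swap 0 1 := by decide
  rcases hπ π with rfl | rfl
  · simp
  · simp [h (L 0) (L 1)]

lemma formAct_zero_index {B : FormalFiber d} (g : Matrix (Fin d) (Fin d) ℝ)
    (a : (Fin 0 → Fin d) → B.ι → FPS d) (L : Fin 0 → Fin d) : formAct g a L = B.act g (a L) := by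
  rw [formAct, idxAct, Fintype.sum_unique, Subsingleton.elim L default]
  simp

lemma vfApply_X (v : Fin d → FPS d) (k : Fin d) : vfApply v (X k) = v k := by
  rw [vfApply, Finset.sum_eq_single k]
  · rw [pderiv_X, Pi.single_eq_same, mul_one]
  · intro j _ hj
    rw [pderiv_X, Pi.single_eq_of_ne hj.symm, mul_zero]
  · simp

/-! ### The curvature form of the connection -/

section Curvature

variable {M : Type*} [TopologicalSpace M] [ChartedSpace (EuclideanSpace ℝ (Fin d)) M]
  [IsManifold (𝓡 d) ∞ M] {B : FormalFiber d} {S : Finset B.ι} {q : ℕ}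

variable (cov : CovariantDerivative (𝓡 d) (EuclideanSpace ℝ (Fin d))
  (TangentSpace (𝓡 d) : M → Type _))

lemma gammaForm_apply (x₀ : M) (w : EuclideanSpace ℝ (Fin d)) (i k : Fin d) :
    gammaForm cov x₀ w i k =
      -∑ j, locChristoffel cov x₀ ((extChartAt (𝓡 d) x₀).symm w) i j k • (X j : FPS d) := rfl

section

variable [T2Space M] [CovariantDerivative.ContMDiffCovariantDerivative cov ∞]

lemma pdV_gammaForm {x₀ p : M} (hp : p ∈ (extChartAt (𝓡 d) x₀).source) (i j k : Fin d) :
    pdV (gammaForm cov x₀) (extChartAt (𝓡 d) x₀ p) i j k = -∑ l, fderiv ℝ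
      (fun w => locChristoffel cov x₀ ((extChartAt (𝓡 d) x₀).symm w) j l k)
      (extChartAt (𝓡 d) x₀ p) (e i) • (X l : FPS d) := by
  refine (pdV_line (locGamma_smoothAt cov hp j k)).unique ?_
  have h1 : ∀ l, HasDerivAt (fun t : ℝ => locChristoffel cov x₀ ((extChartAt (𝓡 d) x₀).symm
      (extChartAt (𝓡 d) x₀ p + t • e i)) j l k) (fderiv ℝ
        (fun w => locChristoffel cov x₀ ((extChartAt (𝓡 d) x₀).symm w) j l k)
        (extChartAt (𝓡 d) x₀ p) (e i)) 0 := fun l => by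
    have h3 : HasFDerivAt (fun w => locChristoffel cov x₀ ((extChartAt (𝓡 d) x₀).symm w) j l k)
        (fderiv ℝ (fun w => locChristoffel cov x₀ ((extChartAt (𝓡 d) x₀).symm w) j l k)
          (extChartAt (𝓡 d) x₀ p)) (extChartAt (𝓡 d) x₀ p + (0 : ℝ) • e i) := by
      rw [zero_smul, add_zero]
      exact ((contDiffAt_locChristoffel cov ((extChartAt (𝓡 d) x₀).map_source hp) j l
        k).differentiableAt (by simp)).hasFDerivAt
    exact h3.comp_hasDerivAt (0 : ℝ) (hasDerivAt_line _ (e i))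
  refine HasDer.of_eq (HasDer.sum (s := Finset.univ) fun l _ => HasDer.smul (h1 l)
    (HasDer.const (X l : FPS d))).neg (fun t => gammaForm_apply cov x₀ _ j k) ?_
  simp

/-- `Γᵢ` is the linear field with matrix `-Γᵏᵢⱼ`. Its curvature is again linear, and differentiating
the coefficients together with the commutator of linear fields gives minus the classical expression
`riemann_eq`. -/
lemma curvForm_eq (p : M) (L : Fin 2 → Fin d) (J : (fiberT d 1).ι) : curvForm cov p L J =
    (1 / 2 : ℝ) • curvV (gammaForm cov p) (extChartAt (𝓡 d) p p) (L 0) (L 1) (J 0) := by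
  have hpp := mem_source_self (d := d) p
  have h1 : ∀ i k, gammaForm cov p (extChartAt (𝓡 d) p p) i k =
      -∑ j, christoffel cov p i j k • (X j : FPS d) := fun i k => by
    simp only [gammaForm_apply, (extChartAt (𝓡 d) p).left_inv hpp, locChristoffel_self]
  have h2 : ∀ i j k, vfApply (gammaForm cov p (extChartAt (𝓡 d) p p) i)
      (gammaForm cov p (extChartAt (𝓡 d) p p) j k) =
      ∑ l, (∑ c, christoffel cov p i l c * christoffel cov p j c k) • (X l : FPS d) := by
    intro i j k
    have h3 : ∀ c, pderiv ℝ c (-∑ x, christoffel cov p j x k • (X x : FPS d)) =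
        -(christoffel cov p j c k • (1 : FPS d)) := fun c => by
      rw [map_neg, map_sum, Finset.sum_eq_single c]
      · rw [Derivation.map_smul, pderiv_X, Pi.single_eq_same]
      · intro x _ hx
        rw [Derivation.map_smul, pderiv_X, Pi.single_eq_of_ne hx, smul_zero]
      · simp
    simp only [vfApply, h1, h3, neg_mul_neg, mul_smul_comm, mul_one, Finset.smul_sum, smul_smul,
      Finset.sum_smul]
    rw [Finset.sum_comm]
    exact Finset.sum_congr rfl fun l _ => Finset.sum_congr rfl fun c _ => by rw [mul_comm]
  rw [curvForm, curvV]
  simp only [Pi.add_apply, Pi.sub_apply, pdV_gammaForm cov hpp, vbr, h2, riemann_eq]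
  rw [← smul_neg]
  congr 1
  simp only [add_smul, sub_smul, Finset.sum_add_distrib, Finset.sum_sub_distrib]
  abel

/-- The set of all components of `SM`. -/
def setSM (d : ℕ) : Finset (fiberSM d).ι := (Finset.univ : Finset Unit)

omit [T2Space M] [CovariantDerivative.ContMDiffCovariantDerivative cov ∞] in
lemma suppIn_setSM (a : (fiberSM d).ι → FPS d) : SuppIn (setSM d) a :=
  fun n hn => absurd (Finset.mem_univ (α := Unit) n) hn

/-- A section of `SM` with the component `yᵏ` in the chart at `x₀`. -/
noncomputable def coordSection (x₀ : M) (k : Fin d) : RawForm M (fiberSM d) 0 := fun p =>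
  formAct (jac x₀ p)⁻¹ fun _ _ => X k

omit [T2Space M] [CovariantDerivative.ContMDiffCovariantDerivative cov ∞] in
lemma inChart_coordSection {x₀ p : M} (hp : p ∈ (extChartAt (𝓡 d) x₀).source) (k : Fin d) :
    inChart x₀ (coordSection x₀ k) p = fun _ _ => X k := by
  have hg := isUnit_det_jac hp
  rw [inChart_eq, coordSection, ← formAct_mul (S := setSM d) (fiberLaws_SM d) hg
    (isUnit_det_inv hg) (fun L => suppIn_setSM _), Matrix.mul_nonsing_inv _ hg, 
    formAct_one (S := setSM d) (fiberLaws_SM d) fun L => suppIn_setSM _]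

lemma inChart_nabla_nabla (LB : FiberLaws B S) {a : RawForm M B q}
    (hS : ∀ x L, SuppIn S (a x L)) (has : ∀ x, IsAntisymm (a x)) {x₀ p : M}
    (hp : p ∈ (extChartAt (𝓡 d) x₀).source)
    (hsm : ∀ᶠ p' in nhds p, SmoothNear x₀ p' a) :
    inChart x₀ (nabla cov (nabla cov a)) p = dyMul fun i => dyMul fun j L =>
      (1 / 2 : ℝ) • B.lie (curvV (gammaForm cov x₀) (extChartAt (𝓡 d) x₀ p) i j)
        (inChart x₀ a p L) := by
  have hS' : ∀ x L, SuppIn S (nabla cov a x L) := fun x =>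
    SuppIn.dyMul fun i L => (pdF_supp (loc_supp LB hS (mem_source_self x)) i L).add
      (LB.lie_supp (hS x L))
  have has' : ∀ x, IsAntisymm (nabla cov a x) := fun x =>
    IsAntisymm.dyMul fun i => (pdF_antisymm (loc_antisymm LB hS has
      (mem_source_self x)) i).add ((has x).lie LB (hS x) _)
  -- The outer `∇` differentiates the inner one, so the local expression of the inner one must hold
  -- and be smooth on a neighbourhood.
  have h1 := loc_nabla cov LB hS' has' hp (by
    filter_upwards [source_mem_nhds hp, hsm.eventually_nhds] with p' hp' hev
    exact SmoothNear.nabla cov LB hS has hp' hev)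
  have h2 := h1.self_of_nhds
  rw [loc_chart hp] at h2
  rw [h2, ← loc_chart hp a, ← locD_locD (W := gammaForm cov x₀) LB (loc_supp LB hS hp) (loc_antisymm LB hS has hp)
    hsm.self_of_nhds (locGamma_smoothAt cov hp)]
  have h3 := loc_nabla cov LB hS has hp hsm
  simp only [locD]
  congr 1
  funext i L
  rw [pdF_congr h3, h3.self_of_nhds]
  rfl

/-- The curvature form in the chart at `x₀`. -/
lemma inChart_curvForm {x₀ p : M} (hp : p ∈ (extChartAt (𝓡 d) x₀).source) (L : Fin 2 → Fin d)
    (J : (fiberT d 1).ι) : inChart x₀ (curvForm cov) p L J = (1 / 2 : ℝ) •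
      curvV (gammaForm cov x₀) (extChartAt (𝓡 d) x₀ p) (L 0) (L 1) (J 0) := by
  have hg := isUnit_det_jac hp
  have hpp := mem_source_self (d := d) p
  set k := J 0 with hk
  -- The transformation of the curvature is deduced from that of `∇²`. On the section equal to `yᵏ`
  -- in the chart at `x₀`, the form `∇² yᵏ` is half the `k`-th component of the curvature; in the
  -- chart at `p` the same section is a linear form whose coefficients are entries of the Jacobi
  -- matrix.
  let t : RawForm M (fiberSM d) 0 := coordSection x₀ k
  have hS : ∀ x L, SuppIn (setSM d) (t x L) := fun x L => suppIn_setSM _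
  have has : ∀ x, IsAntisymm (t x) := fun x => isAntisymm_fin_zero _
  have hsm : ∀ p' ∈ (extChartAt (𝓡 d) x₀).source, SmoothNear x₀ p' t := fun p' hp' L n =>
    (SmoothAt.const (X k)).congr ((eventually_source hp' (source_mem_nhds hp')).mono
      fun w hw => by
        simp only [loc, t]
        rw [inChart_coordSection hw])
  have hval : ∀ (K : Fin d → Fin d → Fin d → FPS d) (u : (Fin 0 → Fin d) → (fiberSM d).ι → FPS d)
      (L : Fin 2 → Fin d), (∀ i j, K j i = -K i j) → dyMul (fun i => dyMul fun j L =>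
        (1 / 2 : ℝ) • (fiberSM d).lie (K i j) (u L)) L () =
        (1 / 2 : ℝ) • vfApply (K (L 0) (L 1)) (u Fin.elim0 ()) := by
    intro K u L hK
    rw [dyMul_one_index, dyMul_zero_index, dyMul_zero_index, hK (L 0) (L 1)]
    change (1 / 2 : ℝ) • ((1 / 2 : ℝ) • vfApply (K (L 0) (L 1)) (u Fin.elim0 ()) -
      (1 / 2 : ℝ) • vfApply (-K (L 0) (L 1)) (u Fin.elim0 ())) = _
    rw [vfApply_neg_left, smul_neg, sub_neg_eq_add, ← add_smul]
    norm_num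
  have e0 : inChart x₀ (nabla cov (nabla cov t)) p L () = (1 / 2 : ℝ) •
      curvV (gammaForm cov x₀) (extChartAt (𝓡 d) x₀ p) (L 0) (L 1) k := by
    rw [inChart_nabla_nabla cov (fiberLaws_SM d) hS has hp
      (Filter.eventually_of_mem (source_mem_nhds hp) hsm)]
    refine (hval _ _ _ fun i j => curvV_swap i j).trans ?_
    rw [inChart_coordSection hp, vfApply_X]
  have e1 : ∀ L' : Fin 2 → Fin d, nabla cov (nabla cov t) p L' () = ∑ c, jac x₀ p k c •
      (1 / 2 : ℝ) • curvV (gammaForm cov p) (extChartAt (𝓡 d) p p) (L' 0) (L' 1) c := by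
    intro L'
    have hS2 : ∀ x L, SuppIn (setSM d) (nabla cov (nabla cov t) x L) := fun x L => suppIn_setSM _
    rw [← inChart_self (fiberLaws_SM d) hS2 p, inChart_nabla_nabla cov (fiberLaws_SM d) hS has hpp
      (by
        filter_upwards [source_mem_nhds hp, source_mem_nhds hpp] with p' hp' hpp'
        exact (hsm p' hp').change (fiberLaws_SM d) hS hp' hpp'),
      inChart_self (fiberLaws_SM d) hS p]
    refine (hval _ _ _ fun i j => curvV_swap i j).trans ?_
    have h1 : t p Fin.elim0 () = ∑ c, jac x₀ p k c • (X c : FPS d) := by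
      simp only [t, coordSection]
      rw [formAct_zero_index]
      change substLin _ (X k) = _
      rw [Matrix.nonsing_inv_nonsing_inv _ hg, substLin_X]
    rw [h1, vfApply_sum, Finset.smul_sum]
    refine Finset.sum_congr rfl fun c _ => ?_
    rw [vfApply_smul, vfApply_X, smul_comm]
  rw [← e0, inChart_eq, inChart_eq, formAct, formAct, idxAct, idxAct]
  refine (Finset.sum_apply (M := fun _ : (Fin 1 → Fin d) => FPS d) _ _ _).trans ?_
  refine Eq.trans ?_ (Finset.sum_apply (M := fun _ : Unit => FPS d) _ _ _).symm
  refine Finset.sum_congr rfl fun L' _ => congrArg (fun f : FPS d =>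
    (∏ s, (jac (d := d) x₀ p)⁻¹ (L' s) (L s)) • f) ?_
  change ∑ J' : Fin 1 → Fin d, (∏ s, jac (d := d) x₀ p (J s) (J' s)) •
    substLin (jac (d := d) x₀ p)⁻¹ (curvForm cov p L' J') =
      substLin (jac (d := d) x₀ p)⁻¹ (nabla cov (nabla cov t) p L' ())
  rw [e1, sum_fin_one, substLin_sum]
  refine Finset.sum_congr rfl fun c _ => ?_
  rw [Fin.prod_univ_one, substLin_smul]
  exact congrArg (fun f : FPS d => jac (d := d) x₀ p k c • substLin (jac (d := d) x₀ p)⁻¹ f)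
    (curvForm_eq cov p L' fun _ => c)

/-- The set of all components of `T_poly`. -/
def setT (d r : ℕ) : Finset (fiberT d r).ι := (Finset.univ : Finset (Fin r → Fin d))

omit [T2Space M] [CovariantDerivative.ContMDiffCovariantDerivative cov ∞] in
lemma suppIn_setT {r : ℕ} (a : (fiberT d r).ι → FPS d) : SuppIn (setT d r) a :=
  fun n hn => absurd (Finset.mem_univ (α := Fin r → Fin d) n) hn

lemma curvForm_formIn : FormIn (setT d 1) (curvForm cov) where
  antisymm x := by
    refine isAntisymm_iff_coeff.2 fun J m => ?_
    simp only [curvForm_eq]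
    refine isAntisymm_two (c := fun i j => coeff m ((1 / 2 : ℝ) •
      curvV (gammaForm cov x) (extChartAt (𝓡 d) x x) i j (J 0))) fun i j => ?_
    rw [curvV_swap i j, Pi.neg_apply, smul_neg, map_neg]
  sym x L := isAntisymm_fin_one _
  supp x L := suppIn_setT _
  smooth {x₀ p} hp L J := by
    refine SmoothAt.congr ?_ ((eventually_source hp (source_mem_nhds hp)).mono fun w hw =>
      inChart_curvForm cov hw L J)
    have h : ∀ᶠ w in nhds (extChartAt (𝓡 d) x₀ p),
        extChartAt (𝓡 d) x₀ ((extChartAt (𝓡 d) x₀).symm w) = w :=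
      (target_mem_nhds ((extChartAt (𝓡 d) x₀).map_source hp)) |> Filter.eventually_of_mem <|
        fun w hw => (extChartAt (𝓡 d) x₀).right_inv hw
    exact ((curvV_smoothAt (locGamma_smoothAt cov hp) (L 0) (L 1) (J 0)).const_smul
      (1 / 2 : ℝ)).congr (h.mono fun w hw => by simp only [hw]; rfl)

end

end Curvature

/-! ### The homotopy formula for `δ` and `δ⁻¹` -/

section Homotopy

variable {ι : Type*} {q : ℕ}

/-- The operator `δ` in a fiber. -/
noncomputable def dOp (b : (Fin q → Fin d) → ι → FPS d) : (Fin (q + 1) → Fin d) → ι → FPS d :=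
  dyMul fun i L n => pderiv ℝ i (b L n)

lemma dOp_apply (b : (Fin q → Fin d) → ι → FPS d) (L : Fin (q + 1) → Fin d) (n : ι) :
    dOp b L n = ((q + 1 : ℕ) : ℝ)⁻¹ •
      ∑ s : Fin (q + 1), ((-1 : ℝ) ^ (s : ℕ)) • pderiv ℝ (L s) (b (s.removeNth L) n) := by
  simp only [dOp, dyMul, Pi.smul_apply, Finset.sum_apply]

lemma contr_apply (b : (Fin (q + 1) → Fin d) → ι → FPS d) (L : Fin q → Fin d) (n : ι) :
    contr b L n = ∑ k, X k * b (Fin.cons k L) n := by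
  simp only [contr, Finset.sum_apply, Pi.smul_apply, smul_eq_mul]

/-- The Euler vector field. -/
noncomputable def euler (f : FPS d) : FPS d := ∑ k, X k * pderiv ℝ k f

lemma coeff_euler (f : FPS d) (m : Fin d →₀ ℕ) : coeff m (euler f) = m.degree * coeff m f := by
  classical
  have h : ∀ k, coeff m (X k * pderiv ℝ k f) = (m k : ℝ) * coeff m f := by
    intro k
    rw [X, coeff_monomial_mul, one_mul]
    split_ifs with hk
    · have hk' : 1 ≤ m k := Finsupp.single_le_iff.1 hk
      rw [coeff_pderiv, tsub_add_cancel_of_le hk, mul_comm]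
      congr 1
      rw [Finsupp.tsub_apply, Finsupp.single_eq_same]
      exact_mod_cast Nat.sub_add_cancel hk'
    · have hk' : m k = 0 := by
        by_contra h0
        exact hk (Finsupp.single_le_iff.2 (Nat.one_le_iff_ne_zero.2 h0))
      rw [hk', Nat.cast_zero, zero_mul]
  rw [euler, map_sum]
  simp only [h]
  rw [← Finset.sum_mul, Finsupp.degree_eq_sum, Nat.cast_sum]

lemma contr_dOp_zero (b : (Fin 0 → Fin d) → ι → FPS d) (L : Fin 0 → Fin d) (n : ι) :
    contr (dOp b) L n = euler (b L n) := by
  rw [contr_apply, euler]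
  refine Finset.sum_congr rfl fun k _ => ?_
  rw [dOp, dyMul_zero_index, Subsingleton.elim L Fin.elim0]
  rfl

lemma removeNth_succ_cons (k : Fin d) (L : Fin (q + 1) → Fin d) (s : Fin (q + 1)) :
    s.succ.removeNth (Fin.cons k L : Fin (q + 2) → Fin d) = Fin.cons k (s.removeNth L) := by
  funext t
  refine Fin.cases ?_ (fun t => ?_) t
  · simp [Fin.removeNth]
  · simp [Fin.removeNth, Fin.succ_succAbove_succ]

/-- The homotopy formula for `δ` and the contraction with the Euler vector field. -/
lemma contr_dOp_add (b : (Fin (q + 1) → Fin d) → ι → FPS d) (hb : IsAntisymm b)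
    (L : Fin (q + 1) → Fin d) (n : ι) :
    ((q + 2 : ℕ) : ℝ) • contr (dOp b) L n + ((q + 1 : ℕ) : ℝ) • dOp (contr b) L n =
      euler (b L n) + ((q + 1 : ℕ) : ℝ) • b L n := by
  have hq1 : ((q + 1 : ℕ) : ℝ) ≠ 0 := by positivity
  have hq2 : ((q + 1 + 1 : ℕ) : ℝ) ≠ 0 := by positivity
  have h1 : ((q + 2 : ℕ) : ℝ) • contr (dOp b) L n = euler (b L n) -
      ∑ s : Fin (q + 1), ((-1 : ℝ) ^ (s : ℕ)) •
        ∑ k, X k * pderiv ℝ (L s) (b (Fin.cons k (s.removeNth L)) n) := by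
    have h : ∀ k : Fin d, X k * dOp b (Fin.cons k L) n = ((q + 1 + 1 : ℕ) : ℝ)⁻¹ •
        (X k * pderiv ℝ k (b L n) - ∑ s : Fin (q + 1), ((-1 : ℝ) ^ (s : ℕ)) •
          (X k * pderiv ℝ (L s) (b (Fin.cons k (s.removeNth L)) n))) := by
      intro k
      rw [dOp_apply, Fin.sum_univ_succ, mul_smul_comm, mul_add, Finset.mul_sum, sub_eq_add_neg,
        ← Finset.sum_neg_distrib]
      congr 2
      · simp
      · refine Finset.sum_congr rfl fun s _ => ?_
        rw [removeNth_succ_cons, Fin.cons_succ, Fin.val_succ, pow_succ, mul_smul_comm, mul_neg_one,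
          neg_smul]
    rw [contr_apply]
    simp only [h]
    rw [← Finset.smul_sum, smul_inv_smul₀ hq2, Finset.sum_sub_distrib, euler]
    congr 1
    rw [Finset.sum_comm]
    simp only [Finset.smul_sum]
  have h2 : ((q + 1 : ℕ) : ℝ) • dOp (contr b) L n = ((q + 1 : ℕ) : ℝ) • b L n +
      ∑ s : Fin (q + 1), ((-1 : ℝ) ^ (s : ℕ)) •
        ∑ k, X k * pderiv ℝ (L s) (b (Fin.cons k (s.removeNth L)) n) := by
    rw [dOp_apply, smul_inv_smul₀ hq1]
    have h : ∀ s : Fin (q + 1), ((-1 : ℝ) ^ (s : ℕ)) •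
        pderiv ℝ (L s) (contr b (s.removeNth L) n) = b L n + ((-1 : ℝ) ^ (s : ℕ)) •
        ∑ k, X k * pderiv ℝ (L s) (b (Fin.cons k (s.removeNth L)) n) := by
      intro s
      have h3 : pderiv ℝ (L s) (contr b (s.removeNth L) n) = b (Fin.cons (L s) (s.removeNth L)) n +
          ∑ k, X k * pderiv ℝ (L s) (b (Fin.cons k (s.removeNth L)) n) := by
        rw [contr_apply, map_sum]
        simp only [Derivation.leibniz, smul_eq_mul, pderiv_X]
        rw [Finset.sum_add_distrib, add_comm, Finset.sum_eq_single (L s)]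
        · rw [Pi.single_eq_same, mul_one]
        · intro k _ hk
          rw [Pi.single_eq_of_ne hk, mul_zero]
        · simp
      rw [h3, smul_add]
      congr 1
      exact congrFun (hb.cons_removeNth s L) n
    simp only [h]
    rw [Finset.sum_add_distrib, Finset.sum_const, Finset.card_univ, Fintype.card_fin]
    congr 1
    exact (Nat.cast_smul_eq_nsmul ℝ _ _).symm
  rw [h1, h2]
  abel

lemma coeff_dOp_dInv (b : (Fin (q + 1) → Fin d) → ι → FPS d) (L : Fin (q + 1) → Fin d) (n : ι)
    (m : Fin d →₀ ℕ) : coeff m (dOp (dInv b) L n) =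
      ((q + 1 : ℕ) : ℝ) / ((m.degree + (q + 1) : ℕ) : ℝ) * coeff m (dOp (contr b) L n) := by
  simp only [dOp_apply, map_smul, map_sum, smul_eq_mul, Finset.mul_sum, coeff_pderiv, coeff_dInv,
    degree_add_single]
  refine Finset.sum_congr rfl fun s _ => ?_
  rw [show m.degree + 1 + q = m.degree + (q + 1) by ring]
  ring

/-- The contraction formula expresses that the Euler field acts by the total degree, and `dInv`
divides by this degree. The integers attached to form degrees come from the normalization of
antisymmetric components. -/
lemma dInv_dOp_add {b : (Fin (q + 1) → Fin d) → ι → FPS d} (hb : IsAntisymm b) :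
    dInv (dOp b) + dOp (dInv b) = b := by
  funext L n
  ext m
  rw [Pi.add_apply, Pi.add_apply, map_add, coeff_dInv, coeff_dOp_dInv]
  have h := congrArg (coeff m) (contr_dOp_add b hb L n)
  simp only [map_add, map_smul, smul_eq_mul, coeff_euler] at h
  have h0 : ((m.degree + (q + 1) : ℕ) : ℝ) ≠ 0 := by positivity
  rw [show (q + 2 : ℕ) = q + 1 + 1 from rfl] at h
  field_simp
  rw [h]
  push_cast
  ring

/-- In form degree zero the Euler field multiplies by the degree in `y` alone, so only the constant
term is lost. -/
lemma coeff_dInv_dOp_zero (b : (Fin 0 → Fin d) → ι → FPS d) (L : Fin 0 → Fin d) (n : ι)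
    (m : Fin d →₀ ℕ) (hm : m ≠ 0) : coeff m (dInv (dOp b) L n) = coeff m (b L n) := by
  rw [coeff_dInv, contr_dOp_zero, coeff_euler]
  have h0 : (m.degree : ℝ) ≠ 0 := by
    rw [Nat.cast_ne_zero]
    exact fun h => hm ((Finsupp.degree_eq_zero_iff m).1 h)
  simp only [Nat.add_zero, zero_add, Nat.cast_one]
  field_simp

lemma coeff_zero_dInv (b : (Fin (q + 1) → Fin d) → ι → FPS d) (L : Fin q → Fin d) (n : ι) :
    coeff 0 (dInv b L n) = 0 := by
  rw [coeff_dInv, coeff_contr]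
  simp

lemma IsAntisymm.cons_cons {Y : Type*} [AddCommGroup Y] {b : (Fin (q + 2) → Fin d) → Y}
    (hb : IsAntisymm b) (k l : Fin d) (L : Fin q → Fin d) :
    b (Fin.cons k (Fin.cons l L : Fin (q + 1) → Fin d)) =
      -b (Fin.cons l (Fin.cons k L : Fin (q + 1) → Fin d)) := by
  have h := hb (Equiv.swap 0 1) (Fin.cons l (Fin.cons k L : Fin (q + 1) → Fin d))
  rw [Equiv.Perm.sign_swap (by simp), Units.val_neg, Units.val_one, neg_one_smul] at h
  rw [← h]
  congr 1
  funext s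
  refine Fin.cases ?_ (fun s => ?_) s
  · simp
  · refine Fin.cases ?_ (fun s => ?_) s
    · simp
    · rw [Function.comp_apply, Equiv.swap_apply_of_ne_of_ne (by simp [Fin.ext_iff])
        (by simp [Fin.ext_iff])]
      simp

lemma contr_contr {b : (Fin (q + 2) → Fin d) → ι → FPS d} (hb : IsAntisymm b) :
    contr (contr b) = 0 := by
  funext L n
  have h : contr (contr b) L n = -contr (contr b) L n := by
    conv_lhs => rw [contr_apply]
    simp only [contr_apply, Finset.mul_sum, ← Finset.sum_neg_distrib]
    rw [Finset.sum_comm]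
    refine Finset.sum_congr rfl fun k _ => Finset.sum_congr rfl fun l _ => ?_
    rw [hb.cons_cons, Pi.neg_apply]
    ring
  ext m
  have h2 := congrArg (coeff m) h
  rw [map_neg] at h2
  rw [Pi.zero_apply, Pi.zero_apply, map_zero]
  linarith

/-- Contracting twice with the same vector vanishes by antisymmetry. The factors do not interfere,
since contraction preserves the total degree in `y` and `dy`. -/
lemma dInv_dInv {b : (Fin (q + 2) → Fin d) → ι → FPS d} (hb : IsAntisymm b) :
    dInv (dInv b) = 0 := by
  funext L n
  ext m
  have h : coeff m (contr (dInv b) L n) =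
      ((q + 2 : ℕ) : ℝ) / ((m.degree + q : ℕ) : ℝ) * coeff m (contr (contr b) L n) := by
    rw [coeff_contr, coeff_contr, Finset.mul_sum]
    refine Finset.sum_congr rfl fun k _ => ?_
    split_ifs with hk
    · rw [coeff_dInv]
      have hle : Finsupp.single k 1 ≤ m := Finsupp.single_le_iff.2 hk
      have h3 : (m - Finsupp.single k 1).degree + 1 = m.degree := by
        rw [← degree_add_single _ k, tsub_add_cancel_of_le hle]
      have h4 : (m - Finsupp.single k 1).degree + (q + 1) = m.degree + q := by omega
      rw [h4]
    · rw [mul_zero]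
  rw [coeff_dInv, h, contr_contr hb]
  simp

lemma dInv_add (a b : (Fin (q + 1) → Fin d) → ι → FPS d) : dInv (a + b) = dInv a + dInv b := by
  funext L n
  ext m
  have h : contr (a + b) L n = contr a L n + contr b L n := by
    simp only [contr_apply, Pi.add_apply, mul_add, Finset.sum_add_distrib]
  rw [Pi.add_apply, Pi.add_apply, map_add, coeff_dInv, coeff_dInv, coeff_dInv, h, map_add, mul_add]

lemma dInv_smul (c : ℝ) (a : (Fin (q + 1) → Fin d) → ι → FPS d) : dInv (c • a) = c • dInv a := by
  funext L n
  ext m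
  have h : contr (c • a) L n = c • contr a L n := by
    simp only [contr_apply, Pi.smul_apply, mul_smul_comm, Finset.smul_sum]
  rw [Pi.smul_apply, Pi.smul_apply, map_smul, coeff_dInv, coeff_dInv, h, map_smul, smul_eq_mul,
    smul_eq_mul]
  ring

lemma dInv_sub (a b : (Fin (q + 1) → Fin d) → ι → FPS d) : dInv (a - b) = dInv a - dInv b := by
  have h := dInv_add a ((-1 : ℝ) • b)
  rwa [dInv_smul, neg_one_smul, neg_one_smul, ← sub_eq_add_neg, ← sub_eq_add_neg] at h

/-- The factor `yᵏ` gains one degree; this gain drives all contraction arguments. -/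
lemma dInv_ordGE {b : (Fin (q + 1) → Fin d) → ι → FPS d} {p : ℕ}
    (hb : ∀ L n, OrdGE p (b L n)) (L : Fin q → Fin d) (n : ι) : OrdGE (p + 1) (dInv b L n) := by
  intro m hm
  have h : OrdGE (p + 1) (contr b L n) := by
    rw [contr_apply]
    refine OrdGE.sum fun k _ => ?_
    rw [add_comm]
    exact (ordGE_X k).mul (hb _ n)
  rw [coeff_dInv, h m hm, mul_zero]

end Homotopy

/-! ### Linearity of the operators and iteration in the degree in `y` -/

section Linearity

variable {M : Type*} [TopologicalSpace M] [ChartedSpace (EuclideanSpace ℝ (Fin d)) M]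
  [IsManifold (𝓡 d) ∞ M] {B : FormalFiber d} {S : Finset B.ι} {q : ℕ}
  {a b : RawForm M B q}

lemma deltaInv_add (a b : RawForm M B (q + 1)) : deltaInv (a + b) = deltaInv a + deltaInv b := by
  funext x
  rw [Pi.add_apply, deltaInv_eq, deltaInv_eq, deltaInv_eq, Pi.add_apply, dInv_add]

lemma deltaInv_smul (c : ℝ) (a : RawForm M B (q + 1)) : deltaInv (c • a) = c • deltaInv a := by
  funext x
  rw [Pi.smul_apply, deltaInv_eq, deltaInv_eq, Pi.smul_apply, dInv_smul]

lemma deltaInv_sub (a b : RawForm M B (q + 1)) : deltaInv (a - b) = deltaInv a - deltaInv b := by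
  funext x
  rw [Pi.sub_apply, deltaInv_eq, deltaInv_eq, deltaInv_eq, Pi.sub_apply, dInv_sub]

lemma deltaInv_deltaInv {a : RawForm M B (q + 2)} (ha : ∀ x, IsAntisymm (a x)) :
    deltaInv (deltaInv a) = 0 := by
  funext x
  rw [deltaInv_eq, deltaInv_eq, dInv_dInv (ha x)]
  rfl

lemma sub_eq_add_smul {X : Type*} [AddCommGroup X] [Module ℝ X] (a b : X) :
    a - b = a + (-1 : ℝ) • b := by
  rw [neg_one_smul, sub_eq_add_neg]

section

variable (LB : FiberLaws B S)
include LB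

lemma delta_eq (hS : ∀ x L, SuppIn S (a x L)) (x : M) : delta a x = dOp (a x) := by
  rw [delta, dOp]
  congr 1
  funext i L n
  exact LB.lie_single i (hS x L) n

lemma deltaInv_delta_add {a : RawForm M B (q + 1)} (ha : FormIn S a) (LF : LawfulFiber B) :
    deltaInv (delta a) + delta (deltaInv a) = a := by
  funext x
  rw [Pi.add_apply, deltaInv_eq, delta_eq LB ha.supp, delta_eq LB (ha.deltaInv LF LB).supp,
    deltaInv_eq, dInv_dOp_add (ha.antisymm x)]

lemma delta_add (ha : FormIn S a) (hb : FormIn S b) : delta (a + b) = delta a + delta b := by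
  funext x
  rw [Pi.add_apply, delta, delta, delta, ← dyMul_add]
  congr 1
  funext i L
  exact LB.lie_add (ha.supp x L) (hb.supp x L)

lemma delta_smul (c : ℝ) (ha : FormIn S a) : delta (c • a) = c • delta a := by
  funext x
  rw [Pi.smul_apply, delta, delta, ← dyMul_smul]
  congr 1
  funext i L
  exact LB.lie_real_smul _ c (ha.supp x L)

lemma actForm_add (A : RawForm M (fiberT d 1) 1) (ha : FormIn S a) (hb : FormIn S b) :
    actForm A (a + b) = actForm A a + actForm A b := by
  funext x
  rw [Pi.add_apply, actForm, actForm, actForm, ← dyMul_add]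
  congr 1
  funext i L
  exact LB.lie_add (ha.supp x L) (hb.supp x L)

lemma actForm_smul (A : RawForm M (fiberT d 1) 1) (c : ℝ) (ha : FormIn S a) :
    actForm A (c • a) = c • actForm A a := by
  funext x
  rw [Pi.smul_apply, actForm, actForm, ← dyMul_smul]
  congr 1
  funext i L
  exact LB.lie_real_smul _ c (ha.supp x L)

lemma actForm_sub (LF : LawfulFiber B) (A : RawForm M (fiberT d 1) 1) (ha : FormIn S a)
    (hb : FormIn S b) : actForm A (a - b) = actForm A a - actForm A b := by
  rw [sub_eq_add_smul, actForm_add LB _ ha (hb.smul LF LB _), actForm_smul LB _ _ hb,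
    ← sub_eq_add_smul]

lemma actForm_sub_left (A A' : RawForm M (fiberT d 1) 1) (ha : FormIn S a) :
    actForm (A - A') a = actForm A a - actForm A' a := by
  funext x
  rw [Pi.sub_apply, actForm, actForm, actForm, ← dyMul_sub]
  congr 1
  funext i L
  exact LB.lie_sub_left _ _ (ha.supp x L)

end

lemma pdF_add {ι : Type*} {α β : EuclideanSpace ℝ (Fin d) → (Fin q → Fin d) → ι → FPS d}
    {z : EuclideanSpace ℝ (Fin d)} (hα : ∀ L n, SmoothAt (fun w => α w L n) z)
    (hβ : ∀ L n, SmoothAt (fun w => β w L n) z) (i : Fin d) :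
    pdF (α + β) z i = pdF α z i + pdF β z i := by
  funext L n
  exact pdF_eq_of_hasDer ((hα L n).add (hβ L n)) ((pdF_line (hα L n) i).add (pdF_line (hβ L n) i))

lemma pdF_smul {ι : Type*} (c : ℝ) {α : EuclideanSpace ℝ (Fin d) → (Fin q → Fin d) → ι → FPS d}
    {z : EuclideanSpace ℝ (Fin d)} (hα : ∀ L n, SmoothAt (fun w => α w L n) z) (i : Fin d) :
    pdF (c • α) z i = c • pdF α z i := by
  funext L n
  exact pdF_eq_of_hasDer ((hα L n).const_smul c) ((pdF_line (hα L n) i).const_smul c)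

variable (cov : CovariantDerivative (𝓡 d) (EuclideanSpace ℝ (Fin d))
  (TangentSpace (𝓡 d) : M → Type _))

section

variable (LB : FiberLaws B S)
include LB

lemma nabla_add (ha : FormIn S a) (hb : FormIn S b) :
    nabla cov (a + b) = nabla cov a + nabla cov b := by
  funext x
  have hx := mem_source_self (d := d) x
  rw [Pi.add_apply, nabla, nabla, nabla, ← dyMul_add]
  congr 1
  funext i L
  rw [Pi.add_apply, Pi.add_apply, LB.lie_add (ha.supp x L) (hb.supp x L), partialX_eq, partialX_eq,
    partialX_eq, pdF_congr (FormIn.loc_add LB ha hb hx), pdF_add (ha.smooth hx) (hb.smooth hx),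
    Pi.add_apply]
  abel

lemma nabla_smul (c : ℝ) (ha : FormIn S a) : nabla cov (c • a) = c • nabla cov a := by
  funext x
  have hx := mem_source_self (d := d) x
  rw [Pi.smul_apply, nabla, nabla, ← dyMul_smul]
  congr 1
  funext i L
  rw [Pi.smul_apply, Pi.smul_apply, LB.lie_real_smul _ c (ha.supp x L), partialX_eq, partialX_eq,
    pdF_congr (FormIn.loc_smul LB c ha hx), pdF_smul c (ha.smooth hx), Pi.smul_apply, smul_add]

lemma nabla_sub (LF : LawfulFiber B) (ha : FormIn S a) (hb : FormIn S b) :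
    nabla cov (a - b) = nabla cov a - nabla cov b := by
  rw [sub_eq_add_smul, nabla_add cov LB ha (hb.smul LF LB _), nabla_smul cov LB _ hb,
    ← sub_eq_add_smul]

end

/-! ### The filtration by the degree in `y` -/

/-- The form vanishes up to order `p` in `y`. -/
def FormOrd (p : ℕ) (a : RawForm M B q) : Prop := ∀ x L n, OrdGE p (a x L n)

lemma FormOrd.zero (p : ℕ) : FormOrd p (0 : RawForm M B q) := fun _ _ _ => OrdGE.zero_fun p

lemma FormOrd.of_zero (a : RawForm M B q) : FormOrd 0 a := fun _ _ _ => OrdGE.of_zero _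

lemma FormOrd.add {p : ℕ} (ha : FormOrd p a) (hb : FormOrd p b) : FormOrd p (a + b) :=
  fun x L n => (ha x L n).add (hb x L n)

lemma FormOrd.sub {p : ℕ} (ha : FormOrd p a) (hb : FormOrd p b) : FormOrd p (a - b) :=
  fun x L n => (ha x L n).sub (hb x L n)

lemma FormOrd.smul {p : ℕ} (c : ℝ) (ha : FormOrd p a) : FormOrd p (c • a) :=
  fun x L n => (ha x L n).smul c

lemma FormOrd.mono {p p' : ℕ} (ha : FormOrd p a) (h : p' ≤ p) : FormOrd p' a :=
  fun x L n => (ha x L n).mono h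

lemma eq_of_formOrd_sub (h : ∀ p, FormOrd p (a - b)) : a = b := by
  funext x L n
  ext m
  have h1 := h (m.degree + 1) x L n m (Nat.lt_succ_self _)
  rw [Pi.sub_apply, Pi.sub_apply, Pi.sub_apply, map_sub] at h1
  exact sub_eq_zero.1 h1

lemma FormOrd.deltaInv {a : RawForm M B (q + 1)} {p : ℕ} (ha : FormOrd p a) :
    FormOrd (p + 1) (deltaInv a) := fun x L n => by
  rw [deltaInv_eq]
  exact dInv_ordGE (ha x) L n

lemma dyMul_ordGE {ι : Type*} {c : Fin d → (Fin q → Fin d) → ι → FPS d} {p : ℕ}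
    (hc : ∀ i L n, OrdGE p (c i L n)) (L : Fin (q + 1) → Fin d) (n : ι) :
    OrdGE p (dyMul c L n) := by
  simp only [dyMul, Pi.smul_apply, Finset.sum_apply]
  exact (OrdGE.sum fun s _ => (hc _ _ n).smul _).smul _

lemma pdF_ordGE {ι : Type*} {α : EuclideanSpace ℝ (Fin d) → (Fin q → Fin d) → ι → FPS d}
    {z : EuclideanSpace ℝ (Fin d)} {p : ℕ} (h : ∀ᶠ w in nhds z, ∀ L n, OrdGE p (α w L n))
    (i : Fin d) (L : Fin q → Fin d) (n : ι) : OrdGE p (pdF α z i L n) := by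
  intro m hm
  rw [coeff_pdF]
  have h1 : (fun w => coeff m (α w L n)) =ᶠ[nhds z] fun _ => 0 := h.mono fun w hw => hw L n m hm
  rw [h1.fderiv_eq]
  simp

lemma gammaVec_ordGE (x : M) (i k : Fin d) : OrdGE 1 (gammaVec cov x i k) :=
  (OrdGE.sum fun j _ => (ordGE_X j).smul _).neg

section

variable (LB : FiberLaws B S)
include LB

lemma formAct_ordGE {g : Matrix (Fin d) (Fin d) ℝ} (hg : IsUnit g.det)
    {b : (Fin q → Fin d) → B.ι → FPS d} (hS : ∀ L, SuppIn S (b L)) {p : ℕ}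
    (hb : ∀ L n, OrdGE p (b L n)) (L : Fin q → Fin d) (n : B.ι) : OrdGE p (formAct g b L n) := by
  simp only [formAct, idxAct, Finset.sum_apply, Pi.smul_apply]
  exact OrdGE.sum fun L' _ => (LB.act_ordGE hg (hS L') (hb L') n).smul _

/-- Derivatives in `x` act on coefficients, and the connection field vanishes at `y = 0`, so no
degree in `y` is lost. -/
lemma FormOrd.nabla {p : ℕ} (hS : ∀ x L, SuppIn S (a x L)) (ha : FormOrd p a) :
    FormOrd p (nabla cov a) := fun x L n => by
  refine dyMul_ordGE (fun i L n => ?_) L n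
  refine (pdF_ordGE ?_ i L n).add (LB.lie_ordGE (gammaVec_ordGE cov x i) (hS x L) (ha x L) n)
  refine (eventually_source (mem_source_self x) (source_mem_nhds (mem_source_self (d := d) x))).mono
    fun w hw => ?_
  simp only [loc, inChart_eq]
  exact formAct_ordGE LB (isUnit_det_jac hw) (hS _) (ha _)

lemma FormOrd.actForm {p : ℕ} {A : RawForm M (fiberT d 1) 1} (hA : FormOrd 1 A)
    (hS : ∀ x L, SuppIn S (a x L)) (ha : FormOrd p a) :
    FormOrd p (actForm A a) := fun x L n => by
  refine dyMul_ordGE (fun i L n => ?_) L n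
  exact LB.lie_ordGE (fun k => hA x _ _) (hS x L) (ha x L) n

end

/-- Here the order is carried by the acting form. Both halves of the bracket keep it, since the
derivative falling on `A` is compensated by `A'` vanishing at `y = 0`. This controls the difference
of the quadratic terms in the equation for `A`. -/
lemma FormOrd.actForm_vector {p : ℕ} {A : RawForm M (fiberT d 1) 1} (hA : FormOrd p A)
    {A' : RawForm M (fiberT d 1) q} (hA' : FormOrd 1 A') :
    FormOrd p (Fedosov.actForm A A') := fun x L n => by
  refine dyMul_ordGE (ι := (fiberT d 1).ι) (fun i L n => ?_) L n
  rw [eq_toVec ((fiberT d 1).lie _ _), fiberT_lie_one]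
  refine OrdGE.sub ?_ ?_
  · exact (OrdGE.vfApply (q := p) (fun k => hA x _ _) (hA' x L _)).mono (by omega)
  · exact (OrdGE.vfApply (q := 1) (fun k => hA' x L _) (hA x _ _)).mono (by omega)

/-! ### Fixed points of contractions -/

/-- The limit of a sequence of forms whose part of degree `p` in `y` does not change any more after
`p` steps. -/
noncomputable def limForm (u : ℕ → RawForm M B q) : RawForm M B q := fun x L n m =>
  coeff m (u m.degree x L n)

lemma coeff_limForm (u : ℕ → RawForm M B q) (x : M) (L : Fin q → Fin d) (n : B.ι)
    (m : Fin d →₀ ℕ) : coeff m (limForm u x L n) = coeff m (u m.degree x L n) := rfl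

lemma FormIn.limForm (LF : LawfulFiber B) (LB : FiberLaws B S) {u : ℕ → RawForm M B q}
    (hu : ∀ N, FormIn S (u N)) : FormIn S (limForm u) := by
  have hsupp : ∀ x L, SuppIn S (Fedosov.limForm u x L) := fun x L n hn => by
    ext m
    rw [coeff_limForm, (hu _).supp x L n hn, map_zero]
  refine ⟨fun x => ?_, fun x L => ?_, hsupp, fun {x₀ p} hp L n m => ?_⟩
  · exact isAntisymm_iff_coeff.2 fun n m =>
      isAntisymm_iff_coeff.1 ((hu m.degree).antisymm x) n m
  · exact LF.sym_of_coeff (fun m => u m.degree x L) (fun m => (hu _).sym x L) fun m n => rfl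
  · refine ((hu m.degree).smooth hp L n m).congr_of_eventuallyEq
      ((eventually_source hp (source_mem_nhds hp)).mono fun w hw => ?_)
    simp only [loc, inChart_eq]
    rw [formAct_coeff_congr LB (isUnit_det_jac hw) (hsupp _) ((hu m.degree).supp _) (c := 1)
      (fun L n k hk => by rw [coeff_limForm, hk, one_mul]), one_mul]

lemma FormOrd.limForm {u : ℕ → RawForm M B q} {p : ℕ} (hu : ∀ N, FormOrd p (u N)) :
    FormOrd p (limForm u) := fun x L n m hm => hu _ x L n m hm

/-- Coefficients of degree at most `N` are stationary from step `N` on, so the limit agrees with `u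
N` in these degrees. -/
lemma limForm_sub_formOrd {u : ℕ → RawForm M B q} (hu : ∀ N, FormOrd (N + 1) (u (N + 1) - u N))
    (N : ℕ) : FormOrd (N + 1) (limForm u - u N) := by
  intro x L n m hm
  have h : ∀ k, coeff m (u (m.degree + k) x L n) = coeff m (u m.degree x L n) := by
    intro k
    induction k with
    | zero => rfl
    | succ k ih =>
      rw [← ih]
      have h1 := hu (m.degree + k) x L n m (by omega)
      rw [Pi.sub_apply, Pi.sub_apply, Pi.sub_apply, map_sub] at h1
      exact sub_eq_zero.1 h1
  rw [Pi.sub_apply, Pi.sub_apply, Pi.sub_apply, map_sub, coeff_limForm,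
    ← h (N - m.degree), Nat.add_sub_cancel' (Nat.lt_succ_iff.1 hm), sub_self]

/-- A map is contracting on the set `C` of forms if it raises the order of differences. -/
def Contracting (C : Set (RawForm M B q)) (Φ : RawForm M B q → RawForm M B q) : Prop :=
  ∀ a ∈ C, ∀ b ∈ C, ∀ p, FormOrd p (a - b) → FormOrd (p + 1) (Φ a - Φ b)

/-- The difference of two fixed points has order `0`, and each application of the map raises this
order. -/
lemma Contracting.unique {C : Set (RawForm M B q)} {Φ : RawForm M B q → RawForm M B q}
    (hΦ : Contracting C Φ) (ha : a ∈ C) (hb : b ∈ C) (hfa : Φ a = a) (hfb : Φ b = b) : a = b := by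
  refine eq_of_formOrd_sub fun p => ?_
  induction p with
  | zero => exact FormOrd.of_zero _
  | succ p ih =>
    have h := hΦ a ha b hb p ih
    rwa [hfa, hfb] at h

lemma Contracting.limForm_sub {C : Set (RawForm M B q)} {Φ : RawForm M B q → RawForm M B q}
    (hΦ : Contracting C Φ) {u : ℕ → RawForm M B q} (hu : ∀ N, u N ∈ C)
    (h0 : FormOrd 1 (u 1 - u 0)) (hs : ∀ N, u (N + 1) = Φ (u N)) (N : ℕ) :
    FormOrd (N + 1) (limForm u - u N) := by
  refine limForm_sub_formOrd (fun N => ?_) N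
  induction N with
  | zero => exact h0
  | succ N ih =>
    rw [hs (N + 1), hs N]
    have h := hΦ _ (hu (N + 1)) _ (hu N) (N + 1) ih
    rwa [hs N] at h

/-- Contracting maps are continuous in the `y`-adic topology, so the limit of the iterates is fixed.
-/
lemma Contracting.map_limForm {C : Set (RawForm M B q)} {Φ : RawForm M B q → RawForm M B q}
    (hΦ : Contracting C Φ) {u : ℕ → RawForm M B q} (hu : ∀ N, u N ∈ C) (hl : limForm u ∈ C)
    (h0 : FormOrd 1 (u 1 - u 0)) (hs : ∀ N, u (N + 1) = Φ (u N)) :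
    Φ (limForm u) = limForm u := by
  refine eq_of_formOrd_sub fun p => ?_
  have h1 := hΦ.limForm_sub hu h0 hs
  have h2 := hΦ _ hl _ (hu p) _ (h1 p)
  have h3 : Φ (limForm u) - limForm u =
      Φ (limForm u) - Φ (u p) - (limForm u - u (p + 1)) := by
    rw [hs p]
    abel
  rw [h3]
  exact (h2.mono (by omega)).sub ((h1 (p + 1)).mono (by omega))

end Linearity

/-! ### The commutator of formal vector fields and the Bianchi identity -/

section Bracket

variable (u v w : Fin d → FPS d)

lemma vbr_swap : vbr v w = -vbr w v := by
  funext k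
  simp only [vbr, Pi.neg_apply]
  abel

lemma vbr_add_right : vbr u (v + w) = vbr u v + vbr u w := by
  funext k
  simp only [vbr, Pi.add_apply, vfApply_add, vfApply_add_left]
  abel

lemma vbr_neg_right : vbr u (-v) = -vbr u v := by
  funext k
  simp only [vbr, Pi.neg_apply, vfApply_neg, vfApply_neg_left]
  abel

lemma vbr_sub_right : vbr u (v - w) = vbr u v - vbr u w := by
  rw [sub_eq_add_neg, vbr_add_right, vbr_neg_right, sub_eq_add_neg]

lemma vbr_smul_right (c : ℝ) : vbr u (c • v) = c • vbr u v := by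
  funext k
  simp only [vbr, Pi.smul_apply, vfApply_smul, vfApply_smul_left, smul_sub]

lemma vbr_add_left : vbr (u + v) w = vbr u w + vbr v w := by
  rw [vbr_swap, vbr_add_right, vbr_swap w u, vbr_swap w v]
  abel

lemma vbr_sub_left : vbr (u - v) w = vbr u w - vbr v w := by
  rw [vbr_swap, vbr_sub_right, vbr_swap w u, vbr_swap w v]
  abel

lemma vbr_single_single (i j : Fin d) :
    vbr (Pi.single i 1) (Pi.single j 1 : Fin d → FPS d) = 0 := by
  funext k
  simp only [vbr, vfApply_single, pderiv_single_one, sub_zero, Pi.zero_apply]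

/-- The cancellation of the terms of the Bianchi identity which contain brackets. -/
lemma bianchi_bracket (a b c dab dac dba dbc dca dcb : Fin d → FPS d) :
    vbr dab c + vbr b dac + vbr a (dbc - dcb + vbr b c) -
      (vbr dba c + vbr a dbc + vbr b (dac - dca + vbr a c)) +
      (vbr dca b + vbr a dcb + vbr c (dab - dba + vbr a b)) = 0 := by
  simp only [vbr_add_right, vbr_sub_right]
  -- After the antisymmetries the first order terms cancel in pairs; the triple brackets cancel by
  -- the Jacobi identity `vbr_vbr`.
  rw [vbr_swap c dab, vbr_swap c dba, vbr_swap b dca, vbr_swap c (vbr a b), vbr_vbr]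
  abel

end Bracket

section Curvature

variable {W : EuclideanSpace ℝ (Fin d) → Fin d → Fin d → FPS d} {z : EuclideanSpace ℝ (Fin d)}

lemma vbr_hasDer {v w : ℝ → Fin d → FPS d} {v' w' : Fin d → FPS d}
    (hv : ∀ k, HasDer (fun t => v t k) (v' k)) (hw : ∀ k, HasDer (fun t => w t k) (w' k))
    (k : Fin d) : HasDer (fun t => vbr (v t) (w t) k) ((vbr v' (w 0) + vbr (v 0) w') k) := by
  refine ((HasDer.vfApply hv (hw k)).sub (HasDer.vfApply hw (hv k))).of_eq (fun _ => rfl) ?_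
  simp only [vbr, Pi.add_apply]
  abel

/-- The derivative of the curvature. -/
lemma curvV_line (hW : ∀ i k, SmoothAt (fun w => W w i k) z) (i j j' k : Fin d) :
    HasDer (fun t => curvV W (z + t • e i) j j' k)
      ((pdV (fun w => pdV W w j) z i j' - pdV (fun w => pdV W w j') z i j +
        (vbr (pdV W z i j) (W z j') + vbr (W z j) (pdV W z i j'))) k) := by
  refine (((pdV_line (W := fun w => pdV W w j) (pdV_smooth (hW j' k))).sub
    (pdV_line (W := fun w => pdV W w j') (pdV_smooth (hW j k)))).add
    (vbr_hasDer (fun k => pdV_line (hW j k)) (fun k => pdV_line (hW j' k)) k)).of_eq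
    (fun _ => rfl) ?_
  simp only [zero_smul, add_zero, Pi.add_apply, Pi.sub_apply]

/-- The second Bianchi identity. -/
lemma bianchi (hW : ∀ i k, SmoothAt (fun w => W w i k) z)
    {α : EuclideanSpace ℝ (Fin d) → (Fin 2 → Fin d) → (fiberT d 1).ι → FPS d}
    (hα : ∀ L n, SmoothAt (fun w => α w L n) z)
    (h : ∀ᶠ w in nhds z, ∀ (L : Fin 2 → Fin d) (J : (fiberT d 1).ι),
      α w L J = (1 / 2 : ℝ) • curvV W w (L 0) (L 1) (J 0)) : locD W α z = 0 := by
  have hline : ∀ i, Filter.Tendsto (fun t : ℝ => z + t • (e i : EuclideanSpace ℝ (Fin d)))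
      (nhds 0) (nhds z) := fun i => by
    simpa using (hasDerivAt_line z (e i)).continuousAt.tendsto
  have key : ∀ i j j' : Fin d, toVec (pdF α z i ![j, j'] + (fiberT d 1).lie (W z i) (α z ![j, j'])) =
      (1 / 2 : ℝ) • (pdV (fun w => pdV W w j) z i j' - pdV (fun w => pdV W w j') z i j +
        (vbr (pdV W z i j) (W z j') + vbr (W z j) (pdV W z i j') +
          vbr (W z i) (pdV W z j j' - pdV W z j' j + vbr (W z j) (W z j')))) := by
    intro i j j'
    have h1 : toVec (pdF α z i ![j, j']) = (1 / 2 : ℝ) • (pdV (fun w => pdV W w j) z i j' -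
        pdV (fun w => pdV W w j') z i j +
        (vbr (pdV W z i j) (W z j') + vbr (W z j) (pdV W z i j'))) := by
      funext k
      refine pdF_eq_of_hasDer (hα _ _) (((curvV_line hW i j j' k).const_smul (1 / 2 : ℝ)).congr ?_)
      exact (hline i).eventually (h.mono fun w hw => hw ![j, j'] fun _ => k)
    have h2 : toVec (α z ![j, j']) = (1 / 2 : ℝ) • curvV W z j j' := by
      funext k
      exact h.self_of_nhds ![j, j'] fun _ => k
    have h3 : toVec (pdF α z i ![j, j'] + (fiberT d 1).lie (W z i) (α z ![j, j'])) =
        toVec (pdF α z i ![j, j']) + toVec ((fiberT d 1).lie (W z i) (α z ![j, j'])) := rfl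
    rw [h3, fiberT_lie_one, h1, h2, vbr_smul_right, ← smul_add, curvV, add_assoc]
  funext L
  refine toVec_injective ?_
  rw [locD, dyMul_two_index]
  have h4 : ∀ x y u : (fiberT d 1).ι → FPS d, toVec ((1 / 3 : ℝ) • (x - y + u)) =
      (1 / 3 : ℝ) • (toVec x - toVec y + toVec u) := fun x y u => rfl
  rw [h4, key, key, key]
  -- Mixed partial derivatives commute, so the second derivatives cancel in the cyclic sum.
  have hc : ∀ i i' j, pdV (fun w => pdV W w i) z i' j = pdV (fun w => pdV W w i') z i j := by
    intro i i' j
    funext k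
    exact pdV_comm (hW j k) i i'
  have h5 := bianchi_bracket (W z (L 0)) (W z (L 1)) (W z (L 2)) (pdV W z (L 0) (L 1))
    (pdV W z (L 0) (L 2)) (pdV W z (L 1) (L 0)) (pdV W z (L 1) (L 2)) (pdV W z (L 2) (L 0))
    (pdV W z (L 2) (L 1))
  rw [hc (L 1) (L 0) (L 2), hc (L 2) (L 0) (L 1), hc (L 2) (L 1) (L 0), ← smul_sub, ← smul_add]
  have h6 : ∀ s1 s2 s3 x y u : Fin d → FPS d, x - y + u = 0 →
      s1 - s2 + x - (s1 - s3 + y) + (s2 - s3 + u) = 0 := by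
    intro s1 s2 s3 x y u hx
    rw [← hx]
    abel
  rw [h6 _ _ _ _ _ _ h5, smul_zero, smul_zero]
  rfl

end Curvature

/-! ### Existence of the form `A` and the gauge condition on its curvature -/

section FedosovForm

variable {M : Type*} [TopologicalSpace M] [ChartedSpace (EuclideanSpace ℝ (Fin d)) M]
  [IsManifold (𝓡 d) ∞ M] {B : FormalFiber d} {S : Finset B.ι} {q : ℕ}

variable (cov : CovariantDerivative (𝓡 d) (EuclideanSpace ℝ (Fin d))
  (TangentSpace (𝓡 d) : M → Type _))

/-- The laws of the fiber of vector fields. -/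
lemma fiberLaws_vector (d : ℕ) : FiberLaws (fiberT d 1) (setT d 1) := fiberLaws_T d 1

lemma curvForm_ord : FormOrd 1 (curvForm cov) := fun x L J =>
  ((OrdGE.sum fun l _ => (ordGE_X l).smul _).smul _).neg

variable [T2Space M] [CovariantDerivative.ContMDiffCovariantDerivative cov ∞]

/-- The map whose fixed point is the form `A`. -/
noncomputable def fedosovMap (A : RawForm M (fiberT d 1) 1) : RawForm M (fiberT d 1) 1 :=
  deltaInv (curvForm cov) + deltaInv (nabla cov A + (1 / 2 : ℝ) • actForm A A)

/-- The smooth one-forms with values in vector fields vanishing at `y = 0`. -/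
def vectorForms (M : Type*) [TopologicalSpace M] [ChartedSpace (EuclideanSpace ℝ (Fin d)) M]
    [IsManifold (𝓡 d) ∞ M] : Set (RawForm M (fiberT d 1) 1) :=
  {A | FormIn (setT d 1) A ∧ FormOrd 1 A}

lemma formOrd_half_act {A : RawForm M (fiberT d 1) 1} (hA : FormOrd 1 A) :
    FormOrd 1 ((1 / 2 : ℝ) • actForm A A) := (hA.actForm_vector hA).smul _

lemma fedosovMap_mem {A : RawForm M (fiberT d 1) 1} (hA : A ∈ vectorForms M) :
    fedosovMap cov A ∈ vectorForms M := by
  have LB := fiberLaws_vector d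
  have LF := lawfulFiber_T d 1
  refine ⟨((curvForm_formIn cov).deltaInv LF LB).add LF LB (((hA.1.nabla cov LF LB).add LF LB
    ((hA.1.actForm LF LB hA.1).smul LF LB _)).deltaInv LF LB), ?_⟩
  exact ((curvForm_ord cov).deltaInv.mono (by omega)).add
    (((hA.2.nabla cov LB hA.1.supp).add (formOrd_half_act hA.2)).deltaInv.mono (by omega))

/-- The quadratic term is polarized as `A·A - A'·A' = A·(A - A') + (A - A')·A'`. Since `A` and `A'`
vanish at `y = 0`, neither summand has smaller order than `A - A'`, and `δ⁻¹` then raises the order.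
-/
lemma fedosovMap_contracting : Contracting (vectorForms M) (fedosovMap cov) := by
  intro A hA A' hA' p hp
  have LB := fiberLaws_vector d
  have LF := lawfulFiber_T d 1
  have h1 : fedosovMap cov A - fedosovMap cov A' = deltaInv (nabla cov (A - A') +
      (1 / 2 : ℝ) • (actForm A (A - A') + actForm (A - A') A')) := by
    rw [nabla_sub cov LB LF hA.1 hA'.1, actForm_sub LB LF A hA.1 hA'.1,
      actForm_sub_left LB A A' hA'.1, fedosovMap, fedosovMap, add_sub_add_left_eq_sub,
      ← deltaInv_sub, sub_add_sub_cancel, smul_sub]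
    congr 1
    abel
  rw [h1]
  exact ((hp.nabla cov LB (hA.1.sub LF LB hA'.1).supp).add
    (((FormOrd.actForm LB hA.2 (hA.1.sub LF LB hA'.1).supp hp).add
      (hp.actForm_vector hA'.2)).smul _)).deltaInv

lemma fedosovIter_mem (N : ℕ) : fedosovIter cov N ∈ vectorForms M := by
  induction N with
  | zero => exact ⟨FormIn.zero (lawfulFiber_T d 1) (fiberLaws_vector d), FormOrd.zero 1⟩
  | succ N ih => exact fedosovMap_mem cov ih

lemma fedosovA_mem : fedosovA cov ∈ vectorForms M :=
  ⟨FormIn.limForm (u := fedosovIter cov) (lawfulFiber_T d 1) (fiberLaws_vector d)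
    fun N => (fedosovIter_mem cov N).1, FormOrd.limForm (u := fedosovIter cov)
    fun N => (fedosovIter_mem cov N).2⟩

/-- The equation `A = δ⁻¹ R + δ⁻¹ (∇ A + ½ [A, A])`. -/
lemma fedosovA_eq : fedosovMap cov (fedosovA cov) = fedosovA cov :=
  (fedosovMap_contracting cov).map_limForm (u := fedosovIter cov) (fedosovIter_mem cov)
    (fedosovA_mem cov)
    (by
      have h : fedosovIter cov 0 = 0 := rfl
      rw [h, sub_zero]
      exact (fedosovIter_mem cov 1).2) fun _ => rfl

/-- By its equation `A` lies in the image of `δ⁻¹`, whose square is zero. -/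
lemma deltaInv_fedosovA : deltaInv (fedosovA cov) = 0 := by
  have LB := fiberLaws_vector d
  have LF := lawfulFiber_T d 1
  have hA := (fedosovA_mem cov).1
  rw [← fedosovA_eq cov, fedosovMap, deltaInv_add, deltaInv_deltaInv (curvForm_formIn cov).antisymm,
    deltaInv_deltaInv ((hA.nabla cov LF LB).add LF LB
      ((hA.actForm LF LB hA).smul LF LB _)).antisymm, add_zero]

/-- The curvature `R + ∇ A - δ A + ½ [A, A]` of the Fedosov connection. -/
noncomputable def fedosovCurv : RawForm M (fiberT d 1) 2 :=
  curvForm cov + nabla cov (fedosovA cov) - delta (fedosovA cov) +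
    (1 / 2 : ℝ) • actForm (fedosovA cov) (fedosovA cov)

lemma fedosovCurv_formIn : FormIn (setT d 1) (fedosovCurv cov) := by
  have LB := fiberLaws_vector d
  have LF := lawfulFiber_T d 1
  have hA := (fedosovA_mem cov).1
  exact (((curvForm_formIn cov).add LF LB (hA.nabla cov LF LB)).sub LF LB
    (hA.delta LF LB)).add LF LB ((hA.actForm LF LB hA).smul LF LB _)

/-- As `δ⁻¹ A = 0`, the homotopy formula gives `δ⁻¹ δ A = A`, and the equation for `A` says that
this equals `δ⁻¹` of the remaining terms of the curvature. -/
lemma deltaInv_fedosovCurv : deltaInv (fedosovCurv cov) = 0 := by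
  have LB := fiberLaws_vector d
  have LF := lawfulFiber_T d 1
  have hA := (fedosovA_mem cov).1
  have h1 := deltaInv_delta_add LB hA LF
  rw [deltaInv_fedosovA] at h1
  have h0 : delta (0 : RawForm M (fiberT d 1) 0) = 0 := by
    have h := delta_smul LB 0 (FormIn.zero (M := M) (q := 0) LF LB)
    rwa [zero_smul, zero_smul] at h
  rw [h0, add_zero] at h1
  have h2 := fedosovA_eq cov
  rw [fedosovMap, deltaInv_add] at h2
  rw [fedosovCurv, deltaInv_add, deltaInv_sub, deltaInv_add, h1]
  have h3 : ∀ x y u v : RawForm M (fiberT d 1) 1, x + (y + u) = v → x + y - v + u = 0 := by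
    rintro x y u v rfl
    abel
  exact h3 _ _ _ _ h2

end FedosovForm

/-! ### The Fedosov connection is flat and `D² = 0` -/

section FedosovDifferential

variable {M : Type*} [TopologicalSpace M] [ChartedSpace (EuclideanSpace ℝ (Fin d)) M]
  [IsManifold (𝓡 d) ∞ M] {B : FormalFiber d} {S : Finset B.ι} {q : ℕ}

lemma inChart_add (LB : FiberLaws B S) {a b : RawForm M B q} (ha : FormIn S a) (hb : FormIn S b)
    {x₀ p : M} (hp : p ∈ (extChartAt (𝓡 d) x₀).source) :
    inChart x₀ (a + b) p = inChart x₀ a p + inChart x₀ b p := by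
  rw [inChart_eq, inChart_eq, inChart_eq, Pi.add_apply,
    formAct_add LB (isUnit_det_jac hp) (ha.supp _) (hb.supp _)]

lemma inChart_smul (LB : FiberLaws B S) (c : ℝ) {a : RawForm M B q} (ha : FormIn S a)
    {x₀ p : M} (hp : p ∈ (extChartAt (𝓡 d) x₀).source) :
    inChart x₀ (c • a) p = c • inChart x₀ a p := by
  rw [inChart_eq, inChart_eq, Pi.smul_apply, formAct_smul LB (isUnit_det_jac hp) _ (ha.supp _)]

lemma inChart_sub (LF : LawfulFiber B) (LB : FiberLaws B S) {a b : RawForm M B q}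
    (ha : FormIn S a) (hb : FormIn S b) {x₀ p : M} (hp : p ∈ (extChartAt (𝓡 d) x₀).source) :
    inChart x₀ (a - b) p = inChart x₀ a p - inChart x₀ b p := by
  rw [sub_eq_add_smul, inChart_add LB ha (hb.smul LF LB _) hp, inChart_smul LB _ hb hp,
    ← sub_eq_add_smul]

variable (cov : CovariantDerivative (𝓡 d) (EuclideanSpace ℝ (Fin d))
  (TangentSpace (𝓡 d) : M → Type _))

/-- The connection form of the Fedosov differential in the chart at `x₀`. -/
noncomputable def fedosovConn (x₀ : M) (w : EuclideanSpace ℝ (Fin d)) (i : Fin d) :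
    Fin d → FPS d :=
  gammaForm cov x₀ w i - Pi.single i 1 + toVec (loc x₀ (fedosovA cov) w fun _ => i)

lemma locChristoffel_symm (htors : cov.torsion = 0) {x₀ p : M}
    (hp : p ∈ (extChartAt (𝓡 d) x₀).source) (i j k : Fin d) :
    locChristoffel cov x₀ p i j k = locChristoffel cov x₀ p j i k := by
  rw [locChristoffel_eq cov hp, locChristoffel_eq cov hp]
  simp only [mul_add, Finset.sum_add_distrib]
  have h := christoffelDefect_symm hp i k j
  rw [christoffelDefect, christoffelDefect] at h
  rw [h]
  congr 1
  refine Finset.sum_congr rfl fun b _ => ?_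
  congr 1
  rw [Finset.sum_comm]
  refine Finset.sum_congr rfl fun i' _ => Finset.sum_congr rfl fun c _ => ?_
  rw [christoffel_symm cov htors p c i' b]
  ring

/-- The coefficients of the two sides are Christoffel symbols with exchanged lower indices. Here
vanishing torsion enters: it makes the mixed terms of `δ` and `Γ` drop out of the curvature. -/
lemma vbr_single_gammaForm (htors : cov.torsion = 0) {x₀ : M} {w : EuclideanSpace ℝ (Fin d)}
    (hw : (extChartAt (𝓡 d) x₀).symm w ∈ (extChartAt (𝓡 d) x₀).source) (i j : Fin d) :
    vbr (Pi.single i 1) (gammaForm cov x₀ w j) = vbr (Pi.single j 1) (gammaForm cov x₀ w i) := by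
  have h : ∀ i j k, vbr (Pi.single i 1) (gammaForm cov x₀ w j) k =
      -(locChristoffel cov x₀ ((extChartAt (𝓡 d) x₀).symm w) j i k • (1 : FPS d)) := by
    intro i j k
    rw [vbr, vfApply_single, gammaForm_apply, map_neg, map_sum, Finset.sum_eq_single i]
    · rw [Derivation.map_smul, pderiv_X, Pi.single_eq_same, vfApply, Finset.sum_eq_zero, sub_zero]
      intro l _
      rw [pderiv_single_one, mul_zero]
    · intro l _ hl
      rw [Derivation.map_smul, pderiv_X, Pi.single_eq_of_ne hl, smul_zero]
    · simp
  funext k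
  rw [h, h, locChristoffel_symm cov htors hw]

variable [T2Space M] [CovariantDerivative.ContMDiffCovariantDerivative cov ∞]

lemma fedosovConn_smoothAt {x₀ p : M} (hp : p ∈ (extChartAt (𝓡 d) x₀).source) (i k : Fin d) :
    SmoothAt (fun w => fedosovConn cov x₀ w i k) (extChartAt (𝓡 d) x₀ p) :=
  ((locGamma_smoothAt cov hp i k).sub (SmoothAt.const _)).add
    ((fedosovA_mem cov).1.smooth hp (fun _ => i) fun _ => k)

/-- All three parts of `D` combine into one covariant derivative with connection form `Γᵢ - ∂/∂yⁱ +
Aᵢ`, to which the formula for the square and the Bianchi identity apply. -/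
lemma inChart_fedosovD (LF : LawfulFiber B) (LB : FiberLaws B S) {a : RawForm M B q}
    (ha : FormIn S a) {x₀ p : M} (hp : p ∈ (extChartAt (𝓡 d) x₀).source) :
    inChart x₀ (fedosovD cov a) p =
      locD (fedosovConn cov x₀) (loc x₀ a) (extChartAt (𝓡 d) x₀ p) := by
  have hA := (fedosovA_mem cov).1
  have hs := inChart_supp LB ha.supp hp
  rw [fedosovD, inChart_add LB ((ha.nabla cov LF LB).sub LF LB (ha.delta LF LB))
    (hA.actForm LF LB ha) hp, inChart_sub LF LB (ha.nabla cov LF LB) (ha.delta LF LB) hp,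
    inChart_nabla cov LB ha.supp ha.antisymm hp (ha.smooth hp), inChart_delta LB ha.supp hp,
    inChart_actForm LB _ ha.supp hp, ← dyMul_sub, ← dyMul_add, locD]
  congr 1
  funext i L
  rw [loc_chart hp, fedosovConn, LB.lie_add_left (hs L), LB.lie_sub_left _ _ (hs L), loc_chart hp,
    gammaForm, (extChartAt (𝓡 d) x₀).left_inv hp]
  abel

lemma loc_fedosovD (LF : LawfulFiber B) (LB : FiberLaws B S) {a : RawForm M B q}
    (ha : FormIn S a) {x₀ p : M} (hp : p ∈ (extChartAt (𝓡 d) x₀).source) :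
    loc x₀ (fedosovD cov a) =ᶠ[nhds (extChartAt (𝓡 d) x₀ p)]
      locD (fedosovConn cov x₀) (loc x₀ a) := by
  filter_upwards [eventually_source hp (source_mem_nhds hp),
    target_mem_nhds ((extChartAt (𝓡 d) x₀).map_source hp)] with w hw hwt
  rw [loc, inChart_fedosovD cov LF LB ha hw, (extChartAt (𝓡 d) x₀).right_inv hwt]

lemma FormIn.fedosovD (LF : LawfulFiber B) (LB : FiberLaws B S) {a : RawForm M B q}
    (ha : FormIn S a) : FormIn S (fedosovD cov a) :=
  ((ha.nabla cov LF LB).sub LF LB (ha.delta LF LB)).add LF LB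
    ((fedosovA_mem cov).1.actForm LF LB ha)

lemma pdV_fedosovConn {x₀ p : M} (hp : p ∈ (extChartAt (𝓡 d) x₀).source) (i j : Fin d) :
    pdV (fedosovConn cov x₀) (extChartAt (𝓡 d) x₀ p) i j =
      pdV (gammaForm cov x₀) (extChartAt (𝓡 d) x₀ p) i j +
        toVec (pdF (loc x₀ (fedosovA cov)) (extChartAt (𝓡 d) x₀ p) i fun _ => j) := by
  funext k
  refine (pdV_line (fedosovConn_smoothAt cov hp j k)).unique ?_
  refine (((pdV_line (locGamma_smoothAt cov hp j k)).sub
    (HasDer.const ((Pi.single j 1 : Fin d → FPS d) k))).add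
      (pdF_line ((fedosovA_mem cov).1.smooth hp (fun _ => j) fun _ => k) i)).of_eq
    (fun _ => rfl) ?_
  rw [sub_zero]
  rfl

/-- The curvature of the Fedosov connection in a chart. -/
lemma inChart_fedosovCurv (htors : cov.torsion = 0) {x₀ p : M}
    (hp : p ∈ (extChartAt (𝓡 d) x₀).source) (L : Fin 2 → Fin d) :
    toVec (inChart x₀ (fedosovCurv cov) p L) = (1 / 2 : ℝ) •
      curvV (fedosovConn cov x₀) (extChartAt (𝓡 d) x₀ p) (L 0) (L 1) := by
  have LB := fiberLaws_vector d
  have LF := lawfulFiber_T d 1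
  have hA := (fedosovA_mem cov).1
  have hR := curvForm_formIn cov
  have hn := hA.nabla cov LF LB
  have hδ := hA.delta LF LB
  have hAA := hA.actForm LF LB hA
  have hc : toVec (inChart x₀ (curvForm cov) p L) = (1 / 2 : ℝ) •
      curvV (gammaForm cov x₀) (extChartAt (𝓡 d) x₀ p) (L 0) (L 1) := by
    funext k
    exact inChart_curvForm cov hp L fun _ => k
  have htoVec : ∀ x y u v : (fiberT d 1).ι → FPS d, toVec (x + y - u + (1 / 2 : ℝ) • v) =
      toVec x + toVec y - toVec u + (1 / 2 : ℝ) • toVec v := fun _ _ _ _ => rfl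
  have hhalf : ∀ x y : (fiberT d 1).ι → FPS d, toVec ((1 / 2 : ℝ) • (x - y)) =
      (1 / 2 : ℝ) • (toVec x - toVec y) := fun _ _ => rfl
  have hadd : ∀ x y : (fiberT d 1).ι → FPS d, toVec (x + y) = toVec x + toVec y := fun _ _ => rfl
  have hL : inChart x₀ (fedosovCurv cov) p L = inChart x₀ (curvForm cov) p L +
      inChart x₀ (nabla cov (fedosovA cov)) p L - inChart x₀ (delta (fedosovA cov)) p L +
      (1 / 2 : ℝ) • inChart x₀ (actForm (fedosovA cov) (fedosovA cov)) p L := by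
    rw [fedosovCurv, inChart_add LB ((hR.add LF LB hn).sub LF LB hδ) (hAA.smul LF LB _) hp,
      inChart_sub LF LB (hR.add LF LB hn) hδ hp, inChart_add LB hR hn hp, inChart_smul LB _ hAA hp]
    rfl
  rw [hL, htoVec, hc, inChart_nabla cov LB hA.supp hA.antisymm hp (hA.smooth hp),
    inChart_delta LB hA.supp hp, inChart_actForm LB _ hA.supp hp, dyMul_one_index, dyMul_one_index,
    dyMul_one_index, hhalf, hhalf, hhalf, hadd, hadd]
  simp only [fiberT_lie_one, curvV, pdV_fedosovConn cov hp]
  have hG : ∀ i, locGamma cov x₀ p i = gammaForm cov x₀ (extChartAt (𝓡 d) x₀ p) i := fun i => by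
    rw [gammaForm, (extChartAt (𝓡 d) x₀).left_inv hp]
  simp only [hG, fedosovConn, loc_chart hp, vbr_add_left, vbr_add_right, vbr_sub_left,
    vbr_sub_right, vbr_single_single]
  -- In the curvature of `Γ - ∂ + A` the constant fields commute and the mixed brackets of `∂` and
  -- `Γ` cancel. What remains is the curvature of `Γ` together with the components of `∇ A`, `-δ A`
  -- and `½ [A, A]`.
  have ht := vbr_single_gammaForm cov htors (x₀ := x₀) (w := extChartAt (𝓡 d) x₀ p)
    (by rwa [(extChartAt (𝓡 d) x₀).left_inv hp]) (L 0) (L 1)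
  rw [ht, vbr_swap (gammaForm cov x₀ (extChartAt (𝓡 d) x₀ p) (L 0)) (Pi.single (L 1) 1),
    vbr_swap (toVec (inChart x₀ (fedosovA cov) p fun _ => L 0)) (Pi.single (L 1) 1),
    vbr_swap (toVec (inChart x₀ (fedosovA cov) p fun _ => L 1))
      (toVec (inChart x₀ (fedosovA cov) p fun _ => L 0)),
    vbr_swap (toVec (inChart x₀ (fedosovA cov) p fun _ => L 0))
      (gammaForm cov x₀ (extChartAt (𝓡 d) x₀ p) (L 1))]
  module

/-- The Bianchi identity for the Fedosov connection. -/
lemma fedosovD_fedosovCurv (htors : cov.torsion = 0) : fedosovD cov (fedosovCurv cov) = 0 := by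
  have LB := fiberLaws_vector d
  have LF := lawfulFiber_T d 1
  have hF := fedosovCurv_formIn cov
  funext p
  have hp := mem_source_self (d := d) p
  rw [← inChart_self LB (hF.fedosovD cov LF LB).supp p, inChart_fedosovD cov LF LB hF hp]
  refine bianchi (fedosovConn_smoothAt cov hp) (hF.smooth hp) ?_
  filter_upwards [eventually_source hp (source_mem_nhds hp),
    target_mem_nhds ((extChartAt (𝓡 d) p).map_source hp)] with w hw hwt L J
  have h := inChart_fedosovCurv cov htors hw L
  rw [(extChartAt (𝓡 d) p).right_inv hwt] at h
  rw [loc]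
  exact (eq_toVec _ J).trans (congrFun h (J 0))

/-- Forms annihilated by `D` and `δ⁻¹` vanish. -/
lemma eq_zero_of_fedosovD_eq_zero (LF : LawfulFiber B) (LB : FiberLaws B S)
    {a : RawForm M B (q + 1)} (ha : FormIn S a) (hD : fedosovD cov a = 0)
    (hδ : deltaInv a = 0) : a = 0 := by
  have hA := fedosovA_mem cov
  have h0 : delta (0 : RawForm M B q) = 0 := by
    have h := delta_smul LB 0 (FormIn.zero (M := M) (q := q) LF LB)
    rwa [zero_smul, zero_smul] at h
  have h1 : delta a = nabla cov a + actForm (fedosovA cov) a := by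
    rw [fedosovD, sub_add_eq_add_sub] at hD
    exact (sub_eq_zero.1 hD).symm
  have h2 := deltaInv_delta_add LB ha LF
  rw [hδ, h0, add_zero, h1] at h2
  -- Now `a = δ⁻¹ (∇ a + A · a)`, so vanishing to order `p` implies vanishing to order `p + 1`.
  refine eq_of_formOrd_sub fun p => ?_
  rw [sub_zero]
  induction p with
  | zero => exact FormOrd.of_zero _
  | succ p ih =>
    rw [← h2]
    exact ((ih.nabla cov LB ha.supp).add (FormOrd.actForm LB hA.2 ha.supp ih)).deltaInv

/-- The iteration for `A` ensures only `δ⁻¹ F = 0`; the Bianchi identity `D F = 0` upgrades this to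
flatness. -/
lemma fedosovCurv_eq_zero (htors : cov.torsion = 0) : fedosovCurv cov = 0 :=
  eq_zero_of_fedosovD_eq_zero cov (lawfulFiber_T d 1) (fiberLaws_vector d) (fedosovCurv_formIn cov)
    (fedosovD_fedosovCurv cov htors) (deltaInv_fedosovCurv cov)

/-- The Fedosov differential is a differential. -/
theorem fedosovD_fedosovD (htors : cov.torsion = 0) (LF : LawfulFiber B) (LB : FiberLaws B S)
    {a : RawForm M B q} (ha : FormIn S a) : fedosovD cov (fedosovD cov a) = 0 := by
  have hD := ha.fedosovD cov LF LB
  funext p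
  have hp := mem_source_self (d := d) p
  have hF : ∀ i j, curvV (fedosovConn cov p) (extChartAt (𝓡 d) p p) i j = 0 := by
    intro i j
    have h := inChart_fedosovCurv cov htors hp ![i, j]
    rw [inChart_self (fiberLaws_vector d) (fedosovCurv_formIn cov).supp, fedosovCurv_eq_zero cov
      htors] at h
    have h2 : curvV (fedosovConn cov p) (extChartAt (𝓡 d) p p) i j =
        (2 : ℝ) • (1 / 2 : ℝ) • curvV (fedosovConn cov p) (extChartAt (𝓡 d) p p) i j := by
      rw [smul_smul]
      norm_num
    rw [h2]
    refine (congrArg (fun v : Fin d → FPS d => (2 : ℝ) • v) h.symm).trans ?_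
    funext k
    change (2 : ℝ) • (0 : FPS d) = 0
    exact smul_zero _
  have h1 := loc_fedosovD cov LF LB ha hp
  rw [← inChart_self LB (hD.fedosovD cov LF LB).supp p, inChart_fedosovD cov LF LB hD hp]
  have h2 : locD (fedosovConn cov p) (loc p (fedosovD cov a)) (extChartAt (𝓡 d) p p) =
      locD (fedosovConn cov p) (locD (fedosovConn cov p) (loc p a)) (extChartAt (𝓡 d) p p) := by
    simp only [locD]
    congr 1
    funext i L
    rw [pdF_congr h1, h1.self_of_nhds]
    rfl
  rw [h2, locD_locD LB (loc_supp LB ha.supp hp) (loc_antisymm LB ha.supp ha.antisymm hp)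
    (ha.smooth hp) (fedosovConn_smoothAt cov hp)]
  have h3 : ∀ i j L, (1 / 2 : ℝ) • B.lie (curvV (fedosovConn cov p) (extChartAt (𝓡 d) p p) i j)
      (loc p a (extChartAt (𝓡 d) p p) L) = 0 := by
    intro i j L
    rw [hF, LB.lie_zero_left ((loc_supp LB ha.supp hp).self_of_nhds L), smul_zero]
  simp only [h3]
  funext L
  simp [dyMul]

end FedosovDifferential

/-! ### Fixed points of the lift equation, exactness and flat sections -/

section Lift

variable {M : Type*} [TopologicalSpace M] [ChartedSpace (EuclideanSpace ℝ (Fin d)) M]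
  [IsManifold (𝓡 d) ∞ M] {B : FormalFiber d} {S : Finset B.ι} {q : ℕ}

lemma IsForm.exists_formIn (LF : LawfulFiber B) {a : RawForm M B q} (ha : IsForm B q a) :
    ∃ S, FiberLaws B S ∧ FormIn S a := by
  obtain ⟨S, hS⟩ := isForm_iff.1 ha
  obtain ⟨S', h, hL⟩ := LF.exists_laws S
  exact ⟨S', hL, hS.mono h⟩

lemma IsForm.exists_formIn₂ (LF : LawfulFiber B) {q' : ℕ} {a : RawForm M B q} {b : RawForm M B q'}
    (ha : IsForm B q a) (hb : IsForm B q' b) : ∃ S, FiberLaws B S ∧ FormIn S a ∧ FormIn S b := by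
  classical
  obtain ⟨S, hS⟩ := isForm_iff.1 ha
  obtain ⟨T, hT⟩ := isForm_iff.1 hb
  obtain ⟨S', h, hL⟩ := LF.exists_laws (S ∪ T)
  exact ⟨S', hL, hS.mono (Finset.subset_union_left.trans h),
    hT.mono (Finset.subset_union_right.trans h)⟩

/-- The part of degree zero in `y`. -/
noncomputable def yZero (t : RawForm M B q) : RawForm M B q := fun x L n => C (coeff 0 (t x L n))

lemma coeff_yZero (t : RawForm M B q) (x : M) (L : Fin q → Fin d) (n : B.ι) (m : Fin d →₀ ℕ) :
    coeff m (yZero t x L n) = if m = 0 then coeff 0 (t x L n) else 0 := coeff_C _ _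

lemma FormIn.yZero (LF : LawfulFiber B) (LB : FiberLaws B S) {t : RawForm M B q}
    (ht : FormIn S t) : FormIn S (yZero t) := by
  classical
  have hsupp : ∀ x L, SuppIn S (Fedosov.yZero t x L) := fun x L n hn => by
    rw [Fedosov.yZero, ht.supp x L n hn, map_zero, map_zero]
  refine ⟨fun x => isAntisymm_iff_coeff.2 fun n m => ?_, fun x L => ?_, hsupp,
    fun {x₀ p} hp L n m => ?_⟩
  · intro π J
    have h := isAntisymm_iff_coeff.1 (ht.antisymm x) n 0 π J
    by_cases hm : m = 0
    · simpa only [coeff_yZero, if_pos hm] using h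
    · simp only [coeff_yZero, if_neg hm, smul_zero]
  · refine LF.sym_of_coeff (fun m => if m = 0 then t x L else 0) (fun m => ?_) fun m n => ?_
    · split_ifs
      · exact ht.sym x L
      · exact LF.sym_zero
    · rw [coeff_yZero]
      split_ifs with h
      · rw [h]
      · rfl
  · have h : (fun w => coeff m (loc x₀ (Fedosov.yZero t) w L n))
        =ᶠ[nhds (extChartAt (𝓡 d) x₀ p)]
        fun w => (if m = 0 then 1 else 0) * coeff m (loc x₀ t w L n) :=
      (eventually_source hp (source_mem_nhds hp)).mono fun w hw => by
        simp only [loc]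
        rw [inChart_eq, inChart_eq]
        refine formAct_coeff_congr LB (isUnit_det_jac hw) (hsupp _) (ht.supp _)
          (fun L n k hk => ?_) L n
        rw [coeff_yZero]
        by_cases hm : m = 0
        · have hk0 : k = 0 := by
            rw [hm, map_zero] at hk
            exact (Finsupp.degree_eq_zero_iff k).1 hk
          rw [if_pos hk0, if_pos hm, one_mul, hk0]
        · have hk0 : k ≠ 0 := fun h => hm ((Finsupp.degree_eq_zero_iff m).1 (by rw [← hk, h, map_zero]))
          rw [if_neg hk0, if_neg hm, zero_mul]
    exact (contDiffAt_const.mul (ht.smooth hp L n m)).congr_of_eventuallyEq h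

/-- The homotopy formula in form degree zero, with the `y`-independent part as defect. -/
lemma deltaInv_delta_zero (LB : FiberLaws B S) {t : RawForm M B 0} (ht : FormIn S t) :
    deltaInv (delta t) = t - yZero t := by
  classical
  funext x L n
  ext m
  rw [deltaInv_eq, delta_eq LB ht.supp, Pi.sub_apply, Pi.sub_apply, Pi.sub_apply, map_sub,
    coeff_yZero]
  by_cases hm : m = 0
  · rw [hm, if_pos rfl, sub_self, coeff_zero_dInv]
  · rw [if_neg hm, sub_zero, coeff_dInv_dOp_zero _ _ _ _ hm]

lemma delta_yZero (LF : LawfulFiber B) (LB : FiberLaws B S) {t : RawForm M B q}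
    (ht : FormIn S t) : delta (yZero t) = 0 := by
  funext x L n
  rw [delta_eq LB (ht.yZero LF LB).supp, dOp_apply]
  have h : ∀ (s : Fin (q + 1)), pderiv ℝ (L s) (yZero t x (s.removeNth L) n) = 0 :=
    fun s => Derivation.map_algebraMap (pderiv ℝ (L s)) (coeff 0 (t x (s.removeNth L) n))
  simp [h]

lemma yZero_eq_of_delta (LB : FiberLaws B S) {t : RawForm M B 0} (ht : FormIn S t)
    (hδ : delta t = 0) : yZero t = t := by
  have h := deltaInv_delta_zero LB ht
  rw [hδ] at h
  have h0 : deltaInv (0 : RawForm M B 1) = 0 := by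
    have h := deltaInv_smul 0 (0 : RawForm M B 1)
    rwa [zero_smul, zero_smul] at h
  rw [h0] at h
  exact (sub_eq_zero.1 h.symm).symm

lemma yZero_deltaInv (a : RawForm M B (q + 1)) : yZero (deltaInv a) = 0 := by
  funext x L n
  rw [yZero, deltaInv_eq, coeff_zero_dInv, map_zero]
  rfl

lemma yZero_add (a b : RawForm M B q) : yZero (a + b) = yZero a + yZero b := by
  funext x L n
  simp [yZero]

/-- Apply `δ⁻¹` to the homotopy formula and use that its square is zero: on the image of `δ⁻¹`, the
operator `δ⁻¹ δ` is the identity. -/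
lemma deltaInv_delta_deltaInv (LF : LawfulFiber B) (LB : FiberLaws B S) {a : RawForm M B (q + 1)}
    (ha : FormIn S a) : deltaInv (delta (deltaInv a)) = deltaInv a := by
  have h := deltaInv_delta_add LB ha LF
  have h2 : delta (deltaInv a) = a - deltaInv (delta a) := eq_sub_of_add_eq' h
  rw [h2, deltaInv_sub, deltaInv_deltaInv (ha.delta LF LB).antisymm, sub_zero]

variable (cov : CovariantDerivative (𝓡 d) (EuclideanSpace ℝ (Fin d))
  (TangentSpace (𝓡 d) : M → Type _))

/-- The part `∇ + A ·` of the Fedosov differential. -/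
noncomputable def twist (a : RawForm M B q) : RawForm M B (q + 1) :=
  nabla cov a + actForm (fedosovA cov) a

lemma fedosovD_eq (a : RawForm M B q) : fedosovD cov a = twist cov a - delta a := by
  rw [fedosovD, twist]
  abel

/-- The iterative solution of `t = c + δ⁻¹ (∇ t + A · t)`. -/
noncomputable def fedosovSol (c : RawForm M B q) : RawForm M B q :=
  limForm fun N => (fun t => c + deltaInv (twist cov t))^[N] c

lemma lift_eq (a : RawForm M B 0) : lift cov a = fedosovSol cov a := by
  have hit : ∀ N, liftIter cov a N = (fun t => a + deltaInv (twist cov t))^[N] a := by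
    intro N
    induction N with
    | zero => rfl
    | succ N ih =>
      rw [Function.iterate_succ_apply', ← ih]
      rfl
  refine funext fun x => funext fun L => funext fun n => MvPowerSeries.ext fun m => ?_
  have h := congrArg (fun u : RawForm M B 0 => coeff m (u x L n)) (hit m.degree)
  exact h

variable [T2Space M] [CovariantDerivative.ContMDiffCovariantDerivative cov ∞]
  (LF : LawfulFiber B) (LB : FiberLaws B S) {a b c t : RawForm M B q}
include LF LB

lemma FormIn.twist (ha : FormIn S a) : FormIn S (twist cov a) :=
  (ha.nabla cov LF LB).add LF LB ((fedosovA_mem cov).1.actForm LF LB ha)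

lemma twist_contracting (c : RawForm M B q) :
    Contracting {a | FormIn S a} fun t => c + deltaInv (twist cov t) := by
  intro a ha b hb p hp
  have h : c + deltaInv (twist cov a) - (c + deltaInv (twist cov b)) =
      deltaInv (twist cov (a - b)) := by
    rw [add_sub_add_left_eq_sub, ← deltaInv_sub, twist, twist, twist, nabla_sub cov LB LF ha hb,
      actForm_sub LB LF _ ha hb]
    congr 1
    abel
  simp only [h]
  exact ((hp.nabla cov LB (ha.sub LF LB hb).supp).add
    (FormOrd.actForm LB (fedosovA_mem cov).2 (ha.sub LF LB hb).supp hp)).deltaInv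

lemma iterate_twist_formIn (hc : FormIn S c) (N : ℕ) :
    FormIn S ((fun t => c + deltaInv (twist cov t))^[N] c) := by
  induction N with
  | zero => exact hc
  | succ N ih =>
    rw [Function.iterate_succ_apply']
    exact hc.add LF LB ((ih.twist cov LF LB).deltaInv LF LB)

lemma FormIn.fedosovSol (hc : FormIn S c) : FormIn S (fedosovSol cov c) :=
  FormIn.limForm LF LB (iterate_twist_formIn cov LF LB hc)

lemma fedosovSol_eq (hc : FormIn S c) :
    c + deltaInv (twist cov (fedosovSol cov c)) = fedosovSol cov c :=
  (twist_contracting cov LF LB c).map_limForm (iterate_twist_formIn cov LF LB hc)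
    (hc.fedosovSol cov LF LB)
    (by
      simp only [Function.iterate_one, Function.iterate_zero, id_eq, add_sub_cancel_left]
      exact ((FormOrd.of_zero _).deltaInv)) fun N => Function.iterate_succ_apply' _ _ _

/-- Uniqueness of the fixed point; it yields linearity of the lift and recognizes flat sections as
lifts. -/
lemma eq_fedosovSol (hc : FormIn S c) (ht : FormIn S t) (h : t = c + deltaInv (twist cov t)) :
    t = fedosovSol cov c :=
  (twist_contracting cov LF LB c).unique ht (hc.fedosovSol cov LF LB) h.symm
    (fedosovSol_eq cov LF LB hc)

lemma fedosovD_add (ha : FormIn S a) (hb : FormIn S b) :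
    fedosovD cov (a + b) = fedosovD cov a + fedosovD cov b := by
  simp only [fedosovD, nabla_add cov LB ha hb, delta_add LB ha hb, actForm_add LB _ ha hb]
  abel

lemma fedosovD_smul (r : ℝ) (ha : FormIn S a) : fedosovD cov (r • a) = r • fedosovD cov a := by
  simp only [fedosovD, nabla_smul cov LB _ ha, delta_smul LB _ ha, actForm_smul LB _ _ ha,
    smul_add, smul_sub]

lemma fedosovD_sub (ha : FormIn S a) (hb : FormIn S b) :
    fedosovD cov (a - b) = fedosovD cov a - fedosovD cov b := by
  rw [sub_eq_add_smul, fedosovD_add cov LF LB ha (hb.smul LF LB _), fedosovD_smul cov LF LB _ hb,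
    ← sub_eq_add_smul]

omit a b c t in
/-- The cohomology of the Fedosov differential vanishes in positive degrees. -/
theorem exists_fedosovD_eq (htors : cov.torsion = 0) {a : RawForm M B (q + 1)} (ha : FormIn S a)
    (hD : fedosovD cov a = 0) : ∃ b : RawForm M B q, FormIn S b ∧ fedosovD cov b = a := by
  -- The sign comes from `D = (∇ + A ·) - δ`: applying `δ⁻¹` to `D b = a` under the condition `δ⁻¹ δ
  -- b = b` gives `b = -δ⁻¹ a + δ⁻¹ (∇ b + A · b)`.
  have hc := (ha.smul LF LB (-1)).deltaInv LF LB
  set b := fedosovSol cov (deltaInv ((-1 : ℝ) • a)) with hb_def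
  have hb : FormIn S b := hc.fedosovSol cov LF LB
  have hDb := hb.fedosovD cov LF LB
  have hb_eq : deltaInv ((-1 : ℝ) • a) + deltaInv (twist cov b) = b := fedosovSol_eq cov LF LB hc
  refine ⟨b, hb, sub_eq_zero.1 (eq_zero_of_fedosovD_eq_zero cov LF LB (hDb.sub LF LB ha) ?_ ?_)⟩
  · rw [fedosovD_sub cov LF LB hDb ha, fedosovD_fedosovD cov htors LF LB hb, hD, sub_zero]
  -- By its equation `b` lies in the image of `δ⁻¹`.
  · have h1 : deltaInv (delta b) = b := by
      rw [← hb_eq, ← deltaInv_add, deltaInv_delta_deltaInv LF LB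
        ((ha.smul LF LB _).add LF LB (hb.twist cov LF LB))]
    rw [fedosovD_eq, deltaInv_sub, deltaInv_sub, h1]
    nth_rewrite 2 [← hb_eq]
    rw [deltaInv_smul, neg_one_smul]
    abel

omit a b c t
variable {a b t : RawForm M B 0}

lemma FormIn.lift (ha : FormIn S a) : FormIn S (lift cov a) := by
  rw [lift_eq]
  exact ha.fedosovSol cov LF LB

lemma isLift_lift (ha : FormIn S a) : IsLift cov a (lift cov a) := by
  rw [IsLift, lift_eq]
  exact (fedosovSol_eq cov LF LB ha).symm

lemma yZero_lift (ha : FormIn S a) : yZero (lift cov a) = yZero a := by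
  rw [isLift_lift cov LF LB ha, yZero_add, yZero_deltaInv, add_zero]

/-- Lifts of `y`-independent sections are flat. -/
theorem fedosovD_lift (htors : cov.torsion = 0) (ha : FormIn S a) (hδ : delta a = 0) :
    fedosovD cov (lift cov a) = 0 := by
  have ht := ha.lift cov LF LB
  refine eq_zero_of_fedosovD_eq_zero cov LF LB (ht.fedosovD cov LF LB)
    (fedosovD_fedosovD cov htors LF LB ht) ?_
  -- With `t = τ(a)` one has `δ⁻¹ D t = δ⁻¹ (∇ t + A · t) - (t - a)`, as the part of `t` of degree
  -- zero in `y` is `a`; this vanishes by the equation of the lift.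
  rw [fedosovD_eq, deltaInv_sub, deltaInv_delta_zero LB ht, yZero_lift cov LF LB ha,
    yZero_eq_of_delta LB ha hδ]
  nth_rewrite 2 [isLift_lift cov LF LB ha]
  rw [twist]
  abel

/-- Flat sections are lifts of `y`-independent sections. -/
theorem eq_lift_of_fedosovD (ht : FormIn S t) (hD : fedosovD cov t = 0) :
    t = lift cov (yZero t) := by
  rw [lift_eq]
  refine eq_fedosovSol cov LF LB (ht.yZero LF LB) ht ?_
  rw [fedosovD_eq, sub_eq_zero] at hD
  rw [hD, deltaInv_delta_zero LB ht]
  abel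

end Lift

/-! ### The lift as a linear bijection onto flat sections -/

section Bundles

variable {M : Type*} [TopologicalSpace M] [ChartedSpace (EuclideanSpace ℝ (Fin d)) M]
  [IsManifold (𝓡 d) ∞ M] [T2Space M] {B : FormalFiber d}
  (cov : CovariantDerivative (𝓡 d) (EuclideanSpace ℝ (Fin d)) (TangentSpace (𝓡 d) : M → Type _))
  [CovariantDerivative.ContMDiffCovariantDerivative cov ∞] (LF : LawfulFiber B)
include LF

theorem isLift_of_constSections {a : RawForm M B 0} (ha : a ∈ constSections M B) :
    IsLift cov a (lift cov a) := by
  obtain ⟨S, LB, h⟩ := ha.1.exists_formIn LF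
  exact isLift_lift cov LF LB h

/-- The sum of the lifts solves the fixed point equation of the lift of the sum. -/
theorem lift_add {a b : RawForm M B 0} (ha : a ∈ constSections M B) (hb : b ∈ constSections M B) :
    lift cov (a + b) = lift cov a + lift cov b := by
  obtain ⟨S, LB, ha, hb⟩ := ha.1.exists_formIn₂ LF hb.1
  have ha' := ha.lift cov LF LB
  have hb' := hb.lift cov LF LB
  rw [lift_eq cov (a + b)]
  refine (eq_fedosovSol cov LF LB (ha.add LF LB hb) (ha'.add LF LB hb') ?_).symm
  have h : twist cov (lift cov a + lift cov b) = twist cov (lift cov a) + twist cov (lift cov b) := by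
    simp only [twist, nabla_add cov LB ha' hb', actForm_add LB _ ha' hb']
    abel
  rw [h, deltaInv_add, add_add_add_comm]
  exact congrArg₂ (· + ·) (isLift_lift cov LF LB ha) (isLift_lift cov LF LB hb)

theorem lift_smul (c : ℝ) {a : RawForm M B 0} (ha : a ∈ constSections M B) :
    lift cov (c • a) = c • lift cov a := by
  obtain ⟨S, LB, ha⟩ := ha.1.exists_formIn LF
  have ha' := ha.lift cov LF LB
  rw [lift_eq cov (c • a)]
  refine (eq_fedosovSol cov LF LB (ha.smul LF LB c) (ha'.smul LF LB c) ?_).symm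
  have h : twist cov (c • lift cov a) = c • twist cov (lift cov a) := by
    simp only [twist, nabla_smul cov LB _ ha', actForm_smul LB _ _ ha', smul_add]
  rw [h, deltaInv_smul, ← smul_add]
  exact congrArg (c • ·) (isLift_lift cov LF LB ha)

omit [T2Space M] in
lemma yZero_mem_constSections {t : RawForm M B 0} (ht : IsForm B 0 t) :
    yZero t ∈ constSections M B := by
  obtain ⟨S, LB, h⟩ := ht.exists_formIn LF
  exact ⟨isForm_iff.2 ⟨S, h.yZero LF LB⟩, delta_yZero LF LB h⟩

lemma lift_mem_flatSections (htors : cov.torsion = 0) {a : RawForm M B 0}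
    (ha : a ∈ constSections M B) : lift cov a ∈ flatSections cov B := by
  obtain ⟨S, LB, h⟩ := ha.1.exists_formIn LF
  exact ⟨isForm_iff.2 ⟨S, h.lift cov LF LB⟩, fedosovD_lift cov LF LB htors h ha.2⟩

lemma yZero_lift_of_constSections {a : RawForm M B 0} (ha : a ∈ constSections M B) :
    yZero (lift cov a) = a := by
  obtain ⟨S, LB, h⟩ := ha.1.exists_formIn LF
  rw [yZero_lift cov LF LB h, yZero_eq_of_delta LB h ha.2]

lemma eq_lift_of_flatSections {t : RawForm M B 0} (ht : t ∈ flatSections cov B) :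
    t = lift cov (yZero t) := by
  obtain ⟨S, LB, h⟩ := ht.1.exists_formIn LF
  exact eq_lift_of_fedosovD cov LF LB h ht.2

/-- The inverse is restriction to `y = 0`. -/
theorem lift_bijOn (htors : cov.torsion = 0) :
    Set.BijOn (lift cov) (constSections M B) (flatSections cov B) := by
  refine ⟨fun a ha => lift_mem_flatSections cov LF htors ha, fun a ha b hb hab => ?_, fun t ht => ?_⟩
  · have h := congrArg yZero hab
    rwa [yZero_lift_of_constSections cov LF ha, yZero_lift_of_constSections cov LF hb] at h
  · exact ⟨yZero t, yZero_mem_constSections LF ht.1, (eq_lift_of_flatSections cov LF ht).symm⟩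

end Bundles

/-! ### Products -/

variable {B₁ B₂ B₃ : FormalFiber d}

/-- A product of components is compatible with coordinate changes and a derivation for
vector fields, on components in given finite sets. -/
structure ProductLaws (T₁ : Finset B₁.ι) (T₂ : Finset B₂.ι) (T₃ : Finset B₃.ι)
    (μ : (B₁.ι → FPS d) → (B₂.ι → FPS d) → B₃.ι → FPS d) : Prop where
  supp : ∀ {a b}, SuppIn T₁ a → SuppIn T₂ b → SuppIn T₃ (μ a b)
  act : ∀ {g : Matrix (Fin d) (Fin d) ℝ} {a b}, IsUnit g.det → SuppIn T₁ a → SuppIn T₂ b →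
    B₃.act g (μ a b) = μ (B₁.act g a) (B₂.act g b)
  lie : ∀ (v : Fin d → FPS d) {a b}, SuppIn T₁ a → SuppIn T₂ b →
    B₃.lie v (μ a b) = μ (B₁.lie v a) b + μ a (B₂.lie v b)

/-- A natural product of fibers. -/
structure IsProduct (μ : (B₁.ι → FPS d) → (B₂.ι → FPS d) → B₃.ι → FPS d) : Prop where
  bilin : ∀ n, ∃ (κ : Type) (T : Finset κ) (c : κ → ℝ) (i : κ → B₁.ι) (j : κ → B₂.ι), ∀ a b,
    μ a b n = ∑ t ∈ T, c t • (a (i t) * b (j t))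
  sym : ∀ {a b}, B₁.IsSym a → B₂.IsSym b → B₃.IsSym (μ a b)
  exists_laws : ∀ (S₁ : Finset B₁.ι) (S₂ : Finset B₂.ι), ∃ T₁ T₂ T₃, S₁ ⊆ T₁ ∧ S₂ ⊆ T₂ ∧
    FiberLaws B₁ T₁ ∧ FiberLaws B₂ T₂ ∧ FiberLaws B₃ T₃ ∧ ProductLaws T₁ T₂ T₃ μ

section

variable {μ : (B₁.ι → FPS d) → (B₂.ι → FPS d) → B₃.ι → FPS d} (hμ : IsProduct μ)
include hμ

lemma IsProduct.add_left (a a' : B₁.ι → FPS d) (b : B₂.ι → FPS d) :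
    μ (a + a') b = μ a b + μ a' b := by
  funext n
  obtain ⟨κ, T, c, i, j, h⟩ := hμ.bilin n
  simp only [Pi.add_apply, h, add_mul, smul_add, Finset.sum_add_distrib]

lemma IsProduct.add_right (a : B₁.ι → FPS d) (b b' : B₂.ι → FPS d) :
    μ a (b + b') = μ a b + μ a b' := by
  funext n
  obtain ⟨κ, T, c, i, j, h⟩ := hμ.bilin n
  simp only [Pi.add_apply, h, mul_add, smul_add, Finset.sum_add_distrib]

lemma IsProduct.zero_left (b : B₂.ι → FPS d) : μ 0 b = 0 := by
  have h := hμ.add_left 0 0 b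
  rwa [add_zero, left_eq_add] at h

lemma IsProduct.zero_right (a : B₁.ι → FPS d) : μ a 0 = 0 := by
  have h := hμ.add_right a 0 0
  rwa [add_zero, left_eq_add] at h

lemma IsProduct.coeff_zero (a : B₁.ι → FPS d) (b : B₂.ι → FPS d) (n : B₃.ι) :
    (C (coeff 0 (μ a b n)) : FPS d) =
      μ (fun n => C (coeff 0 (a n))) (fun n => C (coeff 0 (b n))) n := by
  obtain ⟨κ, T, c, i, j, h⟩ := hμ.bilin n
  have hC : ∀ x : ℝ, (C x : FPS d) = algebraMap ℝ (FPS d) x := fun _ => rfl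
  have hc : ∀ x : ℝ, constantCoeff (algebraMap ℝ (FPS d) x) = x := fun x => constantCoeff_C x
  simp only [h, hC, map_sum, map_mul, Algebra.smul_def, coeff_zero_eq_constantCoeff_apply, hc]

variable {α : EuclideanSpace ℝ (Fin d) → B₁.ι → FPS d} {β : EuclideanSpace ℝ (Fin d) → B₂.ι → FPS d}

lemma IsProduct.smoothAt {z : EuclideanSpace ℝ (Fin d)} (hα : ∀ n, SmoothAt (fun w => α w n) z)
    (hβ : ∀ n, SmoothAt (fun w => β w n) z) (n : B₃.ι) :
    SmoothAt (fun w => μ (α w) (β w) n) z := by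
  obtain ⟨κ, T, c, i, j, h⟩ := hμ.bilin n
  simp only [h]
  exact SmoothAt.sum fun t _ => ((hα _).mul (hβ _)).const_smul _

lemma IsProduct.hasDer {α : ℝ → B₁.ι → FPS d} {β : ℝ → B₂.ι → FPS d} {α' : B₁.ι → FPS d}
    {β' : B₂.ι → FPS d} (hα : ∀ n, HasDer (fun w => α w n) (α' n))
    (hβ : ∀ n, HasDer (fun w => β w n) (β' n)) (n : B₃.ι) :
    HasDer (fun w => μ (α w) (β w) n) ((μ α' (β 0) + μ (α 0) β') n) := by
  obtain ⟨κ, T, c, i, j, h⟩ := hμ.bilin n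
  simp only [Pi.add_apply, h, ← Finset.sum_add_distrib, ← smul_add]
  exact HasDer.sum fun t _ => ((hα _).mul (hβ _)).const_smul _

end

section Sections

variable {M : Type*} [TopologicalSpace M] [ChartedSpace (EuclideanSpace ℝ (Fin d)) M]
  [IsManifold (𝓡 d) ∞ M]

/-- The product of sections. -/
def prodForm (μ : (B₁.ι → FPS d) → (B₂.ι → FPS d) → B₃.ι → FPS d) (a : RawForm M B₁ 0)
    (b : RawForm M B₂ 0) : RawForm M B₃ 0 := fun x L => μ (a x L) (b x L)

variable {μ : (B₁.ι → FPS d) → (B₂.ι → FPS d) → B₃.ι → FPS d} {T₁ : Finset B₁.ι}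
  {T₂ : Finset B₂.ι} {T₃ : Finset B₃.ι} {a : RawForm M B₁ 0} {b : RawForm M B₂ 0}

lemma loc_prodForm (hT : ProductLaws T₁ T₂ T₃ μ) (ha : FormIn T₁ a) (hb : FormIn T₂ b) {x₀ p : M}
    (hp : p ∈ (extChartAt (𝓡 d) x₀).source) :
    loc x₀ (prodForm μ a b) =ᶠ[nhds (extChartAt (𝓡 d) x₀ p)]
      fun w L => μ (loc x₀ a w L) (loc x₀ b w L) := by
  filter_upwards [eventually_source hp (source_mem_nhds hp)] with w hw
  funext L
  simp only [loc, inChart_eq, formAct_zero_index]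
  exact hT.act (isUnit_det_jac hw) (ha.supp _ _) (hb.supp _ _)

variable (hμ : IsProduct μ) (hT : ProductLaws T₁ T₂ T₃ μ)
include hμ

lemma yZero_prodForm : yZero (prodForm μ a b) = prodForm μ (yZero a) (yZero b) := by
  funext x L n
  exact hμ.coeff_zero _ _ n

include hT

lemma FormIn.prodForm (ha : FormIn T₁ a) (hb : FormIn T₂ b) : FormIn T₃ (prodForm μ a b) where
  antisymm x π L := by
    rw [Subsingleton.elim π 1]
    simp
  sym x L := hμ.sym (ha.sym x L) (hb.sym x L)
  supp x L := hT.supp (ha.supp x L) (hb.supp x L)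
  smooth hp L n := (hμ.smoothAt (fun n => ha.smooth hp L n) (fun n => hb.smooth hp L n) n).congr
    ((loc_prodForm hT ha hb hp).mono fun w hw => by simp only [hw])

variable (cov : CovariantDerivative (𝓡 d) (EuclideanSpace ℝ (Fin d))
  (TangentSpace (𝓡 d) : M → Type _))
  [T2Space M] [CovariantDerivative.ContMDiffCovariantDerivative cov ∞]

/-- In a chart, flatness of a section reads `∂ᵢ t = -Wᵢ · t`. The product rule and the derivation
property of the fiber action give the same equation for the product. -/
lemma fedosovD_prodForm (LF₁ : LawfulFiber B₁) (LF₂ : LawfulFiber B₂) (LF₃ : LawfulFiber B₃)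
    (L₁ : FiberLaws B₁ T₁) (L₂ : FiberLaws B₂ T₂) (L₃ : FiberLaws B₃ T₃) (ha : FormIn T₁ a)
    (hb : FormIn T₂ b) (hDa : fedosovD cov a = 0) (hDb : fedosovD cov b = 0) :
    fedosovD cov (prodForm μ a b) = 0 := by
  have hab := ha.prodForm hμ hT hb
  funext p
  have hp := mem_source_self (d := d) p
  rw [← inChart_self L₃ (hab.fedosovD cov LF₃ L₃).supp p, inChart_fedosovD cov LF₃ L₃ hab hp]
  set z := extChartAt (𝓡 d) p p with hz
  have key : ∀ {B : FormalFiber d} {T : Finset B.ι} {t : RawForm M B 0}, LawfulFiber B →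
      FiberLaws B T → FormIn T t → fedosovD cov t = 0 → ∀ i,
      pdF (loc p t) z i Fin.elim0 = -B.lie (fedosovConn cov p z i) (loc p t z Fin.elim0) := by
    intro B T t LF LB ht hD i
    have h := inChart_fedosovD cov LF LB ht hp
    rw [inChart_self LB (ht.fedosovD cov LF LB).supp, hD] at h
    have h2 := congrFun h fun _ => i
    rw [locD, dyMul_zero_index] at h2
    exact eq_neg_of_add_eq_zero_left h2.symm
  have hsa := (loc_supp L₁ ha.supp hp).self_of_nhds Fin.elim0
  have hsb := (loc_supp L₂ hb.supp hp).self_of_nhds Fin.elim0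
  have hloc := loc_prodForm hT ha hb hp
  funext L
  rw [locD, dyMul_zero_index]
  have hpd : pdF (loc p (prodForm μ a b)) z (L 0) Fin.elim0 =
      μ (pdF (loc p a) z (L 0) Fin.elim0) (loc p b z Fin.elim0) +
        μ (loc p a z Fin.elim0) (pdF (loc p b) z (L 0) Fin.elim0) := by
    rw [pdF_congr hloc]
    funext n
    refine pdF_eq_of_hasDer (hμ.smoothAt (fun n => ha.smooth hp _ n)
      (fun n => hb.smooth hp _ n) n) ?_
    have h := hμ.hasDer (fun n => pdF_line (ha.smooth hp Fin.elim0 n) (L 0))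
      (fun n => pdF_line (hb.smooth hp Fin.elim0 n) (L 0)) n
    simpa only [zero_smul, add_zero] using h
  rw [hpd, hloc.self_of_nhds, hT.lie _ hsa hsb, add_add_add_comm, ← hμ.add_left, ← hμ.add_right,
    key LF₁ L₁ ha hDa, key LF₂ L₂ hb hDb, neg_add_cancel, neg_add_cancel, hμ.zero_left,
    hμ.zero_right, add_zero]
  rfl

omit hT
variable (LF₁ : LawfulFiber B₁) (LF₂ : LawfulFiber B₂) (LF₃ : LawfulFiber B₃)
include LF₁ LF₂ LF₃

omit [T2Space M] [CovariantDerivative.ContMDiffCovariantDerivative cov ∞] in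
lemma prodForm_mem_constSections (ha : a ∈ constSections M B₁) (hb : b ∈ constSections M B₂) :
    prodForm μ a b ∈ constSections M B₃ := by
  obtain ⟨S₁, ha'⟩ := isForm_iff.1 ha.1
  obtain ⟨S₂, hb'⟩ := isForm_iff.1 hb.1
  obtain ⟨T₁, T₂, T₃, h₁, h₂, L₁, L₂, L₃, hT⟩ := hμ.exists_laws S₁ S₂
  have h := (ha'.mono h₁).prodForm hμ hT (hb'.mono h₂)
  rw [← yZero_eq_of_delta L₁ (ha'.mono h₁) ha.2, ← yZero_eq_of_delta L₂ (hb'.mono h₂) hb.2,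
    ← yZero_prodForm hμ]
  exact yZero_mem_constSections LF₃ (isForm_iff.2 ⟨_, h⟩)

/-- Lifting is multiplicative. -/
theorem lift_prodForm (htors : cov.torsion = 0) (ha : a ∈ constSections M B₁)
    (hb : b ∈ constSections M B₂) :
    lift cov (prodForm μ a b) = prodForm μ (lift cov a) (lift cov b) := by
  have hta := lift_mem_flatSections cov LF₁ htors ha
  have htb := lift_mem_flatSections cov LF₂ htors hb
  obtain ⟨S₁, ha'⟩ := isForm_iff.1 hta.1
  obtain ⟨S₂, hb'⟩ := isForm_iff.1 htb.1
  obtain ⟨T₁, T₂, T₃, h₁, h₂, L₁, L₂, L₃, hT⟩ := hμ.exists_laws S₁ S₂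
  have h := (ha'.mono h₁).prodForm hμ hT (hb'.mono h₂)
  -- The product of the lifts is flat, so it is the lift of its restriction to `y = 0`, and
  -- restriction is multiplicative.
  rw [eq_lift_of_fedosovD cov LF₃ L₃ h (fedosovD_prodForm hμ hT cov LF₁ LF₂ LF₃ L₁ L₂ L₃
    (ha'.mono h₁) (hb'.mono h₂) hta.2 htb.2), yZero_prodForm hμ,
    yZero_lift_of_constSections cov LF₁ ha, yZero_lift_of_constSections cov LF₂ hb]

end Sections

/-! ### Lifts of invariant constants -/

section Unit

variable {M : Type*} [TopologicalSpace M] [ChartedSpace (EuclideanSpace ℝ (Fin d)) M]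
  [IsManifold (𝓡 d) ∞ M] {B : FormalFiber d} {S : Finset B.ι}
  (cov : CovariantDerivative (𝓡 d) (EuclideanSpace ℝ (Fin d)) (TangentSpace (𝓡 d) : M → Type _))
  [T2Space M] [CovariantDerivative.ContMDiffCovariantDerivative cov ∞]

/-- Invariant elements of the fiber with constant components are their own lifts. -/
theorem lift_invariant (LF : LawfulFiber B) (LB : FiberLaws B S) {u : B.ι → FPS d}
    (hsym : B.IsSym u) (hS : SuppIn S u) (hact : ∀ g, IsUnit g.det → B.act g u = u)
    (hlie : ∀ v, B.lie v u = 0) (hC : ∀ n, C (coeff 0 (u n)) = u n) :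
    lift cov (fun (_ : M) _ => u : RawForm M B 0) = fun _ _ => u := by
  have hloc : ∀ {x₀ p : M}, p ∈ (extChartAt (𝓡 d) x₀).source →
      loc x₀ (fun _ _ => u : RawForm M B 0) =ᶠ[nhds (extChartAt (𝓡 d) x₀ p)] fun _ _ => u := by
    intro x₀ p hp
    filter_upwards [eventually_source hp (source_mem_nhds hp)] with w hw
    funext L
    simp only [loc, inChart_eq, formAct_zero_index]
    exact hact _ (isUnit_det_jac hw)
  have hu : FormIn S (fun _ _ => u : RawForm M B 0) := by
    refine ⟨fun x π L => ?_, fun _ _ => hsym, fun _ _ => hS, fun hp L n => ?_⟩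
    · rw [Subsingleton.elim π 1]
      simp
    · exact (SmoothAt.const (u n)).congr ((hloc hp).mono fun w hw => by simp only [hw])
  have hD : fedosovD cov (fun _ _ => u : RawForm M B 0) = 0 := by
    funext p
    have hp := mem_source_self (d := d) p
    rw [← inChart_self LB (hu.fedosovD cov LF LB).supp p, inChart_fedosovD cov LF LB hu hp]
    funext L
    rw [locD, dyMul_zero_index, pdF_congr (hloc hp), (hloc hp).self_of_nhds, hlie, add_zero]
    funext n
    exact pdF_eq_of_hasDer (SmoothAt.const (u n)) (HasDer.const (u n))
  have h := eq_lift_of_fedosovD cov LF LB hu hD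
  have hy : yZero (fun _ _ => u : RawForm M B 0) = fun _ _ => u := by
    funext x L n
    exact hC n
  rw [hy] at h
  exact h.symm

end Unit

/-- Tuples as pairs of an initial and a final part. -/
def splitEquiv (k l : ℕ) (κ : Type*) : (Fin (k + l) → κ) ≃ (Fin k → κ) × (Fin l → κ) where
  toFun J := (fun s => J (Fin.castAdd l s), fun s => J (Fin.natAdd k s))
  invFun p := Fin.append p.1 p.2
  left_inv J := by
    funext s
    refine Fin.addCases (fun s => ?_) (fun s => ?_) s <;> simp
  right_inv p := by simp

lemma splitEquiv_update_castAdd {k l : ℕ} {κ : Type*} (J : Fin (k + l) → κ) (s : Fin k) (x : κ) :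
    splitEquiv k l κ (Function.update J (Fin.castAdd l s) x) =
      (Function.update (splitEquiv k l κ J).1 s x, (splitEquiv k l κ J).2) :=
  Prod.ext (Function.update_comp_eq_of_injective J (Fin.castAdd_injective k l) s x)
    (Function.update_comp_eq_of_forall_ne J x fun t h => by
      have := congrArg Fin.val h
      simp at this
      omega)

lemma splitEquiv_update_natAdd {k l : ℕ} {κ : Type*} (J : Fin (k + l) → κ) (s : Fin l) (x : κ) :
    splitEquiv k l κ (Function.update J (Fin.natAdd k s) x) =
      ((splitEquiv k l κ J).1, Function.update (splitEquiv k l κ J).2 s x) :=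
  Prod.ext (Function.update_comp_eq_of_forall_ne J x fun t h => by
      have := congrArg Fin.val h
      simp at this
      omega)
    (Function.update_comp_eq_of_injective J (Fin.natAdd_injective l k) s x)

/-! ### Functions -/

lemma productLaws_SM (d : ℕ) : ProductLaws (B₁ := fiberSM d) (B₂ := fiberSM d) (B₃ := fiberSM d)
    (Finset.univ : Finset Unit) (Finset.univ : Finset Unit) (Finset.univ : Finset Unit)
    (fun a b => a * b) where
  supp _ _ := suppIn_univ (ι := Unit) _
  act _ _ _ := funext fun _ => substLin_mul _ _ _
  lie _ _ _ _ _ := funext fun _ => vfApply_mul _ _ _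

lemma isProduct_SM (d : ℕ) : IsProduct (B₁ := fiberSM d) (B₂ := fiberSM d) (B₃ := fiberSM d)
    (fun a b => a * b) where
  bilin n := ⟨Unit, Finset.univ, fun _ => 1, fun _ => n, fun _ => n, fun a b => by simp⟩
  sym _ _ := trivial
  exists_laws S₁ S₂ := ⟨_, _, _, Finset.subset_univ (α := Unit) S₁,
    Finset.subset_univ (α := Unit) S₂, fiberLaws_SM d, fiberLaws_SM d, fiberLaws_SM d,
    productLaws_SM d⟩

/-! ### Exterior forms -/

section Wedge

variable {k l : ℕ}

/-- The product of components without antisymmetrization. -/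
noncomputable def tens {X : Type*} [Mul X] {κ : Type*} (a : (Fin k → κ) → X) (b : (Fin l → κ) → X) :
    (Fin (k + l) → κ) → X := fun J => a (splitEquiv k l κ J).1 * b (splitEquiv k l κ J).2

lemma wedge_eq {κ X : Type*} [Ring X] [Module ℝ X] (a : (Fin k → κ) → X) (b : (Fin l → κ) → X) :
    wedge a b = ∑ π : Equiv.Perm (Fin (k + l)), (((k + l).factorial : ℝ)⁻¹ *
      ((Equiv.Perm.sign π : ℤ) : ℝ)) • fun J => tens a b (J ∘ π) := by
  funext J
  simp only [wedge, Finset.sum_apply, Pi.smul_apply, mul_smul, ← Finset.smul_sum, Int.cast_smul_eq_zsmul]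
  rfl

lemma wedge_apply {κ X : Type*} [Ring X] [Module ℝ X] (a : (Fin k → κ) → X) (b : (Fin l → κ) → X)
    (J : Fin (k + l) → κ) : wedge a b J = ∑ π : Equiv.Perm (Fin (k + l)),
      (((k + l).factorial : ℝ)⁻¹ * ((Equiv.Perm.sign π : ℤ) : ℝ)) •
        (a (splitEquiv k l κ (J ∘ π)).1 * b (splitEquiv k l κ (J ∘ π)).2) := by
  rw [wedge_eq, Finset.sum_apply]
  rfl

lemma wedge_antisymm {κ X : Type*} [Ring X] [Module ℝ X] (a : (Fin k → κ) → X)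
    (b : (Fin l → κ) → X) : IsAntisymm (wedge a b) := by
  intro σ J
  simp only [wedge]
  rw [smul_comm]
  congr 1
  rw [Finset.smul_sum]
  refine Eq.trans (Finset.sum_congr rfl fun π _ => ?_) (Equiv.sum_comp (Equiv.mulLeft σ) _)
  rw [Equiv.coe_mulLeft, Equiv.Perm.sign_mul, Units.val_mul, smul_smul, ← mul_assoc, ← Units.val_mul,
    Int.units_mul_self, Units.val_one, one_mul]
  rfl

/-- The action on components of exterior forms. -/
noncomputable def formE (h : Matrix (Fin d) (Fin d) ℝ) (a : (Fin k → Fin d) → FPS d) : (Fin k → Fin d) → FPS d :=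
  fun J => ∑ J' : Fin k → Fin d, (∏ s, h (J' s) (J s)) • substLin h (a J')

lemma formE_perm (h : Matrix (Fin d) (Fin d) ℝ) (a : (Fin k → Fin d) → FPS d)
    (π : Equiv.Perm (Fin k)) : formE h (fun J => a (J ∘ π)) = fun J => formE h a (J ∘ π) := by
  funext J
  refine Fintype.sum_equiv (π.symm.arrowCongr (Equiv.refl _)) _ _ fun J' => ?_
  rw [← Equiv.prod_comp π]
  rfl

lemma formE_tens (h : Matrix (Fin d) (Fin d) ℝ) (a : (Fin k → Fin d) → FPS d)
    (b : (Fin l → Fin d) → FPS d) : formE h (tens a b) = tens (formE h a) (formE h b) := by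
  funext J
  rw [tens, formE, formE, formE, Finset.sum_mul_sum, ← Fintype.sum_prod_type']
  refine Fintype.sum_equiv (splitEquiv k l (Fin d)) _ _ fun J' => ?_
  rw [Fin.prod_univ_add, tens, substLin_mul, smul_mul_smul_comm]
  rfl

/-- The Lie derivative on components of exterior forms. -/
noncomputable def lieE (v : Fin d → FPS d) (a : (Fin k → Fin d) → FPS d) : (Fin k → Fin d) → FPS d :=
  fun J => vfApply v (a J) +
    ∑ s : Fin k, ∑ i : Fin d, pderiv ℝ (J s) (v i) * a (Function.update J s i)

lemma lieE_perm (v : Fin d → FPS d) (a : (Fin k → Fin d) → FPS d)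
    (π : Equiv.Perm (Fin k)) : lieE v (fun J => a (J ∘ π)) = fun J => lieE v a (J ∘ π) := by
  funext J
  rw [lieE, lieE, ← Equiv.sum_comp π]
  congr 1
  refine Finset.sum_congr rfl fun s _ => Finset.sum_congr rfl fun i _ => ?_
  rw [Function.update_comp_equiv, Equiv.symm_apply_apply, Function.comp_apply]

lemma lieE_tens (v : Fin d → FPS d) (a : (Fin k → Fin d) → FPS d) (b : (Fin l → Fin d) → FPS d) :
    lieE v (tens a b) = tens (lieE v a) b + tens a (lieE v b) := by
  funext J
  rw [Pi.add_apply, tens, tens, lieE, lieE, lieE, tens, Fin.sum_univ_add, vfApply_mul, add_mul,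
    mul_add, Finset.sum_mul, Finset.mul_sum]
  simp only [Finset.sum_mul, Finset.mul_sum, tens, splitEquiv_update_castAdd,
    splitEquiv_update_natAdd]
  rw [add_add_add_comm]
  congr 2
  · exact Finset.sum_congr rfl fun s _ => Finset.sum_congr rfl fun i _ => (mul_assoc _ _ _).symm
  · exact Finset.sum_congr rfl fun s _ => Finset.sum_congr rfl fun i _ => mul_left_comm _ _ _

/-- The wedge product is a linear combination of permuted tensor products. Both actions commute with
permutations of the indices; on tensor products the linear change is multiplicative and the Lie
derivative is a derivation. -/
lemma productLaws_E (d k l : ℕ) : ProductLaws (B₁ := fiberE d k) (B₂ := fiberE d l)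
    (B₃ := fiberE d (k + l)) (Finset.univ : Finset (Fin k → Fin d))
    (Finset.univ : Finset (Fin l → Fin d)) (Finset.univ : Finset (Fin (k + l) → Fin d)) wedge where
  supp _ _ := suppIn_univ (ι := Fin (k + l) → Fin d) _
  act {g} a b hg _ _ := by
    have LB := fiberLaws_E d (k + l)
    have hu : ∀ c : (fiberE d (k + l)).ι → FPS d,
      SuppIn (Finset.univ : Finset (Fin (k + l) → Fin d)) c :=
      suppIn_univ (ι := Fin (k + l) → Fin d)
    refine (congrArg _ (wedge_eq a b)).trans ((LB.act_sum hg _ fun _ _ => hu _).trans ?_)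
    refine Eq.trans ?_ (wedge_eq _ _).symm
    refine Finset.sum_congr rfl fun π _ => (LB.act_real_smul hg _ (hu _)).trans ?_
    exact congrArg _ ((formE_perm g⁻¹ (tens a b) π).trans
      (funext fun J => congrFun (formE_tens g⁻¹ a b) _))
  lie v a b _ _ := by
    have LB := fiberLaws_E d (k + l)
    have hu : ∀ c : (fiberE d (k + l)).ι → FPS d,
      SuppIn (Finset.univ : Finset (Fin (k + l) → Fin d)) c :=
      suppIn_univ (ι := Fin (k + l) → Fin d)
    refine (congrArg _ (wedge_eq a b)).trans ((LB.lie_sum v _ fun _ _ => hu _).trans ?_)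
    refine Eq.trans ?_ (congrArg₂ (· + ·) (wedge_eq _ _).symm (wedge_eq _ _).symm)
    refine Eq.trans ?_ Finset.sum_add_distrib
    refine Finset.sum_congr rfl fun π _ => (LB.lie_real_smul v _ (hu _)).trans ?_
    refine Eq.trans ?_ (smul_add _ _ _)
    exact congrArg _ ((lieE_perm v (tens a b) π).trans
      (funext fun J => congrFun (lieE_tens v a b) _))

lemma isProduct_E (d k l : ℕ) : IsProduct (B₁ := fiberE d k) (B₂ := fiberE d l)
    (B₃ := fiberE d (k + l)) wedge where
  bilin J := ⟨_, Finset.univ, _, fun π : Equiv.Perm (Fin (k + l)) => (splitEquiv k l _ (J ∘ π)).1,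
    fun π : Equiv.Perm (Fin (k + l)) => (splitEquiv k l _ (J ∘ π)).2, fun a b =>
      wedge_apply a b J⟩
  sym _ _ := wedge_antisymm _ _
  exists_laws S₁ S₂ := ⟨_, _, _, Finset.subset_univ (α := Fin k → Fin d) S₁,
    Finset.subset_univ (α := Fin l → Fin d) S₂, fiberLaws_E d k, fiberLaws_E d l,
    fiberLaws_E d (k + l), productLaws_E d k l⟩

end Wedge

/-! ### Polydifferential operators -/

section Cup

variable {r s N : ℕ}

lemma splitEquiv_mem_ordSet {α : Fin (r + s) → (Fin d →₀ ℕ)} : α ∈ ordSet d (r + s) N ↔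
    splitEquiv r s _ α ∈ ordSet d r N ×ˢ ordSet d s N := by
  rw [Finset.mem_product, mem_ordSet, mem_ordSet, mem_ordSet, Fin.forall_fin_add]
  rfl

lemma tens_suppIn {a : (Fin r → (Fin d →₀ ℕ)) → FPS d} {b : (Fin s → (Fin d →₀ ℕ)) → FPS d}
    (ha : SuppIn (ordSet d r N) a) (hb : SuppIn (ordSet d s N) b) :
    SuppIn (ordSet d (r + s) N) (tens a b) := by
  intro α hα
  rw [splitEquiv_mem_ordSet, Finset.mem_product, not_and_or] at hα
  rw [tens]
  rcases hα with h | h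
  · rw [ha _ h, zero_mul]
  · rw [hb _ h, mul_zero]

lemma polyOp_tens {a : (Fin r → (Fin d →₀ ℕ)) → FPS d} {b : (Fin s → (Fin d →₀ ℕ)) → FPS d}
    (ha : SuppIn (ordSet d r N) a) (hb : SuppIn (ordSet d s N) b) (f : Fin (r + s) → FPS d) :
    polyOp (tens a b) f =
      polyOp a (splitEquiv r s _ f).1 * polyOp b (splitEquiv r s _ f).2 := by
  rw [polyOp_eq_sum (tens_suppIn ha hb), polyOp_eq_sum ha, polyOp_eq_sum hb, Finset.sum_mul_sum,
    ← Finset.sum_product']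
  refine Finset.sum_equiv (splitEquiv r s _) (fun α => splitEquiv_mem_ordSet) fun α _ => ?_
  rw [Fin.prod_univ_add, tens, mul_mul_mul_comm]
  rfl

/-- Since coefficients of bounded order are determined by their operator, the laws are checked on
operators, where the cup product is the product of values in separate arguments. -/
lemma productLaws_D (d r s N : ℕ) : ProductLaws (B₁ := fiberD d r) (B₂ := fiberD d s)
    (B₃ := fiberD d (r + s)) (ordSet d r N) (ordSet d s N) (ordSet d (r + s) N) tens where
  supp := tens_suppIn
  act {g a b} hg ha hb := by
    refine (modelD d (r + s) N).op_inj ((modelD d (r + s) N).act_supp _ _ hg (tens_suppIn ha hb))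
      (tens_suppIn ((modelD d r N).act_supp _ _ hg ha) ((modelD d s N).act_supp _ _ hg hb)) ?_
    funext f
    refine ((modelD d (r + s) N).op_act hg (tens_suppIn ha hb) f).trans ?_
    refine Eq.trans ?_ (polyOp_tens ((modelD d r N).act_supp _ _ hg ha)
      ((modelD d s N).act_supp _ _ hg hb) f).symm
    refine (congrArg _ (polyOp_tens ha hb _)).trans ((substLin_mul _ _ _).trans ?_)
    exact congrArg₂ (· * ·) ((modelD d r N).op_act hg ha _).symm
      ((modelD d s N).op_act hg hb _).symm
  lie v a b ha hb := by
    have ha' := (modelD d r N).lie_supp v _ ha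
    have hb' := (modelD d s N).lie_supp v _ hb
    refine (modelD d (r + s) N).op_inj ((modelD d (r + s) N).lie_supp _ _ (tens_suppIn ha hb))
      ((tens_suppIn ha' hb).add (tens_suppIn ha hb')) ?_
    refine Eq.trans ?_ ((modelD d (r + s) N).op_add (tens_suppIn ha' hb) (tens_suppIn ha hb')).symm
    funext f
    refine ((modelD d (r + s) N).op_lie v (tens_suppIn ha hb) f).trans ?_
    refine Eq.trans ?_ (congrArg₂ (· + ·) (polyOp_tens ha' hb f) (polyOp_tens ha hb' f)).symm
    change vfApply v (polyOp (tens a b) f) - ∑ i, polyOp (tens a b) (Function.update f i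
      (vfApply v (f i))) = _
    have h1 := (modelD d r N).op_lie v ha (splitEquiv r s _ f).1
    have h2 := (modelD d s N).op_lie v hb (splitEquiv r s _ f).2
    change polyOp ((fiberD d r).lie v a) (splitEquiv r s _ f).1 = vfApply v (polyOp a
      (splitEquiv r s _ f).1) - ∑ i, polyOp a (Function.update (splitEquiv r s _ f).1 i
        (vfApply v ((splitEquiv r s _ f).1 i))) at h1
    change polyOp ((fiberD d s).lie v b) (splitEquiv r s _ f).2 = vfApply v (polyOp b
      (splitEquiv r s _ f).2) - ∑ i, polyOp b (Function.update (splitEquiv r s _ f).2 i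
        (vfApply v ((splitEquiv r s _ f).2 i))) at h2
    simp only [polyOp_tens ha hb, Fin.sum_univ_add, splitEquiv_update_castAdd,
      splitEquiv_update_natAdd, vfApply_mul, ← Finset.sum_mul, ← Finset.mul_sum]
    rw [h1, h2, sub_mul, mul_sub]
    exact add_sub_add_comm _ _ _ _

lemma isProduct_D (d r s : ℕ) : IsProduct (B₁ := fiberD d r) (B₂ := fiberD d s)
    (B₃ := fiberD d (r + s)) tens where
  bilin α := ⟨Unit, Finset.univ, fun _ => 1, fun _ => (splitEquiv r s _ α).1,
    fun _ => (splitEquiv r s _ α).2, fun a b => by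
      rw [Fintype.sum_unique, one_smul]
      rfl⟩
  sym _ _ := trivial
  exists_laws S₁ S₂ := by
    obtain ⟨N₁, h₁⟩ := exists_subset_ordSet S₁
    obtain ⟨N₂, h₂⟩ := exists_subset_ordSet S₂
    have hmono : ∀ {r N N' : ℕ}, N ≤ N' → ordSet d r N ⊆ ordSet d r N' := fun h α hα =>
      mem_ordSet.2 fun i => (mem_ordSet.1 hα i).trans h
    exact ⟨_, _, _, h₁.trans (hmono (le_max_left N₁ N₂)), h₂.trans (hmono (le_max_right N₁ N₂)),
      fiberLaws_D d r _, fiberLaws_D d s _, fiberLaws_D d (r + s) _, productLaws_D d r s _⟩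

end Cup

/-! ### Functions and exterior forms on `M` as `y`-independent sections -/

section Functions

variable {M : Type*} [TopologicalSpace M] [ChartedSpace (EuclideanSpace ℝ (Fin d)) M]
  [IsManifold (𝓡 d) ∞ M]

lemma C_injective : Function.Injective (C : ℝ → FPS d) := fun x y h => by
  simpa using congrArg constantCoeff h

lemma isForm_ofFun {f : M → ℝ} :
    IsForm (fiberSM d) 0 (ofFun (d := d) f) ↔ ContMDiff (𝓡 d) 𝓘(ℝ) ∞ f := by
  classical
  have hin : ∀ x₀ x L n, inChart x₀ (ofFun (d := d) f) x L n = C (f x) := by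
    intro x₀ x L n
    rw [inChart_eq, formAct_zero_index]
    exact substLin_C _ _
  constructor
  · intro h x
    have h1 : ContMDiffOn (𝓡 d) 𝓘(ℝ) ∞ f (chartAt (EuclideanSpace ℝ (Fin d)) x).source :=
      (h.smooth x Fin.elim0 () 0).congr fun y _ =>
        ((congrArg (coeff 0) (hin x y _ _)).trans (coeff_zero_C _)).symm
    exact h1.contMDiffAt ((chartAt _ x).open_source.mem_nhds (mem_chart_source _ x))
  · intro h
    refine ⟨fun x π L => ?_, fun _ _ => trivial, ⟨(Finset.univ : Finset Unit),
      fun x L n hn => absurd (Finset.mem_univ (α := Unit) n) hn⟩, fun x₀ L n m => ?_⟩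
    · rw [Subsingleton.elim π 1]
      simp
    · simp only [hin, coeff_C]
      split_ifs
      · exact h.contMDiffOn
      · exact contMDiffOn_const

lemma isForm_ofDiffForm {k : ℕ} {η : M → (Fin k → Fin d) → ℝ} :
    IsForm (fiberE d k) 0 (ofDiffForm η) ↔ IsDiffForm k η := by
  classical
  have hin : ∀ x₀ x L J, inChart x₀ (ofDiffForm η) x L J =
      C (∑ J' : Fin k → Fin d, (∏ s, (jac x₀ x)⁻¹ (J' s) (J s)) * η x J') := by
    intro x₀ x L J
    rw [inChart_eq, formAct_zero_index, map_sum]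
    refine Finset.sum_congr rfl fun J' _ => ?_
    rw [map_mul, ← smul_eq_C_mul]
    exact congrArg _ (substLin_C _ _)
  constructor
  · intro h
    refine ⟨fun x π J => C_injective (d := d) ?_, fun x₀ J => ?_⟩
    · refine (h.sym x Fin.elim0 π J).trans ?_
      exact (map_zsmul (C : ℝ →+* FPS d) _ _).symm
    · exact (h.smooth x₀ Fin.elim0 J 0).congr fun y _ =>
        ((congrArg (coeff 0) (hin x₀ y _ _)).trans (coeff_zero_C _)).symm
  · intro h
    refine ⟨fun x π L => ?_, fun x L π J => ?_, ⟨(Finset.univ : Finset (Fin k → Fin d)),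
      fun x L n hn => absurd (Finset.mem_univ (α := Fin k → Fin d) n) hn⟩, fun x₀ L n m => ?_⟩
    · rw [Subsingleton.elim π 1]
      simp
    · exact (congrArg C (h.antisymm x π J)).trans (map_zsmul (C : ℝ →+* FPS d) _ _)
    · simp only [hin, coeff_C]
      split_ifs
      · exact h.smooth x₀ n
      · exact contMDiffOn_const

lemma mem_constSections_iff {B : FormalFiber d} (LF : LawfulFiber B) {t : RawForm M B 0} :
    t ∈ constSections M B ↔ IsForm B 0 t ∧ yZero t = t := by
  refine ⟨fun h => ⟨h.1, ?_⟩, fun h => ?_⟩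
  · obtain ⟨S, LB, ht⟩ := h.1.exists_formIn LF
    exact yZero_eq_of_delta LB ht h.2
  · rw [← h.2]
    exact yZero_mem_constSections LF h.1

lemma C_coeff_zero_C (x : ℝ) : (C (coeff 0 (C x : FPS d)) : FPS d) = C x := by
  rw [coeff_zero_C]

lemma ofFun_bijOn : Set.BijOn (fun f : C^∞⟮𝓡 d, M; ℝ⟯ => ofFun (d := d) f) Set.univ
    (constSections M (fiberSM d)) := by
  refine ⟨fun f _ => (mem_constSections_iff (lawfulFiber_SM d)).2
    ⟨isForm_ofFun.2 f.contMDiff, ?_⟩, fun f _ g _ h => ?_, fun a ha => ?_⟩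
  · funext x L n
    exact C_coeff_zero_C _
  · ext x
    exact C_injective (congrFun (congrFun (congrFun h x) Fin.elim0) ())
  · have h := (mem_constSections_iff (lawfulFiber_SM d)).1 ha
    have h2 : ofFun (d := d) (fun x => coeff 0 (a x Fin.elim0 ())) = a := by
      refine Eq.trans ?_ h.2
      funext x L n
      rw [Subsingleton.elim L Fin.elim0]
      rfl
    rw [← h2] at h
    exact ⟨⟨_, isForm_ofFun.1 h.1⟩, trivial, h2⟩

lemma ofDiffForm_bijOn (k : ℕ) : Set.BijOn (fun η : M → (Fin k → Fin d) → ℝ => ofDiffForm η)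
    {η | IsDiffForm k η} (constSections M (fiberE d k)) := by
  refine ⟨fun η hη => (mem_constSections_iff (lawfulFiber_E d k)).2
    ⟨isForm_ofDiffForm.2 hη, ?_⟩, fun f _ g _ h => ?_, fun a ha => ?_⟩
  · funext x L n
    exact C_coeff_zero_C _
  · funext x J
    exact C_injective (congrFun (congrFun (congrFun h x) Fin.elim0) J)
  · have h := (mem_constSections_iff (lawfulFiber_E d k)).1 ha
    have h2 : ofDiffForm (fun x J => coeff 0 (a x Fin.elim0 J)) = a := by
      refine Eq.trans ?_ h.2
      funext x L n
      rw [Subsingleton.elim L Fin.elim0]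
      rfl
    rw [← h2] at h
    exact ⟨_, isForm_ofDiffForm.1 h.1, h2⟩

lemma wedgeE_ofDiffForm {k l : ℕ} (η : M → (Fin k → Fin d) → ℝ) (θ : M → (Fin l → Fin d) → ℝ) :
    ofDiffForm (fun x => wedge (η x) (θ x)) = wedgeE (ofDiffForm η) (ofDiffForm θ) := by
  funext x L J
  refine Eq.trans ?_ (wedge_apply (ofDiffForm η x L) (ofDiffForm θ x L) J).symm
  refine (congrArg (C : ℝ →+* FPS d) (wedge_apply (η x) (θ x) J)).trans ?_
  rw [map_sum]
  refine Finset.sum_congr rfl fun π _ => ?_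
  rw [smul_eq_mul, map_mul, ← smul_eq_C_mul, map_mul]
  rfl

end Functions

/-! ### Lifts of the units -/

section Units

variable {M : Type*} [TopologicalSpace M] [ChartedSpace (EuclideanSpace ℝ (Fin d)) M]
  [IsManifold (𝓡 d) ∞ M] [T2Space M]
  (cov : CovariantDerivative (𝓡 d) (EuclideanSpace ℝ (Fin d)) (TangentSpace (𝓡 d) : M → Type _))
  [CovariantDerivative.ContMDiffCovariantDerivative cov ∞]

lemma C_coeff_zero_one : (C (coeff 0 (1 : FPS d)) : FPS d) = 1 := C_coeff_zero_C 1

theorem lift_one_SM : lift cov (1 : RawForm M (fiberSM d) 0) = 1 :=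
  lift_invariant cov (lawfulFiber_SM d) (fiberLaws_SM d) trivial (suppIn_univ (ι := Unit) _)
    (fun _ _ => funext fun _ => substLin_one _) (fun _ => funext fun _ => vfApply_one _)
    fun _ => C_coeff_zero_one

theorem lift_one_E :
    lift cov (fun _ _ _ => 1 : RawForm M (fiberE d 0) 0) = fun _ _ _ => 1 := by
  refine lift_invariant cov (lawfulFiber_E d 0) (fiberLaws_E d 0) (fun π J => ?_)
    (suppIn_univ (ι := Fin 0 → Fin d) _) (fun g _ => funext fun J => ?_)
    (fun v => funext fun J => ?_) fun _ => C_coeff_zero_one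
  · rw [Subsingleton.elim π 1]
    simp
  · change ∑ J' : Fin 0 → Fin d, (∏ s, g⁻¹ (J' s) _) • substLin g⁻¹ 1 = 1
    simp [substLin_one]
  · change vfApply v 1 + ∑ s : Fin 0, _ = 0
    simp [vfApply_one]

lemma polyOp_one (f : Fin 0 → FPS d) : polyOp (fun _ => 1) f = 1 := by
  rw [polyOp, finsum_unique]
  simp

lemma polySymbol_zero_index (Q : (Fin 0 → FPS d) → FPS d) (α : Fin 0 → (Fin d →₀ ℕ)) :
    polySymbol Q α = Q Fin.elim0 := by
  rw [polySymbol, Fintype.piFinset_of_isEmpty, Fintype.sum_unique]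
  rw [Finset.univ_eq_empty, Finset.prod_empty, one_mul]
  exact congrArg Q (Subsingleton.elim _ _)

/-- Without arguments an operator is a power series, its symbol is its value, and the constant `1`
is invariant. -/
theorem lift_one_D :
    lift cov (fun _ _ _ => 1 : RawForm M (fiberD d 0) 0) = fun _ _ _ => 1 := by
  refine lift_invariant cov (lawfulFiber_D d 0) (fiberLaws_D d 0 0) trivial
    (fun α hα => absurd (mem_ordSet.2 fun i => i.elim0) hα) (fun g _ => funext fun α => ?_)
    (fun v => funext fun α => ?_) fun _ => C_coeff_zero_one
  · refine (polySymbol_zero_index (fun f => substLin g⁻¹ (polyOp (fun _ => 1)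
      fun i => substLin g (f i))) α).trans ?_
    rw [polyOp_one, substLin_one]
  · refine (polySymbol_zero_index (fun f => vfApply v (polyOp (fun _ => 1) f) - ∑ i : Fin 0,
      polyOp (fun _ => 1) (Function.update f i (vfApply v (f i)))) α).trans ?_
    rw [polyOp_one, vfApply_one, Finset.univ_eq_empty, Finset.sum_empty, sub_zero]
    rfl

end Units

end Fedosov

theorem mainTheorem8 {d : ℕ} {M : Type*} [TopologicalSpace M]
    [ChartedSpace (EuclideanSpace ℝ (Fin d)) M] [IsManifold (𝓡 d) ∞ M] [T2Space M]
    (cov : CovariantDerivative (𝓡 d) (EuclideanSpace ℝ (Fin d))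
      (TangentSpace (𝓡 d) : M → Type _))
    [CovariantDerivative.ContMDiffCovariantDerivative cov ∞] (htors : cov.torsion = 0) :
    -- `D` is a differential on `Ω(M, B)` without cohomology in positive degrees
    (∀ K : Fedosov.Kind,
      (∀ (q : ℕ) (a : Fedosov.RawForm M (K.fiber d) q), Fedosov.IsForm (K.fiber d) q a →
        Fedosov.IsForm (K.fiber d) (q + 1) (Fedosov.fedosovD cov a) ∧
        Fedosov.fedosovD cov (Fedosov.fedosovD cov a) = 0) ∧
      (∀ (q : ℕ) (a : Fedosov.RawForm M (K.fiber d) (q + 1)),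
        Fedosov.IsForm (K.fiber d) (q + 1) a → Fedosov.fedosovD cov a = 0 →
        ∃ b : Fedosov.RawForm M (K.fiber d) q,
          Fedosov.IsForm (K.fiber d) q b ∧ Fedosov.fedosovD cov b = a)) ∧
    -- `SM`: the lift is an isomorphism of algebras from `C^∞(M)`
    (Set.BijOn (fun f : C^∞⟮𝓡 d, M; ℝ⟯ => Fedosov.lift cov (Fedosov.ofFun (d := d) f))
        Set.univ (Fedosov.flatSections cov (Fedosov.fiberSM d)) ∧
      (∀ f : C^∞⟮𝓡 d, M; ℝ⟯,
        Fedosov.IsLift cov (Fedosov.ofFun (d := d) f)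
          (Fedosov.lift cov (Fedosov.ofFun (d := d) f))) ∧
      (∀ f g : C^∞⟮𝓡 d, M; ℝ⟯,
        Fedosov.lift cov (Fedosov.ofFun (d := d) ⇑(f + g)) =
          Fedosov.lift cov (Fedosov.ofFun f) + Fedosov.lift cov (Fedosov.ofFun g)) ∧
      (∀ (c : ℝ) (f : C^∞⟮𝓡 d, M; ℝ⟯),
        Fedosov.lift cov (Fedosov.ofFun (d := d) ⇑(c • f)) =
          c • Fedosov.lift cov (Fedosov.ofFun f)) ∧
      (∀ f g : C^∞⟮𝓡 d, M; ℝ⟯,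
        Fedosov.lift cov (Fedosov.ofFun (d := d) ⇑(f * g)) =
          Fedosov.lift cov (Fedosov.ofFun f) * Fedosov.lift cov (Fedosov.ofFun g)) ∧
      Fedosov.lift cov (Fedosov.ofFun (d := d) ⇑(1 : C^∞⟮𝓡 d, M; ℝ⟯)) = 1) ∧
    -- `E`: the lift is an isomorphism of graded algebras from `A(M)`
    ((∀ k : ℕ,
        Set.BijOn (fun η : M → (Fin k → Fin d) → ℝ => Fedosov.lift cov (Fedosov.ofDiffForm η))
          {η | Fedosov.IsDiffForm k η} (Fedosov.flatSections cov (Fedosov.fiberE d k)) ∧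
        (∀ η : M → (Fin k → Fin d) → ℝ, Fedosov.IsDiffForm k η →
          Fedosov.IsLift cov (Fedosov.ofDiffForm η)
            (Fedosov.lift cov (Fedosov.ofDiffForm η))) ∧
        (∀ η θ : M → (Fin k → Fin d) → ℝ, Fedosov.IsDiffForm k η → Fedosov.IsDiffForm k θ →
          Fedosov.lift cov (Fedosov.ofDiffForm (η + θ)) =
            Fedosov.lift cov (Fedosov.ofDiffForm η) +
              Fedosov.lift cov (Fedosov.ofDiffForm θ)) ∧
        (∀ (c : ℝ) (η : M → (Fin k → Fin d) → ℝ), Fedosov.IsDiffForm k η →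
          Fedosov.lift cov (Fedosov.ofDiffForm (c • η)) =
            c • Fedosov.lift cov (Fedosov.ofDiffForm η))) ∧
      (∀ (k l : ℕ) (η : M → (Fin k → Fin d) → ℝ) (θ : M → (Fin l → Fin d) → ℝ),
        Fedosov.IsDiffForm k η → Fedosov.IsDiffForm l θ →
          Fedosov.IsDiffForm (k + l) (fun x => Fedosov.wedge (η x) (θ x)) ∧
          Fedosov.lift cov (Fedosov.ofDiffForm fun x => Fedosov.wedge (η x) (θ x)) =
            Fedosov.wedgeE (Fedosov.lift cov (Fedosov.ofDiffForm η))
              (Fedosov.lift cov (Fedosov.ofDiffForm θ))) ∧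
      Fedosov.lift cov (Fedosov.ofDiffForm fun (_ : M) (_ : Fin 0 → Fin d) => (1 : ℝ)) =
        fun _ _ _ => 1) ∧
    -- `T_poly`: the lift is an isomorphism of graded vector spaces from `ker δ ∩ Γ(M, T_poly)`
    (∀ r : ℕ,
      Set.BijOn (Fedosov.lift cov) (Fedosov.constSections M (Fedosov.fiberT d r))
        (Fedosov.flatSections cov (Fedosov.fiberT d r)) ∧
      (∀ a ∈ Fedosov.constSections M (Fedosov.fiberT d r),
        Fedosov.IsLift cov a (Fedosov.lift cov a)) ∧
      (∀ a ∈ Fedosov.constSections M (Fedosov.fiberT d r),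
        ∀ b ∈ Fedosov.constSections M (Fedosov.fiberT d r),
          Fedosov.lift cov (a + b) = Fedosov.lift cov a + Fedosov.lift cov b) ∧
      (∀ c : ℝ, ∀ a ∈ Fedosov.constSections M (Fedosov.fiberT d r),
        Fedosov.lift cov (c • a) = c • Fedosov.lift cov a)) ∧
    -- `D_poly`: the lift is an isomorphism of graded algebras from `ker δ ∩ Γ(M, D_poly)`
    ((∀ r : ℕ,
        Set.BijOn (Fedosov.lift cov) (Fedosov.constSections M (Fedosov.fiberD d r))
          (Fedosov.flatSections cov (Fedosov.fiberD d r)) ∧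
        (∀ a ∈ Fedosov.constSections M (Fedosov.fiberD d r),
          Fedosov.IsLift cov a (Fedosov.lift cov a)) ∧
        (∀ a ∈ Fedosov.constSections M (Fedosov.fiberD d r),
          ∀ b ∈ Fedosov.constSections M (Fedosov.fiberD d r),
            Fedosov.lift cov (a + b) = Fedosov.lift cov a + Fedosov.lift cov b) ∧
        (∀ c : ℝ, ∀ a ∈ Fedosov.constSections M (Fedosov.fiberD d r),
          Fedosov.lift cov (c • a) = c • Fedosov.lift cov a)) ∧
      (∀ r s : ℕ, ∀ P ∈ Fedosov.constSections M (Fedosov.fiberD d r),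
        ∀ Q ∈ Fedosov.constSections M (Fedosov.fiberD d s),
          Fedosov.cup P Q ∈ Fedosov.constSections M (Fedosov.fiberD d (r + s)) ∧
          Fedosov.lift cov (Fedosov.cup P Q) =
            Fedosov.cup (Fedosov.lift cov P) (Fedosov.lift cov Q)) ∧
      Fedosov.lift cov (fun (_ : M) _ (_ : (Fedosov.fiberD d 0).ι) => (1 : Fedosov.FPS d)) =
        fun _ _ _ => 1) := by
  refine ⟨fun K => ⟨fun q a ha => ?_, fun q a ha hD => ?_⟩, ⟨?_, ?_, ?_, ?_, ?_, ?_⟩,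
    ⟨fun k => ⟨?_, ?_, ?_, ?_⟩, fun k l η θ hη hθ => ⟨?_, ?_⟩, ?_⟩,
    fun r => ⟨?_, ?_, ?_, ?_⟩, fun r => ⟨?_, ?_, ?_, ?_⟩, fun r s P hP Q hQ => ⟨?_, ?_⟩, ?_⟩
  · have LF := Fedosov.Kind.lawful d K
    obtain ⟨S, LB, h⟩ := ha.exists_formIn LF
    exact ⟨Fedosov.isForm_iff.2 ⟨S, h.fedosovD cov LF LB⟩,
      Fedosov.fedosovD_fedosovD cov htors LF LB h⟩
  · have LF := Fedosov.Kind.lawful d K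
    obtain ⟨S, LB, h⟩ := ha.exists_formIn LF
    obtain ⟨b, hb, hb'⟩ := Fedosov.exists_fedosovD_eq cov LF LB htors h hD
    exact ⟨b, Fedosov.isForm_iff.2 ⟨S, hb⟩, hb'⟩
  · exact (Fedosov.lift_bijOn cov (Fedosov.lawfulFiber_SM d) htors).comp Fedosov.ofFun_bijOn
  · exact fun f => Fedosov.isLift_of_constSections cov (Fedosov.lawfulFiber_SM d)
      (Fedosov.ofFun_bijOn.mapsTo (Set.mem_univ f))
  · intro f g
    rw [← Fedosov.lift_add cov (Fedosov.lawfulFiber_SM d)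
      (Fedosov.ofFun_bijOn.mapsTo (Set.mem_univ f)) (Fedosov.ofFun_bijOn.mapsTo (Set.mem_univ g))]
    congr 1
    funext x L u
    exact map_add MvPowerSeries.C (f x) (g x)
  · intro c f
    rw [← Fedosov.lift_smul cov (Fedosov.lawfulFiber_SM d) c
      (Fedosov.ofFun_bijOn.mapsTo (Set.mem_univ f))]
    congr 1
    funext x L u
    exact (map_mul MvPowerSeries.C c (f x)).trans (MvPowerSeries.smul_eq_C_mul _ _).symm
  · intro f g
    refine Eq.trans ?_ (Fedosov.lift_prodForm (Fedosov.isProduct_SM d) cov (Fedosov.lawfulFiber_SM d)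
      (Fedosov.lawfulFiber_SM d) (Fedosov.lawfulFiber_SM d) htors
      (Fedosov.ofFun_bijOn.mapsTo (Set.mem_univ f)) (Fedosov.ofFun_bijOn.mapsTo (Set.mem_univ g)))
    congr 1
    funext x L u
    exact map_mul MvPowerSeries.C (f x) (g x)
  · refine Eq.trans (congrArg _ ?_) (Fedosov.lift_one_SM cov)
    funext x L u
    exact map_one MvPowerSeries.C
  · exact (Fedosov.lift_bijOn cov (Fedosov.lawfulFiber_E d k) htors).comp
      (Fedosov.ofDiffForm_bijOn k)
  · exact fun η hη => Fedosov.isLift_of_constSections cov (Fedosov.lawfulFiber_E d k)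
      ((Fedosov.ofDiffForm_bijOn k).mapsTo hη)
  · intro η θ hη hθ
    rw [← Fedosov.lift_add cov (Fedosov.lawfulFiber_E d k)
      ((Fedosov.ofDiffForm_bijOn k).mapsTo hη) ((Fedosov.ofDiffForm_bijOn k).mapsTo hθ)]
    congr 1
    funext x L J
    exact map_add MvPowerSeries.C (η x J) (θ x J)
  · intro c η hη
    rw [← Fedosov.lift_smul cov (Fedosov.lawfulFiber_E d k) c
      ((Fedosov.ofDiffForm_bijOn k).mapsTo hη)]
    congr 1
    funext x L J
    exact (map_mul MvPowerSeries.C c (η x J)).trans (MvPowerSeries.smul_eq_C_mul _ _).symm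
  · have h := Fedosov.prodForm_mem_constSections (Fedosov.isProduct_E d k l)
      (Fedosov.lawfulFiber_E d k) (Fedosov.lawfulFiber_E d l) (Fedosov.lawfulFiber_E d (k + l))
      ((Fedosov.ofDiffForm_bijOn k).mapsTo hη) ((Fedosov.ofDiffForm_bijOn l).mapsTo hθ)
    refine Fedosov.isForm_ofDiffForm.1 ?_
    rw [Fedosov.wedgeE_ofDiffForm]
    exact h.1
  · rw [Fedosov.wedgeE_ofDiffForm]
    exact Fedosov.lift_prodForm (Fedosov.isProduct_E d k l) cov
      (Fedosov.lawfulFiber_E d k) (Fedosov.lawfulFiber_E d l) (Fedosov.lawfulFiber_E d (k + l))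
      htors ((Fedosov.ofDiffForm_bijOn k).mapsTo hη) ((Fedosov.ofDiffForm_bijOn l).mapsTo hθ)
  · refine Eq.trans (congrArg _ ?_) (Fedosov.lift_one_E cov)
    funext x L u
    exact map_one MvPowerSeries.C
  · exact Fedosov.lift_bijOn cov (Fedosov.lawfulFiber_T d r) htors
  · exact fun a ha => Fedosov.isLift_of_constSections cov (Fedosov.lawfulFiber_T d r) ha
  · exact fun a ha b hb => Fedosov.lift_add cov (Fedosov.lawfulFiber_T d r) ha hb
  · exact fun c a ha => Fedosov.lift_smul cov (Fedosov.lawfulFiber_T d r) c ha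
  · exact Fedosov.lift_bijOn cov (Fedosov.lawfulFiber_D d r) htors
  · exact fun a ha => Fedosov.isLift_of_constSections cov (Fedosov.lawfulFiber_D d r) ha
  · exact fun a ha b hb => Fedosov.lift_add cov (Fedosov.lawfulFiber_D d r) ha hb
  · exact fun c a ha => Fedosov.lift_smul cov (Fedosov.lawfulFiber_D d r) c ha
  · exact Fedosov.prodForm_mem_constSections (Fedosov.isProduct_D d r s)
      (Fedosov.lawfulFiber_D d r) (Fedosov.lawfulFiber_D d s) (Fedosov.lawfulFiber_D d (r + s)) hP hQ
  · exact Fedosov.lift_prodForm (Fedosov.isProduct_D d r s) cov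
      (Fedosov.lawfulFiber_D d r) (Fedosov.lawfulFiber_D d s) (Fedosov.lawfulFiber_D d (r + s))
      htors hP hQ
  · exact Fedosov.lift_one_D cov
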